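/- Let $\mathbb T=\mathbb R/2\pi\mathbb Z$, $\langle x\rangle=(1+x^2)^{1/2}$, and let $(s,p)$ satisfy either (i) $\frac12\le s<\frac34$ and $1\le p<\frac{4}{3-4s}$, or (ii) $s\ge\frac34$ and $1\le p<\infty$. Let $\mathcal{F}L^{s,p}(\mathbb T)$ be the space of distributions $f$ on $\mathbb T$ with $\|f\|_{\mathcal{F}L^{s,p}}=\|\langle n\rangle^s\widehat f(n)\|_{\ell^p_n}<\infty$, let $X^{s,1/2}_{p,2}$ be the completion of the Schwartz functions on $\mathbb R\times\mathbb T$ under the norm $\|\langle n\rangle^s\langle\tau-n^3\rangle^{1/2}\widehat u(\tau,n)\|_{\ell^p_nL^2_\tau}$, and let $X^{s,1/2}_{p,2}(T)$ be the space of restrictions of its elements to $[-T,T]\times\mathbb T$. Fix a sign $\sigma\in\{1,-1\}$ and consider, for real-valued $u$, the first renormalized mKdV equation $$\partial_tu+\partial_x^3u=\sigma\Big(u^2-\frac1{2\pi}\int_0^{2\pi}u^2\,dx\Big)\partial_xu,\qquad u|_{t=0}=u_0.\tag{mKdV1}$$ By a solution on $[-T,T]$ we mean a real-valued $u\in C([-T,T];\mathcal{F}L^{s,p}(\mathbb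 T))\cap X^{s,1/2}_{p,2}(T)$ with $u(0)=u_0$ which satisfies the equation on $(-T,T)\times\mathbb T$ in the sense of distributions, the right-hand side being read as $\sigma\,\partial_x\big(\frac13u^3-\frac1{2\pi}(\int_0^{2\pi} u^2dx)\,u\big)$ (which makes sense since $\mathcal{F}L^{s,p}(\mathbb T)\subset L^4(\mathbb T)$). Then (mKdV1) is locally well-posed in the real-valued part of $\mathcal{F}L^{s,p}(\mathbb T)$: 1. (Existence and continuous dependence) For every $R\ge0$ there are $T\in(0,1]$ and $C\ge0$, depending only on $s,p,\sigma,R$, such that every real-valued $u_0$ with $\|u_0\|_{\mathcal{F}L^{s,p}}\le R$ admits a solution $u$ on $[-T,T]$, and the solutions $u,v$ with any two such data $u_0,v_0$ satisfy $\sup_{|t|\le T}\|u(t)-v(t)\|_{\mathcal{F}L^{s,p}}\le C\|u_0-v_0\|_{\mathcal{F}L^{s,p}}$. 2. (Conditional uniqueness) For every $T\in(0,1]$, any two solutions on $[-T,T]$ with the same initial datum coincide on $[-T,T]$. -/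

import Mathlib

open MeasureTheory Filter Topology FourierTransform
open scoped ENNReal NNReal

noncomputable section

namespace MKdV

instance fact_two_pi_pos : Fact (0 < 2 * Real.pi) := ⟨Real.two_pi_pos⟩

/-- The torus `𝕋 = ℝ / 2πℤ`. -/
abbrev Torus : Type := AddCircle (2 * Real.pi)

/-- The normalized measure `dx / 2π` on the torus, so that integrals against it are averages. -/
abbrev torusMeasure : Measure Torus := AddCircle.haarAddCircle

/-- Complex-valued `L²(𝕋)`. For every pair `(s, p)` considered below one has `s ≥ 1/2` and
`s > 3/4 - 1/p`, so every distribution in `FL^{s,p}(𝕋)` belongs to `L²(𝕋)` (even to `L⁴(𝕋)`);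
hence `FL^{s,p}(𝕋)` is the set of `f : L2T` with `flNorm s p f < ∞`. -/
abbrev L2T : Type := Lp ℂ 2 torusMeasure

/-- The Japanese bracket `⟨x⟩ = (1 + x²)^{1/2}`. -/
def jb (x : ℝ) : ℝ := Real.sqrt (1 + x ^ 2)

/-- The Fourier-Lebesgue norm `‖ ⟨n⟩^s f̂(n) ‖_{ℓ^p_n}` (for `1 ≤ p < ∞`), with values in `[0, ∞]`;
here `f̂(n) = (2π)⁻¹ ∫ f(x) e^{-inx} dx`. -/
def flNorm (s p : ℝ) (f : L2T) : ℝ≥0∞ :=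
  (∑' n : ℤ, (ENNReal.ofReal (jb n ^ s) * ‖fourierCoeff f n‖ₑ) ^ p) ^ (1 / p)

/-- `f` is real-valued (almost everywhere). -/
def IsRealValued (f : L2T) : Prop := ∀ᵐ x ∂torusMeasure, (f x).im = 0

/-- The `n`-th Fourier coefficient as a continuous linear functional on `L²(𝕋)`. -/
def coeffCLM (n : ℤ) : L2T →L[ℂ] ℂ := innerSL ℂ (fourierLp 2 n)

theorem coeffCLM_apply (n : ℤ) (f : L2T) : coeffCLM n f = fourierCoeff f n := by
  rw [← fourierBasis_repr, HilbertBasis.repr_apply_apply, coe_fourierBasis]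
  rfl

/-- Space-time functions in `L²(ℝ × 𝕋) = L²(ℝ; L²(𝕋))`. -/
abbrev L2ST : Type := Lp L2T 2 (volume : Measure ℝ)

/-- The space-time Fourier transform
`v̂(τ, n) = (2π)⁻¹ ∫ (F_x v)(t, n) e^{-itτ} dt`, in the sense of Plancherel in `t`. Mathlib's `𝓕`
uses the kernel `e^{-2πi tξ}`, whence the substitution `ξ = τ / 2π`. -/
def stFourier (v : L2ST) (n : ℤ) (τ : ℝ) : ℂ :=
  ((2 * Real.pi)⁻¹ : ℝ) * (𝓕 ((coeffCLM n).compLp v : Lp ℂ 2 (volume : Measure ℝ))) (τ / (2 * Real.pi))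

/-- The norm `‖ ⟨n⟩^s ⟨τ - n³⟩^b v̂(τ, n) ‖_{ℓ^p_n L^q_τ}` of `X^{s,b}_{p,q}(ℝ × 𝕋)`, with values in
`[0, ∞]`, for finite `p, q ≥ 1`. It is used for `b = 1/2`, `q = 2` and the pairs `(s, p)` above only.
In that case finiteness of the norm forces `v ∈ L²(ℝ × 𝕋)`, and the completion of the Schwartz
functions on `ℝ × 𝕋` is exactly the set of `v` of finite norm, because the Schwartz functions
are dense in the corresponding weighted `ℓ^p_n L²_τ` space. -/
def xNorm (s b p q : ℝ) (v : L2ST) : ℝ≥0∞ :=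
  (∑' n : ℤ, (ENNReal.ofReal (jb n ^ s) *
    (∫⁻ τ : ℝ, (ENNReal.ofReal (jb (τ - (n : ℝ) ^ 3) ^ b) * ‖stFourier v n τ‖ₑ) ^ q) ^ (1 / q)) ^ p)
      ^ (1 / p)

/-- `u` belongs to the restriction space `X^{s,b}_{p,q}(T)`: on the interval `[-T, T]` it coincides
(as a space-time function, so almost everywhere) with an element of `X^{s,b}_{p,q}(ℝ × 𝕋)`. -/
def MemXRestr (s b p q T : ℝ) (u : ℝ → L2T) : Prop :=
  ∃ v : L2ST, xNorm s b p q v < ⊤ ∧ ∀ᵐ t ∂(volume.restrict (Set.Icc (-T) T)), v t = u t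

/-- `u ∈ C([-T, T]; FL^{s,p}(𝕋))`. -/
def MemCFL (s p T : ℝ) (u : ℝ → L2T) : Prop :=
  (∀ t ∈ Set.Icc (-T) T, flNorm s p (u t) < ⊤) ∧
  ∀ t₀ ∈ Set.Icc (-T) T,
    Tendsto (fun t => flNorm s p (u t - u t₀)) (𝓝[Set.Icc (-T) T] t₀) (𝓝 0)

/-- The average `(2π)⁻¹ ∫ |f|² dx`. -/
def meanSq (f : L2T) : ℝ := ∫ x, ‖f x‖ ^ 2 ∂torusMeasure

/-- A test function `φ ∈ C_c^∞((-T, T) × 𝕋)`, written as a function of `(t, x) ∈ ℝ²` that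
is `2π`-periodic in `x`. -/
structure IsTestFunction (T : ℝ) (φ : ℝ → ℝ → ℂ) : Prop where
  smooth : ContDiff ℝ (⊤ : ℕ∞) (fun z : ℝ × ℝ => φ z.1 z.2)
  periodic : ∀ t x, φ t (x + 2 * Real.pi) = φ t x
  compact_support : ∃ T' < T, ∀ t x, T' ≤ |t| → φ t x = 0

/-- `u` satisfies `∂_t u + ∂_x³ u = σ (u² - m(u)) ∂_x u` on `(-T, T) × 𝕋` in the sense of
distributions, where `m(u)(t) = (2π)⁻¹ ∫ |u(t)|² dx`. For real-valued `u` in `L³`, the right-hand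
side is the distribution `σ ∂_x (u³ / 3 - m(u) u)`. -/
def IsDistribSolution (σ T : ℝ) (u : ℝ → L2T) : Prop :=
  ∀ φ : ℝ → ℝ → ℂ, IsTestFunction T φ →
    (∫ t in (-T)..T, ∫ x in (0 : ℝ)..(2 * Real.pi),
        u t (x : Torus) * (deriv (fun r => φ r x) t + iteratedDeriv 3 (φ t) x)) =
      (σ : ℂ) * ∫ t in (-T)..T, ∫ x in (0 : ℝ)..(2 * Real.pi),
        (u t (x : Torus) ^ 3 / 3 - (meanSq (u t) : ℂ) * u t (x : Torus)) * deriv (φ t) x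

/-- `u` is a real-valued solution on `[-T, T]`, with initial datum `u₀`, of the first renormalized
mKdV equation with sign `σ`, in the class `C([-T, T]; FL^{s,p}(𝕋)) ∩ X^{s,1/2}_{p,2}(T)`. -/
structure IsSolution (s p σ T : ℝ) (u₀ : L2T) (u : ℝ → L2T) : Prop where
  real : ∀ t ∈ Set.Icc (-T) T, IsRealValued (u t)
  cont : MemCFL s p T u
  memX : MemXRestr s (1 / 2) p 2 T u
  initial : u 0 = u₀
  eqn : IsDistribSolution σ T u

end MKdV

end

open MKdV

noncomputable section

namespace MKdV

/-! Pass to the interaction profile `w n t = exp(-i n³ t) û(t, n)`. Mode by mode the equation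
becomes `w n t = w n 0 + iσ ∑ c(n,a,b) ∫₀ᵗ exp(-iφr) w_a w_b w_{n-a-b} dr`, where `φ = n³ - a³ - b³
- (n-a-b)³ = 3(a+b)(n-a)(n-b)`. Subtracting the mean of `u²` removes every resonant interaction (`φ
= 0`) except `a = b = n`. Everything is done for this integral equation.

In time, a profile is measured by `yN`: the supremum plus the Nikolskii seminorm of order 1/2 in
`L²`. This is an algebra, it tolerates the jumps of sharp time cutoffs, and integration against
`exp(-iφr)` gains `|φ|^(-1/2)` (`yN_primitive_oscInt_le`). For the gain, add to the integrand its
translate by the half period `π/|φ|`: the exponentials cancel and leave an increment of the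
amplitude over a distance `π/|φ|`, together with thin boundary layers.

In frequency, what remains is the multiplier `|c| |φ|^(-1/2) ⟨n⟩^s (⟨a⟩⟨b⟩⟨n-a-b⟩)^(-s)`. Off
resonance, and for `s ≤ 3/4`, it is at most a constant times `(⟨X⟩⟨Y⟩)^(-(s+1/4))` for one of twelve
pairs `X, Y` of independent linear forms (`triWeight_le_of_phase_ne`); on resonance it is bounded
because `s ≥ 1/2`. Hence it lies in `ℓ^{p'}` in `(a,b)` uniformly in `n` once `(s+1/4)p' > 1`, that
is `s > 3/4 - 1/p`. Hölder's inequality then gives the trilinear estimate `seqN_trilinear`. The time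
interval contributes a factor `√(b - a)`, so the Duhamel map is a contraction on short intervals
(`duhamel_lipschitz`). This gives existence and Lipschitz dependence. By the half-period argument
the primitives even have a finite `H^{1/2}` seminorm (`slobN_primitive_oscInt_le`), which by
Plancherel puts the solution in `X^{s,1/2}_{p,2}`.

For uniqueness, the `X^{s,1/2}_{p,2}` bound of a given solution controls the `L²` and Nikolskii
norms of its profile but not the supremum. The embedding of this space into `L⁴` and `L⁶` is enough
to bound the supremum of the oscillatory primitive of a triple product
(`supN_primitive_oscInt_triple_le`). The integral equation then shows that the profile has finite
`profN`, and the contraction estimate, restarted on successive short intervals, gives uniqueness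
(`profile_unique`).

The equivalence of the distributional equation with the integral equation rests on the embedding of
the data space into sequences in `ℓ^{4/3}`: the sums for the Fourier coefficients of `u³` then
converge absolutely, by Young's inequality. -/

/-! ### Elementary inequalities for the Japanese bracket. -/

theorem one_le_jb (x : ℝ) : 1 ≤ jb x := by
  rw [jb, Real.one_le_sqrt]; nlinarith [sq_nonneg x]

theorem jb_pos (x : ℝ) : 0 < jb x := one_pos.trans_le (one_le_jb x)

theorem abs_le_jb (x : ℝ) : |x| ≤ jb x := by
  rw [jb]; apply Real.abs_le_sqrt; linarith

theorem jb_le_one_add (x : ℝ) : jb x ≤ 1 + |x| := by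
  rw [jb, Real.sqrt_le_left (by positivity)]
  nlinarith [sq_abs x, abs_nonneg x]

theorem jb_neg (x : ℝ) : jb (-x) = jb x := by simp [jb]

theorem jb_mono {x y : ℝ} (h : |x| ≤ |y|) : jb x ≤ jb y := by
  rw [jb, jb]; apply Real.sqrt_le_sqrt
  have := sq_le_sq.2 h
  linarith

theorem jb_add_le (x y : ℝ) : jb (x + y) ≤ jb x + jb y := by
  have hx := jb_pos x
  have hy := jb_pos y
  have h1 : jb x ^ 2 = 1 + x ^ 2 := by rw [jb, Real.sq_sqrt (by positivity)]
  have h2 : jb y ^ 2 = 1 + y ^ 2 := by rw [jb, Real.sq_sqrt (by positivity)]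
  rw [jb, Real.sqrt_le_left (by positivity)]
  have h3 : |x| * |y| ≤ jb x * jb y := mul_le_mul (abs_le_jb x) (abs_le_jb y) (abs_nonneg _) hx.le
  have h4 : x * y ≤ |x| * |y| := by rw [← abs_mul]; exact le_abs_self _
  nlinarith [one_le_jb x, one_le_jb y]

theorem jb_le_two_mul {m : ℤ} (h : m ≠ 0) : jb m ^ 2 ≤ 2 * |(m : ℝ)| ^ 2 := by
  have : (1 : ℝ) ≤ |(m : ℝ)| := by exact_mod_cast Int.one_le_abs h
  rw [jb, Real.sq_sqrt (by positivity), sq_abs]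
  nlinarith [sq_abs (m : ℝ)]

/-! ### Pointwise bounds for the trilinear multiplier. -/

/-- A product of three negative powers is dominated by a product of two of them. -/
theorem rpow_triple_le_pair {X Y Z α β γ κ : ℝ} (hX : 1 ≤ X) (hY : 1 ≤ Y) (hZ : 1 ≤ Z)
    (hα : α ≤ κ) (hβ : β ≤ κ) (hγ : γ ≤ κ) (hs : α + β + γ = 2 * κ) :
    X ^ (-α) * Y ^ (-β) * Z ^ (-γ) ≤ (Y * Z) ^ (-κ) ∨
    X ^ (-α) * Y ^ (-β) * Z ^ (-γ) ≤ (X * Z) ^ (-κ) ∨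
    X ^ (-α) * Y ^ (-β) * Z ^ (-γ) ≤ (X * Y) ^ (-κ) := by
  -- The largest factor is the one to eliminate: `α = (κ - β) + (κ - γ)` splits its power in two,
  -- and lowering `X` to `Y` in one part and to `Z` in the other raises both remaining exponents to
  -- `κ`.
  have key : ∀ X Y Z α β γ : ℝ, 1 ≤ X → 1 ≤ Y → 1 ≤ Z → α ≤ κ → β ≤ κ → γ ≤ κ →
      α + β + γ = 2 * κ → Y ≤ X → Z ≤ X →
      X ^ (-α) * Y ^ (-β) * Z ^ (-γ) ≤ (Y * Z) ^ (-κ) := by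
    intro X Y Z α β γ hX hY hZ hα hβ hγ hs hYX hZX
    have hX0 : 0 < X := by linarith
    have hY0 : 0 < Y := by linarith
    have hZ0 : 0 < Z := by linarith
    have e1 : X ^ (-α) = X ^ (-(κ - β)) * X ^ (-(κ - γ)) := by
      rw [← Real.rpow_add hX0]; congr 1; linarith
    have e2 : (Y * Z) ^ (-κ) = Y ^ (-(κ - β)) * Z ^ (-(κ - γ)) * (Y ^ (-β) * Z ^ (-γ)) := by
      rw [Real.mul_rpow hY0.le hZ0.le, mul_mul_mul_comm, ← Real.rpow_add hY0, ← Real.rpow_add hZ0]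
      congr 2 <;> ring
    rw [e1, e2, mul_assoc]
    exact mul_le_mul_of_nonneg_right (mul_le_mul
      (Real.rpow_le_rpow_of_nonpos hY0 hYX (by linarith))
      (Real.rpow_le_rpow_of_nonpos hZ0 hZX (by linarith)) (by positivity) (by positivity))
      (by positivity)
  rcases le_total X Y with h1 | h1
  · rcases le_total Y Z with h2 | h2
    · right; right
      have := key Z X Y γ α β hZ hX hY hγ hα hβ (by linarith) (h1.trans h2) h2
      linarith [this]
    · right; left
      have := key Y X Z β α γ hY hX hZ hβ hα hγ (by linarith) h1 h2
      linarith [this]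
  · rcases le_total X Z with h2 | h2
    · right; right
      have := key Z X Y γ α β hZ hX hY hγ hα hβ (by linarith) h2 (h1.trans h2)
      linarith [this]
    · left
      exact key X Y Z α β γ hX hY hZ hα hβ hγ hs h1 h2

/-- The weight bound when `n₁` carries the largest frequency, in terms of abstract sizes. -/
theorem weight_core {s J0 J1 J2 J3 A B C : ℝ} (hs1 : 1 / 2 ≤ s) (hs2 : s ≤ 3 / 4)
    (h0 : 1 ≤ J0) (h1 : 1 ≤ J1) (h2 : 1 ≤ J2) (h3 : 1 ≤ J3) (hA : 1 ≤ A) (hB : 1 ≤ B) (hC : 1 ≤ C)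
    (h21 : J2 ≤ J1) (h31 : J3 ≤ J1) (h0s : J0 ≤ J1 + J2 + J3)
    (hA3 : J0 ≤ A + J3) (hC2 : J0 ≤ C + J2) (hA1 : J1 ≤ A + J2) (hC1 : J1 ≤ C + J3)
    (hA' : A ≤ J1 + J2) (hB' : B ≤ J2 + J3) (hC' : C ≤ J1 + J3) :
    J0 * J0 ^ s * (A * B * C) ^ (-(1 / 2) : ℝ) * (J1 * J2 * J3) ^ (-s) ≤
      24 * (B ^ (-(1 / 2) : ℝ) * J2 ^ (-s) * J3 ^ (-s)) ∨
    J0 * J0 ^ s * (A * B * C) ^ (-(1 / 2) : ℝ) * (J1 * J2 * J3) ^ (-s) ≤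
      24 * (A ^ (-(2 * (s + 1 / 4) / 3)) * B ^ (-(2 * (s + 1 / 4) / 3)) * C ^ (-(2 * (s + 1 / 4) / 3))) := by
  have hA0 : 0 < A := by linarith
  have hB0 : 0 < B := by linarith
  have hC0 : 0 < C := by linarith
  have p0 : 0 < J0 := by linarith
  have p1 : 0 < J1 := by linarith
  have p2 : 0 < J2 := by linarith
  have p3 : 0 < J3 := by linarith
  have e1 : J0 ^ s * J1 ^ (-s) ≤ 3 := by
    have : J0 ^ s ≤ (3 * J1) ^ s := Real.rpow_le_rpow p0.le (by linarith) (by linarith)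
    rw [Real.mul_rpow (by norm_num) p1.le] at this
    rw [Real.rpow_neg p1.le, ← div_eq_mul_inv, div_le_iff₀ (by positivity)]
    refine this.trans ?_
    gcongr
    calc (3 : ℝ) ^ s ≤ 3 ^ (1 : ℝ) := Real.rpow_le_rpow_of_exponent_le (by norm_num) (by linarith)
      _ = 3 := by norm_num
  have e2 : J0 * J0 ^ s * (A * B * C) ^ (-(1 / 2) : ℝ) * (J1 * J2 * J3) ^ (-s) =
      (J0 ^ s * J1 ^ (-s)) * (J0 * (A * B * C) ^ (-(1 / 2) : ℝ) * J2 ^ (-s) * J3 ^ (-s)) := by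
    rw [Real.mul_rpow (by positivity) p3.le, Real.mul_rpow p1.le p2.le]; ring
  have e3 : J0 * J0 ^ s * (A * B * C) ^ (-(1 / 2) : ℝ) * (J1 * J2 * J3) ^ (-s) ≤
      3 * (J0 * (A * B * C) ^ (-(1 / 2) : ℝ) * J2 ^ (-s) * J3 ^ (-s)) := by
    rw [e2]; gcongr
  -- If `A` and `C` are both comparable to the output frequency, `(A C)^(-1/2)` pays for the
  -- derivative `J0`. If one of them is small, the two smaller input frequencies are both at least
  -- `J0 / 2`, and two powers `-s` pay for the derivative.
  by_cases hcase : J0 / 4 ≤ A ∧ J0 / 4 ≤ C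
  · left
    refine e3.trans ?_
    have f1 : J0 * (A * C) ^ (-(1 / 2) : ℝ) ≤ 4 := by
      have : (A * C) ^ (-(1 / 2) : ℝ) ≤ ((J0 / 4) ^ 2) ^ (-(1 / 2) : ℝ) :=
        Real.rpow_le_rpow_of_nonpos (by positivity) (by nlinarith [hcase.1, hcase.2]) (by norm_num)
      have h' : ((J0 / 4) ^ 2) ^ (-(1 / 2) : ℝ) = 4 / J0 := by
        rw [← Real.rpow_natCast, ← Real.rpow_mul (by positivity)]
        norm_num
        rw [Real.rpow_neg_one]; simp
      rw [h'] at this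
      calc _ ≤ J0 * (4 / J0) := by gcongr
        _ = 4 := by field_simp
    have f2 : (A * B * C) ^ (-(1 / 2) : ℝ) = (A * C) ^ (-(1 / 2) : ℝ) * B ^ (-(1 / 2) : ℝ) := by
      rw [← Real.mul_rpow (by positivity) hB0.le]; congr 1; ring
    rw [f2]
    calc _ = 3 * (J0 * (A * C) ^ (-(1 / 2) : ℝ)) * (B ^ (-(1 / 2) : ℝ) * J2 ^ (-s) * J3 ^ (-s)) := by ring
      _ ≤ 3 * 4 * (B ^ (-(1 / 2) : ℝ) * J2 ^ (-s) * J3 ^ (-s)) := by gcongr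
      _ ≤ _ := by gcongr; norm_num
  · right
    refine e3.trans ?_
    -- by the symmetry exchanging the second and the third frequency it is enough to treat one case
    have key : ∀ J2 J3 A C : ℝ, 1 ≤ J2 → 1 ≤ J3 → 1 ≤ A → 1 ≤ C → J3 ≤ J1 → J2 ≤ J1 → J0 ≤ A + J3 →
        J1 ≤ A + J2 → B ≤ J2 + J3 → C ≤ J1 + J3 → A < J0 / 4 →
        J0 * J2 ^ (-s) * J3 ^ (-s) ≤ 8 * (A * B * C) ^ (-((2 * s - 1) / 3)) := by
      intro J2 J3 A C h2 h3 hA hC h31 h21 hA3 hA1 hB' hC' hlt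
      have p2 : 0 < J2 := by linarith
      have p3 : 0 < J3 := by linarith
      -- For small `A` the frequency `J2` controls all three of `A`, `B`, `C`, so the surplus decay
      -- `J2^(1-2s)`, which needs `s ≥ 1/2`, can be shared equally among them.
      have g1 : A * B * C ≤ (3 * J2) ^ 3 := by
        have a1 : A ≤ 3 * J2 := by linarith
        have a2 : B ≤ 3 * J2 := by linarith
        have a3 : C ≤ 3 * J2 := by linarith
        calc A * B * C ≤ (3 * J2) * (3 * J2) * (3 * J2) := by gcongr
          _ = _ := by ring
      have g2 : ((3 * J2) ^ 3) ^ (-((2 * s - 1) / 3)) ≤ (A * B * C) ^ (-((2 * s - 1) / 3)) :=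
        Real.rpow_le_rpow_of_nonpos (by positivity) g1 (by linarith)
      have g3 : ((3 * J2) ^ 3) ^ (-((2 * s - 1) / 3)) = (3 * J2) ^ (-(2 * s - 1)) := by
        rw [← Real.rpow_natCast, ← Real.rpow_mul (by positivity)]; congr 1; push_cast; ring
      have g4 : J0 * J2 ^ (-s) * J3 ^ (-s) ≤ 8 * (3 * J2) ^ (-(2 * s - 1)) := by
        have b1 : J0 ≤ 2 * J2 := by linarith
        have b2 : J0 ≤ 2 * J3 := by linarith
        have c1 : J0 = J0 ^ (1 - s) * J0 ^ s := by rw [← Real.rpow_add p0]; simp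
        have c2 : J0 ^ (1 - s) ≤ (2 * J2) ^ (1 - s) := Real.rpow_le_rpow p0.le b1 (by linarith)
        have c3 : J0 ^ s ≤ (2 * J3) ^ s := Real.rpow_le_rpow p0.le b2 (by linarith)
        rw [Real.mul_rpow (by norm_num) p2.le] at c2
        rw [Real.mul_rpow (by norm_num) p3.le] at c3
        have c4 : J3 ^ s * J3 ^ (-s) = 1 := by rw [← Real.rpow_add p3]; simp
        have c5 : J2 ^ (1 - s) * J2 ^ (-s) = J2 ^ (-(2 * s - 1)) := by
          rw [← Real.rpow_add p2]; congr 1; ring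
        have c6 : (2 : ℝ) ^ (1 - s) * 2 ^ s = 2 := by
          rw [← Real.rpow_add (by norm_num)]; simp
        have c7 : (1 : ℝ) / 3 ≤ 3 ^ (-(2 * s - 1)) := by
          calc (1 : ℝ) / 3 = 3 ^ (-1 : ℝ) := by rw [Real.rpow_neg_one]; norm_num
            _ ≤ _ := Real.rpow_le_rpow_of_exponent_le (by norm_num) (by linarith)
        rw [Real.mul_rpow (by norm_num) p2.le]
        calc J0 * J2 ^ (-s) * J3 ^ (-s) = (J0 ^ (1 - s) * J0 ^ s) * J2 ^ (-s) * J3 ^ (-s) := by rw [← c1]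
          _ ≤ (2 ^ (1 - s) * J2 ^ (1 - s)) * (2 ^ s * J3 ^ s) * J2 ^ (-s) * J3 ^ (-s) := by gcongr
          _ = (2 ^ (1 - s) * 2 ^ s) * (J3 ^ s * J3 ^ (-s)) * (J2 ^ (1 - s) * J2 ^ (-s)) := by ring
          _ = 2 * J2 ^ (-(2 * s - 1)) := by rw [c4, c5, c6]; ring
          _ ≤ 8 * (1 / 3) * J2 ^ (-(2 * s - 1)) := by gcongr; norm_num
          _ ≤ 8 * 3 ^ (-(2 * s - 1)) * J2 ^ (-(2 * s - 1)) := by gcongr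
          _ = _ := by ring
      calc _ ≤ _ := g4
        _ = 8 * ((3 * J2) ^ 3) ^ (-((2 * s - 1) / 3)) := by rw [g3]
        _ ≤ _ := by gcongr
    have h8 : J0 * J2 ^ (-s) * J3 ^ (-s) ≤ 8 * (A * B * C) ^ (-((2 * s - 1) / 3)) := by
      by_cases hAlt : A < J0 / 4
      · exact key J2 J3 A C h2 h3 hA hC h31 h21 hA3 hA1 hB' hC' hAlt
      · have hClt : C < J0 / 4 := by
          by_contra h; exact hcase ⟨not_lt.1 hAlt, not_lt.1 h⟩
        have := key J3 J2 C A h3 h2 hC hA h21 h31 hC2 hC1 (by linarith) hA' hClt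
        calc _ = J0 * J3 ^ (-s) * J2 ^ (-s) := by ring
          _ ≤ _ := this
          _ = _ := by congr 2; ring
    -- The exponents match because `2(s + 1/4)/3 = 1/2 + (2s - 1)/3`.
    have f4 : A ^ (-(2 * (s + 1 / 4) / 3)) * B ^ (-(2 * (s + 1 / 4) / 3)) * C ^ (-(2 * (s + 1 / 4) / 3))
        = (A * B * C) ^ (-(1 / 2) : ℝ) * (A * B * C) ^ (-((2 * s - 1) / 3)) := by
      rw [← Real.rpow_add (by positivity), ← Real.mul_rpow hA0.le hB0.le, ← Real.mul_rpow (by positivity) hC0.le]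
      congr 1; ring
    rw [f4]
    calc _ = 3 * (A * B * C) ^ (-(1 / 2) : ℝ) * (J0 * J2 ^ (-s) * J3 ^ (-s)) := by ring
      _ ≤ 3 * (A * B * C) ^ (-(1 / 2) : ℝ) * (8 * (A * B * C) ^ (-((2 * s - 1) / 3))) := by gcongr
      _ = _ := by ring

/-- The resonance function `n³ - a³ - b³ - (n - a - b)³`. -/
def phase (n a b : ℤ) : ℤ := 3 * ((a + b) * (n - a) * (n - b))

/-- The coefficient of `û(a) û(b) û(n - a - b)` in the nonlinearity, up to the factor `i σ`:
the non-resonant interactions and the self-interaction of the mode `n`. -/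
def triCoeff (n a b : ℤ) : ℝ :=
  if phase n a b ≠ 0 then n / 3 else if a = n ∧ b = n then -n else 0

/-- The gain of the normal form at the resonance function. -/
def triGain (n a b : ℤ) : ℝ := (max 1 |(phase n a b : ℝ)|) ^ (-(1 / 2) : ℝ)

theorem triGain_nonneg (n a b : ℤ) : 0 ≤ triGain n a b := by
  unfold triGain; positivity

/-- The multiplier of the trilinear estimate. -/
def triWeight (s : ℝ) (n a b : ℤ) : ℝ :=
  |triCoeff n a b| * triGain n a b * jb n ^ s * (jb a * jb b * jb (n - a - b : ℤ)) ^ (-s)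

theorem triWeight_nonneg (s : ℝ) (n a b : ℤ) : 0 ≤ triWeight s n a b := by
  have := triGain_nonneg n a b
  have := jb_pos n; have := jb_pos a; have := jb_pos b; have := jb_pos (n - a - b : ℤ)
  unfold triWeight; positivity

/-- Pairs of linear forms in the frequencies that determine the interaction. -/
def pairForm (n : ℤ) : Fin 12 → ℤ × ℤ → ℤ × ℤ :=
  ![fun x => (n - x.1, x.2), fun x => (n - x.1, n - x.1 - x.2), fun x => (x.2, n - x.1 - x.2),
    fun x => (n - x.2, x.1), fun x => (n - x.2, n - x.1 - x.2), fun x => (x.1, n - x.1 - x.2),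
    fun x => (x.1 + x.2, x.1), fun x => (x.1 + x.2, x.2), fun x => (x.1, x.2),
    fun x => (x.1 + x.2, n - x.1), fun x => (x.1 + x.2, n - x.2), fun x => (n - x.1, n - x.2)]

/-- Injectivity allows a sum over `(a, b)` of a function of the chosen pair to be bounded by the
full sum over `ℤ × ℤ`, uniformly in `n`. -/
theorem pairForm_injective (n : ℤ) (i : Fin 12) : Function.Injective (pairForm n i) := by
  rintro ⟨a, b⟩ ⟨c, d⟩ h
  fin_cases i <;> simp [pairForm] at h <;> ext <;> simp <;> omega

theorem jb_int_le_of_abs {m k : ℤ} (h : |m| ≤ |k|) : jb m ≤ jb k :=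
  jb_mono (by exact_mod_cast h)

/-- Off resonance the gain is at most `(⟨a+b⟩⟨n-a⟩⟨n-b⟩)^(-1/2)`. Taking the largest input frequency
as `J1`, `weight_core` leaves three decaying factors with exponents `(1/2, s, s)` or three equal
ones. Both triples sum to `2(s + 1/4)`, so `rpow_triple_le_pair` with `κ = s + 1/4` removes the
largest factor. -/
theorem triWeight_le_of_phase_ne {s : ℝ} (hs1 : 1 / 2 ≤ s) (hs2 : s ≤ 3 / 4) (n a b : ℤ)
    (h : phase n a b ≠ 0) : ∃ i : Fin 12, triWeight s n a b ≤
      24 * (jb (pairForm n i (a, b)).1 * jb (pairForm n i (a, b)).2) ^ (-(s + 1 / 4)) := by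
  have hA : a + b ≠ 0 := by intro h0; apply h; simp [phase, h0]
  have hB : n - a ≠ 0 := by intro h0; apply h; simp [phase, h0]
  have hC : n - b ≠ 0 := by intro h0; apply h; simp [phase, h0]
  have pn := jb_pos n
  have pa := jb_pos a
  have pb := jb_pos b
  have pc := jb_pos (n - a - b : ℤ)
  have pA := jb_pos (a + b : ℤ)
  have pB := jb_pos (n - a : ℤ)
  have pC := jb_pos (n - b : ℤ)
  have hc : |triCoeff n a b| ≤ jb n := by
    rw [triCoeff, if_pos h, abs_div, abs_of_pos (by norm_num : (0:ℝ) < 3)]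
    have := abs_le_jb n
    have := abs_nonneg (n : ℝ)
    linarith
  -- Nonzero integers satisfy `⟨m⟩² ≤ 2m²`, and `2³ ≤ 3²`: the factor 3 in `phase` pays for passing
  -- from absolute values to brackets.
  have hg : triGain n a b ≤ (jb (a + b : ℤ) * jb (n - a : ℤ) * jb (n - b : ℤ)) ^ (-(1 / 2) : ℝ) := by
    refine Real.rpow_le_rpow_of_nonpos (by positivity) (le_max_of_le_right ?_) (by norm_num)
    have e : |(phase n a b : ℝ)| = 3 * (|((a + b : ℤ) : ℝ)| * |((n - a : ℤ) : ℝ)| * |((n - b : ℤ) : ℝ)|) := by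
      rw [phase]; push_cast; rw [abs_mul, abs_mul, abs_mul]; norm_num
    rw [e]
    refine abs_le_of_sq_le_sq' ?_ (by positivity) |>.2
    have h1 := jb_le_two_mul hA
    have h2 := jb_le_two_mul hB
    have h3 := jb_le_two_mul hC
    calc _ = jb (a + b : ℤ) ^ 2 * jb (n - a : ℤ) ^ 2 * jb (n - b : ℤ) ^ 2 := by ring
      _ ≤ (2 * |((a + b : ℤ) : ℝ)| ^ 2) * (2 * |((n - a : ℤ) : ℝ)| ^ 2) * (2 * |((n - b : ℤ) : ℝ)| ^ 2) := by
        gcongr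
      _ = 8 * (|((a + b : ℤ) : ℝ)| * |((n - a : ℤ) : ℝ)| * |((n - b : ℤ) : ℝ)|) ^ 2 := by ring
      _ ≤ 9 * (|((a + b : ℤ) : ℝ)| * |((n - a : ℤ) : ℝ)| * |((n - b : ℤ) : ℝ)|) ^ 2 := by
        gcongr; norm_num
      _ = _ := by ring
  have hW : triWeight s n a b ≤ jb n * jb n ^ s *
      (jb (a + b : ℤ) * jb (n - a : ℤ) * jb (n - b : ℤ)) ^ (-(1 / 2) : ℝ) *
        (jb a * jb b * jb (n - a - b : ℤ)) ^ (-s) := by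
    rw [triWeight]
    calc _ ≤ jb n * (jb (a + b : ℤ) * jb (n - a : ℤ) * jb (n - b : ℤ)) ^ (-(1 / 2) : ℝ) * jb n ^ s *
        (jb a * jb b * jb (n - a - b : ℤ)) ^ (-s) := by
          have := triGain_nonneg n a b
          gcongr
      _ = _ := by ring
  have tri : ∀ x y z : ℤ, x = y + z → jb x ≤ jb y + jb z := by
    rintro x y z rfl; push_cast; exact jb_add_le _ _
  have tri' : ∀ x y z : ℤ, x = y - z → jb x ≤ jb y + jb z := by
    rintro x y z rfl; push_cast; rw [sub_eq_add_neg, ← jb_neg z]; exact jb_add_le _ _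
  have tri0 : jb n ≤ jb a + jb b + jb (n - a - b : ℤ) :=
    (tri n (a + b) (n - a - b) (by ring)).trans (by gcongr; exact tri _ _ _ rfl)
  have o := fun k : ℤ => one_le_jb k
  -- The indices `i`, `j`, `k` are the rows of `pairForm` that hold the pairs `(Y, Z)`, `(X, Z)`,
  -- `(X, Y)`.
  have fin1 : ∀ (X Y Z : ℤ) (α β γ : ℝ) (i j k : Fin 12), α ≤ s + 1 / 4 → β ≤ s + 1 / 4 → γ ≤ s + 1 / 4 →
      α + β + γ = 2 * (s + 1 / 4) → pairForm n i (a, b) = (Y, Z) → pairForm n j (a, b) = (X, Z) →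
      pairForm n k (a, b) = (X, Y) →
      triWeight s n a b ≤ 24 * (jb X ^ (-α) * jb Y ^ (-β) * jb Z ^ (-γ)) →
      ∃ i : Fin 12, triWeight s n a b ≤
        24 * (jb (pairForm n i (a, b)).1 * jb (pairForm n i (a, b)).2) ^ (-(s + 1 / 4)) := by
    intro X Y Z α β γ i j k h1 h2 h3 hsum hi hj hk hle
    rcases rpow_triple_le_pair (o X) (o Y) (o Z) h1 h2 h3 hsum with h' | h' | h'
    · exact ⟨i, by rw [hi]; exact hle.trans (by gcongr)⟩
    · exact ⟨j, by rw [hj]; exact hle.trans (by gcongr)⟩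
    · exact ⟨k, by rw [hk]; exact hle.trans (by gcongr)⟩
  have l1 : 1 / 2 ≤ s + 1 / 4 := by linarith
  have l2 : s ≤ s + 1 / 4 := by linarith
  have l3 : 1 / 2 + s + s = 2 * (s + 1 / 4) := by ring
  have l4 : 2 * (s + 1 / 4) / 3 ≤ s + 1 / 4 := by linarith
  have l5 : 2 * (s + 1 / 4) / 3 + 2 * (s + 1 / 4) / 3 + 2 * (s + 1 / 4) / 3 = 2 * (s + 1 / 4) := by ring
  have m : (|b| ≤ |a| ∧ |n - a - b| ≤ |a|) ∨ (|a| ≤ |b| ∧ |n - a - b| ≤ |b|) ∨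
      (|a| ≤ |n - a - b| ∧ |b| ≤ |n - a - b|) := by omega
  rcases m with ⟨m1, m2⟩ | ⟨m1, m2⟩ | ⟨m1, m2⟩
  · rcases weight_core (J0 := jb n) (J1 := jb a) (J2 := jb b) (J3 := jb (n - a - b : ℤ))
      (A := jb (a + b : ℤ)) (B := jb (n - a : ℤ)) (C := jb (n - b : ℤ)) hs1 hs2 (o _) (o _) (o _) (o _)
      (o _) (o _) (o _) (jb_int_le_of_abs m1) (jb_int_le_of_abs m2) tri0 (tri _ _ _ (by ring))
      (tri _ _ _ (by ring)) (tri' _ _ _ (by ring)) (tri' _ _ _ (by ring)) (tri _ _ _ (by ring))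
      (tri _ _ _ (by ring)) (tri _ _ _ (by ring)) with h' | h'
    · exact fin1 (n - a) b (n - a - b) (1 / 2) s s 2 1 0 l1 l2 l2 l3 rfl rfl rfl (hW.trans h')
    · exact fin1 (a + b) (n - a) (n - b) _ _ _ 11 10 9 l4 l4 l4 l5 rfl rfl rfl (hW.trans h')
  · rcases weight_core (J0 := jb n) (J1 := jb b) (J2 := jb a) (J3 := jb (n - a - b : ℤ))
      (A := jb (a + b : ℤ)) (B := jb (n - b : ℤ)) (C := jb (n - a : ℤ)) hs1 hs2 (o _) (o _) (o _) (o _)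
      (o _) (o _) (o _) (jb_int_le_of_abs m1) (jb_int_le_of_abs m2) (by linarith) (tri _ _ _ (by ring))
      (tri _ _ _ (by ring)) (tri' _ _ _ (by ring)) (tri' _ _ _ (by ring)) (tri _ _ _ (by ring))
      (tri _ _ _ (by ring)) (tri _ _ _ (by ring)) with h' | h'
    · refine fin1 (n - b) a (n - a - b) (1 / 2) s s 5 4 3 l1 l2 l2 l3 rfl rfl rfl (hW.trans (le_trans (le_of_eq ?_) h'))
      congr 2 <;> ring_nf
    · refine fin1 (a + b) (n - a) (n - b) (2 * (s + 1 / 4) / 3) (2 * (s + 1 / 4) / 3) (2 * (s + 1 / 4) / 3)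
        11 10 9 l4 l4 l4 l5 rfl rfl rfl (hW.trans ((le_of_eq ?_).trans (h'.trans (le_of_eq ?_))))
      · congr 2 <;> ring_nf
      · ring
  · rcases weight_core (J0 := jb n) (J1 := jb (n - a - b : ℤ)) (J2 := jb a) (J3 := jb b)
      (A := jb (n - b : ℤ)) (B := jb (a + b : ℤ)) (C := jb (n - a : ℤ)) hs1 hs2 (o _) (o _) (o _) (o _)
      (o _) (o _) (o _) (jb_int_le_of_abs m1) (jb_int_le_of_abs m2) (by linarith) (tri _ _ _ (by ring))
      (tri _ _ _ (by ring)) (tri' _ _ _ (by ring)) (tri' _ _ _ (by ring)) (tri _ _ _ (by ring))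
      (tri _ _ _ (by ring)) (tri _ _ _ (by ring)) with h' | h'
    · refine fin1 (a + b) a b (1 / 2) s s 8 7 6 l1 l2 l2 l3 rfl rfl rfl (hW.trans (le_trans (le_of_eq ?_) h'))
      congr 2 <;> ring_nf
    · refine fin1 (a + b) (n - a) (n - b) (2 * (s + 1 / 4) / 3) (2 * (s + 1 / 4) / 3) (2 * (s + 1 / 4) / 3)
        11 10 9 l4 l4 l4 l5 rfl rfl rfl (hW.trans ((le_of_eq ?_).trans (h'.trans (le_of_eq ?_))))
      · congr 2 <;> ring_nf
      · ring

/-- The only surviving resonance is the self-interaction of the mode `n`, of size `|n| ⟨n⟩^(-2s)`.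
Its boundedness is where `s ≥ 1/2` is indispensable. -/
theorem triWeight_le_one_of_phase_eq {s : ℝ} (hs1 : 1 / 2 ≤ s) (n a b : ℤ)
    (h : phase n a b = 0) : triWeight s n a b ≤ if a = n ∧ b = n then 1 else 0 := by
  rw [triWeight, triCoeff, if_neg (not_not.2 h)]
  split_ifs with h'
  · obtain ⟨rfl, hb⟩ := h'
    subst hb
    have p := jb_pos b
    have e : jb (b - b - b : ℤ) = jb b := by
      rw [show b - b - b = -b by ring]; push_cast; exact jb_neg _
    have hg : triGain b b b = 1 := by simp [triGain, h]
    rw [e, hg, abs_neg]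
    have h1 : (jb b * jb b * jb b) ^ (-s) = (jb b ^ s)⁻¹ * (jb b ^ (2 * s))⁻¹ := by
      rw [Real.mul_rpow (by positivity) p.le, Real.mul_rpow p.le p.le, Real.rpow_neg p.le, two_mul,
        Real.rpow_add p]
      ring
    rw [h1]
    have h2 : jb b ≤ jb b ^ (2 * s) := by
      calc jb b = jb b ^ (1 : ℝ) := by simp
        _ ≤ _ := Real.rpow_le_rpow_of_exponent_le (one_le_jb _) (by linarith)
    have h3 : |(b : ℝ)| ≤ jb b ^ (2 * s) := (abs_le_jb _).trans h2
    have q : 0 < jb b ^ s := by positivity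
    have q2 : 0 < jb b ^ (2 * s) := by positivity
    calc _ = |(b : ℝ)| / jb b ^ (2 * s) := by field_simp
      _ ≤ 1 := by rw [div_le_one q2]; exact h3
  · simp

/-- Lowering the regularity exponent increases the multiplier, up to a constant. -/
theorem triWeight_le_of_le {s s' : ℝ} (h : s' ≤ s) (n a b : ℤ) :
    triWeight s n a b ≤ 3 ^ (s - s') * triWeight s' n a b := by
  have pn := jb_pos n
  have pa := jb_pos a
  have pb := jb_pos b
  have pc := jb_pos (n - a - b : ℤ)
  have h1 : jb n ≤ 3 * (jb a * jb b * jb (n - a - b : ℤ)) := by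
    have t1 : jb n ≤ jb a + jb b + jb (n - a - b : ℤ) := by
      have e : (n : ℝ) = a + b + (n - a - b : ℤ) := by push_cast; ring
      calc jb n = jb (a + b + (n - a - b : ℤ)) := by rw [← e]
        _ ≤ _ := (jb_add_le _ _).trans (by gcongr; exact jb_add_le _ _)
    have oa := one_le_jb a
    have ob := one_le_jb b
    have oc := one_le_jb (n - a - b : ℤ)
    have u1 : 1 ≤ jb a * jb b := one_le_mul_of_one_le_of_one_le oa ob
    have u2 : 1 ≤ jb b * jb (n - a - b : ℤ) := one_le_mul_of_one_le_of_one_le ob oc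
    have u3 : 1 ≤ jb a * jb (n - a - b : ℤ) := one_le_mul_of_one_le_of_one_le oa oc
    nlinarith
  set X := jb a * jb b * jb (n - a - b : ℤ) with hX
  have pX : 0 < X := by positivity
  have h2 : jb n ^ s * X ^ (-s) ≤ 3 ^ (s - s') * (jb n ^ s' * X ^ (-s')) := by
    have e1 : jb n ^ s = jb n ^ (s - s') * jb n ^ s' := by rw [← Real.rpow_add pn]; congr 1; ring
    have e2 : X ^ (-s') = X ^ (s - s') * X ^ (-s) := by rw [← Real.rpow_add pX]; congr 1; ring
    have e3 : jb n ^ (s - s') ≤ 3 ^ (s - s') * X ^ (s - s') := by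
      rw [← Real.mul_rpow (by norm_num) pX.le]
      exact Real.rpow_le_rpow pn.le h1 (by linarith)
    rw [e1, e2]
    calc _ ≤ 3 ^ (s - s') * X ^ (s - s') * jb n ^ s' * X ^ (-s) := by gcongr
      _ = _ := by ring
  have g := triGain_nonneg n a b
  rw [triWeight, triWeight, ← hX]
  calc _ = |triCoeff n a b| * triGain n a b * (jb n ^ s * X ^ (-s)) := by ring
    _ ≤ |triCoeff n a b| * triGain n a b * (3 ^ (s - s') * (jb n ^ s' * X ^ (-s'))) := by gcongr
    _ = _ := by ring

/-! ### Summability of the multiplier and the trilinear estimate in weighted `ℓ^p`. -/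

theorem tsum_mul_le_Lp_mul_Lq {ι : Type*} {p q : ℝ} (hpq : p.HolderConjugate q) (f g : ι → ℝ≥0∞) :
    ∑' i, f i * g i ≤ (∑' i, f i ^ p) ^ (1 / p) * (∑' i, g i ^ q) ^ (1 / q) := by
  let _ : MeasurableSpace ι := ⊤
  have := ENNReal.lintegral_mul_le_Lp_mul_Lq (Measure.count : Measure ι) hpq
    (f := f) (g := g) measurable_from_top.aemeasurable measurable_from_top.aemeasurable
  simpa [lintegral_count] using this

theorem tsum_Lp_add_le {ι : Type*} {p : ℝ} (hp : 1 ≤ p) (f g : ι → ℝ≥0∞) :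
    (∑' i, (f i + g i) ^ p) ^ (1 / p) ≤ (∑' i, f i ^ p) ^ (1 / p) + (∑' i, g i ^ p) ^ (1 / p) := by
  let _ : MeasurableSpace ι := ⊤
  have := ENNReal.lintegral_Lp_add_le (μ := (Measure.count : Measure ι))
    (f := f) (g := g) measurable_from_top.aemeasurable measurable_from_top.aemeasurable hp
  simpa [lintegral_count] using this

theorem tsum_sq_mul_le {ι : Type*} (f g : ι → ℝ≥0∞) :
    (∑' i, f i * g i) ^ 2 ≤ (∑' i, f i ^ 2) * ∑' i, g i ^ 2 := by
  have h := tsum_mul_le_Lp_mul_Lq (p := 2) (q := 2) (by constructor <;> norm_num) f g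
  have h2 := ENNReal.pow_le_pow_left h (n := 2)
  rw [mul_pow, ← ENNReal.rpow_natCast ((∑' i, f i ^ (2:ℝ)) ^ (1 / 2 : ℝ)),
    ← ENNReal.rpow_natCast ((∑' i, g i ^ (2:ℝ)) ^ (1 / 2 : ℝ)), ← ENNReal.rpow_mul, ← ENNReal.rpow_mul] at h2
  simpa using h2

theorem tsum_jb_rpow_lt_top {θ : ℝ} (hθ : 1 < θ) : ∑' n : ℤ, ENNReal.ofReal (jb n ^ (-θ)) < ⊤ := by
  have hs : Summable fun n : ℤ => jb n ^ (-θ) := by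
    refine Summable.of_norm_bounded_eventually (Real.summable_abs_int_rpow hθ) ?_
    have : ∀ᶠ n : ℤ in cofinite, n ≠ 0 := by
      rw [Filter.eventually_cofinite]; exact (Set.finite_singleton (0 : ℤ)).subset (by intro; simp)
    filter_upwards [this] with n hn
    rw [Real.norm_of_nonneg (Real.rpow_nonneg (jb_pos _).le _)]
    exact Real.rpow_le_rpow_of_nonpos (by positivity) (abs_le_jb _) (by linarith)
  rw [← ENNReal.ofReal_tsum_of_nonneg (fun n => Real.rpow_nonneg (jb_pos _).le _) hs]
  exact ENNReal.ofReal_lt_top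

/-- Which pair of forms dominates varies with `(a, b)`, so all twelve are summed. Each contributes
at most the square of a convergent one-dimensional sum, and the resonant point `(n, n)` adds at most
1. -/
theorem tsum_triWeight_rpow_of_le {s q : ℝ} (hs1 : 1 / 2 ≤ s) (hs2 : s ≤ 3 / 4) (hq : 0 < q)
    (hκ : 1 < (s + 1 / 4) * q) : ∃ K : ℝ≥0∞, K ≠ ⊤ ∧ ∀ n : ℤ,
      ∑' v : ℤ × ℤ, ENNReal.ofReal (triWeight s n v.1 v.2) ^ q ≤ K := by
  set Z := ∑' n : ℤ, ENNReal.ofReal (jb n ^ (-((s + 1 / 4) * q))) with hZ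
  have hZt : Z ≠ ⊤ := (tsum_jb_rpow_lt_top hκ).ne
  set P : ℤ × ℤ → ℝ≥0∞ := fun v =>
    ENNReal.ofReal (jb v.1 ^ (-((s + 1 / 4) * q))) * ENNReal.ofReal (jb v.2 ^ (-((s + 1 / 4) * q))) with hP
  have hPsum : ∑' v, P v = Z * Z := by
    rw [hP, ENNReal.tsum_prod (f := fun a b : ℤ => ENNReal.ofReal (jb a ^ (-((s + 1 / 4) * q))) *
      ENNReal.ofReal (jb b ^ (-((s + 1 / 4) * q))))]
    simp_rw [ENNReal.tsum_mul_left, ENNReal.tsum_mul_right]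
    rw [← hZ]
  refine ⟨ENNReal.ofReal (24 ^ q) * (12 * (Z * Z)) + 1, ?_, fun n => ?_⟩
  · exact ENNReal.add_ne_top.2 ⟨ENNReal.mul_ne_top ENNReal.ofReal_ne_top
      (ENNReal.mul_ne_top (by norm_num) (ENNReal.mul_ne_top hZt hZt)), ENNReal.one_ne_top⟩
  have hpt : ∀ v : ℤ × ℤ, ENNReal.ofReal (triWeight s n v.1 v.2) ^ q ≤
      ENNReal.ofReal (24 ^ q) * (∑ i : Fin 12, P (pairForm n i v)) + if v = (n, n) then 1 else 0 := by
    rintro ⟨a, b⟩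
    by_cases h : phase n a b = 0
    · refine le_add_of_nonneg_of_le zero_le ?_
      have h1 := triWeight_le_one_of_phase_eq hs1 n a b h
      by_cases h2 : a = n ∧ b = n
      · rw [if_pos h2] at h1
        rw [if_pos (by rw [h2.1, h2.2])]
        exact ENNReal.rpow_le_one (by simpa using h1) hq.le
      · rw [if_neg h2] at h1
        simp [ENNReal.ofReal_of_nonpos h1, hq]
    · refine le_add_of_le_of_nonneg ?_ zero_le
      obtain ⟨i, hi⟩ := triWeight_le_of_phase_ne hs1 hs2 n a b h
      have p1 := jb_pos (pairForm n i (a, b)).1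
      have p2 := jb_pos (pairForm n i (a, b)).2
      calc ENNReal.ofReal (triWeight s n a b) ^ q = ENNReal.ofReal (triWeight s n a b ^ q) :=
            ENNReal.ofReal_rpow_of_nonneg (triWeight_nonneg _ _ _ _) hq.le
        _ ≤ ENNReal.ofReal ((24 * (jb (pairForm n i (a, b)).1 * jb (pairForm n i (a, b)).2) ^ (-(s + 1 / 4))) ^ q) := by
            exact ENNReal.ofReal_le_ofReal (Real.rpow_le_rpow (triWeight_nonneg _ _ _ _) hi hq.le)
        _ = ENNReal.ofReal (24 ^ q) * P (pairForm n i (a, b)) := by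
            rw [hP]
            simp only
            rw [← ENNReal.ofReal_mul (by positivity), ← ENNReal.ofReal_mul (by positivity)]
            congr 1
            rw [Real.mul_rpow (by norm_num) (by positivity), ← Real.rpow_mul (by positivity),
              Real.mul_rpow p1.le p2.le, neg_mul]
        _ ≤ _ := by
            gcongr
            exact Finset.single_le_sum (f := fun i => P (pairForm n i (a, b))) (fun _ _ => zero_le)
              (Finset.mem_univ i)
  calc _ ≤ ∑' v : ℤ × ℤ, (ENNReal.ofReal (24 ^ q) * (∑ i : Fin 12, P (pairForm n i v)) +
        if v = (n, n) then 1 else 0) := ENNReal.tsum_le_tsum hpt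
    _ = ENNReal.ofReal (24 ^ q) * (∑ i : Fin 12, ∑' v, P (pairForm n i v)) + 1 := by
        rw [ENNReal.tsum_add, ENNReal.tsum_mul_left, tsum_ite_eq,
          Summable.tsum_finsetSum (fun _ _ => ENNReal.summable)]
    _ ≤ ENNReal.ofReal (24 ^ q) * (∑ i : Fin 12, Z * Z) + 1 := by
        gcongr with i
        exact (ENNReal.tsum_comp_le_tsum_of_injective (pairForm_injective n i) P).trans_eq hPsum
    _ = _ := by simp

/-- The admissible pairs of exponents. -/
def Admissible (s p : ℝ) : Prop :=
  (1 / 2 ≤ s ∧ s < 3 / 4 ∧ 1 ≤ p ∧ p < 4 / (3 - 4 * s)) ∨ (3 / 4 ≤ s ∧ 1 ≤ p)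

theorem Admissible.one_le {s p : ℝ} (h : Admissible s p) : 1 ≤ p := by
  rcases h with h | h
  exacts [h.2.2.1, h.2]

theorem Admissible.half_le {s p : ℝ} (h : Admissible s p) : 1 / 2 ≤ s := by
  rcases h with h | h
  exacts [h.1, by linarith [h.1]]

/-- The two regimes merge into one condition, equivalent to `(min s (3/4) + 1/4) p' > 1` for the
conjugate exponent. At `s = 3/4` it already holds for every finite `p`, so no larger exponent is
needed. -/
theorem Admissible.lt_min {s p : ℝ} (h : Admissible s p) : 3 / 4 - 1 / p < min s (3 / 4) := by
  have hp : 0 < p := by linarith [h.one_le]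
  have hp' : 0 < 1 / p := by positivity
  rcases h with ⟨h1, h2, h3, h4⟩ | ⟨h1, h2⟩
  · rw [min_eq_left h2.le]
    rw [lt_div_iff₀ (by linarith)] at h4
    have : (3 - 4 * s) / 4 < 1 / p := by
      rw [div_lt_div_iff₀ (by norm_num) hp]; linarith
    linarith
  · rw [min_eq_right h1]; linarith

theorem tsum_triWeight_rpow {s p q : ℝ} (h : Admissible s p) (hq : 0 < q)
    (hq1 : 1 < (min s (3 / 4) + 1 / 4) * q) : ∃ K : ℝ≥0∞, K ≠ ⊤ ∧ ∀ n : ℤ,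
      ∑' v : ℤ × ℤ, ENNReal.ofReal (triWeight s n v.1 v.2) ^ q ≤ K := by
  obtain ⟨K, hK, hb⟩ := tsum_triWeight_rpow_of_le (s := min s (3 / 4))
    (le_min h.half_le (by norm_num)) (min_le_right _ _) hq hq1
  refine ⟨ENNReal.ofReal (3 ^ (s - min s (3 / 4))) ^ q * K,
    ENNReal.mul_ne_top (ENNReal.rpow_ne_top_of_nonneg hq.le ENNReal.ofReal_ne_top) hK, fun n => ?_⟩
  calc _ ≤ ∑' v : ℤ × ℤ, ENNReal.ofReal (3 ^ (s - min s (3 / 4))) ^ q *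
        ENNReal.ofReal (triWeight (min s (3 / 4)) n v.1 v.2) ^ q := by
        refine ENNReal.tsum_le_tsum fun v => ?_
        rw [← ENNReal.mul_rpow_of_nonneg _ _ hq.le, ← ENNReal.ofReal_mul (by positivity)]
        gcongr
        exact triWeight_le_of_le (min_le_left _ _) _ _ _
    _ ≤ _ := by rw [ENNReal.tsum_mul_left]; gcongr; exact hb n

/-- Hölder's inequality in `(a, b)` for fixed `n`, with the multiplier in `ℓ^{p'}`. -/
theorem tsum_triWeight_mul_le {s p : ℝ} (h : Admissible s p) : ∃ K : ℝ≥0∞, K ≠ ⊤ ∧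
    ∀ (n : ℤ) (x : ℤ × ℤ → ℝ≥0∞),
      (∑' v : ℤ × ℤ, ENNReal.ofReal (triWeight s n v.1 v.2) * x v) ^ p ≤ K * ∑' v, x v ^ p := by
  have hlt := h.lt_min
  have hmin : 1 / 2 ≤ min s (3 / 4) := le_min h.half_le (by norm_num)
  rcases h.one_le.eq_or_lt with rfl | hp
  -- For `p = 1` only a uniform bound of the multiplier is needed; it is read off from its `ℓ²` sum,
  -- which converges because `2 (1/2 + 1/4) > 1`.
  · obtain ⟨K, hK, hb⟩ := tsum_triWeight_rpow (q := 2) h (by norm_num) (by linarith)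
    refine ⟨K ^ (1 / 2 : ℝ), ENNReal.rpow_ne_top_of_nonneg (by norm_num) hK, fun n x => ?_⟩
    simp only [ENNReal.rpow_one]
    rw [← ENNReal.tsum_mul_left]
    refine ENNReal.tsum_le_tsum fun v => ?_
    gcongr
    have h1 : ENNReal.ofReal (triWeight s n v.1 v.2) ^ (2 : ℝ) ≤ K := (ENNReal.le_tsum v).trans (hb n)
    calc _ = (ENNReal.ofReal (triWeight s n v.1 v.2) ^ (2 : ℝ)) ^ (1 / 2 : ℝ) := by
          rw [← ENNReal.rpow_mul]; norm_num
      _ ≤ _ := by gcongr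
  · have hpq : p.HolderConjugate (p.conjExponent) := Real.HolderConjugate.conjExponent hp
    set q := p.conjExponent
    have hq0 : 0 < q := hpq.symm.pos
    have e1 : 1 / q = 1 - 1 / p := by
      have := hpq.inv_add_inv_eq_one
      rw [one_div, one_div]; linarith
    obtain ⟨K, hK, hb⟩ := tsum_triWeight_rpow (q := q) h hq0 (by
      rw [← div_lt_iff₀ hq0, e1]; linarith)
    refine ⟨K ^ (1 / q * p), ENNReal.rpow_ne_top_of_nonneg (by positivity) hK, fun n x => ?_⟩
    have h1 := tsum_mul_le_Lp_mul_Lq hpq.symm (fun v : ℤ × ℤ => ENNReal.ofReal (triWeight s n v.1 v.2)) x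
    have p0 : 0 < p := by linarith
    calc _ ≤ ((∑' v : ℤ × ℤ, ENNReal.ofReal (triWeight s n v.1 v.2) ^ q) ^ (1 / q) *
          (∑' v, x v ^ p) ^ (1 / p)) ^ p := by gcongr
      _ ≤ (K ^ (1 / q) * (∑' v, x v ^ p) ^ (1 / p)) ^ p := by gcongr; exact hb n
      _ = _ := by
        rw [ENNReal.mul_rpow_of_nonneg _ _ p0.le, ← ENNReal.rpow_mul, ← ENNReal.rpow_mul]
        congr 1
        rw [one_div_mul_cancel p0.ne', ENNReal.rpow_one]

/-- The norm `‖⟨n⟩^s x(n)‖_{ℓ^p}` of a sequence of sizes. -/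
def seqN (s p : ℝ) (x : ℤ → ℝ≥0∞) : ℝ≥0∞ :=
  (∑' n : ℤ, (ENNReal.ofReal (jb n ^ s) * x n) ^ p) ^ (1 / p)

theorem flNorm_eq_seqN (s p : ℝ) (f : L2T) : flNorm s p f = seqN s p fun n => ‖fourierCoeff f n‖ₑ := rfl

theorem seqN_mono {s p : ℝ} (hp : 1 ≤ p) {x y : ℤ → ℝ≥0∞} (h : ∀ n, x n ≤ y n) :
    seqN s p x ≤ seqN s p y := by
  have : 0 < p := by linarith
  unfold seqN
  gcongr with n
  exact h n

theorem seqN_add_le {s p : ℝ} (hp : 1 ≤ p) (x y : ℤ → ℝ≥0∞) :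
    seqN s p (fun n => x n + y n) ≤ seqN s p x + seqN s p y := by
  unfold seqN
  simp_rw [mul_add]
  exact tsum_Lp_add_le hp _ _

theorem seqN_const_mul {s p : ℝ} (hp : 1 ≤ p) (c : ℝ≥0∞) (x : ℤ → ℝ≥0∞) :
    seqN s p (fun n => c * x n) = c * seqN s p x := by
  have p0 : 0 < p := by linarith
  unfold seqN
  have : ∀ n : ℤ, (ENNReal.ofReal (jb n ^ s) * (c * x n)) ^ p =
      c ^ p * (ENNReal.ofReal (jb n ^ s) * x n) ^ p := fun n => by
    rw [← ENNReal.mul_rpow_of_nonneg _ _ p0.le]; congr 1; ring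
  simp_rw [this, ENNReal.tsum_mul_left]
  rw [ENNReal.mul_rpow_of_nonneg _ _ (by positivity), ← ENNReal.rpow_mul, mul_one_div_cancel p0.ne',
    ENNReal.rpow_one]

theorem seqN_rpow {s p : ℝ} (hp : 1 ≤ p) (x : ℤ → ℝ≥0∞) :
    seqN s p x ^ p = ∑' n : ℤ, (ENNReal.ofReal (jb n ^ s) * x n) ^ p := by
  have p0 : 0 < p := by linarith
  rw [seqN, ← ENNReal.rpow_mul, one_div_mul_cancel p0.ne', ENNReal.rpow_one]

theorem mul_le_seqN {s p : ℝ} (hp : 1 ≤ p) (x : ℤ → ℝ≥0∞) (n : ℤ) :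
    ENNReal.ofReal (jb n ^ s) * x n ≤ seqN s p x := by
  have p0 : 0 < p := by linarith
  rw [← ENNReal.rpow_le_rpow_iff p0, seqN_rpow hp]
  exact ENNReal.le_tsum n

theorem le_seqN {s p : ℝ} (hp : 1 ≤ p) (hs : 0 ≤ s) (x : ℤ → ℝ≥0∞) (n : ℤ) : x n ≤ seqN s p x := by
  refine le_trans ?_ (mul_le_seqN hp x n)
  refine le_mul_of_one_le_left zero_le ?_
  rw [ENNReal.one_le_ofReal]
  exact Real.one_le_rpow (one_le_jb _) hs

/-- The trilinear estimate in weighted sequence spaces. -/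
theorem seqN_trilinear {s p : ℝ} (h : Admissible s p) : ∃ K : ℝ≥0∞, K ≠ ⊤ ∧
    ∀ x y z : ℤ → ℝ≥0∞,
      seqN s p (fun n => ∑' v : ℤ × ℤ, ENNReal.ofReal (|triCoeff n v.1 v.2| * triGain n v.1 v.2) *
        (x v.1 * y v.2 * z (n - v.1 - v.2))) ≤ K * (seqN s p x * seqN s p y * seqN s p z) := by
  obtain ⟨K, hK, hb⟩ := tsum_triWeight_mul_le h
  have hp := h.one_le
  have p0 : 0 < p := by linarith
  refine ⟨K ^ (1 / p), ENNReal.rpow_ne_top_of_nonneg (by positivity) hK, fun x y z => ?_⟩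
  set X := fun n : ℤ => ENNReal.ofReal (jb n ^ s) * x n with hX
  set Y := fun n : ℤ => ENNReal.ofReal (jb n ^ s) * y n with hY
  set Z := fun n : ℤ => ENNReal.ofReal (jb n ^ s) * z n with hZ
  have h1 : ∀ n : ℤ, ENNReal.ofReal (jb n ^ s) * ∑' v : ℤ × ℤ,
      ENNReal.ofReal (|triCoeff n v.1 v.2| * triGain n v.1 v.2) * (x v.1 * y v.2 * z (n - v.1 - v.2)) =
      ∑' v : ℤ × ℤ, ENNReal.ofReal (triWeight s n v.1 v.2) * (X v.1 * Y v.2 * Z (n - v.1 - v.2)) := by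
    intro n
    rw [← ENNReal.tsum_mul_left]
    congr 1; ext ⟨a, b⟩
    have pn := jb_pos n
    have pa := jb_pos a
    have pb := jb_pos b
    have pc := jb_pos (n - a - b : ℤ)
    have g := triGain_nonneg n a b
    have w := triWeight_nonneg s n a b
    have e : jb n ^ s * (|triCoeff n a b| * triGain n a b) =
        triWeight s n a b * (jb a ^ s * jb b ^ s * jb (n - a - b : ℤ) ^ s) := by
      have e2 : (jb a * jb b * jb (n - a - b : ℤ)) ^ (-s) * (jb a ^ s * jb b ^ s * jb (n - a - b : ℤ) ^ s) = 1 := by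
        rw [← Real.mul_rpow pa.le pb.le, ← Real.mul_rpow (by positivity) pc.le, ← Real.rpow_add (by positivity)]
        simp
      rw [triWeight]
      calc _ = |triCoeff n a b| * triGain n a b * jb n ^ s * 1 := by ring
        _ = _ := by rw [← e2]; ring
    have e' := congrArg ENNReal.ofReal e
    rw [ENNReal.ofReal_mul (p := jb n ^ s) (by positivity), ENNReal.ofReal_mul w,
      ENNReal.ofReal_mul (p := jb a ^ s * jb b ^ s) (by positivity),
      ENNReal.ofReal_mul (p := jb a ^ s) (by positivity)] at e'
    simp only [hX, hY, hZ]
    rw [← mul_assoc, e']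
    ring
  rw [← ENNReal.rpow_le_rpow_iff p0, seqN_rpow hp]
  simp_rw [h1]
  -- With the multiplier gone, the sum over `n` is taken first; for fixed `(a, b)` it is a translate
  -- of the full sum of `Z`.
  have h2 : ∑' n : ℤ, ∑' v : ℤ × ℤ, (X v.1 * Y v.2 * Z (n - v.1 - v.2)) ^ p =
      (∑' n, X n ^ p) * (∑' n, Y n ^ p) * ∑' n, Z n ^ p := by
    rw [ENNReal.tsum_comm]
    have : ∀ v : ℤ × ℤ, ∑' n : ℤ, (X v.1 * Y v.2 * Z (n - v.1 - v.2)) ^ p =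
        X v.1 ^ p * Y v.2 ^ p * ∑' n, Z n ^ p := fun v => by
      simp_rw [ENNReal.mul_rpow_of_nonneg _ _ p0.le, ENNReal.tsum_mul_left]
      congr 1
      rw [← (Equiv.subRight (v.1 + v.2)).tsum_eq (fun n => Z n ^ p)]
      congr 1; ext n; simp [sub_sub]
    simp_rw [this]
    rw [ENNReal.tsum_prod (f := fun a b => X a ^ p * Y b ^ p * ∑' n, Z n ^ p)]
    simp_rw [ENNReal.tsum_mul_right, ENNReal.tsum_mul_left, ENNReal.tsum_mul_right]
  calc _ ≤ ∑' n : ℤ, K * ∑' v : ℤ × ℤ, (X v.1 * Y v.2 * Z (n - v.1 - v.2)) ^ p :=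
        ENNReal.tsum_le_tsum fun n => hb n _
    _ = K * ((∑' n, X n ^ p) * (∑' n, Y n ^ p) * ∑' n, Z n ^ p) := by rw [ENNReal.tsum_mul_left, h2]
    _ = _ := by
        rw [ENNReal.mul_rpow_of_nonneg _ _ p0.le, ENNReal.mul_rpow_of_nonneg _ _ p0.le,
          ENNReal.mul_rpow_of_nonneg _ _ p0.le, seqN_rpow hp, seqN_rpow hp, seqN_rpow hp,
          ← ENNReal.rpow_mul, one_div_mul_cancel p0.ne', ENNReal.rpow_one]

/-! ### The space `ℓ^{4/3}` and convolutions. -/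

/-- The embedding of the weighted space into `ℓ^{4/3}`. -/
theorem tsum_rpow_four_thirds_le {s p : ℝ} (h : Admissible s p) : ∃ K : ℝ≥0∞, K ≠ ⊤ ∧
    ∀ x : ℤ → ℝ≥0∞, ∑' n, x n ^ (4 / 3 : ℝ) ≤ K * seqN s p x ^ (4 / 3 : ℝ) := by
  have hp := h.one_le
  have p0 : 0 < p := by linarith
  have hlt := h.lt_min.trans_le (min_le_left _ _)
  have hs := h.half_le
  -- For `p ≤ 4/3` this is the inclusion of `ℓ^p` in `ℓ^{4/3}`. For larger `p` it is Hölder's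
  -- inequality with exponent `3p/4` against a power of the weight, summable exactly because `s >
  -- 3/4 - 1/p`.
  rcases le_or_gt p (4 / 3) with h1 | h1
  · refine ⟨1, ENNReal.one_ne_top, fun x => ?_⟩
    rw [one_mul]
    have hsum : (∑' n, x n ^ p) ≤ seqN s p x ^ p := by
      rw [seqN_rpow hp]
      refine ENNReal.tsum_le_tsum fun n => ?_
      gcongr
      refine le_mul_of_one_le_left zero_le ?_
      rw [ENNReal.one_le_ofReal]
      exact Real.one_le_rpow (one_le_jb _) (by linarith)
    have e : ∀ n, x n ^ (4 / 3 : ℝ) = x n ^ p * x n ^ (4 / 3 - p) := fun n => by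
      rw [← ENNReal.rpow_add_of_nonneg _ _ p0.le (by linarith)]; congr 1; ring
    calc ∑' n, x n ^ (4 / 3 : ℝ) ≤ ∑' n, x n ^ p * seqN s p x ^ (4 / 3 - p) := by
          refine ENNReal.tsum_le_tsum fun n => ?_
          rw [e]
          refine mul_le_mul_right ?_ _
          refine ENNReal.rpow_le_rpow ?_ (by linarith)
          · exact le_seqN hp (by linarith) x n
      _ ≤ seqN s p x ^ p * seqN s p x ^ (4 / 3 - p) := by rw [ENNReal.tsum_mul_right]; gcongr
      _ = _ := by rw [← ENNReal.rpow_add_of_nonneg _ _ p0.le (by linarith)]; congr 1; ring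
  · set r := 3 * p / 4 with hr
    have hr1 : 1 < r := by rw [hr]; linarith
    have hrq : r.HolderConjugate r.conjExponent := Real.HolderConjugate.conjExponent hr1
    set q := r.conjExponent with hqdef
    have hq0 : 0 < q := hrq.symm.pos
    have e1 : 1 / q = 1 - 4 / (3 * p) := by
      have := hrq.inv_add_inv_eq_one
      have e : r⁻¹ = 4 / (3 * p) := by rw [hr, inv_div]
      rw [one_div]; linarith
    have hθ : 1 < s * (4 / 3) * q := by
      rw [← div_lt_iff₀ hq0, e1]
      have : 4 / (3 * p) = 4 / 3 * (1 / p) := by field_simp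
      rw [this]; linarith
    refine ⟨(∑' n : ℤ, ENNReal.ofReal (jb n ^ (-(s * (4 / 3) * q)))) ^ (1 / q),
      ENNReal.rpow_ne_top_of_nonneg (by positivity) (tsum_jb_rpow_lt_top hθ).ne, fun x => ?_⟩
    have e2 : ∀ n : ℤ, x n ^ (4 / 3 : ℝ) = ENNReal.ofReal (jb n ^ (-(s * (4 / 3)))) *
        (ENNReal.ofReal (jb n ^ s) * x n) ^ (4 / 3 : ℝ) := fun n => by
      have pn := jb_pos n
      rw [ENNReal.mul_rpow_of_nonneg _ _ (by norm_num), ENNReal.ofReal_rpow_of_nonneg (by positivity) (by norm_num),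
        ← mul_assoc, ← ENNReal.ofReal_mul (by positivity), ← Real.rpow_mul pn.le, ← Real.rpow_add pn]
      simp
    calc ∑' n, x n ^ (4 / 3 : ℝ) = ∑' n : ℤ, ENNReal.ofReal (jb n ^ (-(s * (4 / 3)))) *
        (ENNReal.ofReal (jb n ^ s) * x n) ^ (4 / 3 : ℝ) := by simp_rw [← e2]
      _ ≤ _ := tsum_mul_le_Lp_mul_Lq hrq.symm _ _
      _ = _ := by
        congr 1
        · congr 2; ext n
          have pn := jb_pos n
          rw [ENNReal.ofReal_rpow_of_nonneg (by positivity) hq0.le, ← Real.rpow_mul pn.le, neg_mul]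
        · simp_rw [← ENNReal.rpow_mul]
          rw [seqN, ← ENNReal.rpow_mul]
          congr 1
          · congr 1; ext n; congr 1; rw [hr]; ring
          · rw [hr]; field_simp

theorem tsum_sq_le_of_four_thirds (x : ℤ → ℝ≥0∞) :
    ∑' n, x n ^ 2 ≤ (∑' n, x n ^ (4 / 3 : ℝ)) ^ (3 / 2 : ℝ) := by
  set A := ∑' n, x n ^ (4 / 3 : ℝ) with hA
  have h1 : ∀ n, x n ^ 2 ≤ x n ^ (4 / 3 : ℝ) * A ^ (1 / 2 : ℝ) := fun n => by
    calc x n ^ 2 = x n ^ (4 / 3 : ℝ) * (x n ^ (4 / 3 : ℝ)) ^ (1 / 2 : ℝ) := by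
          rw [← ENNReal.rpow_mul, ← ENNReal.rpow_add_of_nonneg _ _ (by norm_num) (by norm_num),
            ← ENNReal.rpow_natCast]
          norm_num
      _ ≤ _ := by gcongr; exact ENNReal.le_tsum n
  calc _ ≤ ∑' n, x n ^ (4 / 3 : ℝ) * A ^ (1 / 2 : ℝ) := ENNReal.tsum_le_tsum h1
    _ = A ^ (1 : ℝ) * A ^ (1 / 2 : ℝ) := by rw [ENNReal.tsum_mul_right, ← hA, ENNReal.rpow_one]
    _ = _ := by rw [← ENNReal.rpow_add_of_nonneg _ _ (by norm_num) (by norm_num)]; norm_num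

/-- Young's inequality `ℓ^{4/3} * ℓ^{4/3} ⊆ ℓ²`. -/
theorem tsum_conv_sq_le (x y : ℤ → ℝ≥0∞) :
    ∑' n : ℤ, (∑' k, x k * y (n - k)) ^ 2 ≤
      ((∑' n, x n ^ (4 / 3 : ℝ)) * ∑' n, y n ^ (4 / 3 : ℝ)) ^ (3 / 2 : ℝ) := by
  set A := ∑' n, x n ^ (4 / 3 : ℝ) with hA
  set B := ∑' n, y n ^ (4 / 3 : ℝ) with hB
  have hshift : ∀ (n : ℤ) (f : ℤ → ℝ≥0∞), ∑' k, f (n - k) = ∑' k, f k := fun n f =>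
    (Equiv.subLeft n).tsum_eq f
  have h1 : ∀ n : ℤ, (∑' k, x k * y (n - k)) ^ 2 ≤
      (∑' k, x k ^ (4 / 3 : ℝ) * y (n - k) ^ (4 / 3 : ℝ)) * (A * B) ^ (1 / 2 : ℝ) := fun n => by
    -- Cauchy-Schwarz on the exponents `2/3 + 1/3` keeps a convolution of 4/3-powers, summable in
    -- `n`. A second Cauchy-Schwarz bounds the other factor uniformly in `n`.
    have e : ∀ k, x k * y (n - k) = (x k ^ (2 / 3 : ℝ) * y (n - k) ^ (2 / 3 : ℝ)) *
        (x k ^ (1 / 3 : ℝ) * y (n - k) ^ (1 / 3 : ℝ)) := fun k => by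
      rw [mul_mul_mul_comm, ← ENNReal.rpow_add_of_nonneg _ _ (by norm_num) (by norm_num),
        ← ENNReal.rpow_add_of_nonneg _ _ (by norm_num) (by norm_num)]
      norm_num
    have pw : ∀ (u : ℝ≥0∞) (r : ℝ), (u ^ r) ^ 2 = u ^ (r * 2) := fun u r => by
      rw [← ENNReal.rpow_natCast, ← ENNReal.rpow_mul]; norm_num
    have h2 := tsum_sq_mul_le (fun k => x k ^ (2 / 3 : ℝ) * y (n - k) ^ (2 / 3 : ℝ))
      (fun k => x k ^ (1 / 3 : ℝ) * y (n - k) ^ (1 / 3 : ℝ))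
    simp_rw [← e, mul_pow, pw] at h2
    norm_num at h2
    have h3 := tsum_sq_mul_le (fun k => x k ^ (2 / 3 : ℝ)) (fun k => y (n - k) ^ (2 / 3 : ℝ))
    simp_rw [pw] at h3
    norm_num at h3
    rw [hshift n (fun k => y k ^ (4 / 3 : ℝ)), ← hA, ← hB] at h3
    have h4 : ∑' k, x k ^ (2 / 3 : ℝ) * y (n - k) ^ (2 / 3 : ℝ) ≤ (A * B) ^ (1 / 2 : ℝ) := by
      rw [one_div, ENNReal.le_rpow_inv_iff (by norm_num)]
      simpa using h3
    exact h2.trans (by gcongr)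
  calc _ ≤ ∑' n : ℤ, (∑' k, x k ^ (4 / 3 : ℝ) * y (n - k) ^ (4 / 3 : ℝ)) * (A * B) ^ (1 / 2 : ℝ) :=
        ENNReal.tsum_le_tsum h1
    _ = (A * B) ^ (1 : ℝ) * (A * B) ^ (1 / 2 : ℝ) := by
        rw [ENNReal.tsum_mul_right, ENNReal.tsum_comm, ENNReal.rpow_one]
        simp_rw [ENNReal.tsum_mul_left]
        have : ∀ k : ℤ, ∑' n : ℤ, y (n - k) ^ (4 / 3 : ℝ) = B := fun k =>
          (Equiv.subRight k).tsum_eq (fun n => y n ^ (4 / 3 : ℝ))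
        simp_rw [this, ENNReal.tsum_mul_right]
        rw [← hA]
    _ = _ := by rw [← ENNReal.rpow_add_of_nonneg _ _ (by norm_num) (by norm_num)]; norm_num

/-! ### Norms in time: Minkowski's inequality and the Nikolskii space. -/

/-- Minkowski's inequality in `L²` for countable sums. -/
theorem eLpNorm_two_le_tsum {α ι E : Type*} [MeasurableSpace α] {μ : Measure α} [Countable ι]
    [NormedAddCommGroup E] {G : α → E} {g : ι → α → E} (hg : ∀ i, AEStronglyMeasurable (g i) μ)
    (hG : ∀ x, ‖G x‖ₑ ≤ ∑' i, ‖g i x‖ₑ) : eLpNorm G 2 μ ≤ ∑' i, eLpNorm (g i) 2 μ := by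
  have hfin : ∀ s : Finset ι, eLpNorm (fun x => ∑ i ∈ s, ‖g i x‖ₑ) 2 μ ≤ ∑ i ∈ s, eLpNorm (g i) 2 μ := by
    intro s
    have := eLpNorm_sum_le (μ := μ) (p := 2) (f := fun i x => ‖g i x‖ₑ) (s := s)
      (fun i _ => (hg i).enorm.aestronglyMeasurable) (by norm_num)
    convert! this using 2
    ext x; simp
  have h1 : eLpNorm G 2 μ ≤ eLpNorm (fun x => ∑' i, ‖g i x‖ₑ) 2 μ :=
    eLpNorm_mono_enorm fun x => by simpa using hG x
  refine h1.trans ?_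
  rw [eLpNorm_eq_lintegral_rpow_enorm_toReal (by norm_num) (by norm_num)]
  simp only [enorm_eq_self, ENNReal.toReal_ofNat]
  rw [one_div, ENNReal.rpow_inv_le_iff (by norm_num)]
  have h2 : ∀ x, (∑' i, ‖g i x‖ₑ) ^ (2 : ℝ) = ⨆ s : Finset ι, (∑ i ∈ s, ‖g i x‖ₑ) ^ (2 : ℝ) := fun x => by
    rw [ENNReal.tsum_eq_iSup_sum]
    exact (ENNReal.orderIsoRpow 2 (by norm_num)).map_iSup _
  simp_rw [h2]
  rw [lintegral_iSup_directed]
  · refine iSup_le fun s => ?_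
    have h3 := hfin s
    rw [eLpNorm_eq_lintegral_rpow_enorm_toReal (by norm_num) (by norm_num)] at h3
    simp only [enorm_eq_self, ENNReal.toReal_ofNat] at h3
    rw [one_div, ENNReal.rpow_inv_le_iff (by norm_num)] at h3
    exact h3.trans (by gcongr; exact ENNReal.sum_le_tsum s)
  · intro s
    exact (Finset.aemeasurable_fun_sum s fun i _ => (hg i).enorm).pow_const 2
  · refine Monotone.directed_le fun s t hst x => ?_
    dsimp only
    gcongr

theorem eLpNorm_two_sq {α E : Type*} [MeasurableSpace α] {μ : Measure α} [NormedAddCommGroup E]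
    (f : α → E) : eLpNorm f 2 μ ^ 2 = ∫⁻ x, ‖f x‖ₑ ^ 2 ∂μ := by
  rw [eLpNorm_eq_lintegral_rpow_enorm_toReal (by norm_num) (by norm_num), ← ENNReal.rpow_natCast,
    ← ENNReal.rpow_mul]
  norm_num

theorem eLpNorm_two_le_of_sq_le {α E : Type*} [MeasurableSpace α] {μ : Measure α} [NormedAddCommGroup E]
    {f : α → E} {c : ℝ≥0∞} (h : ∫⁻ x, ‖f x‖ₑ ^ 2 ∂μ ≤ c ^ 2) : eLpNorm f 2 μ ≤ c := by
  rw [← eLpNorm_two_sq] at h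
  exact (ENNReal.pow_le_pow_left_iff two_ne_zero).1 h

/-- The increment `f(t + h) - f(t)`. -/
def tdiff (h : ℝ) (f : ℝ → ℂ) : ℝ → ℂ := fun t => f (t + h) - f t

theorem measurable_tdiff {f : ℝ → ℂ} (hf : Measurable f) (h : ℝ) : Measurable (tdiff h f) := by
  unfold tdiff; fun_prop

def supN (f : ℝ → ℂ) : ℝ≥0∞ := ⨆ t, ‖f t‖ₑ

theorem le_supN (f : ℝ → ℂ) (t : ℝ) : ‖f t‖ₑ ≤ supN f := le_iSup (fun t => ‖f t‖ₑ) t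

/-- The Nikolskii seminorm `sup_{h > 0} h^{-1/2} ‖f(· + h) - f‖_{L²}`. -/
def nikN (f : ℝ → ℂ) : ℝ≥0∞ :=
  ⨆ h : Set.Ioi (0 : ℝ), eLpNorm (tdiff h f) 2 volume / ENNReal.ofReal (√h)

/-- A jump has increments of `L²` size `√h`, which the Nikolskii seminorm tolerates and the
`H^{1/2}` seminorm does not. Sharp truncation to a time interval is therefore harmless, and
boundedness turns the space into an algebra. -/
def yN (f : ℝ → ℂ) : ℝ≥0∞ := supN f + nikN f

theorem nikN_le_iff {f : ℝ → ℂ} {D : ℝ≥0∞} :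
    nikN f ≤ D ↔ ∀ h > 0, eLpNorm (tdiff h f) 2 volume ≤ D * ENNReal.ofReal (√h) := by
  rw [nikN, iSup_le_iff]
  simp only [Subtype.forall, Set.mem_Ioi, gt_iff_lt]
  refine forall₂_congr fun h hh => ?_
  have : 0 < √h := Real.sqrt_pos.2 hh
  rw [ENNReal.div_le_iff (by simpa using this) ENNReal.ofReal_ne_top]

theorem eLpNorm_tdiff_le (f : ℝ → ℂ) {h : ℝ} (hh : 0 ≤ h) :
    eLpNorm (tdiff h f) 2 volume ≤ nikN f * ENNReal.ofReal (√h) := by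
  rcases hh.eq_or_lt with rfl | hh
  · have : tdiff 0 f = 0 := by ext t; simp [tdiff]
    simp [this]
  · exact nikN_le_iff.1 le_rfl h hh

theorem supN_le_yN (f : ℝ → ℂ) : supN f ≤ yN f := le_self_add

theorem supN_tsum_le {ι : Type*} {G : ℝ → ℂ} {g : ι → ℝ → ℂ}
    (hG : ∀ t, HasSum (fun i => g i t) (G t)) : supN G ≤ ∑' i, supN (g i) := by
  refine iSup_le fun t => ?_
  rw [← (hG t).tsum_eq]
  exact enorm_tsum_le_tsum_enorm.trans (ENNReal.tsum_le_tsum fun i => le_supN _ _)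

theorem tdiff_hasSum {ι : Type*} {G : ℝ → ℂ} {g : ι → ℝ → ℂ}
    (hG : ∀ t, HasSum (fun i => g i t) (G t)) (h t : ℝ) :
    ‖tdiff h G t‖ₑ ≤ ∑' i, ‖tdiff h (g i) t‖ₑ := by
  have := (hG (t + h)).sub (hG t)
  unfold tdiff
  rw [← this.tsum_eq]
  exact enorm_tsum_le_tsum_enorm

theorem nikN_tsum_le {ι : Type*} [Countable ι] {G : ℝ → ℂ} {g : ι → ℝ → ℂ} (hg : ∀ i, Measurable (g i))
    (hG : ∀ t, HasSum (fun i => g i t) (G t)) : nikN G ≤ ∑' i, nikN (g i) := by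
  refine nikN_le_iff.2 fun h hh => ?_
  refine (eLpNorm_two_le_tsum (g := fun i => tdiff h (g i))
    (fun i => (measurable_tdiff (hg i) h).aestronglyMeasurable) (tdiff_hasSum hG h)).trans ?_
  rw [← ENNReal.tsum_mul_right]
  exact ENNReal.tsum_le_tsum fun i => eLpNorm_tdiff_le _ hh.le

theorem yN_tsum_le {ι : Type*} [Countable ι] {G : ℝ → ℂ} {g : ι → ℝ → ℂ} (hg : ∀ i, Measurable (g i))
    (hG : ∀ t, HasSum (fun i => g i t) (G t)) : yN G ≤ ∑' i, yN (g i) := by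
  unfold yN
  rw [ENNReal.tsum_add]
  exact add_le_add (supN_tsum_le hG) (nikN_tsum_le hg hG)

theorem yN_add_le {f g : ℝ → ℂ} (hf : Measurable f) (hg : Measurable g) :
    yN (fun t => f t + g t) ≤ yN f + yN g := by
  have h1 : ∀ i, Measurable ((![f, g] : Fin 2 → ℝ → ℂ) i) := by
    intro i; fin_cases i
    exacts [hf, hg]
  have h2 : ∀ t, HasSum (fun i => (![f, g] : Fin 2 → ℝ → ℂ) i t) (f t + g t) := by
    intro t
    have := hasSum_fintype (fun i => (![f, g] : Fin 2 → ℝ → ℂ) i t)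
    simpa using this
  have := yN_tsum_le h1 h2
  simpa using this

theorem tdiff_const_mul (c : ℂ) (f : ℝ → ℂ) (h : ℝ) :
    tdiff h (fun t => c * f t) = c • tdiff h f := by
  ext t; simp [tdiff, mul_sub]

theorem supN_const_mul_le (c : ℂ) (f : ℝ → ℂ) : supN (fun t => c * f t) ≤ ‖c‖ₑ * supN f :=
  iSup_le fun t => by rw [enorm_mul]; gcongr; exact le_supN f t

theorem nikN_const_mul_le (c : ℂ) (f : ℝ → ℂ) : nikN (fun t => c * f t) ≤ ‖c‖ₑ * nikN f := by
  refine nikN_le_iff.2 fun h hh => ?_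
  rw [tdiff_const_mul, eLpNorm_const_smul, mul_assoc]
  gcongr
  exact eLpNorm_tdiff_le f hh.le

theorem yN_const_mul_le (c : ℂ) (f : ℝ → ℂ) : yN (fun t => c * f t) ≤ ‖c‖ₑ * yN f := by
  unfold yN; rw [mul_add]
  exact add_le_add (supN_const_mul_le c f) (nikN_const_mul_le c f)

theorem yN_neg (f : ℝ → ℂ) : yN (fun t => -f t) = yN f := by
  refine le_antisymm ?_ ?_
  · simpa using yN_const_mul_le (-1) f
  · simpa using yN_const_mul_le (-1) (fun t => -f t)

theorem yN_const (c : ℂ) : yN (fun _ => c) = ‖c‖ₑ := by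
  have h1 : nikN (fun _ => c) = 0 := by
    refine le_antisymm (nikN_le_iff.2 fun h _ => ?_) zero_le
    have : tdiff h (fun _ => c) = 0 := by ext t; simp [tdiff]
    simp [this]
  rw [yN, h1, supN, ciSup_const, add_zero]

theorem supN_mul_le (f g : ℝ → ℂ) : supN (fun t => f t * g t) ≤ supN f * supN g :=
  iSup_le fun t => by rw [enorm_mul]; exact mul_le_mul' (le_supN f t) (le_supN g t)

theorem eLpNorm_mul_le_supN (f : ℝ → ℂ) {g : ℝ → ℂ} (hg : Measurable g) : eLpNorm (fun t => f t * g t) 2 volume ≤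
    supN f * eLpNorm g 2 volume := by
  refine eLpNorm_two_le_of_sq_le ?_
  rw [mul_pow, eLpNorm_two_sq]
  calc _ ≤ ∫⁻ t, supN f ^ 2 * ‖g t‖ₑ ^ 2 := by
        gcongr with t
        rw [enorm_mul, mul_pow]; gcongr; exact le_supN f t
    _ = _ := lintegral_const_mul'' _ (by fun_prop)

/-- The increment of a product obeys a Leibniz rule in which the undifferenced factor is bounded by
its supremum; adding `nikN f * nikN g` completes the product. -/
theorem yN_mul_le {f g : ℝ → ℂ} (hf : Measurable f) (hg : Measurable g) :
    yN (fun t => f t * g t) ≤ yN f * yN g := by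
  have h1 : nikN (fun t => f t * g t) ≤ supN f * nikN g + nikN f * supN g := by
    refine nikN_le_iff.2 fun h hh => ?_
    have e : tdiff h (fun t => f t * g t) =
        (fun t => f (t + h) * tdiff h g t) + fun t => g t * tdiff h f t := by
      ext t; simp [tdiff]; ring
    have s : supN (fun t => f (t + h)) ≤ supN f := iSup_le fun t => le_supN f _
    rw [e]
    have := measurable_tdiff hf h
    have := measurable_tdiff hg h
    refine (eLpNorm_add_le (by fun_prop) (by fun_prop) (by norm_num)).trans ?_
    calc _ ≤ supN f * (nikN g * ENNReal.ofReal (√h)) + supN g * (nikN f * ENNReal.ofReal (√h)) := by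
          gcongr
          · refine (eLpNorm_mul_le_supN _ (by assumption)).trans ?_
            gcongr
            exact eLpNorm_tdiff_le g hh.le
          · refine (eLpNorm_mul_le_supN _ (by assumption)).trans ?_
            gcongr
            exact eLpNorm_tdiff_le f hh.le
      _ = _ := by ring
  unfold yN
  calc _ ≤ supN f * supN g + (supN f * nikN g + nikN f * supN g) := add_le_add (supN_mul_le f g) h1
    _ ≤ supN f * supN g + (supN f * nikN g + nikN f * supN g) + nikN f * nikN g := le_self_add
    _ = _ := by ring

/-! ### Integrals over moving windows. -/

theorem lintegral_sq_le {α : Type*} [MeasurableSpace α] {μ : Measure α} {f g : α → ℝ≥0∞}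
    (hf : AEMeasurable f μ) (hg : AEMeasurable g μ) :
    (∫⁻ x, f x * g x ∂μ) ^ 2 ≤ (∫⁻ x, f x ^ 2 ∂μ) * ∫⁻ x, g x ^ 2 ∂μ := by
  have h := ENNReal.lintegral_mul_le_Lp_mul_Lq μ (p := 2) (q := 2) (by constructor <;> norm_num) hf hg
  have h2 := ENNReal.pow_le_pow_left h (n := 2)
  rw [mul_pow, ← ENNReal.rpow_natCast ((∫⁻ x, f x ^ (2:ℝ) ∂μ) ^ (1 / 2 : ℝ)),
    ← ENNReal.rpow_natCast ((∫⁻ x, g x ^ (2:ℝ) ∂μ) ^ (1 / 2 : ℝ)), ← ENNReal.rpow_mul, ← ENNReal.rpow_mul] at h2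
  simpa using h2

theorem setLIntegral_sq_le {α : Type*} [MeasurableSpace α] {μ : Measure α} {f : α → ℝ≥0∞}
    (hf : Measurable f) (A : Set α) : (∫⁻ x in A, f x ∂μ) ^ 2 ≤ μ A * ∫⁻ x in A, f x ^ 2 ∂μ := by
  have := lintegral_sq_le (μ := μ.restrict A) (f := fun _ => 1) (g := f) aemeasurable_const hf.aemeasurable
  simpa using this

theorem ofReal_sqrt_sq {x : ℝ} (hx : 0 ≤ x) : ENNReal.ofReal (√x) ^ 2 = ENNReal.ofReal x := by
  rw [← ENNReal.ofReal_pow (Real.sqrt_nonneg _), Real.sq_sqrt hx]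

theorem le_ofReal_sqrt_mul {x y : ℝ≥0∞} {c : ℝ} (hc : 0 ≤ c) (h : x ^ 2 ≤ ENNReal.ofReal c * y ^ 2) :
    x ≤ ENNReal.ofReal (√c) * y := by
  rw [← ofReal_sqrt_sq hc, ← mul_pow] at h
  exact (ENNReal.pow_le_pow_left_iff two_ne_zero).1 h

theorem setLIntegral_le_sqrt_mul {E : Type*} [NormedAddCommGroup E] {g : ℝ → E} (hg : StronglyMeasurable g)
    {A : Set ℝ} {v : ℝ} (hv : 0 ≤ v) (hA : volume A ≤ ENNReal.ofReal v) :
    ∫⁻ x in A, ‖g x‖ₑ ≤ ENNReal.ofReal (√v) * eLpNorm g 2 volume := by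
  refine le_ofReal_sqrt_mul hv ((setLIntegral_sq_le hg.enorm A).trans ?_)
  rw [eLpNorm_two_sq]
  gcongr
  exact Measure.restrict_le_self

theorem lintegral_window {K : ℝ → ℝ≥0∞} (hK : Measurable K) (h : ℝ) :
    ∫⁻ t, ∫⁻ r in Set.Ioc t (t + h), K r = ENNReal.ofReal h * ∫⁻ t, K t := by
  have h1 : ∀ t, ∫⁻ r in Set.Ioc t (t + h), K r = ∫⁻ r in Set.Ioc 0 h, K (r + t) := fun t => by
    rw [← lintegral_indicator measurableSet_Ioc, ← lintegral_indicator measurableSet_Ioc,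
      ← lintegral_add_right_eq_self _ t]
    congr 1; ext r
    simp only [Set.indicator, Set.mem_Ioc]
    congr 1
    simp only [eq_iff_iff]
    constructor <;> rintro ⟨h1, h2⟩ <;> constructor <;> linarith
  simp_rw [h1]
  rw [lintegral_lintegral_swap (by
    have : Measurable fun z : ℝ × ℝ => K (z.2 + z.1) := by fun_prop
    exact this.aemeasurable)]
  simp_rw [lintegral_add_left_eq_self K]
  simp [mul_comm]

/-- Cauchy-Schwarz on each window, restricted to the support of `K`, then Fubini. Bounding `V` by
the window length gives a factor `h` in norm; bounding it by the size `v` of the support gives `√(v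
h)`. Both are needed later. -/
theorem lintegral_window_sq_le {K : ℝ → ℝ≥0∞} (hK : Measurable K) (h : ℝ) {V : ℝ≥0∞}
    (hV : ∀ t, volume (Set.Ioc t (t + h) ∩ Function.support K) ≤ V) :
    ∫⁻ t, (∫⁻ r in Set.Ioc t (t + h), K r) ^ 2 ≤ V * ENNReal.ofReal h * ∫⁻ t, K t ^ 2 := by
  have hs : MeasurableSet (Function.support K) := measurableSet_support hK
  calc _ ≤ ∫⁻ t, V * ∫⁻ r in Set.Ioc t (t + h), K r ^ 2 := by
        refine lintegral_mono fun t => ?_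
        have e : ∫⁻ r in Set.Ioc t (t + h), K r = ∫⁻ r in Set.Ioc t (t + h) ∩ Function.support K, K r := by
          rw [Set.inter_comm, ← setLIntegral_indicator hs, Set.indicator_support]
        rw [e]
        refine (setLIntegral_sq_le hK _).trans ?_
        exact mul_le_mul' (hV t) (lintegral_mono_set Set.inter_subset_left)
    _ ≤ _ := by
        by_cases hVt : V = ⊤
        · by_cases h0 : ∫⁻ t, K t ^ 2 = 0
          · rw [h0, mul_zero]
            rw [lintegral_eq_zero_iff (by fun_prop)] at h0
            have : ∀ t, ∫⁻ r in Set.Ioc t (t + h), K r ^ 2 = 0 := fun t =>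
              (lintegral_eq_zero_iff (by fun_prop)).2 (ae_restrict_of_ae h0)
            simp [this]
          · rcases le_or_gt h 0 with hh | hh
            · have : ∀ t, Set.Ioc t (t + h) = ∅ := fun t => Set.Ioc_eq_empty (by linarith)
              simp [this]
            · rw [hVt, ENNReal.top_mul (by simpa using hh), ENNReal.top_mul h0]
              exact le_top
        · rw [lintegral_const_mul' _ _ hVt, lintegral_window (by fun_prop), mul_assoc]

/-! ### Oscillatory integrals and the half-period shift. -/

/-- The integrand `1_{[a,b]}(t) e^{-iφt} F(t)`. -/
def oscInt (a b φ : ℝ) (F : ℝ → ℂ) : ℝ → ℂ :=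
  (Set.Icc a b).indicator fun t => Complex.exp (-(Complex.I * φ * t)) * F t

theorem norm_exp_phase (φ t : ℝ) : ‖Complex.exp (-(Complex.I * φ * t))‖ = 1 := by
  rw [Complex.norm_exp]; simp

theorem measurable_oscInt {F : ℝ → ℂ} (hF : Measurable F) (a b φ : ℝ) : Measurable (oscInt a b φ F) := by
  unfold oscInt
  exact Measurable.indicator (by fun_prop) measurableSet_Icc

theorem enorm_oscInt (a b φ : ℝ) (F : ℝ → ℂ) (t : ℝ) :
    ‖oscInt a b φ F t‖ₑ = (Set.Icc a b).indicator (fun t => ‖F t‖ₑ) t := by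
  unfold oscInt
  by_cases h : t ∈ Set.Icc a b
  · rw [Set.indicator_of_mem h, Set.indicator_of_mem h, enorm_mul, ← ofReal_norm, norm_exp_phase]
    simp
  · rw [Set.indicator_of_notMem h, Set.indicator_of_notMem h, enorm_zero]

theorem enorm_oscInt_le (a b φ : ℝ) (F : ℝ → ℂ) (t : ℝ) : ‖oscInt a b φ F t‖ₑ ≤ ‖F t‖ₑ := by
  rw [enorm_oscInt]; exact Set.indicator_le_self _ _ _

theorem support_oscInt_subset (a b φ : ℝ) (F : ℝ → ℂ) : Function.support (oscInt a b φ F) ⊆ Set.Icc a b :=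
  Function.support_subset_iff'.2 fun _ hx => Set.indicator_of_notMem hx _

theorem eLpNorm_oscInt_le_supN {a b : ℝ} (hab : a ≤ b) (φ : ℝ) (F : ℝ → ℂ) :
    eLpNorm (oscInt a b φ F) 2 volume ≤ ENNReal.ofReal (√(b - a)) * supN F := by
  refine eLpNorm_two_le_of_sq_le ?_
  calc _ ≤ ∫⁻ t, (Set.Icc a b).indicator (fun _ => supN F ^ 2) t := by
        refine lintegral_mono fun t => ?_
        rw [enorm_oscInt]
        by_cases h : t ∈ Set.Icc a b
        · simp only [Set.indicator_of_mem h]; gcongr; exact le_supN F t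
        · simp [Set.indicator_of_notMem h]
    _ = _ := by
        rw [lintegral_indicator measurableSet_Icc, setLIntegral_const, Real.volume_Icc, mul_pow,
          ofReal_sqrt_sq (by linarith), mul_comm]

theorem integrable_oscInt {a b φ : ℝ} {F : ℝ → ℂ} (hF : Measurable F)
    (h2 : eLpNorm (oscInt a b φ F) 2 volume ≠ ⊤) : Integrable (oscInt a b φ F) := by
  have hm := (measurable_oscInt hF a b φ)
  refine ⟨hm.aestronglyMeasurable, ?_⟩
  rw [HasFiniteIntegral]
  have e : ∫⁻ t, ‖oscInt a b φ F t‖ₑ = ∫⁻ t in Set.Icc a b, ‖oscInt a b φ F t‖ₑ := by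
    rw [← lintegral_indicator measurableSet_Icc]
    congr 1; ext t
    by_cases h : t ∈ Set.Icc a b
    · rw [Set.indicator_of_mem h]
    · rw [Set.indicator_of_notMem h, enorm_oscInt, Set.indicator_of_notMem h]
  rw [e]
  refine (setLIntegral_le_sqrt_mul hm.stronglyMeasurable (v := max (b - a) 0) (le_max_right _ _) ?_).trans_lt
    (ENNReal.mul_lt_top ENNReal.ofReal_lt_top h2.lt_top)
  rw [Real.volume_Icc]
  exact ENNReal.ofReal_le_ofReal (le_max_left _ _)

/-- The sum of `G` and its translate by half a period: the oscillation turns it into a difference. -/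
theorem enorm_oscInt_add_shift_le (a b : ℝ) {φ : ℝ} (hφ : φ ≠ 0) (F : ℝ → ℂ) (t : ℝ) :
    ‖oscInt a b φ F t + oscInt a b φ F (t + Real.pi / |φ|)‖ₑ ≤
      (Set.Icc a b).indicator (fun t => ‖tdiff (Real.pi / |φ|) F t‖ₑ) t +
      (Set.Icc (a - Real.pi / |φ|) a ∪ Set.Icc (b - Real.pi / |φ|) b).indicator
        (fun t => ‖oscInt a b φ F t‖ₑ + ‖oscInt a b φ F (t + Real.pi / |φ|)‖ₑ) t := by
  set δ := Real.pi / |φ| with hδ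
  have hδ0 : 0 < δ := div_pos Real.pi_pos (abs_pos.2 hφ)
  have hexp : Complex.exp (-(Complex.I * φ * (t + δ : ℝ))) = -Complex.exp (-(Complex.I * φ * t)) := by
    have h1 : -(Complex.I * φ * (t + δ : ℝ)) = -(Complex.I * φ * t) + -(Complex.I * φ * δ) := by
      push_cast; ring
    rw [h1, Complex.exp_add]
    have h2 : Complex.exp (-(Complex.I * φ * δ)) = -1 := by
      rcases lt_or_gt_of_ne hφ with h | h
      · have : -(Complex.I * φ * δ) = Real.pi * Complex.I := by
          have : (φ : ℂ) ≠ 0 := by exact_mod_cast hφ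
          rw [hδ, abs_of_neg h]; push_cast; field_simp
        rw [this, Complex.exp_pi_mul_I]
      · have : -(Complex.I * φ * δ) = -(Real.pi * Complex.I) := by
          have : (φ : ℂ) ≠ 0 := by exact_mod_cast hφ
          rw [hδ, abs_of_pos h]; push_cast; field_simp
        rw [this, Complex.exp_neg, Complex.exp_pi_mul_I]; norm_num
    rw [h2]; ring
  by_cases h1 : t ∈ Set.Icc a b
  · by_cases h2 : t + δ ∈ Set.Icc a b
    · refine le_add_of_le_of_nonneg ?_ zero_le
      rw [Set.indicator_of_mem h1]
      unfold oscInt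
      rw [Set.indicator_of_mem h1, Set.indicator_of_mem h2, hexp]
      have : Complex.exp (-(Complex.I * φ * t)) * F t + -Complex.exp (-(Complex.I * φ * t)) * F (t + δ) =
          -(Complex.exp (-(Complex.I * φ * t)) * tdiff δ F t) := by rw [tdiff]; ring
      rw [this, enorm_neg, enorm_mul, ← ofReal_norm (Complex.exp _), norm_exp_phase]
      simp
    · refine le_add_of_nonneg_of_le zero_le ?_
      rw [Set.indicator_of_mem]
      · exact enorm_add_le _ _
      · right
        refine ⟨?_, h1.2⟩
        by_contra hlt
        exact h2 ⟨by linarith [h1.1], by linarith⟩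
  · by_cases h2 : t + δ ∈ Set.Icc a b
    · refine le_add_of_nonneg_of_le zero_le ?_
      rw [Set.indicator_of_mem]
      · exact enorm_add_le _ _
      · left
        refine ⟨by linarith [h2.1], ?_⟩
        by_contra hlt
        exact h1 ⟨by linarith, by linarith [h2.2]⟩
    · simp [oscInt, Set.indicator_of_notMem h1, Set.indicator_of_notMem h2]

theorem volume_boundary_layers_le (a b : ℝ) {δ : ℝ} (hδ : 0 ≤ δ) :
    volume (Set.Icc (a - δ) a ∪ Set.Icc (b - δ) b) ≤ ENNReal.ofReal (2 * δ) := by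
  refine (measure_union_le _ _).trans ?_
  rw [Real.volume_Icc, Real.volume_Icc, ← ENNReal.ofReal_add (by linarith) (by linarith)]
  apply ENNReal.ofReal_le_ofReal; linarith

theorem enorm_intervalIntegral_le {g : ℝ → ℂ} {t h : ℝ} (hh : 0 ≤ h) :
    ‖∫ r in t..(t + h), g r‖ₑ ≤ ∫⁻ r in Set.Ioc t (t + h), ‖g r‖ₑ := by
  rw [intervalIntegral.integral_of_le (by linarith)]
  exact enorm_integral_le_lintegral_enorm _

theorem ofReal_sqrt_two_mul_le (x : ℝ) :
    ENNReal.ofReal (√(2 * x)) ≤ ENNReal.ofReal (3 / 2) * ENNReal.ofReal (√x) := by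
  rw [← ENNReal.ofReal_mul (by norm_num)]
  apply ENNReal.ofReal_le_ofReal
  rw [Real.sqrt_mul (by norm_num)]
  gcongr
  rw [Real.sqrt_le_left (by norm_num)]; norm_num

section Shift

variable {a b φ : ℝ} {F : ℝ → ℂ}

/-- The sum of the integrand and its translate by half a period. -/
def oscShift (a b φ : ℝ) (F : ℝ → ℂ) (t : ℝ) : ℂ :=
  oscInt a b φ F t + oscInt a b φ F (t + Real.pi / |φ|)

theorem measurable_oscShift (hF : Measurable F) : Measurable (oscShift a b φ F) := by
  have := measurable_oscInt hF a b φ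
  unfold oscShift; fun_prop

/-- In the interior the shifted sum is an increment of `F`. The two boundary layers have total
length at most `2δ`, and Cauchy-Schwarz there gives `√(2δ) ≤ (3/2)√δ` for each of the two summands.
Only the `L²` norm of the integrand enters, so the bound remains useful for unbounded amplitudes. -/
theorem lintegral_oscShift_le (hφ : φ ≠ 0) (hF : Measurable F) :
    ∫⁻ t, ‖oscShift a b φ F t‖ₑ ≤ (∫⁻ t in Set.Icc a b, ‖tdiff (Real.pi / |φ|) F t‖ₑ) +
      3 * (ENNReal.ofReal (√(Real.pi / |φ|)) * eLpNorm (oscInt a b φ F) 2 volume) := by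
  set δ := Real.pi / |φ| with hδ
  have hδ0 : 0 < δ := div_pos Real.pi_pos (abs_pos.2 hφ)
  have hG := measurable_oscInt hF a b φ
  have hB : MeasurableSet (Set.Icc (a - δ) a ∪ Set.Icc (b - δ) b) := measurableSet_Icc.union measurableSet_Icc
  calc _ ≤ _ := lintegral_mono fun t => enorm_oscInt_add_shift_le a b hφ F t
    _ = (∫⁻ t in Set.Icc a b, ‖tdiff δ F t‖ₑ) + ((∫⁻ t in Set.Icc (a - δ) a ∪ Set.Icc (b - δ) b, ‖oscInt a b φ F t‖ₑ)
        + ∫⁻ t in Set.Icc (a - δ) a ∪ Set.Icc (b - δ) b, ‖oscInt a b φ F (t + δ)‖ₑ) := by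
        have := measurable_tdiff hF δ
        rw [lintegral_add_left (Measurable.indicator (by fun_prop) measurableSet_Icc),
          lintegral_indicator measurableSet_Icc, lintegral_indicator hB, lintegral_add_left (by fun_prop)]
    _ ≤ (∫⁻ t in Set.Icc a b, ‖tdiff δ F t‖ₑ) + (ENNReal.ofReal (√(2 * δ)) * eLpNorm (oscInt a b φ F) 2 volume +
        ENNReal.ofReal (√(2 * δ)) * eLpNorm (oscInt a b φ F) 2 volume) := by
        have hv := volume_boundary_layers_le a b hδ0.le
        gcongr
        · exact setLIntegral_le_sqrt_mul hG.stronglyMeasurable (by linarith) hv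
        · have e : eLpNorm (oscInt a b φ F) 2 volume = eLpNorm (fun t => oscInt a b φ F (t + δ)) 2 volume :=
            (eLpNorm_comp_measurePreserving hG.aestronglyMeasurable
              (measurePreserving_add_right volume δ)).symm
          rw [e]
          refine setLIntegral_le_sqrt_mul (g := fun t => oscInt a b φ F (t + δ)) ?_ (by linarith) hv
          have : Measurable fun t => oscInt a b φ F (t + δ) := by fun_prop
          exact this.stronglyMeasurable
    _ ≤ (∫⁻ t in Set.Icc a b, ‖tdiff δ F t‖ₑ) +
        (ENNReal.ofReal (3 / 2) * ENNReal.ofReal (√δ) * eLpNorm (oscInt a b φ F) 2 volume +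
        ENNReal.ofReal (3 / 2) * ENNReal.ofReal (√δ) * eLpNorm (oscInt a b φ F) 2 volume) := by
        gcongr <;> exact ofReal_sqrt_two_mul_le δ
    _ = _ := by
        have : (3 : ℝ≥0∞) = ENNReal.ofReal (3 / 2) + ENNReal.ofReal (3 / 2) := by
          rw [← ENNReal.ofReal_add (by norm_num) (by norm_num)]; norm_num
        rw [this]; ring

/-- The interior part is controlled by the Nikolskii seminorm at increment `δ`; the boundary layers
are controlled by the supremum times the square root of their length. -/
theorem eLpNorm_oscShift_le (hφ : φ ≠ 0) (hF : Measurable F) :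
    eLpNorm (oscShift a b φ F) 2 volume ≤ 3 * (ENNReal.ofReal (√(Real.pi / |φ|)) * yN F) := by
  set δ := Real.pi / |φ| with hδ
  have hδ0 : 0 < δ := div_pos Real.pi_pos (abs_pos.2 hφ)
  set B := Set.Icc (a - δ) a ∪ Set.Icc (b - δ) b
  have hB : MeasurableSet B := measurableSet_Icc.union measurableSet_Icc
  have hd := measurable_tdiff hF δ
  have h1 : eLpNorm (oscShift a b φ F) 2 volume ≤
      eLpNorm (fun t => ‖tdiff δ F t‖ₑ) 2 volume + eLpNorm (B.indicator fun _ => 2 * supN F) 2 volume := by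
    refine le_trans (eLpNorm_mono_enorm (g := (fun t => ‖tdiff δ F t‖ₑ) + B.indicator fun _ => 2 * supN F)
      fun t => ?_) (eLpNorm_add_le (by fun_prop) ((measurable_const.indicator hB).aestronglyMeasurable) (by norm_num))
    rw [enorm_eq_self, Pi.add_apply]
    refine (enorm_oscInt_add_shift_le a b hφ F t).trans (add_le_add (Set.indicator_le_self _ _ _) ?_)
    refine Set.indicator_le_indicator ?_
    rw [two_mul]
    exact add_le_add ((enorm_oscInt_le _ _ _ _ _).trans (le_supN _ _))
      ((enorm_oscInt_le _ _ _ _ _).trans (le_supN _ _))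
  refine h1.trans ?_
  have h2 : eLpNorm (fun t => ‖tdiff δ F t‖ₑ) 2 volume ≤ ENNReal.ofReal (√δ) * nikN F := by
    rw [mul_comm]
    exact (eLpNorm_enorm _).trans_le (eLpNorm_tdiff_le F hδ0.le)
  have h3 : eLpNorm (B.indicator fun _ => 2 * supN F) 2 volume ≤ 3 * (ENNReal.ofReal (√δ) * supN F) := by
    refine (eLpNorm_indicator_const_le _ _).trans ?_
    rw [enorm_eq_self]
    have : volume B ^ (1 / (2 : ℝ≥0∞).toReal) ≤ ENNReal.ofReal (3 / 2) * ENNReal.ofReal (√δ) := by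
      refine le_trans ?_ (ofReal_sqrt_two_mul_le δ)
      rw [Real.sqrt_eq_rpow, ← ENNReal.ofReal_rpow_of_nonneg (by positivity) (by norm_num)]
      simp only [ENNReal.toReal_ofNat]
      gcongr
      exact volume_boundary_layers_le a b hδ0.le
    calc _ ≤ 2 * supN F * (ENNReal.ofReal (3 / 2) * ENNReal.ofReal (√δ)) := by gcongr
      _ = (2 * ENNReal.ofReal (3 / 2)) * (ENNReal.ofReal (√δ) * supN F) := by ring
      _ = _ := by
        congr 1
        rw [← ENNReal.ofReal_ofNat 2, ← ENNReal.ofReal_mul (by norm_num)]; norm_num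
  calc _ ≤ ENNReal.ofReal (√δ) * nikN F + 3 * (ENNReal.ofReal (√δ) * supN F) := add_le_add h2 h3
    _ ≤ 3 * (ENNReal.ofReal (√δ) * nikN F) + 3 * (ENNReal.ofReal (√δ) * supN F) := by
        exact add_le_add (le_mul_of_one_le_left zero_le (by norm_num)) le_rfl
    _ = _ := by rw [yN]; ring

theorem volume_support_oscShift_le (hab : a ≤ b) :
    volume (Function.support (oscShift a b φ F)) ≤ ENNReal.ofReal (2 * (b - a)) := by
  have : Function.support (oscShift a b φ F) ⊆ Set.Icc a b ∪ Set.Icc (a - Real.pi / |φ|) (b - Real.pi / |φ|) := by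
    intro t ht
    by_contra hn
    rw [Set.mem_union, not_or] at hn
    apply ht
    have h2 : t + Real.pi / |φ| ∉ Set.Icc a b := fun h => hn.2 ⟨by linarith [h.1], by linarith [h.2]⟩
    simp [oscShift, oscInt, Set.indicator_of_notMem hn.1, Set.indicator_of_notMem h2]
  refine (measure_mono this).trans ((measure_union_le _ _).trans ?_)
  rw [Real.volume_Icc, Real.volume_Icc, ← ENNReal.ofReal_add (by linarith) (by linarith)]
  apply ENNReal.ofReal_le_ofReal; linarith

/-- The half-period trick for a window integral: the main part carries the cancellation, and the
remainder is a difference of two translated windows. -/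
theorem two_mul_integral_oscInt (hF : Measurable F) (h2 : eLpNorm (oscInt a b φ F) 2 volume ≠ ⊤)
    (t h : ℝ) :
    2 * ∫ r in t..(t + h), oscInt a b φ F r = (∫ r in t..(t + h), oscShift a b φ F r) -
      ((∫ r in (t + Real.pi / |φ|)..(t + Real.pi / |φ| + h), oscInt a b φ F r) -
        ∫ r in t..(t + h), oscInt a b φ F r) := by
  have hi := integrable_oscInt hF h2
  have e : ∫ r in t..(t + h), oscShift a b φ F r = (∫ r in t..(t + h), oscInt a b φ F r) +
      ∫ r in t..(t + h), oscInt a b φ F (r + Real.pi / |φ|) := by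
    unfold oscShift
    exact intervalIntegral.integral_add hi.intervalIntegrable (hi.comp_add_right _).intervalIntegrable
  rw [e, intervalIntegral.integral_comp_add_right (fun r => oscInt a b φ F r),
    show t + h + Real.pi / |φ| = t + Real.pi / |φ| + h by ring]
  ring

/-- Moving a window of length `h` by `δ` and moving a window of length `δ` by `h` change the same
end pieces. The remainder can thus always be estimated with the shorter of the two lengths. -/
theorem integral_oscInt_shift_sub (hF : Measurable F) (h2 : eLpNorm (oscInt a b φ F) 2 volume ≠ ⊤)
    (t h δ : ℝ) :
    (∫ r in (t + δ)..(t + δ + h), oscInt a b φ F r) - ∫ r in t..(t + h), oscInt a b φ F r =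
    (∫ r in (t + h)..(t + h + δ), oscInt a b φ F r) - ∫ r in t..(t + δ), oscInt a b φ F r := by
  have hi : ∀ x y, IntervalIntegrable (oscInt a b φ F) volume x y := fun x y =>
    (integrable_oscInt hF h2).intervalIntegrable
  have e1 := intervalIntegral.integral_add_adjacent_intervals (hi t (t + δ)) (hi (t + δ) (t + δ + h))
  have e2 := intervalIntegral.integral_add_adjacent_intervals (hi t (t + h)) (hi (t + h) (t + h + δ))
  rw [show t + h + δ = t + δ + h by ring] at e2 ⊢
  linear_combination e1 - e2

end Shift

theorem continuous_window {G : ℝ → ℂ} (hG : Integrable G) (h : ℝ) :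
    Continuous fun t => ∫ r in t..(t + h), G r := by
  have hi : ∀ x y, IntervalIntegrable G volume x y := fun x y => hG.intervalIntegrable
  have hc := intervalIntegral.continuous_primitive hi 0
  have e : (fun t => ∫ r in t..(t + h), G r) = fun t => (∫ r in (0:ℝ)..(t + h), G r) - ∫ r in (0:ℝ)..t, G r := by
    ext t
    rw [intervalIntegral.integral_interval_sub_left (hi _ _) (hi _ _)]
  rw [e]
  exact (hc.comp (continuous_id.add continuous_const)).sub hc

theorem eLpNorm_window_le {K : ℝ → ℂ} (hK : Measurable K) {h v : ℝ} (hh : 0 ≤ h) (hv : 0 ≤ v)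
    (hV : ∀ t, volume (Set.Ioc t (t + h) ∩ Function.support K) ≤ ENNReal.ofReal v) :
    eLpNorm (fun t => ∫ r in t..(t + h), K r) 2 volume ≤
      ENNReal.ofReal (√v) * ENNReal.ofReal (√h) * eLpNorm K 2 volume := by
  refine eLpNorm_two_le_of_sq_le ?_
  rw [mul_pow, mul_pow, ofReal_sqrt_sq hv, ofReal_sqrt_sq hh, eLpNorm_two_sq]
  refine le_trans ?_ (lintegral_window_sq_le hK.enorm h (V := ENNReal.ofReal v) (by
    have : Function.support (fun t => ‖K t‖ₑ) = Function.support K := by ext; simp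
    rw [this]; exact hV))
  gcongr with t
  exact enorm_intervalIntegral_le hh

theorem eLpNorm_window_le_length {K : ℝ → ℂ} (hK : Measurable K) {h : ℝ} (hh : 0 ≤ h) :
    eLpNorm (fun t => ∫ r in t..(t + h), K r) 2 volume ≤ ENNReal.ofReal h * eLpNorm K 2 volume := by
  have := eLpNorm_window_le hK hh hh (fun t => (measure_mono Set.inter_subset_left).trans (by simp))
  rwa [← ENNReal.ofReal_mul (by positivity), Real.mul_self_sqrt hh] at this

theorem enorm_window_le {K : ℝ → ℂ} (hK : Measurable K) {h : ℝ} (hh : 0 ≤ h) (t : ℝ) :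
    ‖∫ r in t..(t + h), K r‖ₑ ≤ ENNReal.ofReal (√h) * eLpNorm K 2 volume :=
  (enorm_intervalIntegral_le hh).trans (setLIntegral_le_sqrt_mul hK.stronglyMeasurable hh (by simp))

theorem enorm_le_enorm_two_mul (z : ℂ) : ‖z‖ₑ ≤ ‖2 * z‖ₑ := by
  rw [enorm_mul]
  refine le_mul_of_one_le_left zero_le ?_
  rw [← ofReal_norm]; simp

section

variable {a b φ : ℝ} {F : ℝ → ℂ}

/-- The remainder is written with windows of length `δ`, however large `h` is; its two windows raise
the constant from 3 to 5. As the right side contains no supremum, this serves both existence and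
uniqueness. -/
theorem enorm_integral_oscInt_le (hφ : φ ≠ 0) (hF : Measurable F)
    (h2 : eLpNorm (oscInt a b φ F) 2 volume ≠ ⊤) {h : ℝ} (hh : 0 ≤ h) (t : ℝ) :
    ‖∫ r in t..(t + h), oscInt a b φ F r‖ₑ ≤ (∫⁻ t in Set.Icc a b, ‖tdiff (Real.pi / |φ|) F t‖ₑ) +
      5 * (ENNReal.ofReal (√(Real.pi / |φ|)) * eLpNorm (oscInt a b φ F) 2 volume) := by
  have hδ0 : 0 < Real.pi / |φ| := div_pos Real.pi_pos (abs_pos.2 hφ)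
  refine (enorm_le_enorm_two_mul _).trans ?_
  rw [two_mul_integral_oscInt hF h2, integral_oscInt_shift_sub hF h2]
  refine (enorm_sub_le).trans ?_
  have hm := measurable_oscInt hF a b φ
  calc _ ≤ (∫⁻ t, ‖oscShift a b φ F t‖ₑ) +
        (ENNReal.ofReal (√(Real.pi / |φ|)) * eLpNorm (oscInt a b φ F) 2 volume +
          ENNReal.ofReal (√(Real.pi / |φ|)) * eLpNorm (oscInt a b φ F) 2 volume) := by
        refine add_le_add ((enorm_intervalIntegral_le hh).trans (setLIntegral_le_lintegral _ _)) ?_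
        exact enorm_sub_le.trans (add_le_add (enorm_window_le hm hδ0.le _) (enorm_window_le hm hδ0.le _))
    _ ≤ _ := add_le_add_left (lintegral_oscShift_le hφ hF) _
    _ = _ := by ring

theorem eLpNorm_integral_oscInt_le (hφ : φ ≠ 0) (hF : Measurable F)
    (h2 : eLpNorm (oscInt a b φ F) 2 volume ≠ ⊤) {h : ℝ} (hh : 0 ≤ h) :
    eLpNorm (fun t => ∫ r in t..(t + h), oscInt a b φ F r) 2 volume ≤
      eLpNorm (fun t => ∫ r in t..(t + h), oscShift a b φ F r) 2 volume +
      2 * (ENNReal.ofReal (min h (Real.pi / |φ|)) * eLpNorm (oscInt a b φ F) 2 volume) := by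
  have hδ0 : 0 < Real.pi / |φ| := div_pos Real.pi_pos (abs_pos.2 hφ)
  have hm := measurable_oscInt hF a b φ
  have hi := integrable_oscInt hF h2
  have hKi : Integrable (oscShift a b φ F) := hi.add (hi.comp_add_right (Real.pi / |φ|))
  have hPc := continuous_window hKi h
  have hm0 : 0 ≤ min h (Real.pi / |φ|) := le_min hh hδ0.le
  have hid := two_mul_integral_oscInt hF h2
  have hsub := integral_oscInt_shift_sub hF h2
  revert hPc hid hsub hm hi hm0
  generalize oscShift a b φ F = K
  generalize oscInt a b φ F = G
  generalize Real.pi / |φ| = δ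
  intro hm hi hPc hm0 hid hsub
  -- both forms of the boundary term are differences of two translates of the same window function
  obtain ⟨x, y, hxy⟩ : ∃ x y : ℝ, ∀ t, (∫ r in (t + δ)..(t + δ + h), G r) - ∫ r in t..(t + h), G r =
      (∫ r in (t + x)..(t + x + min h δ), G r) - ∫ r in (t + y)..(t + y + min h δ), G r := by
    rcases le_total h δ with hle | hle
    · exact ⟨δ, 0, fun t => by rw [min_eq_left hle]; simp⟩
    · exact ⟨h, 0, fun t => by rw [min_eq_right hle, hsub]; simp⟩
  have hEc := continuous_window hi (min h δ)
  have hEle := eLpNorm_window_le_length hm hm0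
  revert hEc hEle hxy
  generalize min h δ = m
  intro hxy hEc hEle
  have hEx : ∀ x : ℝ, eLpNorm (fun t => ∫ r in (t + x)..(t + x + m), G r) 2 volume =
      eLpNorm (fun t => ∫ r in t..(t + m), G r) 2 volume := fun x =>
    eLpNorm_comp_measurePreserving (g := fun t => ∫ r in t..(t + m), G r) hEc.aestronglyMeasurable
      (measurePreserving_add_right volume x)
  have hcx : ∀ x : ℝ, AEStronglyMeasurable (fun t => ∫ r in (t + x)..(t + x + m), G r) volume := fun x =>
    (hEc.comp (continuous_id.add (continuous_const (y := x)))).aestronglyMeasurable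
  have h1 : eLpNorm (fun t => ∫ r in t..(t + h), G r) 2 volume ≤
      eLpNorm ((fun t => ∫ r in t..(t + h), K r) - ((fun t => ∫ r in (t + x)..(t + x + m), G r) -
        fun t => ∫ r in (t + y)..(t + y + m), G r)) 2 volume := by
    refine eLpNorm_mono_enorm fun t => (enorm_le_enorm_two_mul _).trans (le_of_eq ?_)
    rw [hid, hxy]
    rfl
  refine h1.trans ((eLpNorm_sub_le hPc.aestronglyMeasurable ((hcx x).sub (hcx y)) (by norm_num)).trans ?_)
  refine add_le_add le_rfl ((eLpNorm_sub_le (hcx x) (hcx y) (by norm_num)).trans ?_)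
  rw [hEx, hEx, ← two_mul]
  exact mul_le_mul_right hEle _

/-- The increments of the oscillatory primitive. -/
theorem tdiff_primitive {G : ℝ → ℂ} (hG : Integrable G) (c h : ℝ) :
    tdiff h (fun t => ∫ r in c..t, G r) = fun t => ∫ r in t..(t + h), G r := by
  have hi : ∀ x y, IntervalIntegrable G volume x y := fun x y => hG.intervalIntegrable
  ext t
  rw [tdiff, intervalIntegral.integral_interval_sub_left (hi _ _) (hi _ _)]

theorem supN_primitive_le {G : ℝ → ℂ} {C : ℝ≥0∞}
    (h : ∀ t h : ℝ, 0 ≤ h → ‖∫ r in t..(t + h), G r‖ₑ ≤ C) (c : ℝ) :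
    supN (fun t => ∫ r in c..t, G r) ≤ C := by
  refine iSup_le fun t => ?_
  rcases le_total c t with hct | hct
  · have := h c (t - c) (by linarith)
    rwa [add_sub_cancel] at this
  · have := h t (c - t) (by linarith)
    rw [add_sub_cancel] at this
    change ‖∫ r in c..t, G r‖ₑ ≤ C
    rwa [intervalIntegral.integral_symm, enorm_neg]

end

/-- The gain of the normal form at frequency `N`. -/
def gain (N : ℤ) : ℝ := (max 1 |(N : ℝ)|) ^ (-(1 / 2) : ℝ)

theorem gain_zero : gain 0 = 1 := by simp [gain]

theorem sqrt_pi_div_le_gain {N : ℤ} (hN : N ≠ 0) :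
    ENNReal.ofReal (√(Real.pi / |(N : ℝ)|)) ≤ 2 * ENNReal.ofReal (gain N) := by
  have h1 : (1 : ℝ) ≤ |(N : ℝ)| := by exact_mod_cast Int.one_le_abs hN
  have h0 : 0 < |(N : ℝ)| := by linarith
  rw [← ENNReal.ofReal_ofNat 2, ← ENNReal.ofReal_mul (by norm_num)]
  apply ENNReal.ofReal_le_ofReal
  rw [gain, max_eq_right h1, Real.sqrt_div Real.pi_pos.le, Real.rpow_neg h0.le, ← Real.sqrt_eq_rpow,
    div_eq_mul_inv]
  gcongr
  rw [Real.sqrt_le_left (by norm_num)]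
  linarith [Real.pi_le_four]

theorem eLpNorm_oscInt_ne_top {a b φ : ℝ} {F : ℝ → ℂ} (hab : a ≤ b) (hS : supN F ≠ ⊤) :
    eLpNorm (oscInt a b φ F) 2 volume ≠ ⊤ :=
  ne_top_of_le_ne_top (ENNReal.mul_ne_top ENNReal.ofReal_ne_top hS) (eLpNorm_oscInt_le_supN hab φ F)

/-- The basic linear estimate: the gain comes from the half-period shift and the small factor from
Cauchy-Schwarz on `[a, b]`. For `N = 0` there is nothing to gain. For `N ≠ 0` the supremum
contributes 5 and the seminorm 7, and `√(π/|N|) ≤ 2 |N|^(-1/2)` doubles their sum to 24. -/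
theorem yN_primitive_oscInt_le {a b : ℝ} (hab : a ≤ b) (hL : b - a ≤ 2) (c : ℝ) (N : ℤ) {F : ℝ → ℂ}
    (hF : Measurable F) (hy : yN F ≠ ⊤) :
    yN (fun t => ∫ r in c..t, oscInt a b N F r) ≤
      24 * (ENNReal.ofReal (√(b - a)) * (ENNReal.ofReal (gain N) * yN F)) := by
  have hS : supN F ≠ ⊤ := ne_top_of_le_ne_top hy (supN_le_yN F)
  have h2 := eLpNorm_oscInt_ne_top (φ := N) hab hS
  have hi := integrable_oscInt hF h2
  have hm := measurable_oscInt hF a b N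
  have hG := (eLpNorm_oscInt_le_supN hab N F).trans (mul_le_mul_right (supN_le_yN F) _)
  have hLs : ENNReal.ofReal (√(b - a)) ≤ 2 := by
    rw [← ENNReal.ofReal_ofNat 2]
    apply ENNReal.ofReal_le_ofReal
    rw [Real.sqrt_le_left (by norm_num)]; linarith
  set l := ENNReal.ofReal (√(b - a)) with hl
  by_cases hN : N = 0
  · subst hN
    rw [gain_zero, ENNReal.ofReal_one, one_mul]
    have h1 : supN (fun t => ∫ r in c..t, oscInt a b (0 : ℤ) F r) ≤ 2 * (l * yN F) := by
      refine supN_primitive_le (fun t h hh => ?_) c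
      refine (enorm_intervalIntegral_le hh).trans ?_
      have e : ∫⁻ r in Set.Ioc t (t + h), ‖oscInt a b (0 : ℤ) F r‖ₑ ≤
          ∫⁻ r in Set.Icc a b, ‖oscInt a b (0 : ℤ) F r‖ₑ := by
        refine (setLIntegral_le_lintegral _ _).trans ?_
        rw [← lintegral_indicator measurableSet_Icc]
        refine lintegral_mono fun r => ?_
        by_cases hr : r ∈ Set.Icc a b
        · rw [Set.indicator_of_mem hr]
        · rw [Set.indicator_of_notMem hr, enorm_oscInt, Set.indicator_of_notMem hr]
      refine e.trans ((setLIntegral_le_sqrt_mul hm.stronglyMeasurable (v := b - a) (by linarith) (by simp)).trans ?_)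
      exact mul_le_mul' hLs hG
    have h3 : nikN (fun t => ∫ r in c..t, oscInt a b (0 : ℤ) F r) ≤ 2 * (l * yN F) := by
      refine nikN_le_iff.2 fun h hh => ?_
      rw [tdiff_primitive hi]
      refine (eLpNorm_window_le (v := b - a) hm hh.le (by linarith) (fun t => ?_)).trans ?_
      · refine (measure_mono (Set.inter_subset_right.trans (support_oscInt_subset _ _ _ _))).trans (by simp)
      · calc _ ≤ 2 * ENNReal.ofReal (√h) * (l * yN F) := by gcongr
          _ = _ := by ring
    calc _ ≤ 2 * (l * yN F) + 2 * (l * yN F) := add_le_add h1 h3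
      _ = 4 * (l * yN F) := by ring
      _ ≤ _ := by gcongr; norm_num
  · have hφ : (N : ℝ) ≠ 0 := by exact_mod_cast hN
    have hδ0 : 0 < Real.pi / |(N : ℝ)| := div_pos Real.pi_pos (abs_pos.2 hφ)
    have hgain := sqrt_pi_div_le_gain hN
    set δ := Real.pi / |(N : ℝ)| with hδ
    set d := ENNReal.ofReal (√δ) with hd
    have h1 : supN (fun t => ∫ r in c..t, oscInt a b N F r) ≤ 5 * (l * (d * yN F)) := by
      refine supN_primitive_le (fun t h hh => ?_) c
      refine (enorm_integral_oscInt_le hφ hF h2 hh t).trans ?_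
      rw [← hδ, ← hd]
      have e1 : ∫⁻ t in Set.Icc a b, ‖tdiff δ F t‖ₑ ≤ l * (nikN F * d) :=
        (setLIntegral_le_sqrt_mul (measurable_tdiff hF δ).stronglyMeasurable (v := b - a) (by linarith)
          (by simp)).trans (mul_le_mul_right (eLpNorm_tdiff_le F hδ0.le) _)
      calc _ ≤ l * (nikN F * d) + 5 * (d * (l * supN F)) := by
            gcongr; exact eLpNorm_oscInt_le_supN hab _ _
        _ ≤ 5 * (l * (nikN F * d)) + 5 * (d * (l * supN F)) :=
            add_le_add (le_mul_of_one_le_left zero_le (by norm_num)) le_rfl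
        _ = _ := by rw [yN]; ring
    have h3 : nikN (fun t => ∫ r in c..t, oscInt a b N F r) ≤ 7 * (l * (d * yN F)) := by
      refine nikN_le_iff.2 fun h hh => ?_
      rw [tdiff_primitive hi]
      refine (eLpNorm_integral_oscInt_le hφ hF h2 hh.le).trans ?_
      rw [← hδ]
      have e1 := eLpNorm_window_le (v := 2 * (b - a)) (measurable_oscShift (a := a) (b := b) (φ := N) hF) hh.le
        (by linarith) (fun t => (measure_mono Set.inter_subset_right).trans (volume_support_oscShift_le hab))
      have e2 := eLpNorm_oscShift_le (a := a) (b := b) hφ hF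
      rw [← hδ, ← hd] at e2
      -- The geometric mean splits the length of the remainder windows between the `√h` of the
      -- seminorm and the `√δ` of the gain.
      have e3 : ENNReal.ofReal (min h δ) ≤ ENNReal.ofReal (√h) * d := by
        rw [← ENNReal.ofReal_mul (by positivity)]
        apply ENNReal.ofReal_le_ofReal
        rw [← Real.sqrt_mul hh.le]
        apply Real.le_sqrt_of_sq_le
        rw [sq]
        exact mul_le_mul (min_le_left _ _) (min_le_right _ _) (le_min hh.le hδ0.le) hh.le
      calc _ ≤ ENNReal.ofReal (3 / 2) * l * ENNReal.ofReal (√h) * (3 * (d * yN F)) +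
            2 * (ENNReal.ofReal (√h) * d * (l * yN F)) := by
            refine add_le_add (e1.trans ?_) ?_
            · gcongr
              exact ofReal_sqrt_two_mul_le _
            · gcongr
        _ = (ENNReal.ofReal (3 / 2) * 3 + 2) * (l * (d * yN F)) * ENNReal.ofReal (√h) := by ring
        _ ≤ _ := by
            gcongr
            rw [← ENNReal.ofReal_ofNat 3, ← ENNReal.ofReal_ofNat 2, ← ENNReal.ofReal_ofNat 7,
              ← ENNReal.ofReal_mul (by norm_num), ← ENNReal.ofReal_add (by norm_num) (by norm_num)]
            apply ENNReal.ofReal_le_ofReal; norm_num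
    calc _ ≤ 5 * (l * (d * yN F)) + 7 * (l * (d * yN F)) := add_le_add h1 h3
      _ = 12 * (l * (d * yN F)) := by ring
      _ ≤ 12 * (l * (2 * ENNReal.ofReal (gain N) * yN F)) := by gcongr
      _ = _ := by ring

/-! ### The `H^{1/2}` seminorm of oscillatory primitives. -/

/-- The Sobolev-Slobodeckij seminorm of order `1/2`, restricted to increments of length at most one. -/
def slobN (f : ℝ → ℂ) : ℝ≥0∞ :=
  eLpNorm (fun z : ℝ × ℝ => tdiff z.1 f z.2 / (z.1 : ℂ)) 2 ((volume.restrict (Set.Ioc 0 1)).prod volume)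

theorem measurable_slob {f : ℝ → ℂ} (hf : Measurable f) :
    Measurable fun z : ℝ × ℝ => tdiff z.1 f z.2 / (z.1 : ℂ) := by
  unfold tdiff
  have : Measurable fun x : ℝ => (x : ℂ) := Complex.measurable_ofReal
  fun_prop

theorem slobN_sq {f : ℝ → ℂ} (hf : Measurable f) :
    slobN f ^ 2 = ∫⁻ h in Set.Ioc (0 : ℝ) 1, eLpNorm (tdiff h f) 2 volume ^ 2 / ENNReal.ofReal (h ^ 2) := by
  rw [slobN, eLpNorm_two_sq, lintegral_prod _ ((measurable_slob hf).enorm.pow_const 2).aemeasurable]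
  refine setLIntegral_congr_fun measurableSet_Ioc fun h hh => ?_
  simp only
  have e : ∀ t, ‖tdiff h f t / (h : ℂ)‖ₑ ^ 2 = ‖tdiff h f t‖ₑ ^ 2 * (ENNReal.ofReal (h ^ 2))⁻¹ := fun t => by
    have hpos : 0 < h := hh.1
    have : ‖(h : ℂ)‖ₑ = ENNReal.ofReal h := by
      rw [← ofReal_norm, Complex.norm_real, Real.norm_of_nonneg hpos.le]
    rw [div_eq_mul_inv, enorm_mul, enorm_inv (by exact_mod_cast hpos.ne'), mul_pow, this,
      ← ENNReal.inv_pow, ENNReal.ofReal_pow hpos.le]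
  simp_rw [e]
  have := measurable_tdiff hf h
  rw [lintegral_mul_const _ (by fun_prop), eLpNorm_two_sq, div_eq_mul_inv]

theorem slobN_tsum_le {ι : Type*} [Countable ι] {G : ℝ → ℂ} {g : ι → ℝ → ℂ} (hg : ∀ i, Measurable (g i))
    (hG : ∀ t, HasSum (fun i => g i t) (G t)) : slobN G ≤ ∑' i, slobN (g i) := by
  refine eLpNorm_two_le_tsum (fun i => (measurable_slob (hg i)).aestronglyMeasurable) fun z => ?_
  have h := ((hG (z.2 + z.1)).sub (hG z.2)).div_const (z.1 : ℂ)
  unfold tdiff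
  rw [← h.tsum_eq]
  exact enorm_tsum_le_tsum_enorm

theorem slobN_const_mul (c : ℂ) (f : ℝ → ℂ) : slobN (fun t => c * f t) = ‖c‖ₑ * slobN f := by
  unfold slobN
  rw [← eLpNorm_const_smul]
  congr 1; ext z
  simp [tdiff_const_mul, mul_div_assoc]

/-- Splitting at `h = δ`, the integrand is at most 1 below and `δ²/h²` above, and each part
contributes at most `δ`. This is the exact amount that the gain requires. -/
theorem lintegral_min_sq_div_le {δ : ℝ} (hδ : 0 < δ) :
    ∫⁻ h in Set.Ioc (0 : ℝ) 1, ENNReal.ofReal (min h δ) ^ 2 / ENNReal.ofReal (h ^ 2) ≤ 2 * ENNReal.ofReal δ := by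
  have hsub : Set.Ioc (0 : ℝ) 1 ⊆ Set.Ioc 0 δ ∪ Set.Ioi δ := fun x hx => by
    rcases le_or_gt x δ with h | h
    exacts [Or.inl ⟨hx.1, h⟩, Or.inr h]
  refine (lintegral_mono_set hsub).trans ((lintegral_union_le _ _ _).trans ?_)
  rw [two_mul]
  refine add_le_add ?_ ?_
  · calc _ ≤ ∫⁻ h in Set.Ioc (0 : ℝ) δ, 1 := by
          refine setLIntegral_mono measurable_const fun h hh => ?_
          rw [ENNReal.ofReal_pow hh.1.le]
          refine ENNReal.div_le_of_le_mul ?_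
          rw [one_mul]
          gcongr
          exact min_le_left _ _
      _ = _ := by simp
  · have hint : IntegrableOn (fun h : ℝ => δ ^ 2 * h ^ (-2 : ℝ)) (Set.Ioi δ) :=
      (integrableOn_Ioi_rpow_of_lt (by norm_num) hδ).const_mul _
    calc _ ≤ ∫⁻ h in Set.Ioi δ, ENNReal.ofReal (δ ^ 2 * h ^ (-2 : ℝ)) := by
          refine setLIntegral_mono (by fun_prop) fun h hh => ?_
          have h0 : 0 < h := hδ.trans hh
          rw [← ENNReal.ofReal_pow (le_min h0.le hδ.le), ← ENNReal.ofReal_div_of_pos (by positivity)]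
          apply ENNReal.ofReal_le_ofReal
          rw [Real.rpow_neg h0.le, Real.rpow_ofNat, div_eq_mul_inv]
          gcongr
          exact min_le_right _ _
      _ = ENNReal.ofReal (∫ h in Set.Ioi δ, δ ^ 2 * h ^ (-2 : ℝ)) := by
          rw [ofReal_integral_eq_lintegral_ofReal hint]
          refine (ae_restrict_mem measurableSet_Ioi).mono fun h hh => ?_
          have h0 : 0 < h := hδ.trans hh
          change 0 ≤ δ ^ 2 * h ^ (-2 : ℝ)
          positivity
      _ = _ := by
          rw [integral_const_mul, integral_Ioi_rpow_of_lt (by norm_num) hδ]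
          congr 1
          norm_num
          rw [Real.rpow_neg_one]
          field_simp

theorem ennreal_add_sq_le (x y : ℝ≥0∞) : (x + y) ^ 2 ≤ 2 * (x ^ 2 + y ^ 2) := by
  have := ENNReal.rpow_add_le_mul_rpow_add_rpow x y (p := 2) (by norm_num)
  norm_num at this
  exact this

/-- Integration regularizes: the main part of an increment is `O(h)` and the remainder `O(min h δ)`,
so the `H^{1/2}` integral converges at `h = 0` although the amplitude only has Nikolskii regularity.
The same gain in `N` persists, without a small factor in `b - a`. -/
theorem slobN_primitive_oscInt_le {a b : ℝ} (hab : a ≤ b) (hL : b - a ≤ 2) (c : ℝ) (N : ℤ) {F : ℝ → ℂ}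
    (hF : Measurable F) (hy : yN F ≠ ⊤) :
    slobN (fun t => ∫ r in c..t, oscInt a b N F r) ≤ 20 * (ENNReal.ofReal (gain N) * yN F) := by
  have hS : supN F ≠ ⊤ := ne_top_of_le_ne_top hy (supN_le_yN F)
  have h2 := eLpNorm_oscInt_ne_top (φ := N) hab hS
  have hi := integrable_oscInt hF h2
  have hm := measurable_oscInt hF a b N
  have hLs : ENNReal.ofReal (√(b - a)) ≤ ENNReal.ofReal (3 / 2) := by
    apply ENNReal.ofReal_le_ofReal
    rw [Real.sqrt_le_left (by norm_num)]; linarith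
  have hG : eLpNorm (oscInt a b N F) 2 volume ≤ ENNReal.ofReal (3 / 2) * yN F :=
    (eLpNorm_oscInt_le_supN hab N F).trans (mul_le_mul' hLs (supN_le_yN F))
  have hpm : Measurable (fun t => ∫ r in c..t, oscInt a b N F r) :=
    (intervalIntegral.continuous_primitive (fun x y => hi.intervalIntegrable) c).measurable
  refine (ENNReal.pow_le_pow_left_iff two_ne_zero).1 ?_
  rw [slobN_sq hpm]
  have two : (ENNReal.ofReal (3 / 2)) ≤ 2 := by
    rw [← ENNReal.ofReal_ofNat 2]; apply ENNReal.ofReal_le_ofReal; norm_num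
  have hsq : ∀ u : ℝ≥0∞, ∀ h ∈ Set.Ioc (0 : ℝ) 1, (ENNReal.ofReal h * u) ^ 2 / ENNReal.ofReal (h ^ 2) = u ^ 2 := by
    intro u h hh
    have h0 : ENNReal.ofReal (h ^ 2) ≠ 0 := by
      simp [hh.1.ne']
    rw [mul_pow, ← ENNReal.ofReal_pow hh.1.le, ENNReal.mul_div_right_comm, ENNReal.div_self h0 ENNReal.ofReal_ne_top,
      one_mul]
  by_cases hN : N = 0
  · subst hN
    rw [gain_zero, ENNReal.ofReal_one, one_mul]
    calc _ ≤ ∫⁻ h in Set.Ioc (0 : ℝ) 1, (2 * yN F) ^ 2 := by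
          refine setLIntegral_mono measurable_const fun h hh => ?_
          rw [tdiff_primitive hi]
          calc _ ≤ (ENNReal.ofReal h * (2 * yN F)) ^ 2 / ENNReal.ofReal (h ^ 2) := by
                gcongr
                exact (eLpNorm_window_le_length hm hh.1.le).trans
                  (mul_le_mul_right (hG.trans (mul_le_mul_left two _)) _)
            _ = _ := hsq _ h hh
      _ = (2 * yN F) ^ 2 := by simp
      _ ≤ _ := by gcongr; norm_num
  · have hφ : (N : ℝ) ≠ 0 := by exact_mod_cast hN
    have hδ0 : 0 < Real.pi / |(N : ℝ)| := div_pos Real.pi_pos (abs_pos.2 hφ)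
    have hgain := sqrt_pi_div_le_gain hN
    set δ := Real.pi / |(N : ℝ)| with hδ
    set d := ENNReal.ofReal (√δ) with hd
    set y := yN F with hydef
    have hdd : d ^ 2 = ENNReal.ofReal δ := ofReal_sqrt_sq hδ0.le
    have key : ∀ h ∈ Set.Ioc (0 : ℝ) 1,
        eLpNorm (tdiff h fun t => ∫ r in c..t, oscInt a b N F r) 2 volume ^ 2 / ENNReal.ofReal (h ^ 2) ≤
        18 * (d * y) ^ 2 + 18 * y ^ 2 * (ENNReal.ofReal (min h δ) ^ 2 / ENNReal.ofReal (h ^ 2)) := by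
      intro h hh
      rw [tdiff_primitive hi]
      have e1 := eLpNorm_integral_oscInt_le hφ hF h2 hh.1.le
      have e2 := eLpNorm_window_le_length (measurable_oscShift (a := a) (b := b) (φ := N) hF) hh.1.le
      have e3 := eLpNorm_oscShift_le (a := a) (b := b) hφ hF
      rw [← hδ, ← hd, ← hydef] at e3
      rw [← hδ] at e1
      have e4 : eLpNorm (fun t => ∫ r in t..(t + h), oscInt a b N F r) 2 volume ≤
          ENNReal.ofReal h * (3 * (d * y)) + ENNReal.ofReal (min h δ) * (3 * y) := by
        refine e1.trans (add_le_add (e2.trans (by gcongr)) ?_)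
        calc _ ≤ 2 * (ENNReal.ofReal (min h δ) * (ENNReal.ofReal (3 / 2) * y)) := by gcongr
          _ = (2 * ENNReal.ofReal (3 / 2)) * (ENNReal.ofReal (min h δ) * y) := by ring
          _ = 3 * (ENNReal.ofReal (min h δ) * y) := by
              congr 1; rw [← ENNReal.ofReal_ofNat 2, ← ENNReal.ofReal_mul (by norm_num)]; norm_num
          _ = _ := by ring
      calc _ ≤ (ENNReal.ofReal h * (3 * (d * y)) + ENNReal.ofReal (min h δ) * (3 * y)) ^ 2 /
            ENNReal.ofReal (h ^ 2) := by gcongr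
        _ ≤ (2 * ((ENNReal.ofReal h * (3 * (d * y))) ^ 2 + (ENNReal.ofReal (min h δ) * (3 * y)) ^ 2)) /
            ENNReal.ofReal (h ^ 2) := by
            gcongr
            exact ennreal_add_sq_le _ _
        _ = 2 * ((ENNReal.ofReal h * (3 * (d * y))) ^ 2 / ENNReal.ofReal (h ^ 2)) +
            2 * ((ENNReal.ofReal (min h δ) * (3 * y)) ^ 2 / ENNReal.ofReal (h ^ 2)) := by
            rw [mul_add, ENNReal.add_div, mul_div_assoc, mul_div_assoc]
        _ = _ := by
            rw [hsq _ h hh]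
            simp only [div_eq_mul_inv]
            ring
    calc _ ≤ ∫⁻ h in Set.Ioc (0 : ℝ) 1, (18 * (d * y) ^ 2 +
          18 * y ^ 2 * (ENNReal.ofReal (min h δ) ^ 2 / ENNReal.ofReal (h ^ 2))) :=
          setLIntegral_mono (by fun_prop) key
      _ ≤ 18 * (d * y) ^ 2 + 18 * y ^ 2 * (2 * d ^ 2) := by
          rw [lintegral_add_left measurable_const, lintegral_const_mul (18 * y ^ 2) (by fun_prop), hdd]
          refine add_le_add (by simp) ?_
          exact mul_le_mul_right (lintegral_min_sq_div_le hδ0) _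
      _ = 54 * (d * y) ^ 2 := by ring
      _ ≤ 54 * (2 * ENNReal.ofReal (gain N) * y) ^ 2 := by gcongr
      _ = 216 * (ENNReal.ofReal (gain N) * y) ^ 2 := by ring
      _ ≤ 400 * (ENNReal.ofReal (gain N) * y) ^ 2 := by gcongr; norm_num
      _ = _ := by rw [mul_pow 20]; norm_num

/-! ### The embedding into `L^q` and unbounded amplitudes. -/

theorem eLpNorm_natCast_pow {f : ℝ → ℂ} {q : ℕ} (hq : q ≠ 0) :
    eLpNorm f q volume ^ q = ∫⁻ t, ‖f t‖ₑ ^ q := by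
  rw [eLpNorm_eq_lintegral_rpow_enorm_toReal (by exact_mod_cast hq) (by simp), ← ENNReal.rpow_natCast,
    ← ENNReal.rpow_mul]
  have : (q : ℝ) ≠ 0 := by exact_mod_cast hq
  simp [this]

/-- Based on `‖g‖^q ≤ M^(q-2) ‖g‖²`. For dyadic differences `M` is the Nikolskii seminorm and `e`
the dyadic length. -/
theorem eLpNorm_interpolate {g : ℝ → ℂ} {M e : ℝ≥0∞} {q : ℕ} (hq : 2 ≤ q) (hsup : ∀ t, ‖g t‖ₑ ≤ M)
    (h2 : eLpNorm g 2 volume ^ 2 ≤ M ^ 2 * e) (hgm : Measurable g) :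
    eLpNorm g q volume ≤ M * e ^ (1 / (q : ℝ)) := by
  have hq0 : q ≠ 0 := by omega
  refine (ENNReal.pow_le_pow_left_iff hq0).1 ?_
  have he : (e ^ (1 / (q : ℝ))) ^ q = e := by
    rw [← ENNReal.rpow_natCast, ← ENNReal.rpow_mul, one_div_mul_cancel (by exact_mod_cast hq0), ENNReal.rpow_one]
  rw [mul_pow, he, eLpNorm_natCast_pow hq0]
  obtain ⟨r, rfl⟩ := Nat.exists_eq_add_of_le hq
  calc _ ≤ ∫⁻ t, M ^ r * ‖g t‖ₑ ^ 2 := by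
        refine lintegral_mono fun t => ?_
        rw [pow_add, mul_comm]
        gcongr
        exact hsup t
    _ = M ^ r * eLpNorm g 2 volume ^ 2 := by rw [lintegral_const_mul'' _ (by fun_prop), eLpNorm_two_sq]
    _ ≤ M ^ r * (M ^ 2 * e) := by gcongr
    _ = _ := by ring

/-- Square integrability together with half a derivative in the Nikolskii sense. -/
def zN (f : ℝ → ℂ) : ℝ≥0∞ := eLpNorm f 2 volume + nikN f

/-- The average of `f` over `[t, t + 2^{-k}]`. -/
def dyadicMean (f : ℝ → ℂ) (k : ℕ) (t : ℝ) : ℂ := 2 ^ k * ∫ r in t..(t + (1 / 2) ^ k), f r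

theorem locallyIntegrable_of_eLpNorm_two {f : ℝ → ℂ} (hf : Measurable f) (h2 : eLpNorm f 2 volume ≠ ⊤) :
    LocallyIntegrable f :=
  MemLp.locallyIntegrable (p := 2) ⟨hf.aestronglyMeasurable, h2.lt_top⟩ (by norm_num)

theorem continuous_window_of_locallyIntegrable {G : ℝ → ℂ} (hG : LocallyIntegrable G) (h : ℝ) :
    Continuous fun t => ∫ r in t..(t + h), G r := by
  have hi : ∀ x y, IntervalIntegrable G volume x y := fun x y =>
    (hG.integrableOn_isCompact isCompact_uIcc).intervalIntegrable
  have hc := intervalIntegral.continuous_primitive hi 0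
  have e : (fun t => ∫ r in t..(t + h), G r) = fun t => (∫ r in (0:ℝ)..(t + h), G r) - ∫ r in (0:ℝ)..t, G r := by
    ext t
    rw [intervalIntegral.integral_interval_sub_left (hi _ _) (hi _ _)]
  rw [e]
  exact (hc.comp (continuous_id.add continuous_const)).sub hc

theorem continuous_dyadicMean {f : ℝ → ℂ} (hf : LocallyIntegrable f) (k : ℕ) : Continuous (dyadicMean f k) :=
  continuous_const.mul (continuous_window_of_locallyIntegrable hf _)

theorem dyadicMean_tendsto {f : ℝ → ℂ} (hf : LocallyIntegrable f) :
    ∀ᵐ t, Tendsto (fun k => dyadicMean f k t) atTop (𝓝 (f t)) := by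
  filter_upwards [LocallyIntegrable.ae_hasDerivAt_integral hf] with t ht
  have h1 := (ht t).tendsto_slope_zero
  have hseq : Tendsto (fun k : ℕ => ((1 : ℝ) / 2) ^ k) atTop (𝓝[≠] 0) := by
    refine tendsto_nhdsWithin_iff.2 ⟨tendsto_pow_atTop_nhds_zero_of_lt_one (by norm_num) (by norm_num), ?_⟩
    exact Eventually.of_forall fun k => by simp
  have h2 := h1.comp hseq
  refine h2.congr fun k => ?_
  simp only [Function.comp_apply, intervalIntegral.integral_same, sub_zero, dyadicMean]
  rw [Complex.real_smul]
  congr 1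
  simp

/-- Halving the averaging interval changes the mean by half the average of the increments at the new
scale, which brings in the Nikolskii seminorm. -/
theorem dyadicMean_succ_sub {f : ℝ → ℂ} (hf : LocallyIntegrable f) (k : ℕ) (t : ℝ) :
    dyadicMean f k t - dyadicMean f (k + 1) t =
      2 ^ k * ∫ r in t..(t + (1 / 2) ^ (k + 1)), tdiff ((1 / 2) ^ (k + 1)) f r := by
  have hi : ∀ x y, IntervalIntegrable f volume x y := fun x y =>
    (hf.integrableOn_isCompact isCompact_uIcc).intervalIntegrable
  set h : ℝ := (1 / 2) ^ (k + 1) with hh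
  have e1 : ((1 : ℝ) / 2) ^ k = h + h := by rw [hh, pow_succ]; ring
  have e2 : ∫ r in t..(t + h), tdiff h f r = (∫ r in (t + h)..(t + h + h), f r) - ∫ r in t..(t + h), f r := by
    unfold tdiff
    rw [intervalIntegral.integral_sub _ (hi _ _), intervalIntegral.integral_comp_add_right (fun r => f r)]
    have := (hi (t + h) (t + h + h)).comp_add_right h
    simpa using this
  have e3 := intervalIntegral.integral_add_adjacent_intervals (hi t (t + h)) (hi (t + h) (t + h + h))
  rw [dyadicMean, dyadicMean, ← hh, e1, e2, ← add_assoc, ← e3, pow_succ]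
  ring

theorem two_pow_enorm (k : ℕ) : ‖(2 : ℂ) ^ k‖ₑ = 2 ^ k := by
  rw [enorm_pow]; congr 1; rw [← ofReal_norm]; simp

theorem ofReal_half_pow (k : ℕ) : ENNReal.ofReal ((1 / 2) ^ k) = (2 ^ k)⁻¹ := by
  rw [one_div, inv_pow, ENNReal.ofReal_inv_of_pos (by positivity), ENNReal.ofReal_pow (by norm_num)]
  simp

/-- At scale `h` the difference of means is bounded by the seminorm in the supremum and by `√h`
times it in `L²`; interpolation gives `h^(1/q)`, a geometric series for every finite `q`. -/
theorem eLpNorm_dyadicMean_succ_sub_le {f : ℝ → ℂ} (hf : Measurable f) (h2 : eLpNorm f 2 volume ≠ ⊤)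
    {q : ℕ} (hq : 2 ≤ q) (k : ℕ) :
    eLpNorm (fun t => dyadicMean f k t - dyadicMean f (k + 1) t) q volume ≤
      nikN f * ((2⁻¹ : ℝ≥0∞) ^ (1 / (q : ℝ))) ^ (k + 1) := by
  have hl := locallyIntegrable_of_eLpNorm_two hf h2
  set h : ℝ := (1 / 2) ^ (k + 1) with hh
  have h0 : 0 < h := by positivity
  have hm := measurable_tdiff hf h
  have hd := eLpNorm_tdiff_le f h0.le
  have hk : (2 : ℝ≥0∞) ^ k * ENNReal.ofReal h ≤ 1 := by
    rw [hh, ofReal_half_pow, pow_succ, ENNReal.mul_inv (by simp) (by simp), ← mul_assoc,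
      ENNReal.mul_inv_cancel (by simp) (by simp), one_mul]
    simp
  have e : ((2⁻¹ : ℝ≥0∞) ^ (1 / (q : ℝ))) ^ (k + 1) = ENNReal.ofReal h ^ (1 / (q : ℝ)) := by
    rw [hh, ofReal_half_pow, ENNReal.inv_pow, ← ENNReal.rpow_natCast, ← ENNReal.rpow_natCast,
      ← ENNReal.rpow_mul, ← ENNReal.rpow_mul, mul_comm]
  have hss : ENNReal.ofReal (√h) * ENNReal.ofReal (√h) = ENNReal.ofReal h := by
    rw [← ENNReal.ofReal_mul (by positivity), Real.mul_self_sqrt h0.le]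
  rw [e]
  refine eLpNorm_interpolate hq (fun t => ?_) ?_
    (((continuous_dyadicMean hl k).sub (continuous_dyadicMean hl (k + 1))).measurable)
  · rw [dyadicMean_succ_sub hl, enorm_mul, two_pow_enorm]
    calc _ ≤ 2 ^ k * (ENNReal.ofReal (√h) * (nikN f * ENNReal.ofReal (√h))) := by
          gcongr
          exact (enorm_window_le hm h0.le t).trans (by gcongr)
      _ = 2 ^ k * ENNReal.ofReal h * nikN f := by rw [← hss]; ring
      _ ≤ 1 * nikN f := by gcongr
      _ = _ := one_mul _
  · rw [← ofReal_sqrt_sq h0.le, ← mul_pow]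
    gcongr
    have e2 : (fun t => dyadicMean f k t - dyadicMean f (k + 1) t) =
        (2 ^ k : ℂ) • fun t => ∫ r in t..(t + h), tdiff h f r := by
      ext t; rw [dyadicMean_succ_sub hl]; rfl
    rw [e2, eLpNorm_const_smul, two_pow_enorm]
    calc _ ≤ 2 ^ k * (ENNReal.ofReal h * (nikN f * ENNReal.ofReal (√h))) := by
          gcongr
          exact (eLpNorm_window_le_length hm h0.le).trans (by gcongr)
      _ = 2 ^ k * ENNReal.ofReal h * (nikN f * ENNReal.ofReal (√h)) := by ring
      _ ≤ 1 * (nikN f * ENNReal.ofReal (√h)) := by gcongr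
      _ = _ := one_mul _

/-- The embedding of the Nikolskii space of order `1/2` into `L^q` for `2 ≤ q < ∞`. -/
theorem eLpNorm_le_zN {q : ℕ} (hq : 2 ≤ q) : ∃ C : ℝ≥0∞, C ≠ ⊤ ∧ ∀ f : ℝ → ℂ, Measurable f →
    eLpNorm f 2 volume ≠ ⊤ → eLpNorm f q volume ≤ C * zN f := by
  set ρ : ℝ≥0∞ := (2⁻¹ : ℝ≥0∞) ^ (1 / (q : ℝ)) with hρ
  have hq0 : (0 : ℝ) < q := by exact_mod_cast (by omega : 0 < q)
  have hρ1 : ρ < 1 := ENNReal.rpow_lt_one (by simp) (by positivity)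
  refine ⟨1 + (1 - ρ)⁻¹, ENNReal.add_ne_top.2 ⟨ENNReal.one_ne_top, ENNReal.inv_ne_top.2 (tsub_pos_of_lt hρ1).ne'⟩, fun f hf h2 => ?_⟩
  have hl := locallyIntegrable_of_eLpNorm_two hf h2
  have hc := continuous_dyadicMean hl
  have h0 : eLpNorm (dyadicMean f 0) q volume ≤ eLpNorm f 2 volume := by
    have := eLpNorm_interpolate (g := dyadicMean f 0) (M := eLpNorm f 2 volume) (e := 1) hq (fun t => ?_) ?_
      (hc 0).measurable
    · simpa using this
    · have := enorm_window_le hf (zero_le_one' ℝ) t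
      simpa [dyadicMean] using this
    · rw [mul_one]
      gcongr
      have := eLpNorm_window_le_length hf (zero_le_one' ℝ)
      have e : dyadicMean f 0 = fun t => ∫ r in t..(t + 1), f r := by ext t; simp [dyadicMean]
      rw [e]
      simpa using this
  have hq1 : (1 : ℝ≥0∞) ≤ q := by exact_mod_cast (by omega : 1 ≤ q)
  have hk : ∀ k, eLpNorm (dyadicMean f k) q volume ≤
      eLpNorm f 2 volume + nikN f * ∑ j ∈ Finset.range k, ρ ^ j := by
    intro k
    induction k with
    | zero => simpa using h0
    | succ k ih =>
      have e : dyadicMean f (k + 1) = dyadicMean f k - fun t => dyadicMean f k t - dyadicMean f (k + 1) t := by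
        ext t; simp
      rw [e]
      refine (eLpNorm_sub_le (hc k).aestronglyMeasurable ((hc k).sub (hc (k + 1))).aestronglyMeasurable hq1).trans ?_
      calc _ ≤ (eLpNorm f 2 volume + nikN f * ∑ j ∈ Finset.range k, ρ ^ j) + nikN f * ρ ^ (k + 1) :=
            add_le_add ih (eLpNorm_dyadicMean_succ_sub_le hf h2 hq k)
        _ ≤ (eLpNorm f 2 volume + nikN f * ∑ j ∈ Finset.range k, ρ ^ j) + nikN f * ρ ^ k := by
            gcongr (_ + _ * ?_)
            exact pow_le_pow_of_le_one zero_le hρ1.le (Nat.le_succ k)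
        _ = _ := by rw [Finset.sum_range_succ]; ring
  have hfin : ∀ k, eLpNorm (dyadicMean f k) q volume ≤ (1 + (1 - ρ)⁻¹) * zN f := by
    intro k
    have hg : ∑ j ∈ Finset.range k, ρ ^ j ≤ (1 - ρ)⁻¹ := by
      rw [← ENNReal.tsum_geometric]; exact ENNReal.sum_le_tsum _
    calc _ ≤ _ := hk k
      _ ≤ eLpNorm f 2 volume + nikN f * (1 - ρ)⁻¹ := by gcongr
      _ ≤ 1 * zN f + (1 - ρ)⁻¹ * zN f := by
          rw [one_mul, mul_comm]
          exact add_le_add le_self_add (mul_le_mul_right le_add_self _)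
      _ = _ := by ring
  -- Lebesgue differentiation gives almost everywhere convergence of the means, and Fatou's lemma
  -- passes their uniform bound to `f`.
  refine (Lp.eLpNorm_lim_le_liminf_eLpNorm (fun k => (hc k).aestronglyMeasurable) f (dyadicMean_tendsto hl)).trans ?_
  exact liminf_le_of_le (by isBoundedDefault) fun b hb => by
    obtain ⟨k, hk⟩ := hb.exists
    exact hk.trans (hfin k)

theorem holderTriple_four : ENNReal.HolderTriple (4 : ℕ) (4 : ℕ) 2 := by
  constructor
  rw [← ENNReal.toReal_eq_toReal_iff' (by simp) (by simp), ENNReal.toReal_add (by simp) (by simp)]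
  norm_num

theorem holderTriple_six : ENNReal.HolderTriple (6 : ℕ) (6 : ℕ) 3 := by
  constructor
  rw [← ENNReal.toReal_eq_toReal_iff' (by simp) (by simp), ENNReal.toReal_add (by simp) (by simp)]
  norm_num

theorem holderTriple_six_three : ENNReal.HolderTriple (6 : ℕ) 3 2 := by
  constructor
  rw [← ENNReal.toReal_eq_toReal_iff' (by simp) (by simp), ENNReal.toReal_add (by simp) (by simp)]
  norm_num

theorem lintegral_enorm_triple_le {u v w : ℝ → ℂ} (hu : Measurable u) (hv : Measurable v) (hw : Measurable w) :
    ∫⁻ t, ‖u t * v t * w t‖ₑ ≤ eLpNorm u 2 volume * (eLpNorm v (4 : ℕ) volume * eLpNorm w (4 : ℕ) volume) := by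
  have := holderTriple_four
  have h1 : eLpNorm (v • w) 2 volume ≤ _ :=
    eLpNorm_smul_le_mul_eLpNorm (p := (4 : ℕ)) (q := (4 : ℕ)) hw.aestronglyMeasurable hv.aestronglyMeasurable
  calc _ = ∫⁻ t, ‖u t‖ₑ * ‖(v • w) t‖ₑ := by
        refine lintegral_congr fun t => ?_
        rw [mul_assoc, enorm_mul]; rfl
    _ ≤ eLpNorm u 2 volume * eLpNorm (v • w) 2 volume := by
        refine (ENNReal.pow_le_pow_left_iff two_ne_zero).1 ?_
        rw [mul_pow, eLpNorm_two_sq, eLpNorm_two_sq]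
        exact lintegral_sq_le (by fun_prop) ((hv.smul hw).enorm.aemeasurable)
    _ ≤ _ := by gcongr

theorem eLpNorm_triple_le {u v w : ℝ → ℂ} (hu : Measurable u) (hv : Measurable v) (hw : Measurable w) :
    eLpNorm (fun t => u t * v t * w t) 2 volume ≤
      eLpNorm u (6 : ℕ) volume * (eLpNorm v (6 : ℕ) volume * eLpNorm w (6 : ℕ) volume) := by
  have := holderTriple_six
  have := holderTriple_six_three
  have h1 : eLpNorm (v • w) 3 volume ≤ _ :=
    eLpNorm_smul_le_mul_eLpNorm (p := (6 : ℕ)) (q := (6 : ℕ)) hw.aestronglyMeasurable hv.aestronglyMeasurable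
  have h2 : eLpNorm (u • (v • w)) 2 volume ≤ _ :=
    eLpNorm_smul_le_mul_eLpNorm (p := (6 : ℕ)) (q := 3) (hv.smul hw).aestronglyMeasurable hu.aestronglyMeasurable
  have e : (fun t => u t * v t * w t) = u • (v • w) := by
    ext t; simp [mul_assoc]
  rw [e]
  exact h2.trans (by gcongr)

theorem eLpNorm_shift {f : ℝ → ℂ} (hf : Measurable f) (q : ℝ≥0∞) (h : ℝ) :
    eLpNorm (fun t => f (t + h)) q volume = eLpNorm f q volume :=
  eLpNorm_comp_measurePreserving hf.aestronglyMeasurable (measurePreserving_add_right volume h)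

/-- The Leibniz rule with one increment in `L²` and the two other factors in `L⁴`. This replaces the
supremum bounds of the algebra property. -/
theorem lintegral_tdiff_triple_le {f g k : ℝ → ℂ} (hf : Measurable f) (hg : Measurable g) (hk : Measurable k)
    {h : ℝ} (hh : 0 ≤ h) :
    ∫⁻ t, ‖tdiff h (fun t => f t * g t * k t) t‖ₑ ≤ ENNReal.ofReal (√h) *
      (nikN f * (eLpNorm g (4 : ℕ) volume * eLpNorm k (4 : ℕ) volume) +
       nikN g * (eLpNorm f (4 : ℕ) volume * eLpNorm k (4 : ℕ) volume) +
       nikN k * (eLpNorm f (4 : ℕ) volume * eLpNorm g (4 : ℕ) volume)) := by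
  have df := measurable_tdiff hf h
  have dg := measurable_tdiff hg h
  have dk := measurable_tdiff hk h
  have e : ∀ t, ‖tdiff h (fun t => f t * g t * k t) t‖ₑ ≤ ‖tdiff h f t * g (t + h) * k (t + h)‖ₑ +
      ‖tdiff h g t * f t * k (t + h)‖ₑ + ‖tdiff h k t * f t * g t‖ₑ := fun t => by
    have : tdiff h (fun t => f t * g t * k t) t = tdiff h f t * g (t + h) * k (t + h) +
        tdiff h g t * f t * k (t + h) + tdiff h k t * f t * g t := by simp only [tdiff]; ring
    rw [this]
    exact (enorm_add_le _ _).trans (add_le_add_left (enorm_add_le _ _) _)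
  have hg' : Measurable fun t => g (t + h) := by fun_prop
  have hk' : Measurable fun t => k (t + h) := by fun_prop
  calc _ ≤ _ := lintegral_mono e
    _ = (∫⁻ t, ‖tdiff h f t * g (t + h) * k (t + h)‖ₑ) + (∫⁻ t, ‖tdiff h g t * f t * k (t + h)‖ₑ) +
        ∫⁻ t, ‖tdiff h k t * f t * g t‖ₑ := by
        rw [lintegral_add_left (by fun_prop), lintegral_add_left (by fun_prop)]
    _ ≤ (nikN f * ENNReal.ofReal (√h)) * (eLpNorm g (4 : ℕ) volume * eLpNorm k (4 : ℕ) volume) +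
        (nikN g * ENNReal.ofReal (√h)) * (eLpNorm f (4 : ℕ) volume * eLpNorm k (4 : ℕ) volume) +
        (nikN k * ENNReal.ofReal (√h)) * (eLpNorm f (4 : ℕ) volume * eLpNorm g (4 : ℕ) volume) := by
        refine add_le_add (add_le_add ?_ ?_) ?_
        · refine (lintegral_enorm_triple_le df hg' hk').trans ?_
          rw [eLpNorm_shift hg, eLpNorm_shift hk]
          gcongr; exact eLpNorm_tdiff_le f hh
        · refine (lintegral_enorm_triple_le dg hf hk').trans ?_
          rw [eLpNorm_shift hk]
          gcongr; exact eLpNorm_tdiff_le g hh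
        · refine (lintegral_enorm_triple_le dk hf hg).trans ?_
          gcongr; exact eLpNorm_tdiff_le k hh
    _ = _ := by ring

/-- The sup-norm bound for the oscillatory primitive of a product of three functions that are not
assumed to be bounded. -/
theorem supN_primitive_oscInt_triple_le : ∃ C : ℝ≥0∞, C ≠ ⊤ ∧ ∀ (a b : ℝ), a ≤ b → b - a ≤ 2 →
    ∀ (c : ℝ) (N : ℤ) (f g k : ℝ → ℂ), Measurable f → Measurable g → Measurable k →
    zN f ≠ ⊤ → zN g ≠ ⊤ → zN k ≠ ⊤ →
    eLpNorm (oscInt a b N fun t => f t * g t * k t) 2 volume ≠ ⊤ ∧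
    supN (fun t => ∫ r in c..t, oscInt a b N (fun t => f t * g t * k t) r) ≤
      C * (ENNReal.ofReal (gain N) * (zN f * zN g * zN k)) := by
  obtain ⟨C4, hC4, h4⟩ := eLpNorm_le_zN (q := 4) (by norm_num)
  obtain ⟨C6, hC6, h6⟩ := eLpNorm_le_zN (q := 6) (by norm_num)
  refine ⟨6 * C4 ^ 2 + 10 * C6 ^ 3, by finiteness, fun a b hab hL c N f g k hf hg hk zf zg zk => ?_⟩
  have e2 : ∀ {f}, zN f ≠ ⊤ → eLpNorm f 2 volume ≠ ⊤ := fun h => ne_top_of_le_ne_top h le_self_add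
  set F := fun t => f t * g t * k t with hFdef
  have hF : Measurable F := by fun_prop
  -- The boundary layers require the product in `L²`, hence its three factors in `L⁶`.
  have hF2 : eLpNorm F 2 volume ≤ C6 ^ 3 * (zN f * zN g * zN k) := by
    refine (eLpNorm_triple_le hf hg hk).trans ?_
    calc _ ≤ (C6 * zN f) * ((C6 * zN g) * (C6 * zN k)) :=
          mul_le_mul' (h6 f hf (e2 zf)) (mul_le_mul' (h6 g hg (e2 zg)) (h6 k hk (e2 zk)))
      _ = _ := by ring
  have hG : eLpNorm (oscInt a b N F) 2 volume ≤ C6 ^ 3 * (zN f * zN g * zN k) :=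
    (eLpNorm_mono_enorm fun t => enorm_oscInt_le _ _ _ _ _).trans hF2
  have hGt : eLpNorm (oscInt a b N F) 2 volume ≠ ⊤ := ne_top_of_le_ne_top (by finiteness) hG
  refine ⟨hGt, ?_⟩
  have hm := measurable_oscInt hF a b N
  set Z := zN f * zN g * zN k with hZ
  by_cases hN : N = 0
  · subst hN
    rw [gain_zero, ENNReal.ofReal_one, one_mul]
    refine supN_primitive_le (fun t h hh => ?_) c
    refine (enorm_intervalIntegral_le hh).trans ?_
    have e : ∫⁻ r in Set.Ioc t (t + h), ‖oscInt a b (0 : ℤ) F r‖ₑ ≤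
        ∫⁻ r in Set.Icc a b, ‖oscInt a b (0 : ℤ) F r‖ₑ := by
      refine (setLIntegral_le_lintegral _ _).trans ?_
      rw [← lintegral_indicator measurableSet_Icc]
      refine lintegral_mono fun r => ?_
      by_cases hr : r ∈ Set.Icc a b
      · rw [Set.indicator_of_mem hr]
      · rw [Set.indicator_of_notMem hr, enorm_oscInt, Set.indicator_of_notMem hr]
    refine e.trans ((setLIntegral_le_sqrt_mul hm.stronglyMeasurable (v := 2) (by norm_num)
      (by rw [Real.volume_Icc]; exact ENNReal.ofReal_le_ofReal hL)).trans ?_)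
    calc _ ≤ 2 * (C6 ^ 3 * Z) := by
          refine mul_le_mul' ?_ hG
          rw [← ENNReal.ofReal_ofNat 2]
          apply ENNReal.ofReal_le_ofReal
          rw [Real.sqrt_le_left (by norm_num)]; norm_num
      _ = 0 + 2 * C6 ^ 3 * Z := by ring
      _ ≤ 6 * C4 ^ 2 * Z + 10 * C6 ^ 3 * Z := by gcongr <;> norm_num
      _ = _ := by ring
  · have hφ : (N : ℝ) ≠ 0 := by exact_mod_cast hN
    have hδ0 : 0 < Real.pi / |(N : ℝ)| := div_pos Real.pi_pos (abs_pos.2 hφ)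
    have hgain := sqrt_pi_div_le_gain hN
    refine supN_primitive_le (fun t h hh => ?_) c
    refine (enorm_integral_oscInt_le hφ hF hGt hh t).trans ?_
    set δ := Real.pi / |(N : ℝ)| with hδ
    set d := ENNReal.ofReal (√δ) with hd
    have nz : ∀ f, nikN f ≤ zN f := fun f => le_add_self
    calc _ ≤ d * (zN f * ((C4 * zN g) * (C4 * zN k)) + zN g * ((C4 * zN f) * (C4 * zN k)) +
          zN k * ((C4 * zN f) * (C4 * zN g))) + 5 * (d * (C6 ^ 3 * Z)) := by
          refine add_le_add ((setLIntegral_le_lintegral _ _).trans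
            ((lintegral_tdiff_triple_le hf hg hk hδ0.le).trans ?_)) (by gcongr)
          have a1 := h4 f hf (e2 zf)
          have a2 := h4 g hg (e2 zg)
          have a3 := h4 k hk (e2 zk)
          gcongr <;> exact nz _
      _ = d * ((3 * C4 ^ 2 + 5 * C6 ^ 3) * Z) := by rw [hZ]; ring
      _ ≤ (2 * ENNReal.ofReal (gain N)) * ((3 * C4 ^ 2 + 5 * C6 ^ 3) * Z) := by gcongr
      _ = _ := by ring

/-! ### Limits and series in the weighted sequence space. -/

/-- Fatou's property: a bound on every finite partial sum survives modewise limits. -/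
theorem seqN_le_of_tendsto {s p : ℝ} (hp : 1 ≤ p) {y : ℕ → ℤ → ℝ≥0∞} {x : ℤ → ℝ≥0∞} {C : ℝ≥0∞}
    (hlim : ∀ n, Tendsto (fun j => y j n) atTop (𝓝 (x n))) (hC : ∀ j, seqN s p (y j) ≤ C) :
    seqN s p x ≤ C := by
  have hp0 : 0 < p := by linarith
  rw [← ENNReal.rpow_le_rpow_iff hp0, seqN_rpow hp]
  refine ENNReal.summable.tsum_le_of_sum_le fun S => ?_
  refine le_of_tendsto' (x := atTop) (f := fun j : ℕ => ∑ n ∈ S, (ENNReal.ofReal (jb (n : ℤ) ^ s) * y j n) ^ p) ?_ fun j => ?_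
  · refine tendsto_finsetSum _ fun n _ => ?_
    exact ((ENNReal.continuous_rpow_const).tendsto _).comp
      (ENNReal.Tendsto.const_mul (hlim n) (Or.inr ENNReal.ofReal_ne_top))
  · calc _ ≤ ∑' n : ℤ, (ENNReal.ofReal (jb n ^ s) * y j n) ^ p := ENNReal.sum_le_tsum S
      _ = seqN s p (y j) ^ p := (seqN_rpow hp _).symm
      _ ≤ C ^ p := ENNReal.rpow_le_rpow (hC j) hp0.le

theorem seqN_zero {s p : ℝ} (hp : 1 ≤ p) : seqN s p (fun _ => 0) = 0 := by
  simpa using seqN_const_mul (s := s) hp 0 (fun _ => 0)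

theorem seqN_sum_le {s p : ℝ} (hp : 1 ≤ p) (y : ℕ → ℤ → ℝ≥0∞) (J : ℕ) :
    seqN s p (fun n => ∑ j ∈ Finset.range J, y j n) ≤ ∑ j ∈ Finset.range J, seqN s p (y j) := by
  induction J with
  | zero => simp [seqN_zero hp]
  | succ J ih =>
    simp only [Finset.sum_range_succ]
    exact (seqN_add_le hp _ _).trans (by gcongr)

theorem seqN_tsum_le {s p : ℝ} (hp : 1 ≤ p) (y : ℕ → ℤ → ℝ≥0∞) :
    seqN s p (fun n => ∑' j, y j n) ≤ ∑' j, seqN s p (y j) :=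
  seqN_le_of_tendsto hp (fun n => (ENNReal.summable (f := fun j => y j n)).hasSum.tendsto_sum_nat)
    fun J => (seqN_sum_le hp y J).trans (ENNReal.sum_le_tsum _)

/-- The family `X` is left abstract because the estimate is applied to three different norms of a
single oscillatory term: `yN`, `slobN` and `supN`. -/
theorem seqN_trilinear_le {s p : ℝ} (h : Admissible s p) : ∃ K : ℝ≥0∞, K ≠ ⊤ ∧
    ∀ (C : ℝ≥0∞) (x y z : ℤ → ℝ≥0∞) (X : ℤ → ℤ × ℤ → ℝ≥0∞),
      (∀ n v, X n v ≤ C * (ENNReal.ofReal (gain (phase n v.1 v.2)) * (x v.1 * y v.2 * z (n - v.1 - v.2)))) →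
      seqN s p (fun n => ∑' v : ℤ × ℤ, ‖(triCoeff n v.1 v.2 : ℂ)‖ₑ * X n v) ≤
        C * (K * (seqN s p x * seqN s p y * seqN s p z)) := by
  obtain ⟨K, hK, hb⟩ := seqN_trilinear h
  refine ⟨K, hK, fun C x y z X hX => ?_⟩
  refine le_trans ?_ (mul_le_mul' le_rfl (hb x y z))
  rw [← seqN_const_mul h.one_le]
  refine seqN_mono h.one_le fun n => ?_
  rw [← ENNReal.tsum_mul_left]
  refine ENNReal.tsum_le_tsum fun v => ?_
  have e : ‖(triCoeff n v.1 v.2 : ℂ)‖ₑ = ENNReal.ofReal |triCoeff n v.1 v.2| := by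
    rw [← ofReal_norm, Complex.norm_real, Real.norm_eq_abs]
  rw [e, ENNReal.ofReal_mul (abs_nonneg _)]
  calc _ ≤ _ := mul_le_mul' le_rfl (hX n v)
    _ = _ := by
      change _ = C * (_ * ENNReal.ofReal (gain (phase n v.1 v.2)) * _)
      ring

/-! ### The trilinear Duhamel operator on profiles. -/

/-- The norm of `ℓ^p_n`-valued profiles `w = (w_n(t))`. -/
def profN (s p : ℝ) (w : ℤ → ℝ → ℂ) : ℝ≥0∞ := seqN s p fun n => yN (w n)

theorem yN_ne_top_of_profN {s p : ℝ} (h : Admissible s p) {w : ℤ → ℝ → ℂ} (hw : profN s p w ≠ ⊤) (n : ℤ) :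
    yN (w n) ≠ ⊤ :=
  ne_top_of_le_ne_top hw (le_seqN h.one_le (by linarith [h.half_le]) (fun n => yN (w n)) n)

theorem enorm_le_profN {s p : ℝ} (h : Admissible s p) (w : ℤ → ℝ → ℂ) (n : ℤ) (t : ℝ) :
    ‖w n t‖ₑ ≤ profN s p w :=
  (le_supN _ t).trans ((supN_le_yN _).trans
    (le_seqN h.one_le (by linarith [h.half_le]) (fun n => yN (w n)) n))

/-- One term of the trilinear Duhamel operator. -/
def triTerm (a b c : ℝ) (w₁ w₂ w₃ : ℤ → ℝ → ℂ) (n : ℤ) (v : ℤ × ℤ) (t : ℝ) : ℂ :=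
  ∫ r in c..t, oscInt a b (phase n v.1 v.2 : ℤ)
    (fun t => w₁ v.1 t * w₂ v.2 t * w₃ (n - v.1 - v.2) t) r

def triOp (a b c : ℝ) (w₁ w₂ w₃ : ℤ → ℝ → ℂ) (n : ℤ) (t : ℝ) : ℂ :=
  ∑' v : ℤ × ℤ, (triCoeff n v.1 v.2 : ℂ) * triTerm a b c w₁ w₂ w₃ n v t

theorem yN_triple_le {f g k : ℝ → ℂ} (hf : Measurable f) (hg : Measurable g) (hk : Measurable k) :
    yN (fun t => f t * g t * k t) ≤ yN f * yN g * yN k :=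
  (yN_mul_le (hf.mul hg) hk).trans (mul_le_mul' (yN_mul_le hf hg) le_rfl)

theorem integrable_oscInt_of_yN {a b φ : ℝ} (hab : a ≤ b) {F : ℝ → ℂ} (hF : Measurable F) (h : yN F ≠ ⊤) :
    Integrable (oscInt a b φ F) :=
  integrable_oscInt hF (eLpNorm_oscInt_ne_top hab (ne_top_of_le_ne_top h (supN_le_yN F)))

section bounds

variable {s p a b c : ℝ} {w₁ w₂ w₃ : ℤ → ℝ → ℂ}

theorem yN_triple_ne_top (h : Admissible s p)
    (m₁ : ∀ n, Measurable (w₁ n)) (m₂ : ∀ n, Measurable (w₂ n)) (m₃ : ∀ n, Measurable (w₃ n))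
    (f₁ : profN s p w₁ ≠ ⊤) (f₂ : profN s p w₂ ≠ ⊤) (f₃ : profN s p w₃ ≠ ⊤) (i j k : ℤ) :
    yN (fun t => w₁ i t * w₂ j t * w₃ k t) ≠ ⊤ :=
  ne_top_of_le_ne_top (ENNReal.mul_ne_top (ENNReal.mul_ne_top (yN_ne_top_of_profN h f₁ i)
    (yN_ne_top_of_profN h f₂ j)) (yN_ne_top_of_profN h f₃ k)) (yN_triple_le (m₁ i) (m₂ j) (m₃ k))

theorem integrable_triTerm (h : Admissible s p) (hab : a ≤ b)
    (m₁ : ∀ n, Measurable (w₁ n)) (m₂ : ∀ n, Measurable (w₂ n)) (m₃ : ∀ n, Measurable (w₃ n))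
    (f₁ : profN s p w₁ ≠ ⊤) (f₂ : profN s p w₂ ≠ ⊤) (f₃ : profN s p w₃ ≠ ⊤) (φ : ℝ) (i j k : ℤ) :
    Integrable (oscInt a b φ fun t => w₁ i t * w₂ j t * w₃ k t) :=
  integrable_oscInt_of_yN hab (((m₁ i).mul (m₂ j)).mul (m₃ k)) (yN_triple_ne_top h m₁ m₂ m₃ f₁ f₂ f₃ i j k)

theorem continuous_triTerm (h : Admissible s p) (hab : a ≤ b)
    (m₁ : ∀ n, Measurable (w₁ n)) (m₂ : ∀ n, Measurable (w₂ n)) (m₃ : ∀ n, Measurable (w₃ n))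
    (f₁ : profN s p w₁ ≠ ⊤) (f₂ : profN s p w₂ ≠ ⊤) (f₃ : profN s p w₃ ≠ ⊤) (n : ℤ) (v : ℤ × ℤ) :
    Continuous (triTerm a b c w₁ w₂ w₃ n v) :=
  intervalIntegral.continuous_primitive
    (fun _ _ => (integrable_triTerm h hab m₁ m₂ m₃ f₁ f₂ f₃ _ _ _ _).intervalIntegrable) c

theorem yN_triTerm_le (h : Admissible s p) (hab : a ≤ b) (hL : b - a ≤ 2)
    (m₁ : ∀ n, Measurable (w₁ n)) (m₂ : ∀ n, Measurable (w₂ n)) (m₃ : ∀ n, Measurable (w₃ n))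
    (f₁ : profN s p w₁ ≠ ⊤) (f₂ : profN s p w₂ ≠ ⊤) (f₃ : profN s p w₃ ≠ ⊤) (n : ℤ) (v : ℤ × ℤ) :
    yN (triTerm a b c w₁ w₂ w₃ n v) ≤ (24 * ENNReal.ofReal (√(b - a))) *
      (ENNReal.ofReal (gain (phase n v.1 v.2)) * (yN (w₁ v.1) * yN (w₂ v.2) * yN (w₃ (n - v.1 - v.2)))) := by
  refine (yN_primitive_oscInt_le hab hL c _ (((m₁ _).mul (m₂ _)).mul (m₃ _))
    (yN_triple_ne_top h m₁ m₂ m₃ f₁ f₂ f₃ _ _ _)).trans ?_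
  rw [← mul_assoc]
  gcongr
  exact yN_triple_le (m₁ _) (m₂ _) (m₃ _)

theorem slobN_triTerm_le (h : Admissible s p) (hab : a ≤ b) (hL : b - a ≤ 2)
    (m₁ : ∀ n, Measurable (w₁ n)) (m₂ : ∀ n, Measurable (w₂ n)) (m₃ : ∀ n, Measurable (w₃ n))
    (f₁ : profN s p w₁ ≠ ⊤) (f₂ : profN s p w₂ ≠ ⊤) (f₃ : profN s p w₃ ≠ ⊤) (n : ℤ) (v : ℤ × ℤ) :
    slobN (triTerm a b c w₁ w₂ w₃ n v) ≤ 20 *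
      (ENNReal.ofReal (gain (phase n v.1 v.2)) * (yN (w₁ v.1) * yN (w₂ v.2) * yN (w₃ (n - v.1 - v.2)))) := by
  refine (slobN_primitive_oscInt_le hab hL c _ (((m₁ _).mul (m₂ _)).mul (m₃ _))
    (yN_triple_ne_top h m₁ m₂ m₃ f₁ f₂ f₃ _ _ _)).trans ?_
  gcongr
  exact yN_triple_le (m₁ _) (m₂ _) (m₃ _)

theorem seqN_triTerm_le (h : Admissible s p) : ∃ K : ℝ≥0∞, K ≠ ⊤ ∧ ∀ {a b c : ℝ} {w₁ w₂ w₃ : ℤ → ℝ → ℂ},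
    a ≤ b → b - a ≤ 2 → (∀ n, Measurable (w₁ n)) → (∀ n, Measurable (w₂ n)) → (∀ n, Measurable (w₃ n)) →
    profN s p w₁ ≠ ⊤ → profN s p w₂ ≠ ⊤ → profN s p w₃ ≠ ⊤ →
    seqN s p (fun n => ∑' v : ℤ × ℤ, ‖(triCoeff n v.1 v.2 : ℂ)‖ₑ * yN (triTerm a b c w₁ w₂ w₃ n v)) ≤
      K * ENNReal.ofReal (√(b - a)) * (profN s p w₁ * profN s p w₂ * profN s p w₃) ∧
    seqN s p (fun n => ∑' v : ℤ × ℤ, ‖(triCoeff n v.1 v.2 : ℂ)‖ₑ * slobN (triTerm a b c w₁ w₂ w₃ n v)) ≤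
      K * (profN s p w₁ * profN s p w₂ * profN s p w₃) := by
  obtain ⟨K, hK, hb⟩ := seqN_trilinear_le h
  refine ⟨24 * K, ENNReal.mul_ne_top (by norm_num) hK, fun hab hL m₁ m₂ m₃ f₁ f₂ f₃ => ⟨?_, ?_⟩⟩
  · refine (hb _ (fun n => yN _) (fun n => yN _) (fun n => yN _) _
      (yN_triTerm_le h hab hL m₁ m₂ m₃ f₁ f₂ f₃)).trans (le_of_eq ?_)
    simp only [profN]; ring
  · refine (hb _ (fun n => yN _) (fun n => yN _) (fun n => yN _) _
      (slobN_triTerm_le h hab hL m₁ m₂ m₃ f₁ f₂ f₃)).trans ?_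
    simp only [profN]
    rw [← mul_assoc]
    gcongr
    norm_num

theorem tsum_triTerm_ne_top (h : Admissible s p) (hab : a ≤ b) (hL : b - a ≤ 2)
    (m₁ : ∀ n, Measurable (w₁ n)) (m₂ : ∀ n, Measurable (w₂ n)) (m₃ : ∀ n, Measurable (w₃ n))
    (f₁ : profN s p w₁ ≠ ⊤) (f₂ : profN s p w₂ ≠ ⊤) (f₃ : profN s p w₃ ≠ ⊤) (n : ℤ) :
    ∑' v : ℤ × ℤ, ‖(triCoeff n v.1 v.2 : ℂ)‖ₑ * yN (triTerm a b c w₁ w₂ w₃ n v) ≠ ⊤ := by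
  obtain ⟨K, hK, hb⟩ := seqN_triTerm_le h
  refine ne_top_of_le_ne_top ?_ ((le_seqN h.one_le (by linarith [h.half_le]) (fun n => ∑' v : ℤ × ℤ, _) n).trans
    (hb (c := c) hab hL m₁ m₂ m₃ f₁ f₂ f₃).1)
  exact ENNReal.mul_ne_top (ENNReal.mul_ne_top hK ENNReal.ofReal_ne_top)
    (ENNReal.mul_ne_top (ENNReal.mul_ne_top f₁ f₂) f₃)

theorem summable_of_tsum_enorm_ne_top {ι : Type*} {f : ι → ℂ} (h : ∑' i, ‖f i‖ₑ ≠ ⊤) : Summable f := by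
  refine Summable.of_norm ?_
  have := ENNReal.summable_toReal h
  simpa using this

theorem enorm_triCoeff_mul_le (n : ℤ) (v : ℤ × ℤ) (t : ℝ) :
    ‖(triCoeff n v.1 v.2 : ℂ) * triTerm a b c w₁ w₂ w₃ n v t‖ₑ ≤
      ‖(triCoeff n v.1 v.2 : ℂ)‖ₑ * yN (triTerm a b c w₁ w₂ w₃ n v) := by
  rw [enorm_mul]
  exact mul_le_mul' le_rfl ((le_supN _ t).trans (supN_le_yN _))

theorem hasSum_triOp (h : Admissible s p) (hab : a ≤ b) (hL : b - a ≤ 2)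
    (m₁ : ∀ n, Measurable (w₁ n)) (m₂ : ∀ n, Measurable (w₂ n)) (m₃ : ∀ n, Measurable (w₃ n))
    (f₁ : profN s p w₁ ≠ ⊤) (f₂ : profN s p w₂ ≠ ⊤) (f₃ : profN s p w₃ ≠ ⊤) (n : ℤ) (t : ℝ) :
    HasSum (fun v : ℤ × ℤ => (triCoeff n v.1 v.2 : ℂ) * triTerm a b c w₁ w₂ w₃ n v t)
      (triOp a b c w₁ w₂ w₃ n t) :=
  (summable_of_tsum_enorm_ne_top (ne_top_of_le_ne_top (tsum_triTerm_ne_top h hab hL m₁ m₂ m₃ f₁ f₂ f₃ n)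
    (ENNReal.tsum_le_tsum fun v => enorm_triCoeff_mul_le n v t))).hasSum

theorem continuous_triOp (h : Admissible s p) (hab : a ≤ b) (hL : b - a ≤ 2)
    (m₁ : ∀ n, Measurable (w₁ n)) (m₂ : ∀ n, Measurable (w₂ n)) (m₃ : ∀ n, Measurable (w₃ n))
    (f₁ : profN s p w₁ ≠ ⊤) (f₂ : profN s p w₂ ≠ ⊤) (f₃ : profN s p w₃ ≠ ⊤) (n : ℤ) :
    Continuous (triOp a b c w₁ w₂ w₃ n) := by
  have hfin := tsum_triTerm_ne_top (c := c) h hab hL m₁ m₂ m₃ f₁ f₂ f₃ n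
  refine continuous_tsum
    (fun v => (continuous_triTerm h hab m₁ m₂ m₃ f₁ f₂ f₃ n v).const_mul _) (ENNReal.summable_toReal hfin) ?_
  intro v t
  rw [← toReal_enorm]
  exact ENNReal.toReal_mono (ENNReal.ne_top_of_tsum_ne_top hfin v) (enorm_triCoeff_mul_le n v t)

theorem yN_triOp_le (h : Admissible s p) (hab : a ≤ b) (hL : b - a ≤ 2)
    (m₁ : ∀ n, Measurable (w₁ n)) (m₂ : ∀ n, Measurable (w₂ n)) (m₃ : ∀ n, Measurable (w₃ n))
    (f₁ : profN s p w₁ ≠ ⊤) (f₂ : profN s p w₂ ≠ ⊤) (f₃ : profN s p w₃ ≠ ⊤) (n : ℤ) :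
    yN (triOp a b c w₁ w₂ w₃ n) ≤
      ∑' v : ℤ × ℤ, ‖(triCoeff n v.1 v.2 : ℂ)‖ₑ * yN (triTerm a b c w₁ w₂ w₃ n v) :=
  (yN_tsum_le (fun v => ((continuous_triTerm h hab m₁ m₂ m₃ f₁ f₂ f₃ n v).const_mul _).measurable)
    (hasSum_triOp h hab hL m₁ m₂ m₃ f₁ f₂ f₃ n)).trans
    (ENNReal.tsum_le_tsum fun _ => yN_const_mul_le _ _)

theorem slobN_triOp_le (h : Admissible s p) (hab : a ≤ b) (hL : b - a ≤ 2)
    (m₁ : ∀ n, Measurable (w₁ n)) (m₂ : ∀ n, Measurable (w₂ n)) (m₃ : ∀ n, Measurable (w₃ n))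
    (f₁ : profN s p w₁ ≠ ⊤) (f₂ : profN s p w₂ ≠ ⊤) (f₃ : profN s p w₃ ≠ ⊤) (n : ℤ) :
    slobN (triOp a b c w₁ w₂ w₃ n) ≤
      ∑' v : ℤ × ℤ, ‖(triCoeff n v.1 v.2 : ℂ)‖ₑ * slobN (triTerm a b c w₁ w₂ w₃ n v) :=
  (slobN_tsum_le (fun v => ((continuous_triTerm h hab m₁ m₂ m₃ f₁ f₂ f₃ n v).const_mul _).measurable)
    (hasSum_triOp h hab hL m₁ m₂ m₃ f₁ f₂ f₃ n)).trans
    (ENNReal.tsum_le_tsum fun _ => (slobN_const_mul _ _).le)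

/-- The first bound carries the small factor that makes the Duhamel map a contraction. The second
only has to be finite: it is used once, to place the solution in `X^{s,1/2}_{p,2}`. -/
theorem profN_triOp_le (h : Admissible s p) : ∃ K : ℝ≥0∞, K ≠ ⊤ ∧ ∀ {a b c : ℝ} {w₁ w₂ w₃ : ℤ → ℝ → ℂ},
    a ≤ b → b - a ≤ 2 → (∀ n, Measurable (w₁ n)) → (∀ n, Measurable (w₂ n)) → (∀ n, Measurable (w₃ n)) →
    profN s p w₁ ≠ ⊤ → profN s p w₂ ≠ ⊤ → profN s p w₃ ≠ ⊤ →
    profN s p (triOp a b c w₁ w₂ w₃) ≤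
      K * ENNReal.ofReal (√(b - a)) * (profN s p w₁ * profN s p w₂ * profN s p w₃) ∧
    seqN s p (fun n => slobN (triOp a b c w₁ w₂ w₃ n)) ≤
      K * (profN s p w₁ * profN s p w₂ * profN s p w₃) := by
  obtain ⟨K, hK, hb⟩ := seqN_triTerm_le h
  refine ⟨K, hK, fun hab hL m₁ m₂ m₃ f₁ f₂ f₃ => ⟨?_, ?_⟩⟩
  · exact (seqN_mono h.one_le (yN_triOp_le h hab hL m₁ m₂ m₃ f₁ f₂ f₃)).trans
      (hb hab hL m₁ m₂ m₃ f₁ f₂ f₃).1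
  · exact (seqN_mono h.one_le (slobN_triOp_le h hab hL m₁ m₂ m₃ f₁ f₂ f₃)).trans
      (hb hab hL m₁ m₂ m₃ f₁ f₂ f₃).2

end bounds

theorem profN_add_le {s p : ℝ} (hp : 1 ≤ p) {w z : ℤ → ℝ → ℂ}
    (hw : ∀ n, Measurable (w n)) (hz : ∀ n, Measurable (z n)) :
    profN s p (fun n t => w n t + z n t) ≤ profN s p w + profN s p z :=
  (seqN_mono hp fun n => yN_add_le (hw n) (hz n)).trans (seqN_add_le hp _ _)

theorem profN_const_mul_le {s p : ℝ} (hp : 1 ≤ p) (c : ℂ) (w : ℤ → ℝ → ℂ) :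
    profN s p (fun n t => c * w n t) ≤ ‖c‖ₑ * profN s p w :=
  (seqN_mono hp fun n => yN_const_mul_le c (w n)).trans (seqN_const_mul hp _ _).le

theorem profN_sub_le {s p : ℝ} (hp : 1 ≤ p) {w z : ℤ → ℝ → ℂ}
    (hw : ∀ n, Measurable (w n)) (hz : ∀ n, Measurable (z n)) :
    profN s p (fun n t => w n t - z n t) ≤ profN s p w + profN s p z := by
  have h1 : profN s p (fun n t => -z n t) = profN s p z := by
    unfold profN; simp_rw [yN_neg (z _)]
  have := profN_add_le (s := s) hp hw (fun n => (hz n).neg)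
  simp only [sub_eq_add_neg]
  exact this.trans_eq (congrArg _ h1)

/-- Telescoping of a trilinear form, legitimate term by term because all the sums converge
absolutely and all the integrands are integrable. -/
theorem triOp_sub {s p a b : ℝ} (h : Admissible s p) (hab : a ≤ b) (hL : b - a ≤ 2) (c : ℝ)
    {w z : ℤ → ℝ → ℂ} (hw : ∀ n, Measurable (w n)) (hz : ∀ n, Measurable (z n))
    (fw : profN s p w ≠ ⊤) (fz : profN s p z ≠ ⊤) (n : ℤ) (t : ℝ) :
    triOp a b c w w w n t - triOp a b c z z z n t =
      triOp a b c (fun n t => w n t - z n t) w w n t + triOp a b c z (fun n t => w n t - z n t) w n t +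
        triOp a b c z z (fun n t => w n t - z n t) n t := by
  have hd : ∀ n, Measurable fun t => w n t - z n t := fun n => (hw n).sub (hz n)
  have fd : profN s p (fun n t => w n t - z n t) ≠ ⊤ :=
    ne_top_of_le_ne_top (ENNReal.add_ne_top.2 ⟨fw, fz⟩) (profN_sub_le h.one_le hw hz)
  refine ((hasSum_triOp h hab hL hw hw hw fw fw fw n t).sub
    (hasSum_triOp h hab hL hz hz hz fz fz fz n t)).unique ?_
  convert ((hasSum_triOp h hab hL hd hw hw fd fw fw n t).add
    (hasSum_triOp h hab hL hz hd hw fz fd fw n t)).add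
    (hasSum_triOp h hab hL hz hz hd fz fz fd n t) using 2 with v
  · rfl
  rw [← mul_sub, ← mul_add, ← mul_add]
  congr 1
  unfold triTerm
  have I := fun {w₁ w₂ w₃ : ℤ → ℝ → ℂ} m₁ m₂ m₃ f₁ f₂ f₃ φ i j k =>
    (integrable_triTerm (w₁ := w₁) (w₂ := w₂) (w₃ := w₃) h hab m₁ m₂ m₃ f₁ f₂ f₃ φ i j k).intervalIntegrable
      (a := c) (b := t)
  rw [← intervalIntegral.integral_sub (I hw hw hw fw fw fw _ _ _ _) (I hz hz hz fz fz fz _ _ _ _),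
    ← intervalIntegral.integral_add (I hd hw hw fd fw fw _ _ _ _) (I hz hd hw fz fd fw _ _ _ _),
    ← intervalIntegral.integral_add ((I hd hw hw fd fw fw _ _ _ _).add (I hz hd hw fz fd fw _ _ _ _))
      (I hz hz hd fz fz fd _ _ _ _)]
  congr 1
  ext r
  simp only [oscInt, Set.indicator]
  split_ifs
  · ring
  · ring

theorem profN_triOp_sub_le {s p : ℝ} (h : Admissible s p) : ∃ K : ℝ≥0∞, K ≠ ⊤ ∧
    ∀ {a b c : ℝ} {w z : ℤ → ℝ → ℂ} {R : ℝ≥0∞}, a ≤ b → b - a ≤ 2 → R ≠ ⊤ →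
    (∀ n, Measurable (w n)) → (∀ n, Measurable (z n)) → profN s p w ≤ R → profN s p z ≤ R →
    profN s p (fun n t => triOp a b c w w w n t - triOp a b c z z z n t) ≤
      K * ENNReal.ofReal (√(b - a)) * R ^ 2 * profN s p (fun n t => w n t - z n t) := by
  obtain ⟨K, hK, hb⟩ := profN_triOp_le h
  refine ⟨3 * K, ENNReal.mul_ne_top (by norm_num) hK, ?_⟩
  intro a b c w z R hab hL hR hw hz hwR hzR
  have fw := ne_top_of_le_ne_top hR hwR
  have fz := ne_top_of_le_ne_top hR hzR
  have hd : ∀ n, Measurable fun t => w n t - z n t := fun n => (hw n).sub (hz n)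
  have fd : profN s p (fun n t => w n t - z n t) ≠ ⊤ :=
    ne_top_of_le_ne_top (ENNReal.add_ne_top.2 ⟨fw, fz⟩) (profN_sub_le h.one_le hw hz)
  simp_rw [triOp_sub h hab hL c hw hz fw fz]
  have M1 := fun n => (continuous_triOp (c := c) h hab hL hd hw hw fd fw fw n).measurable
  have M2 := fun n => (continuous_triOp (c := c) h hab hL hz hd hw fz fd fw n).measurable
  have M3 := fun n => (continuous_triOp (c := c) h hab hL hz hz hd fz fz fd n).measurable
  refine (profN_add_le h.one_le (fun n => (M1 n).add (M2 n)) M3).trans ?_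
  refine (add_le_add (profN_add_le h.one_le M1 M2) le_rfl).trans ?_
  refine (add_le_add (add_le_add (hb hab hL hd hw hw fd fw fw).1 (hb hab hL hz hd hw fz fd fw).1)
    (hb hab hL hz hz hd fz fz fd).1).trans ?_
  set d := profN s p (fun n t => w n t - z n t)
  calc _ ≤ K * ENNReal.ofReal (√(b - a)) * (d * R * R) + K * ENNReal.ofReal (√(b - a)) * (R * d * R) +
        K * ENNReal.ofReal (√(b - a)) * (R * R * d) := by gcongr
    _ = _ := by ring

/-! ### The fixed point of the Duhamel map. -/

/-- The right-hand side of the integral equation in the interaction representation. -/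
def duhamel (σ a b c : ℝ) (w₀ : ℤ → ℂ) (w : ℤ → ℝ → ℂ) (n : ℤ) (t : ℝ) : ℂ :=
  w₀ n + Complex.I * σ * triOp a b c w w w n t

theorem triOp_zero (a b c : ℝ) : triOp a b c 0 0 0 = 0 := by
  ext n t
  simp only [triOp, triTerm, Pi.zero_apply, mul_zero]
  have h0 : ∀ φ : ℝ, oscInt a b φ (fun _ => (0 : ℂ)) = 0 := by
    intro φ; ext r; simp [oscInt]
  simp [h0]

theorem profN_zero {s p : ℝ} (hp : 1 ≤ p) : profN s p 0 = 0 := by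
  have : ∀ n : ℤ, yN ((0 : ℤ → ℝ → ℂ) n) = 0 := fun n => by
    exact (yN_const 0).trans enorm_zero
  unfold profN
  simp_rw [this]
  exact seqN_zero hp

theorem profN_const (s p : ℝ) (w₀ : ℤ → ℂ) : profN s p (fun n _ => w₀ n) = seqN s p fun n => ‖w₀ n‖ₑ := by
  unfold profN; simp_rw [yN_const]

/-- Reversing all frequencies reverses the signs of `phase` and of `triCoeff`. The resulting minus
sign is compensated by the conjugate of `Complex.I` in `duhamel`, so real-valuedness is preserved.
-/
theorem triOp_reflect (a b c : ℝ) {w : ℤ → ℝ → ℂ} (hw : ∀ n t, w (-n) t = (starRingEnd ℂ) (w n t))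
    (n : ℤ) (t : ℝ) : triOp a b c w w w (-n) t = -(starRingEnd ℂ) (triOp a b c w w w n t) := by
  unfold triOp
  rw [Complex.conj_tsum, ← (Equiv.neg (ℤ × ℤ)).tsum_eq, ← tsum_neg]
  refine tsum_congr fun v => ?_
  have e1 : phase (-n) (-v.1) (-v.2) = -phase n v.1 v.2 := by unfold phase; ring
  have e2 : triCoeff (-n) (-v.1) (-v.2) = -triCoeff n v.1 v.2 := by
    unfold triCoeff; rw [e1]; simp only [neg_ne_zero, neg_inj]
    split_ifs <;> push_cast <;> ring
  have e3 : triTerm a b c w w w (-n) (-v) t = (starRingEnd ℂ) (triTerm a b c w w w n v t) := by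
    unfold triTerm
    rw [← intervalIntegral.intervalIntegral_conj]
    congr 1
    ext r
    have e4 : -n - -v.1 - -v.2 = -(n - v.1 - v.2) := by ring
    simp only [oscInt, Prod.fst_neg, Prod.snd_neg, e1, e4, hw, Set.indicator]
    split_ifs
    · simp only [map_mul, ← Complex.exp_conj, map_neg, Complex.conj_I, Complex.conj_ofReal]
      push_cast
      ring_nf
    · simp
  simp only [Equiv.neg_apply, Prod.fst_neg, Prod.snd_neg, e2, map_mul, Complex.conj_ofReal]
  rw [e3]
  push_cast; ring

theorem duhamel_reflect (σ a b c : ℝ) {w₀ : ℤ → ℂ} {w : ℤ → ℝ → ℂ}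
    (h₀ : ∀ n, w₀ (-n) = (starRingEnd ℂ) (w₀ n))
    (hw : ∀ n t, w (-n) t = (starRingEnd ℂ) (w n t)) (n : ℤ) (t : ℝ) :
    duhamel σ a b c w₀ w (-n) t = (starRingEnd ℂ) (duhamel σ a b c w₀ w n t) := by
  unfold duhamel
  rw [triOp_reflect a b c hw, h₀]
  simp

/-- The Duhamel map is a contraction on balls, on short time intervals. -/
theorem duhamel_contraction {s p : ℝ} (h : Admissible s p) : ∃ K : ℝ≥0∞, K ≠ ⊤ ∧
    ∀ {σ a b c : ℝ} {R : ℝ≥0∞}, ‖(σ : ℂ)‖ₑ = 1 → a ≤ b → b - a ≤ 2 → R ≠ ⊤ →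
    K * ENNReal.ofReal (√(b - a)) * R ^ 2 ≤ 2⁻¹ →
    ∀ (w₀ z₀ : ℤ → ℂ) (w z : ℤ → ℝ → ℂ), (∀ n, Measurable (w n)) → (∀ n, Measurable (z n)) →
    profN s p w ≤ 2 * R → profN s p z ≤ 2 * R →
    profN s p (fun n t => duhamel σ a b c w₀ w n t - duhamel σ a b c z₀ z n t) ≤
      seqN s p (fun n => ‖w₀ n - z₀ n‖ₑ) + 2⁻¹ * profN s p (fun n t => w n t - z n t) := by
  obtain ⟨K, hK, hb⟩ := profN_triOp_sub_le h
  -- The balls have radius `2R`, and `(2R)² = 4R²`.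
  refine ⟨4 * K, ENNReal.mul_ne_top (by norm_num) hK, ?_⟩
  intro σ a b c R hσ hab hL hR hsmall w₀ z₀ w z mw mz hw hz
  have h2R : (2 : ℝ≥0∞) * R ≠ ⊤ := ENNReal.mul_ne_top (by norm_num) hR
  have fw := ne_top_of_le_ne_top h2R hw
  have fz := ne_top_of_le_ne_top h2R hz
  have e : ∀ n t, duhamel σ a b c w₀ w n t - duhamel σ a b c z₀ z n t =
      (w₀ n - z₀ n) + Complex.I * σ * (triOp a b c w w w n t - triOp a b c z z z n t) := by
    intro n t; simp only [duhamel]; ring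
  simp_rw [e]
  have M : ∀ n, Measurable fun t => triOp a b c w w w n t - triOp a b c z z z n t := fun n =>
    (continuous_triOp h hab hL mw mw mw fw fw fw n).measurable.sub
      (continuous_triOp h hab hL mz mz mz fz fz fz n).measurable
  refine (profN_add_le h.one_le (w := fun n _ => w₀ n - z₀ n) (fun n => measurable_const)
    (fun n => (M n).const_mul _)).trans ?_
  rw [profN_const]
  gcongr
  refine (profN_const_mul_le h.one_le _ _).trans ?_
  have hI : ‖Complex.I * (σ : ℂ)‖ₑ = 1 := by
    rw [enorm_mul, hσ, mul_one, ← ofReal_norm, Complex.norm_I, ENNReal.ofReal_one]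
  rw [hI, one_mul]
  refine (hb hab hL h2R mw mz hw hz).trans ?_
  gcongr
  calc _ = 4 * K * ENNReal.ofReal (√(b - a)) * R ^ 2 := by ring
    _ ≤ _ := hsmall

/-- Half of the left side is absorbed, which is only possible because it is known to be finite. -/
theorem le_two_mul_of_le_add_half {x y : ℝ≥0∞} (hx : x ≠ ⊤) (h : x ≤ y + 2⁻¹ * x) : x ≤ 2 * y := by
  by_cases hy : y = ⊤
  · simp [hy]
  lift x to ℝ≥0 using hx
  lift y to ℝ≥0 using hy
  have h2 : (2⁻¹ : ℝ≥0∞) = ((2⁻¹ : ℝ≥0) : ℝ≥0∞) := by simp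
  rw [h2] at h
  norm_cast at h ⊢
  have h' : (x : ℝ) ≤ y + 2⁻¹ * x := by exact_mod_cast h
  have : (x : ℝ) ≤ 2 * y := by linarith
  exact_mod_cast this

section fixedPoint

variable {s p σ a b c : ℝ}

theorem continuous_duhamel (h : Admissible s p) (hab : a ≤ b) (hL : b - a ≤ 2) (w₀ : ℤ → ℂ) {w : ℤ → ℝ → ℂ}
    (mw : ∀ n, Measurable (w n)) (fw : profN s p w ≠ ⊤) (n : ℤ) :
    Continuous (duhamel σ a b c w₀ w n) :=
  continuous_const.add ((continuous_triOp h hab hL mw mw mw fw fw fw n).const_mul _)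

/-- Solutions of the integral equation on a short interval depend on the datum in a Lipschitz way. -/
theorem duhamel_lipschitz (h : Admissible s p) : ∃ K : ℝ≥0∞, K ≠ ⊤ ∧
    ∀ {σ a b c : ℝ} {R : ℝ≥0∞}, ‖(σ : ℂ)‖ₑ = 1 → a ≤ b → b - a ≤ 2 → R ≠ ⊤ →
    K * ENNReal.ofReal (√(b - a)) * R ^ 2 ≤ 2⁻¹ →
    (∀ (w₀ z₀ : ℤ → ℂ) (w z : ℤ → ℝ → ℂ), (∀ n, Measurable (w n)) → (∀ n, Measurable (z n)) →
      profN s p w ≤ 2 * R → profN s p z ≤ 2 * R →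
      (∀ n t, w n t = duhamel σ a b c w₀ w n t) → (∀ n t, z n t = duhamel σ a b c z₀ z n t) →
      profN s p (fun n t => w n t - z n t) ≤ 2 * seqN s p (fun n => ‖w₀ n - z₀ n‖ₑ)) ∧
    (∀ w₀ : ℤ → ℂ, seqN s p (fun n => ‖w₀ n‖ₑ) ≤ R → ∃ w : ℤ → ℝ → ℂ, (∀ n, Continuous (w n)) ∧
      profN s p w ≤ 2 * R ∧ (∀ n t, w n t = duhamel σ a b c w₀ w n t) ∧
      ((∀ n, w₀ (-n) = (starRingEnd ℂ) (w₀ n)) → ∀ n t, w (-n) t = (starRingEnd ℂ) (w n t))) := by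
  obtain ⟨K, hK, hb⟩ := duhamel_contraction h
  refine ⟨K, hK, fun {σ a b c R} hσ hab hL hR hsmall => ⟨?_, ?_⟩⟩
  · intro w₀ z₀ w z mw mz hw hz ew ez
    have h2R : (2 : ℝ≥0∞) * R ≠ ⊤ := ENNReal.mul_ne_top (by norm_num) hR
    refine le_two_mul_of_le_add_half (ne_top_of_le_ne_top (ENNReal.add_ne_top.2
      ⟨ne_top_of_le_ne_top h2R hw, ne_top_of_le_ne_top h2R hz⟩) (profN_sub_le h.one_le mw mz)) ?_
    have := hb hσ hab hL hR hsmall (c := c) w₀ z₀ w z mw mz hw hz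
    simp_rw [← ew, ← ez] at this
    exact this
  intro w₀ hw₀
  have h2R : (2 : ℝ≥0∞) * R ≠ ⊤ := ENNReal.mul_ne_top (by norm_num) hR
  have hd0 : duhamel σ a b c 0 0 = 0 := by
    ext n t; simp [duhamel, triOp_zero]
  -- Picard iteration from zero; the iterates stay in the ball of radius `2R` and successive
  -- differences halve.
  let W : ℕ → ℤ → ℝ → ℂ := fun k => (duhamel σ a b c w₀)^[k] 0
  have hW0 : W 0 = 0 := rfl
  have hWs : ∀ k, W (k + 1) = duhamel σ a b c w₀ (W k) := fun k => Function.iterate_succ_apply' _ _ _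
  have hW : ∀ k, (∀ n, Continuous (W k n)) ∧ profN s p (W k) ≤ 2 * R := by
    intro k
    induction k with
    | zero =>
      rw [hW0, profN_zero h.one_le]
      exact ⟨fun n => continuous_zero, zero_le⟩
    | succ k ih =>
      rw [hWs]
      refine ⟨continuous_duhamel h hab hL w₀ (fun n => (ih.1 n).measurable) (ne_top_of_le_ne_top h2R ih.2), ?_⟩
      have := hb hσ hab hL hR hsmall (c := c) w₀ 0 (W k) 0 (fun n => (ih.1 n).measurable)
        (fun n => measurable_zero) ih.2 (by rw [profN_zero h.one_le]; exact zero_le)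
      simp only [hd0, Pi.zero_apply, sub_zero] at this
      refine this.trans ?_
      calc _ ≤ R + 2⁻¹ * (2 * R) := by gcongr; exact ih.2
        _ = 2 * R := by
          rw [← mul_assoc, ENNReal.inv_mul_cancel (by norm_num) (by norm_num), one_mul, two_mul]
  have hWm : ∀ k n, Measurable (W k n) := fun k n => ((hW k).1 n).measurable
  have hstep : ∀ k, profN s p (fun n t => W (k + 1) n t - W k n t) ≤ 2⁻¹ ^ k * R := by
    intro k
    induction k with
    | zero =>
      have := hb hσ hab hL hR hsmall (c := c) w₀ 0 0 0 (fun n => measurable_zero)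
        (fun n => measurable_zero) (by rw [profN_zero h.one_le]; exact zero_le)
        (by rw [profN_zero h.one_le]; exact zero_le)
      rw [hd0] at this
      rw [hWs, hW0, pow_zero, one_mul]
      refine this.trans ?_
      have e0 : profN s p (fun n t => (0 : ℤ → ℝ → ℂ) n t - (0 : ℤ → ℝ → ℂ) n t) = 0 := by
        simp only [sub_self]
        exact profN_zero h.one_le
      rw [e0]; simpa using hw₀
    | succ k ih =>
      have := hb hσ hab hL hR hsmall (c := c) w₀ w₀ (W (k + 1)) (W k) (hWm _) (hWm _) (hW _).2 (hW _).2
      rw [← hWs, ← hWs] at this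
      refine this.trans ?_
      simp only [sub_self, enorm_zero, seqN_zero h.one_le, zero_add]
      calc _ ≤ 2⁻¹ * (2⁻¹ ^ k * R) := by gcongr
        _ = _ := by ring
  have hgeo : ∀ k, ∑' j : ℕ, (2⁻¹ : ℝ≥0∞) ^ (k + j) * R = 2⁻¹ ^ k * (2 * R) := by
    intro k
    rw [ENNReal.tsum_mul_right]
    simp_rw [pow_add]
    rw [ENNReal.tsum_mul_left, ENNReal.tsum_geometric, ENNReal.one_sub_inv_two, inv_inv, mul_assoc]
  have hsum : ∀ k n t, Summable fun j => W (k + j + 1) n t - W (k + j) n t := by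
    intro k n t
    refine summable_of_tsum_enorm_ne_top (ne_top_of_le_ne_top ?_ (ENNReal.tsum_le_tsum fun j =>
      (enorm_le_profN h (fun n t => W (k + j + 1) n t - W (k + j) n t) n t).trans (hstep (k + j))))
    rw [hgeo]
    exact ENNReal.mul_ne_top (by simp) h2R
  -- The limit is a pointwise telescoping series. The countable triangle inequalities for `yN` and
  -- `seqN` then bound its tails in `profN`, so completeness of the profile space need not be
  -- established.
  let w : ℤ → ℝ → ℂ := fun n t => ∑' j, (W (0 + j + 1) n t - W (0 + j) n t)
  have hlim : ∀ n t, Tendsto (fun k => W k n t) atTop (𝓝 (w n t)) := by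
    intro n t
    have := (hsum 0 n t).hasSum.tendsto_sum_nat
    simp only [zero_add] at this
    have e : ∀ k, ∑ j ∈ Finset.range k, (W (j + 1) n t - W j n t) = W k n t := by
      intro k; rw [Finset.sum_range_sub (fun j => W j n t)]; simp [hW0]
    simp_rw [e] at this
    simpa [w] using this
  have hrest : ∀ k n t, HasSum (fun j => W (k + j + 1) n t - W (k + j) n t) (w n t - W k n t) := by
    intro k n t
    rw [(hsum k n t).hasSum_iff_tendsto_nat]
    have e : ∀ m, ∑ j ∈ Finset.range m, (W (k + j + 1) n t - W (k + j) n t) = W (m + k) n t - W k n t := by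
      intro m; exact (Finset.sum_range_sub (fun j => W (k + j) n t) m).trans (by simp [add_comm])
    simp_rw [e]
    exact ((tendsto_add_atTop_iff_nat k).2 (hlim n t)).sub_const _
  have hwm : ∀ n, Measurable (w n) := fun n =>
    measurable_of_tendsto_metrizable (fun k => hWm k n) (tendsto_pi_nhds.2 (hlim n))
  have htail : ∀ k, profN s p (fun n t => w n t - W k n t) ≤ 2⁻¹ ^ k * (2 * R) := by
    intro k
    refine (seqN_mono h.one_le fun n => yN_tsum_le (fun j => (hWm (k + j + 1) n).sub (hWm (k + j) n))
      (hrest k n)).trans ((seqN_tsum_le h.one_le _).trans ?_)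
    rw [← hgeo]
    exact ENNReal.tsum_le_tsum fun j => hstep (k + j)
  have hwR : profN s p w ≤ 2 * R := by simpa [hW0] using htail 0
  have fixed : ∀ n t, w n t = duhamel σ a b c w₀ w n t := by
    intro n t
    have h1 : ∀ k, ‖duhamel σ a b c w₀ w n t - W (k + 1) n t‖ₑ ≤ 2⁻¹ ^ k * (2 * R) := by
      intro k
      have := hb hσ hab hL hR hsmall (c := c) w₀ w₀ w (W k) hwm (hWm _) hwR (hW _).2
      rw [← hWs] at this
      refine (enorm_le_profN h (fun n t => duhamel σ a b c w₀ w n t - W (k + 1) n t) n t).trans (this.trans ?_)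
      simp only [sub_self, enorm_zero, seqN_zero h.one_le, zero_add]
      calc _ ≤ 2⁻¹ * (2⁻¹ ^ k * (2 * R)) := by gcongr; exact htail k
        _ ≤ 1 * (2⁻¹ ^ k * (2 * R)) := by gcongr; norm_num
        _ = _ := one_mul _
    -- The same sequence converges pointwise both to `w` and to its Duhamel image.
    have h2 : Tendsto (fun k => W (k + 1) n t) atTop (𝓝 (duhamel σ a b c w₀ w n t)) := by
      rw [tendsto_iff_edist_tendsto_0]
      refine tendsto_of_tendsto_of_tendsto_of_le_of_le tendsto_const_nhds
        (h := fun k => 2⁻¹ ^ k * (2 * R)) ?_ (fun _ => zero_le)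
        (fun k => by rw [edist_comm, edist_eq_enorm_sub]; exact h1 k)
      have := ENNReal.Tendsto.mul_const (b := 2 * R) (ENNReal.tendsto_pow_atTop_nhds_zero_of_lt_one
        (r := 2⁻¹) (by simp)) (Or.inr h2R)
      simpa using this
    exact tendsto_nhds_unique ((tendsto_add_atTop_iff_nat 1).2 (hlim n t)) h2
  refine ⟨w, fun n => ?_, hwR, fixed, fun h₀ n t => ?_⟩
  · rw [show w n = duhamel σ a b c w₀ w n from funext (fixed n)]
    exact continuous_duhamel h hab hL w₀ hwm (ne_top_of_le_ne_top h2R hwR) n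
  · have hsymm : ∀ k, ∀ n t, W k (-n) t = (starRingEnd ℂ) (W k n t) := by
      intro k
      induction k with
      | zero => intro n t; simp [hW0]
      | succ k ih => rw [hWs]; exact duhamel_reflect σ a b c h₀ ih
    refine tendsto_nhds_unique (hlim (-n) t) ?_
    simp_rw [hsymm]
    exact (Complex.continuous_conj.tendsto _).comp (hlim n t)

end fixedPoint

/-! ### Fourier coefficients on the torus: uniqueness, products and cubes. -/

theorem hasSum_of_eq {ι : Type*} {f g : ι → ℂ} {x y : ℂ} (h : HasSum f x) (hfg : ∀ i, g i = f i)
    (hxy : y = x) : HasSum g y := by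
  rw [hxy, funext hfg]; exact h

theorem integrable_fourier_mul {h : Torus → ℂ} (hh : Integrable h torusMeasure) (φ : C(Torus, ℂ)) :
    Integrable (fun x => φ x * h x) torusMeasure :=
  hh.bdd_mul φ.continuous.aestronglyMeasurable (c := ‖φ‖) (Eventually.of_forall fun x => φ.norm_coe_le_norm x)

/-- Pairing with `h` is continuous for the uniform norm and vanishes on characters, whose span is
dense in the continuous functions. -/
theorem integral_continuousMap_mul_eq_zero {h : Torus → ℂ} (hh : Integrable h torusMeasure)
    (h0 : ∀ n, fourierCoeff h n = 0) (φ : C(Torus, ℂ)) : ∫ x, φ x * h x ∂torusMeasure = 0 := by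
  let L : C(Torus, ℂ) →ₗ[ℂ] ℂ :=
    { toFun := fun φ => ∫ x, φ x * h x ∂torusMeasure
      map_add' := fun φ ψ => by
        simp only [ContinuousMap.add_apply, add_mul]
        exact integral_add (integrable_fourier_mul hh φ) (integrable_fourier_mul hh ψ)
      map_smul' := fun c φ => by
        simp only [ContinuousMap.smul_apply, smul_eq_mul, mul_assoc, RingHom.id_apply]
        exact integral_const_mul _ _ }
  let L' : C(Torus, ℂ) →L[ℂ] ℂ := L.mkContinuous (∫ x, ‖h x‖ ∂torusMeasure) fun φ => by
    change ‖∫ x, φ x * h x ∂torusMeasure‖ ≤ _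
    refine (norm_integral_le_integral_norm _).trans ?_
    rw [← integral_mul_const]
    refine integral_mono (integrable_fourier_mul hh φ).norm (hh.norm.mul_const _) fun x => ?_
    simp only [norm_mul]
    rw [mul_comm]
    gcongr
    exact φ.norm_coe_le_norm x
  have h1 : (Submodule.span ℂ (Set.range (@fourier (2 * Real.pi)))).topologicalClosure ≤ LinearMap.ker L'.toLinearMap := by
    refine Submodule.topologicalClosure_minimal _ ?_ L'.isClosed_ker
    rw [Submodule.span_le]
    rintro _ ⟨n, rfl⟩
    have := h0 (-n)
    simp only [fourierCoeff, neg_neg, smul_eq_mul] at this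
    exact this
  rw [span_fourier_closure_eq_top] at h1
  exact h1 (Submodule.mem_top (x := φ))

/-- Integrable functions on the torus are determined by their Fourier coefficients. -/
theorem ae_eq_zero_of_fourierCoeff {h : Torus → ℂ} (hh : Integrable h torusMeasure)
    (h0 : ∀ n, fourierCoeff h n = 0) : h =ᵐ[torusMeasure] 0 := by
  refine ae_eq_zero_of_forall_setIntegral_isClosed_eq_zero hh fun F hF => ?_
  have hδ : ∀ n : ℕ, (0 : ℝ) < 1 / (n + 1) := fun n => by positivity
  have ht := thickenedIndicator_tendsto_indicator_closure hδ tendsto_one_div_add_atTop_nhds_zero_nat F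
  rw [tendsto_pi_nhds] at ht
  -- Continuous functions decreasing to the indicator of the closed set `F`; dominated convergence
  -- transfers the vanishing to integrals over `F`.
  let φ : ℕ → C(Torus, ℂ) := fun n =>
    ⟨fun x => (((thickenedIndicator (hδ n) F x : ℝ≥0) : ℝ) : ℂ), by fun_prop⟩
  have hlim : Tendsto (fun n => ∫ x, φ n x * h x ∂torusMeasure) atTop
      (𝓝 (∫ x, F.indicator h x ∂torusMeasure)) := by
    refine tendsto_integral_of_dominated_convergence (fun x => ‖h x‖)
      (fun n => (integrable_fourier_mul hh (φ n)).aestronglyMeasurable) hh.norm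
      (fun n => Eventually.of_forall fun x => ?_) (Eventually.of_forall fun x => ?_)
    · rw [norm_mul]
      refine mul_le_of_le_one_left (norm_nonneg _) ?_
      have := thickenedIndicator_le_one (hδ n) F x
      simpa [φ] using this
    · have hx := ht x
      rw [hF.closure_eq] at hx
      have h2 : Tendsto (fun n => φ n x) atTop (𝓝 ((((F.indicator (fun _ => (1 : ℝ≥0)) x : ℝ≥0) : ℝ) : ℂ))) :=
        (Complex.continuous_ofReal.tendsto _).comp ((NNReal.continuous_coe.tendsto _).comp hx)
      have h3 := h2.mul_const (h x)
      convert h3 using 2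
      by_cases hxF : x ∈ F <;> simp [hxF]
  rw [integral_indicator hF.measurableSet] at hlim
  simp_rw [integral_continuousMap_mul_eq_zero hh h0] at hlim
  exact (tendsto_nhds_unique hlim tendsto_const_nhds)

theorem ae_eq_of_fourierCoeff {f g : Torus → ℂ} (hf : Integrable f torusMeasure)
    (hg : Integrable g torusMeasure) (h : ∀ n, fourierCoeff f n = fourierCoeff g n) :
    f =ᵐ[torusMeasure] g := by
  have := ae_eq_zero_of_fourierCoeff (hf.sub hg) fun n => by
    have e : fourierCoeff (f - g) n = fourierCoeff f n - fourierCoeff g n := by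
      simp only [fourierCoeff, Pi.sub_apply, smul_sub]
      exact integral_sub (integrable_fourier_mul hf (fourier (-n))) (integrable_fourier_mul hg (fourier (-n)))
    rw [e, h, sub_self]
  filter_upwards [this] with x hx
  simpa [sub_eq_zero] using hx

theorem ext_fourierCoeff {f g : L2T} (h : ∀ n, fourierCoeff f n = fourierCoeff g n) : f = g := by
  apply (fourierBasis (T := 2 * Real.pi)).repr.injective
  ext n
  rw [fourierBasis_repr, fourierBasis_repr, h]

theorem norm_fourier_apply (n : ℤ) (x : Torus) : ‖fourier n x‖ = 1 := by
  rw [fourier_apply]; exact Circle.norm_coe _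

theorem memLp_fourier_mul {v : Torus → ℂ} (hv : MemLp v 2 torusMeasure) (n : ℤ) :
    MemLp (fun x => fourier n x * (starRingEnd ℂ) (v x)) 2 torusMeasure := by
  refine hv.congr_norm ?_ (Eventually.of_forall fun x => ?_)
  · exact (fourier n).continuous.aestronglyMeasurable.mul
      (Complex.continuous_conj.comp_aestronglyMeasurable hv.1)
  · rw [norm_mul, norm_fourier_apply, one_mul, RCLike.norm_conj]

/-- The Fourier coefficients of a product of square integrable functions. -/
theorem hasSum_fourierCoeff_mul (u : L2T) {v : Torus → ℂ} (hv : MemLp v 2 torusMeasure) (n : ℤ) :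
    HasSum (fun k : ℤ => fourierCoeff u k * fourierCoeff v (n - k))
      (fourierCoeff (fun x => u x * v x) n) := by
  -- The `n`-th coefficient of `u v` is the inner product of `u` with the character times the
  -- conjugate of `v`, hence continuous in `u` and computable along the Fourier series of `u`.
  let y : L2T := (memLp_fourier_mul hv n).toLp
  have hy : y =ᵐ[torusMeasure] fun x => fourier n x * (starRingEnd ℂ) (v x) := MemLp.coeFn_toLp _
  have key : ∀ w : L2T, inner ℂ y w = fourierCoeff (fun x => w x * v x) n := by
    intro w
    rw [L2.inner_def, fourierCoeff]
    refine integral_congr_ae ?_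
    filter_upwards [hy] with x hx
    rw [RCLike.inner_apply, hx, map_mul, ← fourier_neg, smul_eq_mul]
    simp only [RingHomCompTriple.comp_apply, RingHom.id_apply]
    ring
  have h1 := (hasSum_fourier_series_L2 u).mapL (innerSL ℂ y)
  simp only [innerSL_apply_apply, inner_smul_right] at h1
  rw [key] at h1
  refine hasSum_of_eq h1 (fun k => ?_) rfl
  rw [key]
  congr 1
  rw [fourierCoeff, fourierCoeff]
  refine integral_congr_ae ?_
  filter_upwards [coeFn_fourierLp (T := 2 * Real.pi) 2 k] with x hx
  rw [hx, smul_eq_mul, smul_eq_mul, ← mul_assoc, ← fourier_add]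
  congr 3
  ring

theorem memLp_L2T (f : L2T) : MemLp f 2 torusMeasure := Lp.memLp f

/-- The element of `L²(𝕋)` with prescribed Fourier coefficients (zero if they are not in `ℓ²`). -/
def ofCoeff (x : ℤ → ℂ) : L2T :=
  open Classical in if h : Memℓp x 2 then (fourierBasis (T := 2 * Real.pi)).repr.symm ⟨x, h⟩ else 0

theorem fourierCoeff_ofCoeff {x : ℤ → ℂ} (h : Memℓp x 2) (n : ℤ) : fourierCoeff (ofCoeff x) n = x n := by
  rw [← fourierBasis_repr, ofCoeff, dif_pos h]
  simp

theorem memlp_two_of_tsum {x : ℤ → ℂ} (h : ∑' n, ‖x n‖ₑ ^ 2 ≠ ⊤) : Memℓp x 2 := by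
  rw [memℓp_gen_iff (by norm_num)]
  have := ENNReal.summable_toReal h
  simpa using this

theorem hasSum_of_tsum_enorm_le {ι : Type*} {x : ι → ℂ} (h : ∑' i, ‖x i‖ₑ ≠ ⊤) : HasSum x (∑' i, x i) :=
  (summable_of_tsum_enorm_ne_top h).hasSum

/-- `f²` is square integrable, with Fourier coefficients given by the convolution, if `f̂ ∈ ℓ^{4/3}`. -/
theorem memLp_sq {f : L2T} (hf : ∑' n, ‖fourierCoeff f n‖ₑ ^ (4 / 3 : ℝ) ≠ ⊤) :
    MemLp (fun x => f x * f x) 2 torusMeasure := by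
  have hs : ∀ n, HasSum (fun k : ℤ => fourierCoeff f k * fourierCoeff f (n - k))
      (fourierCoeff (fun x => f x * f x) n) := hasSum_fourierCoeff_mul f (memLp_L2T f)
  have hfin : ∑' n, ‖fourierCoeff (fun x => f x * f x) n‖ₑ ^ 2 ≠ ⊤ := by
    refine ne_top_of_le_ne_top ?_ ((ENNReal.tsum_le_tsum fun n => ?_).trans
      (tsum_conv_sq_le (fun k => ‖fourierCoeff f k‖ₑ) (fun k => ‖fourierCoeff f k‖ₑ)))
    · exact ENNReal.rpow_ne_top_of_nonneg (by norm_num) (ENNReal.mul_ne_top hf hf)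
    · rw [← (hs n).tsum_eq]
      refine pow_le_pow_left' (enorm_tsum_le_tsum_enorm.trans (le_of_eq ?_)) 2
      simp_rw [enorm_mul]
  have hm := memlp_two_of_tsum hfin
  have hint : Integrable (fun x => f x * f x) torusMeasure := (memLp_L2T f).integrable_mul (memLp_L2T f)
  -- A priori `f²` is only integrable. It agrees almost everywhere with the square integrable
  -- function that has the same coefficients.
  have hae := ae_eq_of_fourierCoeff hint
    ((memLp_L2T (ofCoeff _)).integrable (by norm_num)) fun n => (fourierCoeff_ofCoeff hm n).symm
  exact (memLp_congr_ae hae).2 (memLp_L2T _)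

/-- Grouped as a convolution of `x` and `y` paired with `z`: the former is in `ℓ²` by Young's
inequality, the latter because `ℓ^{4/3} ⊆ ℓ²`. -/
theorem tsum_triple_le (x y z : ℤ → ℝ≥0∞) (n : ℤ) :
    ∑' v : ℤ × ℤ, x v.1 * y v.2 * z (n - v.1 - v.2) ≤ ((∑' k, x k ^ (4 / 3 : ℝ)) *
      (∑' k, y k ^ (4 / 3 : ℝ)) * ∑' k, z k ^ (4 / 3 : ℝ)) ^ (3 / 4 : ℝ) := by
  have e1 : ∑' v : ℤ × ℤ, x v.1 * y v.2 * z (n - v.1 - v.2) =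
      ∑' k, (∑' j, x j * y (k - j)) * z (n - k) := by
    simp_rw [← ENNReal.tsum_mul_right]
    rw [ENNReal.tsum_comm, ENNReal.tsum_prod']
    refine tsum_congr fun a => ?_
    refine Eq.trans ?_ ((Equiv.addLeft a).tsum_eq _)
    refine tsum_congr fun b => ?_
    simp only [Equiv.coe_addLeft]
    rw [show a + b - a = b by ring, show n - (a + b) = n - a - b by ring]
  have h1 := tsum_sq_mul_le (fun k => ∑' j, x j * y (k - j)) (fun k => z (n - k))
  have h2 : ∑' k, z (n - k) ^ 2 ≤ (∑' k, z k ^ (4 / 3 : ℝ)) ^ (3 / 2 : ℝ) := by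
    have := (Equiv.subLeft n).tsum_eq (fun k => z k ^ 2)
    simp only [Equiv.subLeft_apply] at this
    rw [this]
    exact tsum_sq_le_of_four_thirds z
  rw [← e1] at h1
  have h4 := h1.trans (mul_le_mul' (tsum_conv_sq_le x y) h2)
  rw [← ENNReal.mul_rpow_of_nonneg _ _ (by norm_num : (0 : ℝ) ≤ 3 / 2)] at h4
  rw [← ENNReal.pow_le_pow_left_iff two_ne_zero]
  refine h4.trans (le_of_eq ?_)
  rw [← ENNReal.rpow_natCast, ← ENNReal.rpow_mul]
  norm_num

/-- Absolute convergence allows summation by fibres, which reduces the cube to two applications of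
the product formula, to `f · f` and to `f · f²`. -/
theorem hasSum_fourierCoeff_cube {f : L2T} (hf : ∑' n, ‖fourierCoeff f n‖ₑ ^ (4 / 3 : ℝ) ≠ ⊤) (n : ℤ) :
    HasSum (fun v : ℤ × ℤ => fourierCoeff f v.1 * fourierCoeff f v.2 * fourierCoeff f (n - v.1 - v.2))
      (fourierCoeff (fun x => f x ^ 3) n) := by
  have hfin : ∑' v : ℤ × ℤ, ‖fourierCoeff f v.1 * fourierCoeff f v.2 * fourierCoeff f (n - v.1 - v.2)‖ₑ ≠ ⊤ := by
    simp_rw [enorm_mul]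
    exact ne_top_of_le_ne_top (ENNReal.rpow_ne_top_of_nonneg (by norm_num)
      (ENNReal.mul_ne_top (ENNReal.mul_ne_top hf hf) hf))
      (tsum_triple_le (fun k => ‖fourierCoeff f k‖ₑ) (fun k => ‖fourierCoeff f k‖ₑ)
        (fun k => ‖fourierCoeff f k‖ₑ) n)
  have h1 := hasSum_of_tsum_enorm_le hfin
  have h2 := hasSum_fourierCoeff_mul f (memLp_sq hf) n
  have h3 := h1.prod_fiberwise (f := fun v : ℤ × ℤ =>
    fourierCoeff f v.1 * fourierCoeff f v.2 * fourierCoeff f (n - v.1 - v.2)) (g := fun a =>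
      fourierCoeff f a * fourierCoeff (fun x => f x * f x) (n - a)) fun a => by
    have := (hasSum_fourierCoeff_mul f (memLp_L2T f) (n - a)).mul_left (fourierCoeff f a)
    simpa only [mul_assoc] using this
  have e : (fun x => f x ^ 3) = fun x => f x * (f x * f x) := by ext x; ring
  rw [e, h2.unique h3]
  exact h1

theorem integrable_cube {f : L2T} (hf : ∑' n, ‖fourierCoeff f n‖ₑ ^ (4 / 3 : ℝ) ≠ ⊤) :
    Integrable (fun x => f x ^ 3) torusMeasure := by
  have := (memLp_L2T f).integrable_mul (memLp_sq hf)
  refine this.congr (Eventually.of_forall fun x => ?_)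
  simp only [Pi.mul_apply]; ring

theorem fourierCoeff_neg_of_real {f : L2T} (hf : IsRealValued f) (n : ℤ) :
    fourierCoeff f (-n) = (starRingEnd ℂ) (fourierCoeff f n) := by
  rw [fourierCoeff, fourierCoeff, ← integral_conj]
  refine integral_congr_ae ?_
  filter_upwards [hf] with x hx
  have : (starRingEnd ℂ) (f x) = f x := Complex.conj_eq_iff_im.2 hx
  simp only [smul_eq_mul, map_mul, this, neg_neg]
  rw [← fourier_neg, neg_neg]

theorem isRealValued_of_fourierCoeff {f : L2T}
    (hf : ∀ n, fourierCoeff f (-n) = (starRingEnd ℂ) (fourierCoeff f n)) : IsRealValued f := by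
  have hi : Integrable f torusMeasure := (memLp_L2T f).integrable (by norm_num)
  have hc : Integrable (fun x => (starRingEnd ℂ) (f x)) torusMeasure :=
    hi.congr' (Complex.continuous_conj.comp_aestronglyMeasurable hi.1) (Eventually.of_forall fun x => by simp)
  have := ae_eq_of_fourierCoeff hi hc fun n => by
    rw [← Complex.conj_conj (fourierCoeff f n), ← hf, fourierCoeff, fourierCoeff, ← integral_conj]
    refine integral_congr_ae (Eventually.of_forall fun x => ?_)
    simp only [smul_eq_mul, map_mul, neg_neg]
    rw [← fourier_neg]
  filter_upwards [this] with x hx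
  exact Complex.conj_eq_iff_im.1 hx.symm

theorem hasSum_meanSq {f : L2T} (hf : IsRealValued f) :
    HasSum (fun k : ℤ => fourierCoeff f k * fourierCoeff f (-k)) (meanSq f : ℂ) := by
  have := hasSum_fourierCoeff_mul f (memLp_L2T f) 0
  simp only [zero_sub] at this
  convert this using 1
  rw [fourierCoeff, meanSq, ← integral_complex_ofReal]
  refine integral_congr_ae ?_
  filter_upwards [hf] with x hx
  have h1 : (starRingEnd ℂ) (f x) = f x := Complex.conj_eq_iff_im.2 hx
  have h2 := Complex.mul_conj' (f x)
  rw [h1] at h2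
  simp only [neg_zero, fourier_zero, one_smul]
  rw [h2]; push_cast; rfl

/-! ### The resonance decomposition of the nonlinearity. -/

/-- Inclusion-exclusion for the three resonant lines `a = n`, `b = n`, `a + b = 0`, which meet
pairwise in three points, distinct since `n ≠ 0`. At `(n, n)` the correction is -2 instead of +1, so
that the value there is `(n/3)(1 - 2 - 2) = -n`. -/
theorem triCoeff_eq {n : ℤ} (hn : n ≠ 0) (a b : ℤ) : (triCoeff n a b : ℂ) =
    n / 3 * (1 - ((if a = n then 1 else 0) + (if b = n then 1 else 0) + (if b = -a then 1 else 0)) +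
      ((if (a, b) = (n, -n) then 1 else 0) + (if (a, b) = (-n, n) then 1 else 0)
        - 2 * (if (a, b) = (n, n) then 1 else 0))) := by
  have hp : phase n a b = 0 ↔ b = -a ∨ a = n ∨ b = n := by
    unfold phase
    constructor
    · intro h
      rcases mul_eq_zero.1 ((mul_eq_zero.1 h).resolve_left (by norm_num)) with h | h
      · rcases mul_eq_zero.1 h with h | h
        · left; omega
        · right; left; omega
      · right; right; omega
    · rintro (h | h | h) <;> subst h <;> ring
  unfold triCoeff
  simp only [ne_eq, hp, Prod.mk.injEq]
  by_cases h1 : a = n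
  · subst h1
    by_cases h2 : b = a
    · subst h2
      have : b ≠ -b := by omega
      have h' : ¬ (b = -b) := this
      simp [h']; ring
    · by_cases h3 : b = -a
      · subst h3
        have h' : ¬ (a = -a) := by omega
        have h'' : ¬ (-a = a) := by omega
        simp [h', h'']
      · simp [h2, h3]
  · by_cases h2 : b = n
    · subst h2
      by_cases h3 : b = -a
      · have h4 : a = -b := by omega
        subst h4
        have h' : ¬ (b = -b) := by omega
        have h'' : ¬ (-b = b) := by omega
        simp [h', h'']
      · have h4 : ¬ a = -b := by omega
        simp [h1, h3, h4]
    · by_cases h3 : b = -a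
      · subst h3
        have h4 : ¬ (-a = n) := h2
        simp [h1, h4]
      · simp [h1, h2, h3]

theorem hasSum_pair_ite {g : ℤ × ℤ → ℂ} {i : ℤ → ℤ × ℤ} (hi : Function.Injective i) {P : ℤ × ℤ → Prop}
    [DecidablePred P] (hP : ∀ v, P v ↔ v ∈ Set.range i) {A : ℂ} (h : HasSum (fun k => g (i k)) A) :
    HasSum (fun v => (if P v then 1 else 0) * g v) A := by
  rw [← hi.hasSum_iff]
  · convert h using 2 with k
    simp [Function.comp, hP]
  · intro v hv
    rw [if_neg (fun h => hv ((hP v).1 h)), zero_mul]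

/-- Resolution of the nonlinearity of the renormalized equation into nonresonant and
resonant interactions. -/
theorem hasSum_triCoeff {x : ℤ → ℂ} {A m : ℂ} (n : ℤ)
    (hA : HasSum (fun v : ℤ × ℤ => x v.1 * x v.2 * x (n - v.1 - v.2)) A)
    (hm : HasSum (fun k : ℤ => x k * x (-k)) m) :
    HasSum (fun v : ℤ × ℤ => (triCoeff n v.1 v.2 : ℂ) * (x v.1 * x v.2 * x (n - v.1 - v.2)))
      (n * (A / 3 - m * x n)) := by
  by_cases hn : n = 0
  · subst hn
    have : ∀ v : ℤ × ℤ, triCoeff 0 v.1 v.2 = 0 := by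
      intro v; unfold triCoeff; split_ifs <;> simp
    simp [this]
  set g : ℤ × ℤ → ℂ := fun v => x v.1 * x v.2 * x (n - v.1 - v.2) with hg
  have h1 : HasSum (fun v : ℤ × ℤ => (if v.1 = n then 1 else 0) * g v) (x n * m) := by
    refine hasSum_pair_ite (i := fun k => (n, k)) (fun a b h => (Prod.mk.inj h).2) (fun v => ?_) ?_
    · constructor
      · rintro rfl; exact ⟨v.2, rfl⟩
      · rintro ⟨k, rfl⟩; rfl
    · refine hasSum_of_eq (hm.mul_left (x n)) (fun k => ?_) rfl
      simp only [hg]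
      rw [show n - n - k = -k by ring]; ring
  have h2 : HasSum (fun v : ℤ × ℤ => (if v.2 = n then 1 else 0) * g v) (x n * m) := by
    refine hasSum_pair_ite (i := fun k => (k, n)) (fun a b h => (Prod.mk.inj h).1) (fun v => ?_) ?_
    · constructor
      · rintro rfl; exact ⟨v.1, rfl⟩
      · rintro ⟨k, rfl⟩; rfl
    · refine hasSum_of_eq (hm.mul_left (x n)) (fun k => ?_) rfl
      simp only [hg]
      rw [show n - k - n = -k by ring]; ring
  have h3 : HasSum (fun v : ℤ × ℤ => (if v.2 = -v.1 then 1 else 0) * g v) (x n * m) := by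
    refine hasSum_pair_ite (i := fun k => (k, -k)) (fun a b h => (Prod.mk.inj h).1) (fun v => ?_) ?_
    · constructor
      · intro h; exact ⟨v.1, Prod.ext rfl h.symm⟩
      · rintro ⟨k, rfl⟩; rfl
    · refine hasSum_of_eq (hm.mul_left (x n)) (fun k => ?_) rfl
      simp only [hg]
      rw [show n - k - -k = n by ring]; ring
  have h4 : ∀ w : ℤ × ℤ, HasSum (fun v : ℤ × ℤ => (if v = w then 1 else 0) * g v) (g w) := by
    intro w
    refine hasSum_of_eq (hasSum_ite_eq w (g w)) (fun v => ?_) rfl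
    split_ifs with h
    · rw [h, one_mul]
    · rw [zero_mul]
  -- The three lines together produce `-n m x_n`, the effect of the renormalization. The three point
  -- terms all equal `x_n² x_{-n}` up to their coefficients 1, 1 and -2, and cancel.
  have h5 := ((hA.sub ((h1.add h2).add h3)).add (((h4 (n, -n)).add (h4 (-n, n))).sub
    ((h4 (n, n)).mul_left 2))).mul_left ((n : ℂ) / 3)
  refine hasSum_of_eq h5 (fun v => ?_) ?_
  · rw [triCoeff_eq hn]
    simp only [hg]
    ring
  · simp only [hg]
    rw [show n - n - -n = n by ring, show n - -n - n = n by ring, show n - n - n = -n by ring]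
    ring

/-- The Fourier coefficients of the flux `u³/3 - m(u) u`. -/
def fluxCoeff (f : L2T) (n : ℤ) : ℂ := fourierCoeff (fun x => f x ^ 3 / 3 - (meanSq f : ℂ) * f x) n

theorem integrable_flux {f : L2T} (hf : ∑' n, ‖fourierCoeff f n‖ₑ ^ (4 / 3 : ℝ) ≠ ⊤) :
    Integrable (fun x => f x ^ 3 / 3 - (meanSq f : ℂ) * f x) torusMeasure :=
  ((integrable_cube hf).div_const 3).sub (((memLp_L2T f).integrable (by norm_num)).const_mul _)

theorem fluxCoeff_eq {f : L2T} (hf : ∑' n, ‖fourierCoeff f n‖ₑ ^ (4 / 3 : ℝ) ≠ ⊤) (n : ℤ) :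
    fluxCoeff f n = fourierCoeff (fun x => f x ^ 3) n / 3 - meanSq f * fourierCoeff f n := by
  have h1 := integrable_fourier_mul ((integrable_cube hf).div_const 3) (fourier (-n))
  have h2 := integrable_fourier_mul (((memLp_L2T f).integrable (by norm_num)).const_mul (meanSq f : ℂ)) (fourier (-n))
  simp only [fluxCoeff, fourierCoeff, smul_eq_mul, mul_sub]
  rw [integral_sub h1 h2, ← integral_const_mul, ← integral_div]
  congr 1
  · refine integral_congr_ae (Eventually.of_forall fun x => ?_); simp only; ring
  · refine integral_congr_ae (Eventually.of_forall fun x => ?_); simp only; ring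

theorem hasSum_fluxCoeff {f : L2T} (hf : ∑' n, ‖fourierCoeff f n‖ₑ ^ (4 / 3 : ℝ) ≠ ⊤)
    (hr : IsRealValued f) (n : ℤ) :
    HasSum (fun v : ℤ × ℤ => (triCoeff n v.1 v.2 : ℂ) *
      (fourierCoeff f v.1 * fourierCoeff f v.2 * fourierCoeff f (n - v.1 - v.2))) (n * fluxCoeff f n) := by
  rw [fluxCoeff_eq hf]
  exact hasSum_triCoeff n (hasSum_fourierCoeff_cube hf n) (hasSum_meanSq hr)

theorem abs_triCoeff_le (n a b : ℤ) : |triCoeff n a b| ≤ |(n : ℝ)| := by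
  unfold triCoeff
  split_ifs
  · rw [abs_div]; simp; linarith [abs_nonneg (n : ℝ)]
  · simp
  · simp

/-! ### Pairing functions on the torus with periodic test functions. -/

theorem fourier_coe (n : ℤ) (x : ℝ) : fourier n (x : Torus) = Complex.exp (Complex.I * n * x) := by
  rw [fourier_coe_apply]
  congr 1
  have : (2 * Real.pi : ℂ) ≠ 0 := by exact_mod_cast Real.two_pi_pos.ne'
  push_cast
  field_simp

theorem integral_torus (f : Torus → ℂ) :
    ∫ x, f x ∂torusMeasure = ((2 * Real.pi)⁻¹ : ℝ) * ∫ x in (0 : ℝ)..(2 * Real.pi), f (x : Torus) := by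
  have := AddCircle.intervalIntegral_preimage (2 * Real.pi) 0 f
  rw [zero_add] at this
  rw [torusMeasure, AddCircle.integral_haarAddCircle, this, Complex.real_smul]

/-- The series of `ψ` converges absolutely and its terms are bounded, so termwise integration only
needs `G` integrable; the flux, which contains `u³`, is of this kind. -/
theorem integral_mul_fourierSeries {G : Torus → ℂ} (hG : Integrable G torusMeasure) (ψ : C(Torus, ℂ))
    (hs : Summable (fourierCoeff ψ)) :
    HasSum (fun k : ℤ => fourierCoeff G (-k) * fourierCoeff ψ k) (∫ x, G x * ψ x ∂torusMeasure) := by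
  have hI : ∀ k : ℤ, Integrable (fun x => fourierCoeff ψ k * (fourier k x * G x)) torusMeasure := fun k =>
    (integrable_fourier_mul hG (fourier k)).const_mul _
  have h1 := hasSum_integral_of_summable_integral_norm hI (by
    have : ∀ k : ℤ, ∫ x, ‖fourierCoeff ψ k * (fourier k x * G x)‖ ∂torusMeasure =
        ‖fourierCoeff ψ k‖ * ∫ x, ‖G x‖ ∂torusMeasure := by
      intro k
      rw [← integral_const_mul]
      refine integral_congr_ae (Eventually.of_forall fun x => ?_)
      simp only [norm_mul, norm_fourier_apply, one_mul]
    simp_rw [this]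
    exact hs.norm.mul_right _)
  refine hasSum_of_eq h1 (fun k => ?_) ?_
  · rw [integral_const_mul, mul_comm]
    congr 1
    simp only [fourierCoeff, neg_neg, smul_eq_mul]
  · refine integral_congr_ae (Eventually.of_forall fun x => ?_)
    have := ((has_pointwise_sum_fourier_series_of_summable hs x).mul_right (G x)).tsum_eq
    simp only [smul_eq_mul] at this ⊢
    rw [mul_comm, ← this]
    exact tsum_congr fun k => by ring

/-- The Fourier coefficients of a `2π`-periodic function on the line. -/
def perCoeff (ψ : ℝ → ℂ) (k : ℤ) : ℂ :=
  ((2 * Real.pi)⁻¹ : ℝ) * ∫ x in (0 : ℝ)..(2 * Real.pi), Complex.exp (-(Complex.I * k * x)) * ψ x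

theorem norm_exp_I_mul (k : ℤ) (x : ℝ) : ‖Complex.exp (-(Complex.I * k * x))‖ = 1 := by
  have : (-(Complex.I * k * x) : ℂ) = ((-(k * x) : ℝ) : ℂ) * Complex.I := by push_cast; ring
  rw [this, Complex.norm_exp_ofReal_mul_I]

theorem norm_perCoeff_le {ψ : ℝ → ℂ} {C : ℝ} (hC : ∀ x, ‖ψ x‖ ≤ C) (k : ℤ) : ‖perCoeff ψ k‖ ≤ C := by
  have hpi := Real.two_pi_pos
  have h1 : ‖∫ x in (0 : ℝ)..(2 * Real.pi), Complex.exp (-(Complex.I * k * x)) * ψ x‖ ≤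
      C * |2 * Real.pi - 0| := by
    refine intervalIntegral.norm_integral_le_of_norm_le_const fun x _ => ?_
    rw [norm_mul, norm_exp_I_mul, one_mul]; exact hC x
  rw [sub_zero, abs_of_pos hpi] at h1
  rw [perCoeff, norm_mul, Complex.norm_real, Real.norm_eq_abs, abs_of_pos (inv_pos.2 hpi)]
  calc _ ≤ (2 * Real.pi)⁻¹ * (C * (2 * Real.pi)) := by gcongr
    _ = C := by field_simp

theorem perCoeff_deriv {ψ ψ' : ℝ → ℂ} (hd : ∀ x, HasDerivAt ψ (ψ' x) x) (hc : Continuous ψ')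
    (hp : ∀ x, ψ (x + 2 * Real.pi) = ψ x) (k : ℤ) : perCoeff ψ' k = Complex.I * k * perCoeff ψ k := by
  have he : ∀ x : ℝ, HasDerivAt (fun x : ℝ => Complex.exp (-(Complex.I * k * x)))
      (-(Complex.I * k) * Complex.exp (-(Complex.I * k * x))) x := by
    intro x
    have h1 : HasDerivAt (fun x : ℝ => (-(Complex.I * k * x) : ℂ)) (-(Complex.I * k * 1)) x :=
      ((Complex.ofRealCLM.hasDerivAt (x := x)).const_mul (Complex.I * (k : ℂ))).neg
    convert h1.cexp using 1
    ring
  have h1 := intervalIntegral.integral_mul_deriv_eq_deriv_mul (a := 0) (b := 2 * Real.pi)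
    (fun x _ => he x) (fun x _ => hd x)
    (Continuous.intervalIntegrable (by fun_prop) _ _) (hc.intervalIntegrable _ _)
  have hp0 : ψ (2 * Real.pi) = ψ 0 := by simpa using hp 0
  have e1 : Complex.exp (-(Complex.I * k * ((2 * Real.pi : ℝ) : ℂ))) = 1 := by
    rw [Complex.exp_neg, show Complex.I * k * ((2 * Real.pi : ℝ) : ℂ) = k * (2 * Real.pi * Complex.I) by
      push_cast; ring, Complex.exp_int_mul_two_pi_mul_I, inv_one]
  rw [perCoeff, perCoeff, h1, hp0, e1]
  simp only [mul_assoc, intervalIntegral.integral_const_mul, neg_mul, intervalIntegral.integral_neg]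
  simp
  ring

/-- A continuous `2π`-periodic function as a function on the torus. -/
def torusLift (ψ : ℝ → ℂ) (hc : Continuous ψ) (hp : ∀ x, ψ (x + 2 * Real.pi) = ψ x) : C(Torus, ℂ) where
  toFun := Function.Periodic.lift (f := ψ) (c := 2 * Real.pi) hp
  continuous_toFun := by
    refine continuous_coinduced_dom.2 ?_
    exact hc

theorem torusLift_coe {ψ : ℝ → ℂ} (hc : Continuous ψ) (hp : ∀ x, ψ (x + 2 * Real.pi) = ψ x) (x : ℝ) :
    torusLift ψ hc hp (x : Torus) = ψ x := Function.Periodic.lift_coe hp x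

theorem fourierCoeff_torusLift {ψ : ℝ → ℂ} (hc : Continuous ψ) (hp : ∀ x, ψ (x + 2 * Real.pi) = ψ x) (k : ℤ) :
    fourierCoeff (torusLift ψ hc hp) k = perCoeff ψ k := by
  rw [fourierCoeff, perCoeff]
  refine (integral_torus _).trans ?_
  congr 1
  refine intervalIntegral.integral_congr fun x _ => ?_
  simp only [smul_eq_mul]
  rw [torusLift_coe, fourier_coe]
  congr 2; push_cast; ring

theorem summable_of_sq_decay {x : ℤ → ℂ} {C : ℝ} (h : ∀ k : ℤ, (1 + (k : ℝ) ^ 2) * ‖x k‖ ≤ C) : Summable x := by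
  have h1 : Summable fun k : ℤ => C / (1 + (k : ℝ) ^ 2) := by
    have hC : 0 ≤ C := le_trans (by positivity) (h 0)
    have h2 : Summable fun k : ℤ => (1 : ℝ) / (k : ℝ) ^ 2 := Real.summable_one_div_int_pow.2 (by norm_num)
    refine Summable.of_norm_bounded_eventually (g := fun k : ℤ => C * (1 / (k : ℝ) ^ 2)) (h2.mul_left C) ?_
    filter_upwards [(Set.finite_singleton (0 : ℤ)).compl_mem_cofinite] with k hk
    have hk0 : (0 : ℝ) < (k : ℝ) ^ 2 := by
      have : (k : ℝ) ≠ 0 := by exact_mod_cast hk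
      positivity
    rw [Real.norm_eq_abs, abs_of_nonneg (by positivity), div_eq_mul_one_div]
    gcongr
    linarith
  refine Summable.of_norm_bounded h1 fun k => ?_
  rw [le_div_iff₀ (by positivity), mul_comm]
  exact h k

theorem summable_inv_one_add_sq : Summable fun k : ℤ => (1 : ℝ) / (1 + (k : ℝ) ^ 2) := by
  have := (summable_of_sq_decay (x := fun k : ℤ => (((1 : ℝ) / (1 + (k : ℝ) ^ 2) : ℝ) : ℂ)) (C := 1) fun k => by
    have : (0 : ℝ) < 1 + (k : ℝ) ^ 2 := by positivity
    rw [Complex.norm_real, Real.norm_eq_abs, abs_of_pos (by positivity)]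
    rw [mul_one_div_cancel this.ne'])
  exact_mod_cast this

theorem hasSum_pairing {G : Torus → ℂ} (hG : Integrable G torusMeasure) {ψ : ℝ → ℂ} (hc : Continuous ψ)
    (hp : ∀ x, ψ (x + 2 * Real.pi) = ψ x) {C : ℝ} (h : ∀ k : ℤ, (1 + (k : ℝ) ^ 2) * ‖perCoeff ψ k‖ ≤ C) :
    HasSum (fun k : ℤ => 2 * Real.pi * (fourierCoeff G (-k) * perCoeff ψ k))
      (∫ x in (0 : ℝ)..(2 * Real.pi), G (x : Torus) * ψ x) := by
  have hs : Summable (fourierCoeff (torusLift ψ hc hp)) := by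
    rw [show fourierCoeff (torusLift ψ hc hp) = perCoeff ψ from funext (fourierCoeff_torusLift hc hp)]
    exact summable_of_sq_decay h
  refine hasSum_of_eq ((integral_mul_fourierSeries hG _ hs).mul_left (2 * Real.pi : ℂ)) (fun k => ?_) ?_
  · rw [fourierCoeff_torusLift]
  · have hpi : (Real.pi : ℂ) ≠ 0 := by exact_mod_cast Real.pi_ne_zero
    rw [integral_torus]
    simp only [torusLift_coe]
    push_cast
    field_simp

namespace IsTestFunction

variable {T : ℝ} {φ ψ : ℝ → ℝ → ℂ}

theorem hasDerivAt_snd (h : IsTestFunction T φ) (t x : ℝ) :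
    HasDerivAt (φ t) (fderiv ℝ (fun z : ℝ × ℝ => φ z.1 z.2) (t, x) (0, 1)) x := by
  have h1 := (h.smooth.differentiable (by simp) (t, x)).hasFDerivAt
  have h2 : HasDerivAt (fun y : ℝ => (t, y)) ((0 : ℝ), (1 : ℝ)) x :=
    (hasDerivAt_const x t).prodMk (hasDerivAt_id x)
  exact h1.comp_hasDerivAt x h2

theorem hasDerivAt_fst (h : IsTestFunction T φ) (t x : ℝ) :
    HasDerivAt (fun r => φ r x) (fderiv ℝ (fun z : ℝ × ℝ => φ z.1 z.2) (t, x) (1, 0)) t := by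
  have h1 := (h.smooth.differentiable (by simp) (t, x)).hasFDerivAt
  have h2 : HasDerivAt (fun y : ℝ => (y, x)) ((1 : ℝ), (0 : ℝ)) t :=
    (hasDerivAt_id t).prodMk (hasDerivAt_const t x)
  exact h1.comp_hasDerivAt t h2

theorem contDiff_fderiv (h : IsTestFunction T φ) (v : ℝ × ℝ) :
    ContDiff ℝ (⊤ : ℕ∞) fun z : ℝ × ℝ => fderiv ℝ (fun z : ℝ × ℝ => φ z.1 z.2) z v :=
  (h.smooth.fderiv_right (m := (⊤ : ℕ∞)) (by simp)).clm_apply contDiff_const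

theorem deriv_snd (h : IsTestFunction T φ) : IsTestFunction T fun t x => deriv (φ t) x where
  smooth := by
    have : (fun z : ℝ × ℝ => deriv (φ z.1) z.2) =
        fun z : ℝ × ℝ => fderiv ℝ (fun z : ℝ × ℝ => φ z.1 z.2) z (0, 1) := by
      ext z; exact (h.hasDerivAt_snd z.1 z.2).deriv
    rw [this]; exact h.contDiff_fderiv _
  periodic t x := by
    rw [← deriv_comp_add_const]
    congr 1
    ext y; exact h.periodic t y
  compact_support := by
    obtain ⟨T', hT', h0⟩ := h.compact_support
    refine ⟨T', hT', fun t x ht => ?_⟩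
    have : φ t = fun _ => 0 := funext fun x => h0 t x ht
    rw [this]; simp

theorem deriv_fst (h : IsTestFunction T φ) : IsTestFunction T fun t x => deriv (fun r => φ r x) t where
  smooth := by
    have : (fun z : ℝ × ℝ => deriv (fun r => φ r z.2) z.1) =
        fun z : ℝ × ℝ => fderiv ℝ (fun z : ℝ × ℝ => φ z.1 z.2) z (1, 0) := by
      ext z; exact (h.hasDerivAt_fst z.1 z.2).deriv
    rw [this]; exact h.contDiff_fderiv _
  periodic t x := by simp_rw [h.periodic]
  compact_support := by
    obtain ⟨T', hT', h0⟩ := h.compact_support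
    refine ⟨(T' + T) / 2, by linarith, fun t x ht => ?_⟩
    have : (fun r => φ r x) =ᶠ[𝓝 t] fun _ => 0 := by
      have : ∀ᶠ r in 𝓝 t, T' < |r| := continuous_abs.continuousAt.eventually (lt_mem_nhds (by linarith))
      filter_upwards [this] with r hr
      exact h0 r x hr.le
    rw [this.deriv_eq]; simp

theorem add (h : IsTestFunction T φ) (h' : IsTestFunction T ψ) :
    IsTestFunction T fun t x => φ t x + ψ t x where
  smooth := h.smooth.add h'.smooth
  periodic t x := by rw [h.periodic, h'.periodic]
  compact_support := by
    obtain ⟨T₁, hT₁, h₁⟩ := h.compact_support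
    obtain ⟨T₂, hT₂, h₂⟩ := h'.compact_support
    refine ⟨max T₁ T₂, max_lt hT₁ hT₂, fun t x ht => ?_⟩
    rw [h₁ t x ((le_max_left _ _).trans ht), h₂ t x ((le_max_right _ _).trans ht), add_zero]

theorem continuous_uncurry (h : IsTestFunction T φ) : Continuous fun z : ℝ × ℝ => φ z.1 z.2 := h.smooth.continuous

theorem continuous_snd (h : IsTestFunction T φ) (t : ℝ) : Continuous (φ t) :=
  h.continuous_uncurry.comp (Continuous.prodMk continuous_const continuous_id)

theorem exists_bound (h : IsTestFunction T φ) : ∃ C, ∀ t x, ‖φ t x‖ ≤ C := by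
  obtain ⟨T', hT', h0⟩ := h.compact_support
  obtain ⟨C, hC⟩ := ((isCompact_Icc (a := -T') (b := T')).prod
    (isCompact_Icc (a := (0 : ℝ)) (b := 2 * Real.pi))).exists_bound_of_continuousOn h.continuous_uncurry.continuousOn
  refine ⟨max C 0, fun t x => ?_⟩
  by_cases ht : T' ≤ |t|
  · rw [h0 t x ht, norm_zero]; exact le_max_right _ _
  · obtain ⟨y, hy, hxy⟩ := Function.Periodic.exists_mem_Ico₀ (f := φ t) (c := 2 * Real.pi) (h.periodic t)
      Real.two_pi_pos x
    rw [hxy]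
    have ht' := abs_lt.1 (not_le.1 ht)
    exact (hC (t, y) ⟨⟨ht'.1.le, ht'.2.le⟩, ⟨hy.1, hy.2.le⟩⟩).trans (le_max_left _ _)

theorem perCoeff_deriv_snd (h : IsTestFunction T φ) (t : ℝ) (k : ℤ) :
    perCoeff (fun x => deriv (φ t) x) k = Complex.I * k * perCoeff (φ t) k :=
  perCoeff_deriv (fun x => (h.hasDerivAt_snd t x).differentiableAt.hasDerivAt) (h.deriv_snd.continuous_snd t)
    (h.periodic t) k

/-- Two derivatives in `x` give decay `k^(-2)` uniformly in time, which is summable and dominates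
the later interchange of sum and time integral. -/
theorem perCoeff_decay (h : IsTestFunction T φ) : ∃ C, ∀ t (k : ℤ), (1 + (k : ℝ) ^ 2) * ‖perCoeff (φ t) k‖ ≤ C := by
  obtain ⟨C₁, hC₁⟩ := h.exists_bound
  obtain ⟨C₂, hC₂⟩ := h.deriv_snd.deriv_snd.exists_bound
  refine ⟨C₁ + C₂, fun t k => ?_⟩
  have h1 := norm_perCoeff_le (hC₁ t) k
  have h2 := norm_perCoeff_le (hC₂ t) k
  rw [h.deriv_snd.perCoeff_deriv_snd, h.perCoeff_deriv_snd] at h2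
  simp only [norm_mul, Complex.norm_I, one_mul, Complex.norm_intCast] at h2
  rw [← mul_assoc, ← sq, sq_abs] at h2
  linarith

theorem hasDerivAt_perCoeff (h : IsTestFunction T φ) (k : ℤ) (t : ℝ) :
    HasDerivAt (fun t => perCoeff (φ t) k) (perCoeff (fun x => deriv (fun r => φ r x) t) k) t := by
  obtain ⟨C, hC⟩ := h.deriv_fst.exists_bound
  have hcont : ∀ {ψ : ℝ → ℂ}, Continuous ψ → Continuous fun x : ℝ => Complex.exp (-(Complex.I * k * x)) * ψ x :=
    fun hψ => by fun_prop
  have := (intervalIntegral.hasDerivAt_integral_of_dominated_loc_of_deriv_le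
    (μ := volume) (a := 0) (b := 2 * Real.pi) (s := Set.univ) (x₀ := t) (bound := fun _ => C)
    (F := fun t x => Complex.exp (-(Complex.I * k * x)) * φ t x)
    (F' := fun t x => Complex.exp (-(Complex.I * k * x)) * deriv (fun r => φ r x) t) univ_mem
    (Eventually.of_forall fun t => (hcont (h.continuous_snd t)).aestronglyMeasurable)
    ((hcont (h.continuous_snd t)).intervalIntegrable _ _)
    (hcont (h.deriv_fst.continuous_snd t)).aestronglyMeasurable
    (Eventually.of_forall fun x _ t _ => by rw [norm_mul, norm_exp_I_mul, one_mul]; exact hC t x)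
    intervalIntegrable_const
    (Eventually.of_forall fun x _ t _ =>
      ((h.hasDerivAt_fst t x).differentiableAt.hasDerivAt).const_mul _)).2
  exact this.const_mul _

theorem continuous_perCoeff (h : IsTestFunction T φ) (k : ℤ) : Continuous fun t => perCoeff (φ t) k :=
  continuous_iff_continuousAt.2 fun t => (h.hasDerivAt_perCoeff k t).continuousAt

theorem perCoeff_eq_zero (h : IsTestFunction T φ) {t : ℝ} (ht : T ≤ |t|) (k : ℤ) : perCoeff (φ t) k = 0 := by
  obtain ⟨T', hT', h0⟩ := h.compact_support
  have : φ t = fun _ => 0 := funext fun x => h0 t x (hT'.le.trans ht)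
  rw [perCoeff, this]; simp

theorem iteratedDeriv_three (t x : ℝ) :
    iteratedDeriv 3 (φ t) x = deriv (fun x => deriv (fun x => deriv (φ t) x) x) x := by
  rw [iteratedDeriv_succ, iteratedDeriv_succ, iteratedDeriv_one]

end IsTestFunction

/-! ### From the equations for the modes to the distributional equation. -/

/-- Termwise integration in time of the pairing of a family of functions on the torus with
a test function. -/
theorem hasSum_integral_pairing {T M : ℝ} (hT : 0 ≤ T) {G : ℝ → Torus → ℂ}
    (hG : ∀ t ∈ Set.Icc (-T) T, Integrable (G t) torusMeasure)
    (hM : ∀ t ∈ Set.Icc (-T) T, ∀ n, ‖fourierCoeff (G t) n‖ ≤ M)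
    {φ : ℝ → ℝ → ℂ} (h : IsTestFunction T φ)
    (hc : ∀ n, ContinuousOn (fun t => fourierCoeff (G t) (-n) * perCoeff (φ t) n) (Set.Icc (-T) T)) :
    HasSum (fun n : ℤ => ∫ t in (-T)..T, 2 * Real.pi * (fourierCoeff (G t) (-n) * perCoeff (φ t) n))
      (∫ t in (-T)..T, ∫ x in (0 : ℝ)..(2 * Real.pi), G t (x : Torus) * φ t x) := by
  have hle : -T ≤ T := by linarith
  have hM0 : 0 ≤ M := (norm_nonneg _).trans (hM 0 ⟨by linarith, hT⟩ 0)
  obtain ⟨C, hC⟩ := h.perCoeff_decay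
  have hpi := Real.two_pi_pos
  have hmem : ∀ {t}, t ∈ Set.uIoc (-T) T → t ∈ Set.Icc (-T) T := fun {t} ht => by
    rw [Set.uIoc_of_le hle] at ht; exact ⟨ht.1.le, ht.2⟩
  refine intervalIntegral.hasSum_integral_of_dominated_convergence
    (fun n _ => 2 * Real.pi * M * C * (1 / (1 + (n : ℝ) ^ 2))) (fun n => ?_)
    (fun n => Eventually.of_forall fun t ht => ?_)
    (Eventually.of_forall fun t _ => summable_inv_one_add_sq.mul_left _)
    intervalIntegrable_const (Eventually.of_forall fun t ht => ?_)
  · rw [Set.uIoc_of_le hle]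
    exact ((continuousOn_const.mul (hc n)).mono Set.Ioc_subset_Icc_self).aestronglyMeasurable measurableSet_Ioc
  · have h1 := hM t (hmem ht) (-n)
    have h2 := hC t n
    have h3 : ‖perCoeff (φ t) n‖ ≤ C * (1 / (1 + (n : ℝ) ^ 2)) := by
      rw [mul_one_div, le_div_iff₀ (by positivity), mul_comm]; exact h2
    have h4 : ‖(2 * Real.pi : ℂ)‖ = 2 * Real.pi := by
      rw [show (2 * Real.pi : ℂ) = ((2 * Real.pi : ℝ) : ℂ) by push_cast; rfl, Complex.norm_real,
        Real.norm_eq_abs, abs_of_pos hpi]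
    rw [norm_mul, h4, norm_mul]
    calc _ ≤ 2 * Real.pi * (M * (C * (1 / (1 + (n : ℝ) ^ 2)))) := by gcongr
      _ = _ := by ring
  · exact hasSum_pairing (hG t (hmem ht)) (h.continuous_snd t) (h.periodic t) (hC t)

/-- A family of functions whose Fourier coefficients solve the differential equations
`u_n' = i n³ u_n + i σ n F_n` is a solution in the sense of distributions. -/
theorem isDistribSolution_of_hasDerivAt {σ T M : ℝ} (hT : 0 ≤ T) {u : ℝ → L2T}
    (hfin : ∀ t ∈ Set.Icc (-T) T, ∑' n, ‖fourierCoeff (u t) n‖ₑ ^ (4 / 3 : ℝ) ≠ ⊤)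
    (hM : ∀ t ∈ Set.Icc (-T) T, ∀ n, ‖fourierCoeff (u t) n‖ ≤ M ∧ ‖fluxCoeff (u t) n‖ ≤ M)
    (hu : ∀ n, ContinuousOn (fun t => fourierCoeff (u t) n) (Set.Icc (-T) T))
    (hF : ∀ n : ℤ, ContinuousOn (fun t => n * fluxCoeff (u t) n) (Set.Icc (-T) T))
    (hd : ∀ n : ℤ, ∀ t ∈ Set.Ioo (-T) T, HasDerivAt (fun t => fourierCoeff (u t) n)
      (Complex.I * n ^ 3 * fourierCoeff (u t) n + Complex.I * σ * (n * fluxCoeff (u t) n)) t) :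
    IsDistribSolution σ T u := by
  intro φ hφ
  have hle : -T ≤ T := by linarith
  have hφ3 := hφ.deriv_snd.deriv_snd.deriv_snd
  have hΨ := hφ.deriv_fst.add hφ3
  have hper3 : ∀ t (k : ℤ), perCoeff (fun x => deriv (fun x => deriv (fun x => deriv (φ t) x) x) x) k =
      (Complex.I * k) ^ 3 * perCoeff (φ t) k := by
    intro t k
    rw [hφ.deriv_snd.deriv_snd.perCoeff_deriv_snd, hφ.deriv_snd.perCoeff_deriv_snd, hφ.perCoeff_deriv_snd]
    ring
  have hperΨ : ∀ t (k : ℤ), perCoeff (fun x => deriv (fun r => φ r x) t +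
      deriv (fun x => deriv (fun x => deriv (φ t) x) x) x) k =
      perCoeff (fun x => deriv (fun r => φ r x) t) k + (Complex.I * k) ^ 3 * perCoeff (φ t) k := by
    intro t k
    rw [← hper3, perCoeff, perCoeff, perCoeff, ← mul_add]
    have c1 := hφ.deriv_fst.continuous_snd t
    have c2 := hφ3.continuous_snd t
    rw [← intervalIntegral.integral_add]
    · simp only [mul_add]
    · exact Continuous.intervalIntegrable (by fun_prop) _ _
    · exact Continuous.intervalIntegrable (by fun_prop) _ _
  have hL := hasSum_integral_pairing hT (G := fun t => u t)
    (fun t _ => (memLp_L2T (u t)).integrable (by norm_num)) (fun t ht n => (hM t ht n).1) hΨ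
    (fun n => (hu (-n)).mul (hΨ.continuous_perCoeff n).continuousOn)
  have hR := hasSum_integral_pairing hT (G := fun t x => u t x ^ 3 / 3 - (meanSq (u t) : ℂ) * u t x)
    (fun t ht => integrable_flux (hfin t ht)) (fun t ht n => (hM t ht n).2) hφ.deriv_snd
    (fun n => by
      -- The factor `n` produced by the `x`-derivative of the test function is moved onto the flux,
      -- whose continuity in time is only assumed after multiplication by the frequency.
      have e : (fun t => fourierCoeff (fun x => u t x ^ 3 / 3 - (meanSq (u t) : ℂ) * u t x) (-n) *
          perCoeff (fun x => deriv (φ t) x) n) =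
          fun t => (((-n : ℤ) : ℂ) * fluxCoeff (u t) (-n)) * (-Complex.I * perCoeff (φ t) n) := by
        ext t
        rw [hφ.perCoeff_deriv_snd, fluxCoeff]; push_cast; ring
      rw [e]
      exact (hF (-n)).mul (continuous_const.mul (hφ.continuous_perCoeff n)).continuousOn)
  -- The mode `-n` of `u` meets the mode `n` of the test function. The time derivative of their
  -- product integrates to zero because the test function vanishes at `±T`.
  have hterm : ∀ n : ℤ, ∫ t in (-T)..T, 2 * Real.pi * (fourierCoeff (u t) (-n) *
      perCoeff (fun x => deriv (fun r => φ r x) t +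
        deriv (fun x => deriv (fun x => deriv (φ t) x) x) x) n) =
      σ * ∫ t in (-T)..T, 2 * Real.pi * (fourierCoeff (fun x => u t x ^ 3 / 3 - (meanSq (u t) : ℂ) * u t x) (-n) *
        perCoeff (fun x => deriv (φ t) x) n) := by
    intro n
    have hcφ := hφ.continuous_perCoeff n
    have hcφ' := hφ.deriv_fst.continuous_perCoeff n
    have hu' := hu (-n)
    have hF' := hF (-n)
    have hcu : ContinuousOn (fun t => (Complex.I * ((-n : ℤ) : ℂ) ^ 3 * fourierCoeff (u t) (-n) +
          Complex.I * σ * (((-n : ℤ) : ℂ) * fluxCoeff (u t) (-n))) * perCoeff (φ t) n +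
        fourierCoeff (u t) (-n) * perCoeff (fun x => deriv (fun r => φ r x) t) n) (Set.uIcc (-T) T) := by
      rw [Set.uIcc_of_le hle]
      exact (((continuousOn_const.mul hu').add (continuousOn_const.mul hF')).mul hcφ.continuousOn).add
        (hu'.mul hcφ'.continuousOn)
    have h1 := intervalIntegral.integral_eq_sub_of_hasDerivAt_of_le hle
      (f := fun t => fourierCoeff (u t) (-n) * perCoeff (φ t) n)
      (hu'.mul hcφ.continuousOn)
      (fun t ht => (hd (-n) t ht).mul (hφ.hasDerivAt_perCoeff n t)) hcu.intervalIntegrable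
    have hTabs : T ≤ |(-T)| := by rw [abs_neg]; exact le_abs_self T
    simp only [hφ.perCoeff_eq_zero (le_abs_self T), hφ.perCoeff_eq_zero hTabs, mul_zero, sub_zero] at h1
    rw [← intervalIntegral.integral_const_mul, ← sub_eq_zero, ← intervalIntegral.integral_sub]
    · rw [← mul_zero (2 * Real.pi : ℂ), ← h1, ← intervalIntegral.integral_const_mul]
      refine intervalIntegral.integral_congr fun t _ => ?_
      rw [hperΨ, hφ.perCoeff_deriv_snd, fluxCoeff]
      have hI : Complex.I ^ 3 = -Complex.I := Complex.I_pow_three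
      push_cast
      rw [mul_pow, hI]
      ring
    · refine ContinuousOn.intervalIntegrable ?_
      rw [Set.uIcc_of_le hle]
      exact continuousOn_const.mul (hu'.mul (hΨ.continuous_perCoeff n).continuousOn)
    · refine ContinuousOn.intervalIntegrable ?_
      rw [Set.uIcc_of_le hle]
      have e : (fun t => (σ : ℂ) * (2 * Real.pi * (fourierCoeff (fun x => u t x ^ 3 / 3 - (meanSq (u t) : ℂ) * u t x) (-n) *
          perCoeff (fun x => deriv (φ t) x) n))) =
          fun t => σ * (2 * Real.pi * ((((-n : ℤ) : ℂ) * fluxCoeff (u t) (-n)) * (-Complex.I * perCoeff (φ t) n))) := by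
        ext t
        rw [hφ.perCoeff_deriv_snd, fluxCoeff]; push_cast; ring
      rw [e]
      exact continuousOn_const.mul (continuousOn_const.mul
        (hF'.mul (continuous_const.mul hcφ).continuousOn))
  simp only [IsTestFunction.iteratedDeriv_three]
  refine hL.unique (hasSum_of_eq (hR.mul_left (σ : ℂ)) (fun n => hterm n) rfl)

/-! ### From the distributional equation to integral equations for the modes. -/

theorem exists_bump {T : ℝ} (hT : 0 < T) : ∃ ρ : ℝ → ℝ, ContDiff ℝ (⊤ : ℕ∞) ρ ∧ (∃ T' < T, ∀ t, T' ≤ |t| → ρ t = 0) ∧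
    ∫ t in (-T)..T, ρ t = 1 := by
  let f : ContDiffBump (0 : ℝ) := ⟨T / 4, T / 2, by linarith, by linarith⟩
  have hz : ∀ t, T / 2 ≤ |t| → f.normed volume t = 0 := by
    intro t ht
    rw [ContDiffBump.normed_def, f.zero_of_le_dist (by rw [Real.dist_eq, sub_zero]; exact ht), zero_div]
  refine ⟨f.normed volume, f.contDiff_normed, ⟨T / 2, by linarith, hz⟩, ?_⟩
  rw [intervalIntegral.integral_of_le (by linarith), ← f.integral_normed (μ := volume)]
  refine setIntegral_eq_integral_of_forall_compl_eq_zero fun t ht => hz t ?_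
  by_contra h
  have := abs_lt.1 (not_le.1 h)
  exact ht ⟨by linarith, by linarith⟩

/-- A smooth function of integral zero supported in `(-T, T)` is the derivative of a smooth function
supported in `(-T, T)`. -/
theorem exists_primitive {T : ℝ} (hT : 0 < T) {ψ : ℝ → ℝ} (hψ : ContDiff ℝ (⊤ : ℕ∞) ψ)
    (hs : ∃ T' < T, ∀ t, T' ≤ |t| → ψ t = 0) (h0 : ∫ t in (-T)..T, ψ t = 0) :
    ∃ χ : ℝ → ℝ, ContDiff ℝ (⊤ : ℕ∞) χ ∧ (∃ T' < T, ∀ t, T' ≤ |t| → χ t = 0) ∧ ∀ t, HasDerivAt χ (ψ t) t := by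
  have hd : ∀ t, HasDerivAt (fun t => ∫ r in (-T)..t, ψ r) (ψ t) t := fun t =>
    intervalIntegral.integral_hasDerivAt_right (hψ.continuous.intervalIntegrable _ _)
      hψ.continuous.stronglyMeasurable.stronglyMeasurableAtFilter hψ.continuous.continuousAt
  refine ⟨fun t => ∫ r in (-T)..t, ψ r, ?_, ?_, hd⟩
  · rw [contDiff_infty_iff_deriv]
    refine ⟨fun t => (hd t).differentiableAt, ?_⟩
    rw [show deriv (fun t => ∫ r in (-T)..t, ψ r) = ψ from funext fun t => (hd t).deriv]
    exact hψ
  · obtain ⟨T', hT', hz⟩ := hs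
    have hneg : ∀ a b, T' ≤ a → a ≤ b → ∫ r in a..b, ψ r = 0 := by
      intro a b ha hab
      refine (intervalIntegral.integral_congr (g := fun _ => 0) fun r hr => ?_).trans (by simp)
      rw [Set.uIcc_of_le hab] at hr
      exact hz r (ha.trans (hr.1.trans (le_abs_self r)))
    have hneg' : ∀ a b, b ≤ -T' → a ≤ b → ∫ r in a..b, ψ r = 0 := by
      intro a b ha hab
      refine (intervalIntegral.integral_congr (g := fun _ => 0) fun r hr => ?_).trans (by simp)
      rw [Set.uIcc_of_le hab] at hr
      exact hz r (by have := hr.2; linarith [neg_abs_le r])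
    refine ⟨max T' 0, max_lt hT' hT, fun t ht => ?_⟩
    have ht' := (le_max_left T' 0).trans ht
    change ∫ r in (-T)..t, ψ r = 0
    have hI := fun a b => hψ.continuous.intervalIntegrable (μ := volume) a b
    rcases le_total 0 t with h | h
    · rw [abs_of_nonneg h] at ht'
      rw [← intervalIntegral.integral_add_adjacent_intervals (hI (-T) T) (hI T t), h0, zero_add]
      rcases le_total T t with h2 | h2
      · exact hneg T t hT'.le h2
      · rw [intervalIntegral.integral_symm, hneg t T ht' h2, neg_zero]
    · rw [abs_of_nonpos h] at ht'
      rcases le_total (-T) t with h2 | h2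
      · exact hneg' _ _ (by linarith) h2
      · rw [intervalIntegral.integral_symm, hneg' _ _ (by linarith) h2, neg_zero]

theorem eqOn_Icc_of_ae {T : ℝ} (hT : 0 < T) {f g : ℝ → ℂ} (hf : ContinuousOn f (Set.Icc (-T) T))
    (hg : ContinuousOn g (Set.Icc (-T) T)) (h : ∀ᵐ t, t ∈ Set.Ioo (-T) T → f t = g t) :
    ∀ t ∈ Set.Icc (-T) T, f t = g t := by
  have hlt : -T < T := by linarith
  have h1 : f =ᵐ[volume.restrict (Set.Icc (-T) T)] g := by
    rw [← restrict_Ioo_eq_restrict_Icc]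
    exact (ae_restrict_iff' measurableSet_Ioo).2 h
  exact fun t ht => Measure.eqOn_Icc_of_ae_eq volume hlt.ne h1 hf hg ht

/-- The lemma of du Bois-Reymond. -/
theorem const_of_integral_deriv {T : ℝ} (hT : 0 < T) {h : ℝ → ℂ} (hc : ContinuousOn h (Set.Icc (-T) T))
    (h0 : ∀ χ χ' : ℝ → ℝ, ContDiff ℝ (⊤ : ℕ∞) χ → (∃ T' < T, ∀ t, T' ≤ |t| → χ t = 0) →
      (∀ t, HasDerivAt χ (χ' t) t) → ∫ t in (-T)..T, (χ' t : ℂ) * h t = 0) :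
    ∃ c, ∀ t ∈ Set.Icc (-T) T, h t = c := by
  have hle : -T ≤ T := by linarith
  obtain ⟨ρ, hρ, hρs, hρ1⟩ := exists_bump hT
  set c := ∫ t in (-T)..T, (ρ t : ℂ) * h t with hcdef
  refine ⟨c, eqOn_Icc_of_ae hT hc continuousOn_const ?_⟩
  have hcI : ∀ {ψ : ℝ → ℝ}, Continuous ψ → IntervalIntegrable (fun t => (ψ t : ℂ) * h t) volume (-T) T := by
    intro ψ hψ
    refine ContinuousOn.intervalIntegrable ?_
    rw [Set.uIcc_of_le hle]
    exact (Complex.continuous_ofReal.comp hψ).continuousOn.mul hc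
  have key := isOpen_Ioo.ae_eq_zero_of_integral_contDiff_smul_eq_zero (μ := volume) (U := Set.Ioo (-T) T)
    (f := fun t => h t - c)
    (((hc.sub continuousOn_const).mono Set.Ioo_subset_Icc_self).locallyIntegrableOn measurableSet_Ioo)
    fun ψ hψ hcs hsupp => by
      have hs : ∃ T' < T, ∀ t, T' ≤ |t| → ψ t = 0 := by
        rcases (tsupport ψ).eq_empty_or_nonempty with he | hne
        · refine ⟨0, hT, fun t _ => ?_⟩
          exact image_eq_zero_of_notMem_tsupport (by rw [he]; simp)
        · obtain ⟨t₀, ht₀, hmax⟩ := hcs.isCompact.exists_isMaxOn hne continuous_abs.continuousOn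
          have h1 := hsupp ht₀
          have h2 : |t₀| < T := abs_lt.2 ⟨h1.1, h1.2⟩
          refine ⟨(|t₀| + T) / 2, by linarith, fun t ht => ?_⟩
          refine image_eq_zero_of_notMem_tsupport fun hmem => ?_
          have : |t| ≤ |t₀| := hmax hmem
          linarith
      have e1 : ∫ t, ψ t • (h t - c) = ∫ t in (-T)..T, (ψ t : ℂ) * (h t - c) := by
        rw [intervalIntegral.integral_of_le hle]
        simp only [Complex.real_smul]
        refine (setIntegral_eq_integral_of_forall_compl_eq_zero fun t ht => ?_).symm
        have : ψ t = 0 := image_eq_zero_of_notMem_tsupport fun hmem =>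
          ht (Set.Ioo_subset_Ioc_self (hsupp hmem))
        simp [this]
      rw [e1]
      set m := ∫ t in (-T)..T, ψ t with hm
      -- Subtracting a multiple of the fixed bump `ρ` makes the integral vanish, so the result is
      -- the derivative of an admissible test function.
      have hψ0 : ContDiff ℝ (⊤ : ℕ∞) fun t => ψ t - m * ρ t := hψ.sub (contDiff_const.mul hρ)
      have iψ := hψ.continuous.intervalIntegrable (μ := volume) (-T) T
      have iρ := hρ.continuous.intervalIntegrable (μ := volume) (-T) T
      obtain ⟨χ, hχ, hχs, hχd⟩ := exists_primitive hT hψ0 (by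
        obtain ⟨T₁, hT₁, h₁⟩ := hs
        obtain ⟨T₂, hT₂, h₂⟩ := hρs
        refine ⟨max T₁ T₂, max_lt hT₁ hT₂, fun t ht => ?_⟩
        rw [h₁ t ((le_max_left _ _).trans ht), h₂ t ((le_max_right _ _).trans ht)]; simp) (by
        rw [intervalIntegral.integral_sub iψ (iρ.const_mul m), intervalIntegral.integral_const_mul, hρ1]
        simp [hm])
      have h3 := h0 χ _ hχ hχs hχd
      have e2 : ∫ t in (-T)..T, ((ψ t - m * ρ t : ℝ) : ℂ) * h t =
          (∫ t in (-T)..T, (ψ t : ℂ) * h t) - m * c := by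
        rw [hcdef, ← intervalIntegral.integral_const_mul, ← intervalIntegral.integral_sub (hcI hψ.continuous)
          ((hcI hρ.continuous).const_mul _)]
        refine intervalIntegral.integral_congr fun t _ => ?_
        push_cast; ring
      rw [e2] at h3
      have e3 : ∫ t in (-T)..T, (ψ t : ℂ) * (h t - c) = (∫ t in (-T)..T, (ψ t : ℂ) * h t) - m * c := by
        have e4 : ((m : ℝ) : ℂ) = ∫ t in (-T)..T, (ψ t : ℂ) := by
          rw [hm]; exact intervalIntegral.integral_ofReal.symm
        rw [e4, ← intervalIntegral.integral_mul_const, ← intervalIntegral.integral_sub (hcI hψ.continuous)]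
        · simp only [mul_sub]
        · exact Continuous.intervalIntegrable
            ((Complex.continuous_ofReal.comp hψ.continuous).mul continuous_const) _ _
      rw [e3, h3]
  filter_upwards [key] with t ht hmem
  exact sub_eq_zero.1 (ht hmem)

/-- If `f' = g` in the sense of distributions on `(-T, T)`, with `f` and `g` continuous on `[-T, T]`, then
`f` is a primitive of `g`. -/
theorem eq_primitive_of_weak_deriv {T : ℝ} (hT : 0 < T) {f g : ℝ → ℂ} (hf : ContinuousOn f (Set.Icc (-T) T))
    (hg : ContinuousOn g (Set.Icc (-T) T))
    (h : ∀ χ χ' : ℝ → ℝ, ContDiff ℝ (⊤ : ℕ∞) χ → (∃ T' < T, ∀ t, T' ≤ |t| → χ t = 0) →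
      (∀ t, HasDerivAt χ (χ' t) t) →
      ∫ t in (-T)..T, (χ' t : ℂ) * f t = -∫ t in (-T)..T, (χ t : ℂ) * g t) :
    ∀ t ∈ Set.Icc (-T) T, f t = f 0 + ∫ r in (0 : ℝ)..t, g r := by
  have hle : -T ≤ T := by linarith
  have h0mem : (0 : ℝ) ∈ Set.Icc (-T) T := ⟨by linarith, hT.le⟩
  have hgi : IntegrableOn g (Set.Icc (-T) T) := hg.integrableOn_Icc
  set P : ℝ → ℂ := fun t => ∫ r in (0 : ℝ)..t, g r with hP
  have hPc : ContinuousOn P (Set.Icc (-T) T) := by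
    have := intervalIntegral.continuousOn_primitive_interval' (μ := volume) (f := g) (a := 0) (b₁ := -T) (b₂ := T)
      (by rw [← Set.uIcc_of_le hle] at hg; exact hg.intervalIntegrable) (by rw [Set.uIcc_of_le hle]; exact h0mem)
    rwa [Set.uIcc_of_le hle] at this
  have hPd : ∀ t ∈ Set.Ioo (-T) T, HasDerivAt P (g t) t := by
    intro t ht
    have hsub : Set.uIcc 0 t ⊆ Set.Icc (-T) T := Set.uIcc_subset_Icc h0mem ⟨ht.1.le, ht.2.le⟩
    refine intervalIntegral.integral_hasDerivAt_right ((hg.mono hsub).intervalIntegrable) ?_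
      (hg.continuousAt (Icc_mem_nhds ht.1 ht.2))
    exact (hg.mono Set.Ioo_subset_Icc_self).stronglyMeasurableAtFilter isOpen_Ioo t ht
  obtain ⟨c, hc⟩ := const_of_integral_deriv hT (hf.sub hPc) fun χ χ' hχ hχs hχd => by
    have hχ' : Continuous χ' := by
      rw [← show deriv χ = χ' from funext fun t => (hχd t).deriv]
      exact hχ.continuous_deriv (by simp)
    have cχ := Complex.continuous_ofReal.comp hχ.continuous
    have cχ' := Complex.continuous_ofReal.comp hχ'
    have i1 : IntervalIntegrable (fun t => (χ' t : ℂ) * f t) volume (-T) T := by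
      refine ContinuousOn.intervalIntegrable ?_
      rw [Set.uIcc_of_le hle]; exact cχ'.continuousOn.mul hf
    have i2 : IntervalIntegrable (fun t => (χ' t : ℂ) * P t) volume (-T) T := by
      refine ContinuousOn.intervalIntegrable ?_
      rw [Set.uIcc_of_le hle]; exact cχ'.continuousOn.mul hPc
    have i3 : IntervalIntegrable (fun t => (χ t : ℂ) * g t) volume (-T) T := by
      refine ContinuousOn.intervalIntegrable ?_
      rw [Set.uIcc_of_le hle]; exact cχ.continuousOn.mul hg
    have h1 := intervalIntegral.integral_eq_sub_of_hasDerivAt_of_le hle (f := fun t => (χ t : ℂ) * P t)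
      (cχ.continuousOn.mul hPc) (fun t ht => ((hχd t).ofReal_comp).mul (hPd t ht)) (i2.add i3)
    obtain ⟨T', hT', hz⟩ := hχs
    have z1 : χ T = 0 := hz T (hT'.le.trans (le_abs_self T))
    have z2 : χ (-T) = 0 := hz (-T) (by rw [abs_neg]; exact hT'.le.trans (le_abs_self T))
    rw [intervalIntegral.integral_add i2 i3, z1, z2] at h1
    have h2 := h χ χ' hχ ⟨T', hT', hz⟩ hχd
    have h3 : ∫ t in (-T)..T, (χ' t : ℂ) * (f - P) t =
        (∫ t in (-T)..T, (χ' t : ℂ) * f t) - ∫ t in (-T)..T, (χ' t : ℂ) * P t := by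
      rw [← intervalIntegral.integral_sub i1 i2]
      simp only [Pi.sub_apply, mul_sub]
    refine h3.trans ?_
    rw [h2]
    simp only [Complex.ofReal_zero, zero_mul, sub_zero] at h1
    linear_combination -h1
  intro t ht
  have h1 : f t - P t = c := hc t ht
  have h2 : f 0 - P 0 = c := hc 0 h0mem
  have h3 : P 0 = 0 := by simp [hP]
  have : f t = f 0 + P t := by rw [h3] at h2; linear_combination h1 - h2
  exact this

theorem fourierCoeff_eq_perIntegral (G : Torus → ℂ) (n : ℤ) :
    ∫ x in (0 : ℝ)..(2 * Real.pi), G (x : Torus) * Complex.exp (-(Complex.I * n * x)) =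
      2 * Real.pi * fourierCoeff G n := by
  have hpi : (Real.pi : ℂ) ≠ 0 := by exact_mod_cast Real.pi_ne_zero
  rw [fourierCoeff, show AddCircle.haarAddCircle = torusMeasure from rfl, integral_torus]
  have e : ∀ x : ℝ, fourier (-n) (x : Torus) • G x = G x * Complex.exp (-(Complex.I * n * x)) := by
    intro x
    rw [fourier_coe, smul_eq_mul, mul_comm]; congr 2; push_cast; ring
  simp_rw [e]
  push_cast
  field_simp

theorem hasDerivAt_exp_mul_I (n : ℤ) (x : ℝ) : HasDerivAt (fun x : ℝ => Complex.exp (-(Complex.I * n * x)))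
    (-(Complex.I * n) * Complex.exp (-(Complex.I * n * x))) x := by
  have h1 : HasDerivAt (fun x : ℝ => (-(Complex.I * n * x) : ℂ)) (-(Complex.I * n * 1)) x :=
    ((Complex.ofRealCLM.hasDerivAt (x := x)).const_mul (Complex.I * (n : ℂ))).neg
  convert h1.cexp using 1
  ring

theorem isTestFunction_mul_exp {T : ℝ} {θ : ℝ → ℂ} (hθ : ContDiff ℝ (⊤ : ℕ∞) θ)
    (hs : ∃ T' < T, ∀ t, T' ≤ |t| → θ t = 0) (n : ℤ) :
    IsTestFunction T fun t x => θ t * Complex.exp (-(Complex.I * n * x)) where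
  smooth := by
    have h1 : ContDiff ℝ (⊤ : ℕ∞) fun z : ℝ × ℝ => θ z.1 := hθ.comp contDiff_fst
    have h2 : ContDiff ℝ (⊤ : ℕ∞) fun z : ℝ × ℝ => ((z.2 : ℝ) : ℂ) :=
      Complex.ofRealCLM.contDiff.comp contDiff_snd
    exact h1.mul (Complex.contDiff_exp.comp ((contDiff_const.mul h2).neg))
  periodic t x := by
    congr 1
    rw [show -(Complex.I * n * ((x + 2 * Real.pi : ℝ) : ℂ)) =
      -(Complex.I * n * x) - n * (2 * Real.pi * Complex.I) by push_cast; ring, Complex.exp_sub,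
      Complex.exp_int_mul_two_pi_mul_I, div_one]
  compact_support := by
    obtain ⟨T', hT', h0⟩ := hs
    exact ⟨T', hT', fun t x ht => by rw [h0 t ht, zero_mul]⟩

/-- The Fourier coefficients of a solution in the sense of distributions satisfy the integral equation. -/
theorem IsDistribSolution.eq_integral {σ T : ℝ} (hT : 0 < T) {u : ℝ → L2T} (h : IsDistribSolution σ T u) (n : ℤ)
    (hu : ContinuousOn (fun t => fourierCoeff (u t) n) (Set.Icc (-T) T))
    (hF : ContinuousOn (fun t => n * fluxCoeff (u t) n) (Set.Icc (-T) T)) :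
    ∀ t ∈ Set.Icc (-T) T, Complex.exp (-(Complex.I * (n ^ 3 : ℤ) * t)) * fourierCoeff (u t) n =
      fourierCoeff (u 0) n + ∫ r in (0 : ℝ)..t, Complex.I * σ *
        (Complex.exp (-(Complex.I * (n ^ 3 : ℤ) * r)) * (n * fluxCoeff (u r) n)) := by
  have hle : -T ≤ T := by linarith
  have hexp : Continuous fun t : ℝ => Complex.exp (-(Complex.I * (n ^ 3 : ℤ) * t)) := by fun_prop
  have := eq_primitive_of_weak_deriv hT (hexp.continuousOn.mul hu)
    ((continuousOn_const (c := Complex.I * σ)).mul (hexp.continuousOn.mul hF)) fun χ χ' hχ hχs hχd => by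
    -- The test function is `χ(t)` times the plane wave `exp(-i(n³t + nx))`, on which `∂_t + ∂_x³`
    -- vanishes; only `χ'` survives on the linear side.
    have hdθ : ∀ t, HasDerivAt (fun t : ℝ => (χ t : ℂ) * Complex.exp (-(Complex.I * (n ^ 3 : ℤ) * t)))
        (χ' t * Complex.exp (-(Complex.I * (n ^ 3 : ℤ) * t)) +
          χ t * (-(Complex.I * (n ^ 3 : ℤ)) * Complex.exp (-(Complex.I * (n ^ 3 : ℤ) * t)))) t := fun t =>
      ((hχd t).ofReal_comp).mul (hasDerivAt_exp_mul_I (n ^ 3) t)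
    have hθ : ContDiff ℝ (⊤ : ℕ∞) fun t : ℝ => (χ t : ℂ) * Complex.exp (-(Complex.I * (n ^ 3 : ℤ) * t)) :=
      (Complex.ofRealCLM.contDiff.comp hχ).mul
        (Complex.contDiff_exp.comp ((contDiff_const.mul Complex.ofRealCLM.contDiff).neg))
    have hφ := isTestFunction_mul_exp (T := T) hθ (by
      obtain ⟨T', hT', h0⟩ := hχs
      exact ⟨T', hT', fun t ht => by rw [h0 t ht]; simp⟩) n
    have h1 := h _ hφ
    have d1 : ∀ (θ : ℂ) (x : ℝ), deriv (fun x : ℝ => θ * Complex.exp (-(Complex.I * n * x))) x =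
        (θ * -(Complex.I * n)) * Complex.exp (-(Complex.I * n * x)) := by
      intro θ x
      rw [((hasDerivAt_exp_mul_I n x).const_mul θ).deriv]; ring
    have d3 : ∀ (t x : ℝ), iteratedDeriv 3 (fun x : ℝ => (χ t : ℂ) * Complex.exp (-(Complex.I * (n ^ 3 : ℤ) * t)) *
        Complex.exp (-(Complex.I * n * x))) x = (χ t : ℂ) * Complex.exp (-(Complex.I * (n ^ 3 : ℤ) * t)) *
          (-(Complex.I * n)) * (-(Complex.I * n)) * (-(Complex.I * n)) * Complex.exp (-(Complex.I * n * x)) := by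
      intro t x
      rw [iteratedDeriv_succ, iteratedDeriv_succ, iteratedDeriv_one]
      simp_rw [funext (d1 _)]
    have dt : ∀ t x : ℝ, deriv (fun r : ℝ => (χ r : ℂ) * Complex.exp (-(Complex.I * (n ^ 3 : ℤ) * r)) *
        Complex.exp (-(Complex.I * n * x))) t = (χ' t * Complex.exp (-(Complex.I * (n ^ 3 : ℤ) * t)) +
          χ t * (-(Complex.I * (n ^ 3 : ℤ)) * Complex.exp (-(Complex.I * (n ^ 3 : ℤ) * t)))) *
            Complex.exp (-(Complex.I * n * x)) := fun t x => ((hdθ t).mul_const _).deriv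
    have hI : Complex.I ^ 3 = -Complex.I := Complex.I_pow_three
    have eL : ∀ t x : ℝ, u t (x : Torus) * (deriv (fun r : ℝ => (χ r : ℂ) * Complex.exp (-(Complex.I * (n ^ 3 : ℤ) * r)) *
        Complex.exp (-(Complex.I * n * x))) t + iteratedDeriv 3 (fun x : ℝ => (χ t : ℂ) *
          Complex.exp (-(Complex.I * (n ^ 3 : ℤ) * t)) * Complex.exp (-(Complex.I * n * x))) x) =
        (χ' t * Complex.exp (-(Complex.I * (n ^ 3 : ℤ) * t))) *
          (u t (x : Torus) * Complex.exp (-(Complex.I * n * x))) := by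
      intro t x
      rw [dt, d3]
      push_cast
      linear_combination (-(u t (x : Torus)) * χ t * Complex.exp (-(Complex.I * n ^ 3 * t)) *
        Complex.exp (-(Complex.I * n * x)) * n ^ 3) * hI
    have eR : ∀ t x : ℝ, (u t (x : Torus) ^ 3 / 3 - (meanSq (u t) : ℂ) * u t (x : Torus)) *
        deriv (fun x : ℝ => (χ t : ℂ) * Complex.exp (-(Complex.I * (n ^ 3 : ℤ) * t)) *
          Complex.exp (-(Complex.I * n * x))) x =
        (χ t * Complex.exp (-(Complex.I * (n ^ 3 : ℤ) * t)) * -(Complex.I * n)) *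
          ((u t (x : Torus) ^ 3 / 3 - (meanSq (u t) : ℂ) * u t (x : Torus)) *
            Complex.exp (-(Complex.I * n * x))) := by
      intro t x
      rw [d1]; ring
    simp_rw [eL, eR, intervalIntegral.integral_const_mul] at h1
    have f1 : ∀ t, ∫ x in (0 : ℝ)..(2 * Real.pi), u t (x : Torus) * Complex.exp (-(Complex.I * n * x)) =
        (2 * Real.pi : ℂ) * fourierCoeff (u t) n := fun t => fourierCoeff_eq_perIntegral (u t) n
    have f2 : ∀ t, ∫ x in (0 : ℝ)..(2 * Real.pi), (u t (x : Torus) ^ 3 / 3 - (meanSq (u t) : ℂ) * u t (x : Torus)) *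
        Complex.exp (-(Complex.I * n * x)) = (2 * Real.pi : ℂ) *
          fourierCoeff (fun x => u t x ^ 3 / 3 - (meanSq (u t) : ℂ) * u t x) n :=
      fun t => fourierCoeff_eq_perIntegral (fun x => u t x ^ 3 / 3 - (meanSq (u t) : ℂ) * u t x) n
    simp_rw [f1, f2] at h1
    have hpi : (2 * Real.pi : ℂ) ≠ 0 := by exact_mod_cast Real.two_pi_pos.ne'
    have g1 : ∫ t in (-T)..T, (χ' t : ℂ) * Complex.exp (-(Complex.I * (n ^ 3 : ℤ) * t)) *
        (2 * Real.pi * fourierCoeff (u t) n) = (2 * Real.pi) * ∫ t in (-T)..T, (χ' t : ℂ) *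
          (Complex.exp (-(Complex.I * (n ^ 3 : ℤ) * t)) * fourierCoeff (u t) n) := by
      rw [← intervalIntegral.integral_const_mul]
      refine intervalIntegral.integral_congr fun t _ => ?_
      ring
    have g2 : (σ : ℂ) * ∫ t in (-T)..T, (χ t : ℂ) * Complex.exp (-(Complex.I * (n ^ 3 : ℤ) * t)) * -(Complex.I * n) *
        (2 * Real.pi * fourierCoeff (fun x => u t x ^ 3 / 3 - (meanSq (u t) : ℂ) * u t x) n) =
        (2 * Real.pi) * -∫ t in (-T)..T, (χ t : ℂ) * (Complex.I * σ *
          (Complex.exp (-(Complex.I * (n ^ 3 : ℤ) * t)) * (n * fluxCoeff (u t) n))) := by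
      rw [← intervalIntegral.integral_const_mul, ← intervalIntegral.integral_neg,
        ← intervalIntegral.integral_const_mul]
      refine intervalIntegral.integral_congr fun t _ => ?_
      simp only [fluxCoeff]; ring
    exact mul_left_cancel₀ hpi (g1.symm.trans (h1.trans g2))
  intro t ht
  have h1 := this t ht
  simpa using h1

/-! ### Plancherel in time: modulation weights and increments. -/

/-- Translation on `L²(ℝ)`. -/
def transLp (h : ℝ) (f : Lp ℂ 2 (volume : Measure ℝ)) : Lp ℂ 2 (volume : Measure ℝ) :=
  Lp.compMeasurePreserving (fun t => t + h) (measurePreserving_add_right volume h) f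

theorem coeFn_transLp (h : ℝ) (f : Lp ℂ 2 (volume : Measure ℝ)) :
    transLp h f =ᵐ[volume] fun t => f (t + h) :=
  Lp.coeFn_compMeasurePreserving f _

theorem transLp_sub (h : ℝ) (f g : Lp ℂ 2 (volume : Measure ℝ)) :
    transLp h (f - g) = transLp h f - transLp h g :=
  map_sub (Lp.compMeasurePreserving (fun t : ℝ => t + h) (measurePreserving_add_right volume h)) f g

theorem enorm_transLp (h : ℝ) (f : Lp ℂ 2 (volume : Measure ℝ)) : ‖transLp h f‖ₑ = ‖f‖ₑ := by
  rw [← ofReal_norm, ← ofReal_norm]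
  exact congrArg _ (Lp.norm_compMeasurePreserving f _)

theorem fourier_sub_Lp (f g : Lp ℂ 2 (volume : Measure ℝ)) : 𝓕 (f - g) = 𝓕 f - 𝓕 g :=
  map_sub (Lp.fourierTransformₗᵢ ℝ ℂ) f g

theorem fourier_smul_Lp (c : ℂ) (f : Lp ℂ 2 (volume : Measure ℝ)) : 𝓕 (c • f) = c • 𝓕 f :=
  map_smul (Lp.fourierTransformₗᵢ ℝ ℂ) c f

theorem enorm_fourier_Lp (f : Lp ℂ 2 (volume : Measure ℝ)) : ‖(𝓕 f : Lp ℂ 2 (volume : Measure ℝ))‖ₑ = ‖f‖ₑ := by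
  rw [← ofReal_norm, ← ofReal_norm, Lp.norm_fourier_eq]

theorem eLpNorm_eq_enorm_Lp (f : Lp ℂ 2 (volume : Measure ℝ)) : eLpNorm f 2 volume = ‖f‖ₑ := by
  rw [Lp.enorm_def]

theorem norm_exp_I (x : ℝ) : ‖Complex.exp (Complex.I * x)‖ = 1 := by
  rw [mul_comm, Complex.norm_exp_ofReal_mul_I]

theorem enorm_exp_I (x : ℝ) : ‖Complex.exp (Complex.I * x)‖ₑ = 1 := by
  rw [← ofReal_norm, norm_exp_I, ENNReal.ofReal_one]

theorem fourier_transLp_schwartz (h : ℝ) (φ : SchwartzMap ℝ ℂ) :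
    (𝓕 (transLp h (φ.toLp 2)) : Lp ℂ 2 (volume : Measure ℝ)) =ᵐ[volume]
      fun ξ => Complex.exp (Complex.I * ((2 * Real.pi * h * ξ : ℝ) : ℂ)) * (𝓕 (φ.toLp 2) : Lp ℂ 2 (volume : Measure ℝ)) ξ := by
  have e1 : transLp h (φ.toLp 2) = (φ.compSubConstCLM ℂ (-h)).toLp 2 := by
    apply Lp.ext
    have h1 := (measurePreserving_add_right (volume : Measure ℝ) h).quasiMeasurePreserving.ae_eq_comp
      (φ.coeFn_toLp 2 volume)
    filter_upwards [coeFn_transLp h (φ.toLp 2), (φ.compSubConstCLM ℂ (-h)).coeFn_toLp 2 volume, h1] with t h2 h3 h4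
    rw [h2, h3, SchwartzMap.compSubConstCLM_apply, sub_neg_eq_add]
    exact h4
  rw [e1, SchwartzMap.toLp_fourier_eq, SchwartzMap.toLp_fourier_eq]
  filter_upwards [(𝓕 (φ.compSubConstCLM ℂ (-h))).coeFn_toLp 2 volume, (𝓕 φ).coeFn_toLp 2 volume] with ξ h1 h2
  rw [h1, h2, SchwartzMap.fourier_coe, SchwartzMap.fourier_coe, Real.fourier_real_eq_integral_exp_smul,
    Real.fourier_real_eq_integral_exp_smul, ← integral_const_mul,
    ← integral_add_right_eq_self (fun v : ℝ => Complex.exp (Complex.I * ((2 * Real.pi * h * ξ : ℝ) : ℂ)) *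
      Complex.exp (((-2 * Real.pi * v * ξ : ℝ) : ℂ) * Complex.I) • φ v) h]
  refine integral_congr_ae (Eventually.of_forall fun v => ?_)
  simp only [smul_eq_mul, SchwartzMap.compSubConstCLM_apply, sub_neg_eq_add]
  rw [← mul_assoc, ← Complex.exp_add]
  congr 2
  push_cast; ring

/-- The Fourier transform turns translations into modulations. -/
theorem fourier_transLp (h : ℝ) (f : Lp ℂ 2 (volume : Measure ℝ)) :
    (𝓕 (transLp h f) : Lp ℂ 2 (volume : Measure ℝ)) =ᵐ[volume]
      fun ξ => Complex.exp (Complex.I * ((2 * Real.pi * h * ξ : ℝ) : ℂ)) * (𝓕 f : Lp ℂ 2 (volume : Measure ℝ)) ξ := by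
  set e : ℝ → ℂ := fun ξ => Complex.exp (Complex.I * ((2 * Real.pi * h * ξ : ℝ) : ℂ)) with he
  have hem : Continuous e := by fun_prop
  have hen : ∀ (g : Lp ℂ 2 (volume : Measure ℝ)), eLpNorm (fun ξ => e ξ * g ξ) 2 volume = ‖g‖ₑ := by
    intro g
    rw [← eLpNorm_eq_enorm_Lp]
    refine eLpNorm_congr_norm_ae (Eventually.of_forall fun ξ => ?_)
    rw [norm_mul, he, norm_exp_I, one_mul]
  have key : eLpNorm (fun ξ => (𝓕 (transLp h f) : Lp ℂ 2 (volume : Measure ℝ)) ξ -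
      e ξ * (𝓕 f : Lp ℂ 2 (volume : Measure ℝ)) ξ) 2 volume = 0 := by
    refine le_antisymm (ENNReal.le_of_forall_pos_le_add fun ε hε _ => ?_) zero_le
    -- Both sides of the identity are isometric in `f`, so it extends from Schwartz functions by
    -- density.
    obtain ⟨φ, hφ⟩ := (SchwartzMap.denseRange_toLpCLM (E := ℝ) (F := ℂ) (p := 2) (μ := volume)
      ENNReal.ofNat_ne_top).exists_dist_lt f (half_pos hε)
    rw [SchwartzMap.toLpCLM_apply] at hφ
    set g := φ.toLp 2 volume with hg
    have hfg : ‖f - g‖ₑ ≤ ENNReal.ofReal (ε / 2) := by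
      rw [← ofReal_norm, ← dist_eq_norm]; exact ENNReal.ofReal_le_ofReal hφ.le
    have h1 : (fun ξ => (𝓕 (transLp h f) : Lp ℂ 2 (volume : Measure ℝ)) ξ -
        e ξ * (𝓕 f : Lp ℂ 2 (volume : Measure ℝ)) ξ) =ᵐ[volume]
        fun ξ => (𝓕 (transLp h (f - g)) : Lp ℂ 2 (volume : Measure ℝ)) ξ -
          e ξ * (𝓕 (f - g) : Lp ℂ 2 (volume : Measure ℝ)) ξ := by
      rw [transLp_sub, fourier_sub_Lp, fourier_sub_Lp]
      filter_upwards [fourier_transLp_schwartz h φ, Lp.coeFn_sub (𝓕 (transLp h f)) (𝓕 (transLp h g)),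
        Lp.coeFn_sub (𝓕 f) (𝓕 g)] with ξ h1 h2 h3
      rw [h2, h3, Pi.sub_apply, Pi.sub_apply, h1]
      ring
    rw [eLpNorm_congr_ae h1]
    refine (eLpNorm_sub_le (Lp.aestronglyMeasurable _)
      (hem.aestronglyMeasurable.mul (Lp.aestronglyMeasurable _)) (by norm_num)).trans ?_
    have e1 : eLpNorm (𝓕 (transLp h (f - g)) : Lp ℂ 2 (volume : Measure ℝ)) 2 volume = ‖f - g‖ₑ := by
      rw [eLpNorm_eq_enorm_Lp, enorm_fourier_Lp, enorm_transLp]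
    have e2 := hen (𝓕 (f - g))
    rw [enorm_fourier_Lp] at e2
    calc _ = ‖f - g‖ₑ + ‖f - g‖ₑ := congrArg₂ (· + ·) e1 e2
      _ ≤ ENNReal.ofReal (ε / 2) + ENNReal.ofReal (ε / 2) := add_le_add hfg hfg
      _ = ENNReal.ofReal ε := by rw [← ENNReal.ofReal_add (by positivity) (by positivity)]; congr 1; ring
      _ = 0 + ε := by rw [zero_add, ENNReal.ofReal_coe_nnreal]
  have key' := (eLpNorm_eq_zero_iff (f := fun ξ => (𝓕 (transLp h f) : Lp ℂ 2 (volume : Measure ℝ)) ξ -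
      e ξ * (𝓕 f : Lp ℂ 2 (volume : Measure ℝ)) ξ) ((Lp.aestronglyMeasurable _).sub
    (hem.aestronglyMeasurable.mul (Lp.aestronglyMeasurable _))) (by norm_num)).1 key
  filter_upwards [key'] with ξ hξ
  exact sub_eq_zero.1 hξ

/-- The factor `exp(-imt)` recentres frequencies at `m`, so an increment of `g` has Fourier
multiplier `exp(ih(2πξ - m)) - 1`. For `m = n³` and `τ = 2πξ` the variable is the modulation `τ -
n³`. -/
theorem eLpNorm_tdiff_sq {f : Lp ℂ 2 (volume : Measure ℝ)} {m : ℝ} {g : ℝ → ℂ}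
    (hg : g =ᵐ[volume] fun t => Complex.exp (-(Complex.I * m * t)) * f t) (h : ℝ) :
    eLpNorm (tdiff h g) 2 volume ^ 2 =
      ∫⁻ ξ, ‖Complex.exp (Complex.I * ((h * (2 * Real.pi * ξ - m) : ℝ) : ℂ)) - 1‖ₑ ^ 2 *
        ‖(𝓕 f : Lp ℂ 2 (volume : Measure ℝ)) ξ‖ₑ ^ 2 := by
  set c : ℂ := Complex.exp (-(Complex.I * m * h)) with hc
  have h1 : eLpNorm (tdiff h g) 2 volume = eLpNorm (c • transLp h f - f : Lp ℂ 2 (volume : Measure ℝ)) 2 volume := by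
    refine eLpNorm_congr_norm_ae ?_
    filter_upwards [hg, (measurePreserving_add_right (volume : Measure ℝ) h).quasiMeasurePreserving.ae_eq_comp hg,
      coeFn_transLp h f, Lp.coeFn_sub (c • transLp h f) f, Lp.coeFn_smul c (transLp h f)] with t e1 e2 e3 e4 e5
    have e6 : g (t + h) = Complex.exp (-(Complex.I * m * ((t + h : ℝ) : ℂ))) * f (t + h) := e2
    rw [tdiff, e6, e1, e4, Pi.sub_apply, e5, Pi.smul_apply, e3, smul_eq_mul]
    have e7 : Complex.exp (-(Complex.I * m * ((t + h : ℝ) : ℂ))) = Complex.exp (-(Complex.I * m * t)) * c := by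
      rw [hc, ← Complex.exp_add]; congr 1; push_cast; ring
    rw [e7, mul_assoc, ← mul_sub, norm_mul, norm_exp_phase, one_mul]
  rw [h1, eLpNorm_eq_enorm_Lp, ← enorm_fourier_Lp, ← eLpNorm_eq_enorm_Lp, eLpNorm_two_sq, fourier_sub_Lp,
    fourier_smul_Lp]
  refine lintegral_congr_ae ?_
  filter_upwards [fourier_transLp h f, Lp.coeFn_sub (c • 𝓕 (transLp h f)) (𝓕 f),
    Lp.coeFn_smul c (𝓕 (transLp h f))] with ξ e1 e2 e3
  rw [e2, Pi.sub_apply, e3, Pi.smul_apply, e1, smul_eq_mul, ← mul_pow, ← enorm_mul, sub_mul, one_mul, ← mul_assoc, hc,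
    ← Complex.exp_add]
  congr 5
  push_cast; ring

theorem norm_exp_I_sub_one_sq_le (x : ℝ) : ‖Complex.exp (Complex.I * x) - 1‖ ^ 2 ≤ 2 * |x| := by
  have h1 := Real.norm_exp_I_mul_ofReal_sub_one_le (x := x)
  have h2 : ‖Complex.exp (Complex.I * x) - 1‖ ≤ 2 := by
    refine (norm_sub_le _ _).trans ?_
    rw [norm_exp_I, norm_one]; norm_num
  rw [Real.norm_eq_abs] at h1
  rw [sq]
  exact mul_le_mul h2 h1 (norm_nonneg _) (by norm_num)

theorem le_norm_exp_I_sub_one {x : ℝ} (hx : |x| ≤ 1) : |x| / 2 ≤ ‖Complex.exp (Complex.I * x) - 1‖ := by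
  rw [Complex.norm_exp_I_mul_ofReal_sub_one, norm_mul, Real.norm_eq_abs, Real.norm_eq_abs, abs_two]
  have h1 : ∀ y : ℝ, 0 ≤ y → y ≤ 1 → y / 2 ≤ 2 * |Real.sin (y / 2)| := by
    intro y hy hy1
    have := Real.mul_le_sin (x := y / 2) (by linarith) (by linarith [Real.pi_gt_three])
    have h2 : 1 / 4 * y ≤ 2 / Real.pi * (y / 2) := by
      have : (1 : ℝ) / 2 ≤ 2 / Real.pi := by
        rw [div_le_div_iff₀ (by norm_num) Real.pi_pos]; linarith [Real.pi_le_four]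
      nlinarith
    linarith [le_abs_self (Real.sin (y / 2))]
  rcases le_total 0 x with h | h
  · rw [abs_of_nonneg h] at hx ⊢; exact h1 x h hx
  · rw [abs_of_nonpos h] at hx ⊢
    have := h1 (-x) (by linarith) hx
    rwa [show -x / 2 = -(x / 2) by ring, Real.sin_neg, abs_neg, ← neg_div] at this

/-- The weighted modulation norm at a fixed frequency. -/
def modN (f : Lp ℂ 2 (volume : Measure ℝ)) (m : ℝ) : ℝ≥0∞ :=
  ∫⁻ ξ, ENNReal.ofReal (jb (2 * Real.pi * ξ - m)) * ‖(𝓕 f : Lp ℂ 2 (volume : Measure ℝ)) ξ‖ₑ ^ 2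

theorem eLpNorm_sq_le_modN {f : Lp ℂ 2 (volume : Measure ℝ)} {m : ℝ} {g : ℝ → ℂ}
    (hg : g =ᵐ[volume] fun t => Complex.exp (-(Complex.I * m * t)) * f t) :
    eLpNorm g 2 volume ^ 2 ≤ modN f m := by
  have h1 : eLpNorm g 2 volume = eLpNorm f 2 volume := by
    refine eLpNorm_congr_norm_ae ?_
    filter_upwards [hg] with t ht
    rw [ht, norm_mul, norm_exp_phase, one_mul]
  rw [h1, eLpNorm_eq_enorm_Lp, ← enorm_fourier_Lp, ← eLpNorm_eq_enorm_Lp, eLpNorm_two_sq]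
  refine lintegral_mono fun ξ => ?_
  refine le_mul_of_one_le_left' ?_
  rw [ENNReal.one_le_ofReal]; exact one_le_jb _

/-- Interpolating the bounds 2 and `|x|` gives `|exp(ix) - 1|² ≤ 2|x|`: half a power of the
modulation controls every single increment. Uniqueness uses this direction. -/
theorem nikN_sq_le_modN {f : Lp ℂ 2 (volume : Measure ℝ)} {m : ℝ} {g : ℝ → ℂ}
    (hg : g =ᵐ[volume] fun t => Complex.exp (-(Complex.I * m * t)) * f t) :
    nikN g ^ 2 ≤ 4 * modN f m := by
  have h1 : nikN g ≤ (2 : ℝ≥0∞) * modN f m ^ (1 / 2 : ℝ) := by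
    refine nikN_le_iff.2 fun h hh => eLpNorm_two_le_of_sq_le ?_
    have e : (modN f m ^ (1 / 2 : ℝ)) ^ 2 = modN f m := by
      rw [← ENNReal.rpow_natCast, ← ENNReal.rpow_mul]; norm_num
    rw [← eLpNorm_two_sq, eLpNorm_tdiff_sq hg, mul_pow, mul_pow, ofReal_sqrt_sq hh.le, e,
      show (2 : ℝ≥0∞) ^ 2 * modN f m * ENNReal.ofReal h = ENNReal.ofReal h * 4 * modN f m by ring,
      modN, ← lintegral_const_mul' _ _ (by finiteness)]
    refine lintegral_mono fun ξ => ?_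
    rw [← mul_assoc]
    gcongr
    rw [← ofReal_norm, ← ENNReal.ofReal_pow (norm_nonneg _), show (4 : ℝ≥0∞) = ENNReal.ofReal 4 by simp,
      ← ENNReal.ofReal_mul hh.le, ← ENNReal.ofReal_mul (by positivity)]
    refine ENNReal.ofReal_le_ofReal ?_
    have h2 := norm_exp_I_sub_one_sq_le (h * (2 * Real.pi * ξ - m))
    rw [abs_mul, abs_of_pos hh] at h2
    have h3 := abs_le_jb (2 * Real.pi * ξ - m)
    have h4 : h * |2 * Real.pi * ξ - m| ≤ h * jb (2 * Real.pi * ξ - m) := by gcongr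
    have h5 := jb_pos (2 * Real.pi * ξ - m)
    nlinarith [mul_pos hh h5]
  refine (pow_le_pow_left' h1 2).trans (le_of_eq ?_)
  rw [mul_pow, ← ENNReal.rpow_natCast (modN f m ^ _), ← ENNReal.rpow_mul]
  norm_num

theorem zN_le_modN {f : Lp ℂ 2 (volume : Measure ℝ)} {m : ℝ} {g : ℝ → ℂ}
    (hg : g =ᵐ[volume] fun t => Complex.exp (-(Complex.I * m * t)) * f t) :
    zN g ≤ 3 * modN f m ^ (1 / 2 : ℝ) := by
  have e : (modN f m ^ (1 / 2 : ℝ)) ^ 2 = modN f m := by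
    rw [← ENNReal.rpow_natCast, ← ENNReal.rpow_mul]; norm_num
  have h1 : eLpNorm g 2 volume ≤ modN f m ^ (1 / 2 : ℝ) := by
    rw [← ENNReal.pow_le_pow_left_iff two_ne_zero, e]; exact eLpNorm_sq_le_modN hg
  have h2 : nikN g ≤ 2 * modN f m ^ (1 / 2 : ℝ) := by
    rw [← ENNReal.pow_le_pow_left_iff two_ne_zero, mul_pow, e]
    refine (nikN_sq_le_modN hg).trans (le_of_eq ?_)
    norm_num
  calc zN g ≤ modN f m ^ (1 / 2 : ℝ) + 2 * modN f m ^ (1 / 2 : ℝ) := add_le_add h1 h2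
    _ = _ := by ring

/-- For `|μ| ≥ 1` the integrand is at least `μ²/4` on `h ≤ 1/|μ|`, which contributes `|μ|/4`, and `8
|μ|/4 ≥ 1 + |μ|`. The summand 2 covers `|μ| ≤ 1`. -/
theorem jb_le_lintegral (μ : ℝ) : ENNReal.ofReal (jb μ) ≤ 2 + 8 *
    ∫⁻ h in Set.Ioc (0 : ℝ) 1, ‖Complex.exp (Complex.I * ((h * μ : ℝ) : ℂ)) - 1‖ₑ ^ 2 / ENNReal.ofReal (h ^ 2) := by
  rcases le_total |μ| 1 with hμ | hμ
  · refine le_trans ?_ le_self_add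
    rw [show (2 : ℝ≥0∞) = ENNReal.ofReal 2 by simp]
    refine ENNReal.ofReal_le_ofReal ((jb_le_one_add μ).trans (by linarith))
  · have hpos : 0 < |μ| := by linarith
    have h1 : ENNReal.ofReal (|μ| / 4) ≤ ∫⁻ h in Set.Ioc (0 : ℝ) 1,
        ‖Complex.exp (Complex.I * ((h * μ : ℝ) : ℂ)) - 1‖ₑ ^ 2 / ENNReal.ofReal (h ^ 2) := by
      calc ENNReal.ofReal (|μ| / 4) = ∫⁻ h in Set.Ioc (0 : ℝ) (1 / |μ|), ENNReal.ofReal (|μ| ^ 2 / 4) := by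
            rw [setLIntegral_const, Real.volume_Ioc, ← ENNReal.ofReal_mul (by positivity)]
            congr 1; field_simp; ring
        _ ≤ ∫⁻ h in Set.Ioc (0 : ℝ) (1 / |μ|),
            ‖Complex.exp (Complex.I * ((h * μ : ℝ) : ℂ)) - 1‖ₑ ^ 2 / ENNReal.ofReal (h ^ 2) := by
            refine setLIntegral_mono' measurableSet_Ioc fun h hh => ?_
            have hh2 : 0 < h ^ 2 := by have := hh.1; positivity
            rw [← ofReal_norm, ← ENNReal.ofReal_pow (norm_nonneg _), ← ENNReal.ofReal_div_of_pos hh2]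
            refine ENNReal.ofReal_le_ofReal ?_
            rw [le_div_iff₀ hh2]
            have hb : |h * μ| ≤ 1 := by
              rw [abs_mul, abs_of_pos hh.1]
              have := hh.2
              rwa [le_div_iff₀ hpos] at this
            have := le_norm_exp_I_sub_one hb
            rw [abs_mul, abs_of_pos hh.1] at this
            calc |μ| ^ 2 / 4 * h ^ 2 = (h * |μ| / 2) ^ 2 := by ring
              _ ≤ _ := by
                refine pow_le_pow_left₀ ?_ this 2
                have := hh.1; positivity
        _ ≤ _ := lintegral_mono_set (Set.Ioc_subset_Ioc_right (by rw [div_le_one hpos]; exact hμ))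
    refine le_trans ?_ (le_trans (mul_le_mul' (le_refl 8) h1) le_add_self)
    rw [show (8 : ℝ≥0∞) = ENNReal.ofReal 8 by simp, ← ENNReal.ofReal_mul (by norm_num)]
    refine ENNReal.ofReal_le_ofReal ((jb_le_one_add μ).trans (by linarith))

/-- The direction used for existence: the Slobodeckij seminorm controls the modulation norm, which
in turn controls the Nikolskii seminorm. -/
theorem modN_le {f : Lp ℂ 2 (volume : Measure ℝ)} {m : ℝ} {g : ℝ → ℂ} (hgm : Measurable g)
    (hg : g =ᵐ[volume] fun t => Complex.exp (-(Complex.I * m * t)) * f t) :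
    modN f m ≤ 2 * eLpNorm g 2 volume ^ 2 + 8 * slobN g ^ 2 := by
  have hFm : AEMeasurable (fun ξ => ‖(𝓕 f : Lp ℂ 2 (volume : Measure ℝ)) ξ‖ₑ ^ 2) volume :=
    (Lp.aestronglyMeasurable _).enorm.pow_const 2
  have h1 : eLpNorm g 2 volume ^ 2 = ∫⁻ ξ, ‖(𝓕 f : Lp ℂ 2 (volume : Measure ℝ)) ξ‖ₑ ^ 2 := by
    have h1 : eLpNorm g 2 volume = eLpNorm f 2 volume := by
      refine eLpNorm_congr_norm_ae ?_
      filter_upwards [hg] with t ht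
      rw [ht, norm_mul, norm_exp_phase, one_mul]
    rw [h1, eLpNorm_eq_enorm_Lp, ← enorm_fourier_Lp, ← eLpNorm_eq_enorm_Lp, eLpNorm_two_sq]
  have h2 : slobN g ^ 2 = ∫⁻ ξ, (∫⁻ h in Set.Ioc (0 : ℝ) 1,
      ‖Complex.exp (Complex.I * ((h * (2 * Real.pi * ξ - m) : ℝ) : ℂ)) - 1‖ₑ ^ 2 / ENNReal.ofReal (h ^ 2)) *
        ‖(𝓕 f : Lp ℂ 2 (volume : Measure ℝ)) ξ‖ₑ ^ 2 := by
    rw [slobN_sq hgm]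
    simp_rw [eLpNorm_tdiff_sq hg]
    have e1 : ∀ ξ : ℝ, (∫⁻ h in Set.Ioc (0 : ℝ) 1,
        ‖Complex.exp (Complex.I * ((h * (2 * Real.pi * ξ - m) : ℝ) : ℂ)) - 1‖ₑ ^ 2 / ENNReal.ofReal (h ^ 2)) *
        ‖(𝓕 f : Lp ℂ 2 (volume : Measure ℝ)) ξ‖ₑ ^ 2 = ∫⁻ h in Set.Ioc (0 : ℝ) 1,
        ‖Complex.exp (Complex.I * ((h * (2 * Real.pi * ξ - m) : ℝ) : ℂ)) - 1‖ₑ ^ 2 / ENNReal.ofReal (h ^ 2) *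
        ‖(𝓕 f : Lp ℂ 2 (volume : Measure ℝ)) ξ‖ₑ ^ 2 := by
      intro ξ
      rw [lintegral_mul_const' _ _ (by finiteness)]
    simp_rw [e1]
    rw [← lintegral_lintegral_swap]
    · refine lintegral_congr_ae ((ae_restrict_iff' measurableSet_Ioc).2 (Eventually.of_forall fun h hh => ?_))
      have hh2 : 0 < h ^ 2 := by have := hh.1; positivity
      simp only [div_eq_mul_inv]
      rw [← lintegral_mul_const' _ _ (by
        rw [ENNReal.inv_ne_top]; exact (ENNReal.ofReal_pos.2 hh2).ne')]
      refine lintegral_congr fun ξ => ?_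
      ring
    · refine AEMeasurable.mul ?_ ?_
      · refine Measurable.aemeasurable ?_
        fun_prop
      · exact hFm.comp_snd
  rw [h1, h2, modN, ← lintegral_const_mul' _ _ (by norm_num), ← lintegral_const_mul' _ _ (by norm_num),
    ← lintegral_add_left' (hFm.const_mul 2)]
  refine lintegral_mono fun ξ => ?_
  calc _ ≤ _ := mul_le_mul' (jb_le_lintegral (2 * Real.pi * ξ - m)) le_rfl
    _ = _ := by ring

/-- The `n`-th Fourier coefficient of a space-time function. -/
def stCoeff (v : L2ST) (n : ℤ) : Lp ℂ 2 (volume : Measure ℝ) := (coeffCLM n).compLp v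

/-- The change of variables `τ = 2πξ` contributes `2π`, against `(2π)^(-2)` from the normalization
of `stFourier`. -/
theorem xNorm_eq_seqN (s p : ℝ) (v : L2ST) : xNorm s (1 / 2) p 2 v =
    seqN s p fun n => (ENNReal.ofReal (2 * Real.pi)⁻¹ * modN (stCoeff v n) ((n : ℝ) ^ 3)) ^ (1 / 2 : ℝ) := by
  unfold xNorm seqN
  congr 1
  refine tsum_congr fun n => ?_
  congr 3
  have hpi := Real.two_pi_pos
  set F : Lp ℂ 2 (volume : Measure ℝ) := (𝓕 (stCoeff v n) : Lp ℂ 2 (volume : Measure ℝ)) with hF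
  have e1 : ∀ τ : ℝ, (ENNReal.ofReal (jb (τ - (n : ℝ) ^ 3) ^ (1 / 2 : ℝ)) * ‖stFourier v n τ‖ₑ) ^ (2 : ℝ) =
      ENNReal.ofReal ((2 * Real.pi)⁻¹ ^ 2) *
        (fun ξ => ENNReal.ofReal (jb (2 * Real.pi * ξ - (n : ℝ) ^ 3)) * ‖F ξ‖ₑ ^ 2) (τ * (2 * Real.pi)⁻¹) := by
    intro τ
    have e2 : ‖stFourier v n τ‖ₑ = ENNReal.ofReal ((2 * Real.pi)⁻¹) * ‖F (τ / (2 * Real.pi))‖ₑ := by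
      rw [stFourier, enorm_mul]
      congr 1
      rw [← ofReal_norm, Complex.norm_real, Real.norm_eq_abs, abs_of_pos (inv_pos.2 hpi)]
    simp only
    rw [e2, show (2 : ℝ) = ((2 : ℕ) : ℝ) by norm_num, ENNReal.rpow_natCast, mul_pow, mul_pow,
      ← ENNReal.ofReal_pow (Real.rpow_nonneg (jb_pos _).le _), ← ENNReal.ofReal_pow (inv_pos.2 (by simpa using hpi)).le,
      ← Real.rpow_natCast, ← Real.rpow_mul (jb_pos _).le]
    have e3 : ((2 : ℕ) : ℝ) * Real.pi * (τ * (((2 : ℕ) : ℝ) * Real.pi)⁻¹) = τ := by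
      have := Real.pi_pos.ne'; push_cast; field_simp
    rw [e3, ← div_eq_mul_inv]
    norm_num
    ring
  simp_rw [e1]
  rw [lintegral_const_mul' _ _ (by finiteness)]
  have hi : (2 * Real.pi)⁻¹ ≠ 0 := (inv_pos.2 hpi).ne'
  have e4 := (Homeomorph.mulRight₀ _ hi).measurableEmbedding.lintegral_map (μ := volume)
    (fun ξ => ENNReal.ofReal (jb (2 * Real.pi * ξ - (n : ℝ) ^ 3)) * ‖F ξ‖ₑ ^ 2)
  simp only [Homeomorph.coe_mulRight₀] at e4
  rw [← e4, Real.map_volume_mul_right hi, lintegral_smul_measure, smul_eq_mul, ← mul_assoc,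
    ← ENNReal.ofReal_mul (by positivity), inv_inv, abs_of_pos hpi, modN]
  congr 2
  field_simp

/-! ### The cubic nonlinearity on Fourier coefficients and its continuity in time. -/

theorem fourierCoeff_sub (f g : L2T) (n : ℤ) :
    fourierCoeff (f - g : L2T) n = fourierCoeff f n - fourierCoeff g n := by
  rw [← coeffCLM_apply, ← coeffCLM_apply, ← coeffCLM_apply, map_sub]

theorem tsum_four_thirds_ne_top {s p : ℝ} (h : Admissible s p) {x : ℤ → ℝ≥0∞} (hx : seqN s p x ≠ ⊤) :
    ∑' n, x n ^ (4 / 3 : ℝ) ≠ ⊤ := by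
  obtain ⟨K, hK, hb⟩ := tsum_rpow_four_thirds_le h
  exact ne_top_of_le_ne_top (ENNReal.mul_ne_top hK (ENNReal.rpow_ne_top_of_nonneg (by norm_num) hx)) (hb x)

theorem tsum_triple_le_seqN {s p : ℝ} (h : Admissible s p) : ∃ K : ℝ≥0∞, K ≠ ⊤ ∧
    ∀ (x y z : ℤ → ℝ≥0∞) (n : ℤ), ∑' v : ℤ × ℤ, x v.1 * y v.2 * z (n - v.1 - v.2) ≤
      K * (seqN s p x * seqN s p y * seqN s p z) := by
  obtain ⟨K, hK, hb⟩ := tsum_rpow_four_thirds_le h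
  refine ⟨(K ^ 3) ^ (3 / 4 : ℝ), ENNReal.rpow_ne_top_of_nonneg (by norm_num) (ENNReal.pow_ne_top hK), fun x y z n => ?_⟩
  refine (tsum_triple_le x y z n).trans ?_
  calc _ ≤ ((K * seqN s p x ^ (4 / 3 : ℝ)) * (K * seqN s p y ^ (4 / 3 : ℝ)) *
        (K * seqN s p z ^ (4 / 3 : ℝ))) ^ (3 / 4 : ℝ) := by
        refine ENNReal.rpow_le_rpow ?_ (by norm_num)
        exact mul_le_mul' (mul_le_mul' (hb x) (hb y)) (hb z)
    _ = (K ^ 3 * (seqN s p x * seqN s p y * seqN s p z) ^ (4 / 3 : ℝ)) ^ (3 / 4 : ℝ) := by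
        have e : (seqN s p x * seqN s p y * seqN s p z) ^ (4 / 3 : ℝ) =
            seqN s p x ^ (4 / 3 : ℝ) * seqN s p y ^ (4 / 3 : ℝ) * seqN s p z ^ (4 / 3 : ℝ) := by
          rw [ENNReal.mul_rpow_of_nonneg _ _ (by norm_num), ENNReal.mul_rpow_of_nonneg _ _ (by norm_num)]
        rw [e]
        congr 1; ring
    _ = _ := by
        rw [ENNReal.mul_rpow_of_nonneg _ _ (by norm_num), ← ENNReal.rpow_mul]
        norm_num

theorem enorm_triCoeff_le (n a b : ℤ) : ‖(triCoeff n a b : ℂ)‖ₑ ≤ ENNReal.ofReal |(n : ℝ)| := by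
  rw [← ofReal_norm, Complex.norm_real]
  exact ENNReal.ofReal_le_ofReal (abs_triCoeff_le n a b)

/-- The cubic nonlinearity on the level of Fourier coefficients. -/
def cubic (x : ℤ → ℂ) (n : ℤ) : ℂ :=
  ∑' v : ℤ × ℤ, (triCoeff n v.1 v.2 : ℂ) * (x v.1 * x v.2 * x (n - v.1 - v.2))

theorem tsum_enorm_tri_le {s p : ℝ} (h : Admissible s p) : ∃ K : ℝ≥0∞, K ≠ ⊤ ∧
    ∀ (x y z : ℤ → ℂ) (n : ℤ), ∑' v : ℤ × ℤ, ‖(triCoeff n v.1 v.2 : ℂ) * (x v.1 * y v.2 * z (n - v.1 - v.2))‖ₑ ≤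
      ENNReal.ofReal |(n : ℝ)| * (K * (seqN s p (fun n => ‖x n‖ₑ) * seqN s p (fun n => ‖y n‖ₑ) *
        seqN s p (fun n => ‖z n‖ₑ))) := by
  obtain ⟨K, hK, hb⟩ := tsum_triple_le_seqN h
  refine ⟨K, hK, fun x y z n => ?_⟩
  refine le_trans ?_ (mul_le_mul_right (hb (fun n => ‖x n‖ₑ) (fun n => ‖y n‖ₑ) (fun n => ‖z n‖ₑ) n) _)
  rw [← ENNReal.tsum_mul_left]
  refine ENNReal.tsum_le_tsum fun v => ?_
  rw [enorm_mul, enorm_mul, enorm_mul]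
  exact mul_le_mul_left (enorm_triCoeff_le n v.1 v.2) _

theorem hasSum_cubic {s p : ℝ} (h : Admissible s p) {x : ℤ → ℂ} (hx : seqN s p (fun n => ‖x n‖ₑ) ≠ ⊤) (n : ℤ) :
    HasSum (fun v : ℤ × ℤ => (triCoeff n v.1 v.2 : ℂ) * (x v.1 * x v.2 * x (n - v.1 - v.2))) (cubic x n) := by
  obtain ⟨K, hK, hb⟩ := tsum_enorm_tri_le h
  exact hasSum_of_tsum_enorm_le (ne_top_of_le_ne_top (by finiteness) (hb x x x n))

/-- A crude bound for one mode, losing a factor `|n|`; it serves only for continuity in time of each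
mode. -/
theorem enorm_cubic_sub_le {s p : ℝ} (h : Admissible s p) : ∃ K : ℝ≥0∞, K ≠ ⊤ ∧
    ∀ (x y : ℤ → ℂ) (M : ℝ≥0∞), seqN s p (fun n => ‖x n‖ₑ) ≤ M → seqN s p (fun n => ‖y n‖ₑ) ≤ M → M ≠ ⊤ →
      ∀ n, ‖cubic x n - cubic y n‖ₑ ≤
        ENNReal.ofReal |(n : ℝ)| * K * M ^ 2 * seqN s p (fun n => ‖x n - y n‖ₑ) := by
  obtain ⟨K, hK, hb⟩ := tsum_enorm_tri_le h
  refine ⟨3 * K, ENNReal.mul_ne_top (by norm_num) hK, fun x y M hx hy hM n => ?_⟩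
  have e := ((hasSum_cubic h (ne_top_of_le_ne_top hM hx) n).sub
    (hasSum_cubic h (ne_top_of_le_ne_top hM hy) n)).tsum_eq
  rw [← e]
  set d : ℤ → ℂ := fun n => x n - y n with hd
  have h1 := hb d x x n
  have h2 := hb y d x n
  have h3 := hb y y d n
  refine enorm_tsum_le_tsum_enorm.trans (le_trans (ENNReal.tsum_le_tsum fun v => ?_)
    (le_trans (le_of_eq (ENNReal.tsum_add.trans (congrArg₂ (· + ·) ENNReal.tsum_add rfl)))
      ((add_le_add (add_le_add h1 h2) h3).trans ?_)))
  · rw [← mul_sub, show x v.1 * x v.2 * x (n - v.1 - v.2) - y v.1 * y v.2 * y (n - v.1 - v.2) =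
      d v.1 * x v.2 * x (n - v.1 - v.2) + y v.1 * d v.2 * x (n - v.1 - v.2) + y v.1 * y v.2 * d (n - v.1 - v.2) by
        simp only [hd]; ring, mul_add, mul_add]
    exact (enorm_add_le _ _).trans (add_le_add (enorm_add_le _ _) le_rfl)
  · set D := seqN s p (fun n => ‖d n‖ₑ) with hD
    calc _ ≤ ENNReal.ofReal |(n : ℝ)| * (K * (D * M * M)) + ENNReal.ofReal |(n : ℝ)| * (K * (M * D * M)) +
          ENNReal.ofReal |(n : ℝ)| * (K * (M * M * D)) := by gcongr
      _ = _ := by ring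

theorem cubic_eq_fluxCoeff {f : L2T} (hf : ∑' n, ‖fourierCoeff f n‖ₑ ^ (4 / 3 : ℝ) ≠ ⊤)
    (hr : IsRealValued f) (n : ℤ) : cubic (fun k => fourierCoeff f k) n = n * fluxCoeff f n :=
  (hasSum_fluxCoeff hf hr n).tsum_eq

/-- A common multiplier of modulus one can be pulled through the cubic nonlinearity. -/
theorem hasSum_oscillating_cubic {s p : ℝ} (h : Admissible s p) {x : ℤ → ℂ} (hx : seqN s p (fun n => ‖x n‖ₑ) ≠ ⊤)
    {w : ℤ → ℂ} {r : ℝ} (hw : ∀ n : ℤ, w n = Complex.exp (-(Complex.I * (n ^ 3 : ℤ) * r)) * x n) (n : ℤ) :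
    HasSum (fun v : ℤ × ℤ => (triCoeff n v.1 v.2 : ℂ) * (Complex.exp (-(Complex.I * ((phase n v.1 v.2 : ℤ) : ℝ) * r)) *
      (w v.1 * w v.2 * w (n - v.1 - v.2)))) (Complex.exp (-(Complex.I * (n ^ 3 : ℤ) * r)) * cubic x n) := by
  refine hasSum_of_eq ((hasSum_cubic h hx n).mul_left _) (fun v => ?_) rfl
  have e : Complex.exp (-(Complex.I * ((phase n v.1 v.2 : ℤ) : ℝ) * r)) *
      (Complex.exp (-(Complex.I * (v.1 ^ 3 : ℤ) * r)) * Complex.exp (-(Complex.I * (v.2 ^ 3 : ℤ) * r)) *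
        Complex.exp (-(Complex.I * ((n - v.1 - v.2) ^ 3 : ℤ) * r))) = Complex.exp (-(Complex.I * (n ^ 3 : ℤ) * r)) := by
    rw [← Complex.exp_add, ← Complex.exp_add, ← Complex.exp_add]
    congr 1
    rw [phase]; push_cast; ring
  rw [hw, hw, hw, ← e]
  ring

/-- The flux is bounded directly, not through `cubic`: its zero mode disappears after multiplication
by the frequency but still enters the termwise pairing. -/
theorem enorm_fluxCoeff_le {s p : ℝ} (h : Admissible s p) : ∃ K : ℝ≥0∞, K ≠ ⊤ ∧
    ∀ f : L2T, IsRealValued f → flNorm s p f ≠ ⊤ → ∀ n, ‖fluxCoeff f n‖ₑ ≤ K * flNorm s p f ^ 3 := by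
  obtain ⟨K, hK, hb⟩ := tsum_triple_le_seqN h
  obtain ⟨K', hK', hb'⟩ := tsum_rpow_four_thirds_le h
  refine ⟨K + K' ^ (3 / 2 : ℝ), ENNReal.add_ne_top.2 ⟨hK, ENNReal.rpow_ne_top_of_nonneg (by norm_num) hK'⟩,
    fun f hr hf n => ?_⟩
  rw [flNorm_eq_seqN] at hf ⊢
  set x : ℤ → ℝ≥0∞ := fun n => ‖fourierCoeff f n‖ₑ with hx
  set S := seqN s p x with hS
  have hf' := tsum_four_thirds_ne_top h hf
  have h1 : ‖fourierCoeff (fun x => f x ^ 3) n‖ₑ ≤ K * S ^ 3 := by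
    rw [← (hasSum_fourierCoeff_cube hf' n).tsum_eq]
    refine (enorm_tsum_le_tsum_enorm).trans (le_trans (le_of_eq (tsum_congr fun v => ?_)) ((hb x x x n).trans (le_of_eq ?_)))
    · rw [enorm_mul, enorm_mul]
    · ring
  have h2 : ‖(meanSq f : ℂ)‖ₑ ≤ K' ^ (3 / 2 : ℝ) * S ^ 2 := by
    rw [← (hasSum_meanSq hr).tsum_eq]
    refine (enorm_tsum_le_tsum_enorm).trans ?_
    calc _ = ∑' k, x k ^ 2 := by
          refine tsum_congr fun k => ?_
          rw [enorm_mul, fourierCoeff_neg_of_real hr, RCLike.enorm_conj, sq]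
      _ ≤ (∑' n, x n ^ (4 / 3 : ℝ)) ^ (3 / 2 : ℝ) := tsum_sq_le_of_four_thirds x
      _ ≤ (K' * S ^ (4 / 3 : ℝ)) ^ (3 / 2 : ℝ) := ENNReal.rpow_le_rpow (hb' x) (by norm_num)
      _ = K' ^ (3 / 2 : ℝ) * S ^ 2 := by
          rw [ENNReal.mul_rpow_of_nonneg _ _ (by norm_num), ← ENNReal.rpow_mul, ← ENNReal.rpow_natCast]
          norm_num
  rw [fluxCoeff_eq hf', add_mul]
  refine (enorm_sub_le).trans (add_le_add ?_ ?_)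
  · rw [div_eq_mul_inv, enorm_mul]
    refine (mul_le_of_le_one_right' ?_).trans h1
    rw [← ofReal_norm, norm_inv]
    exact ENNReal.ofReal_le_one.2 (by norm_num)
  · rw [enorm_mul]
    calc _ ≤ K' ^ (3 / 2 : ℝ) * S ^ 2 * S := mul_le_mul' h2 (le_seqN h.one_le (by linarith [h.half_le]) x n)
      _ = _ := by ring

section Curve

variable {s p : ℝ} {S : Set ℝ} {u : ℝ → L2T}

theorem continuousOn_fourierCoeff (h : Admissible s p)
    (hc : ∀ t₀ ∈ S, Tendsto (fun t => flNorm s p (u t - u t₀)) (𝓝[S] t₀) (𝓝 0)) (n : ℤ) :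
    ContinuousOn (fun t => fourierCoeff (u t) n) S := by
  intro t₀ ht₀
  rw [ContinuousWithinAt, tendsto_iff_edist_tendsto_0]
  refine tendsto_of_tendsto_of_tendsto_of_le_of_le tendsto_const_nhds (hc t₀ ht₀) (fun _ => zero_le) fun t => ?_
  simp only
  rw [edist_eq_enorm_sub, ← fourierCoeff_sub]
  exact le_seqN h.one_le (by linarith [h.half_le]) (fun n => ‖fourierCoeff (u t - u t₀ : L2T) n‖ₑ) n

theorem continuousOn_cubic (h : Admissible s p) (hfin : ∀ t ∈ S, flNorm s p (u t) ≠ ⊤)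
    (hc : ∀ t₀ ∈ S, Tendsto (fun t => flNorm s p (u t - u t₀)) (𝓝[S] t₀) (𝓝 0)) (n : ℤ) :
    ContinuousOn (fun t => cubic (fun k => fourierCoeff (u t) k) n) S := by
  obtain ⟨K, hK, hb⟩ := enorm_cubic_sub_le h
  intro t₀ ht₀
  rw [ContinuousWithinAt, tendsto_iff_edist_tendsto_0]
  set M := 1 + flNorm s p (u t₀) with hM
  have hMt : M ≠ ⊤ := ENNReal.add_ne_top.2 ⟨ENNReal.one_ne_top, hfin t₀ ht₀⟩
  have hlim := ENNReal.Tendsto.const_mul (a := ENNReal.ofReal |(n : ℝ)| * K * M ^ 2) (hc t₀ ht₀)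
    (Or.inr (by finiteness))
  rw [mul_zero] at hlim
  refine tendsto_of_tendsto_of_tendsto_of_le_of_le' tendsto_const_nhds hlim (Eventually.of_forall fun _ => zero_le) ?_
  filter_upwards [(hc t₀ ht₀).eventually (ge_mem_nhds (show (0 : ℝ≥0∞) < 1 by norm_num))] with t ht
  rw [edist_eq_enorm_sub]
  have e : flNorm s p (u t - u t₀) = seqN s p (fun n => ‖fourierCoeff (u t) n - fourierCoeff (u t₀) n‖ₑ) := by
    simp_rw [flNorm_eq_seqN, fourierCoeff_sub]
  rw [e] at ht ⊢
  refine hb _ _ M ?_ le_add_self hMt n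
  refine (seqN_mono h.one_le fun n => ?_).trans ((seqN_add_le h.one_le _ _).trans (add_le_add ht le_rfl))
  calc ‖fourierCoeff (u t) n‖ₑ = ‖(fourierCoeff (u t) n - fourierCoeff (u t₀) n) + fourierCoeff (u t₀) n‖ₑ := by
        rw [sub_add_cancel]
    _ ≤ _ := enorm_add_le _ _

/-- Continuity gives a bound near each time; finitely many neighbourhoods cover the compact set. -/
theorem exists_flNorm_le (h : Admissible s p) (hfin : ∀ t ∈ S, flNorm s p (u t) ≠ ⊤)
    (hc : ∀ t₀ ∈ S, Tendsto (fun t => flNorm s p (u t - u t₀)) (𝓝[S] t₀) (𝓝 0)) (hS : IsCompact S) :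
    ∃ M : ℝ≥0∞, M ≠ ⊤ ∧ ∀ t ∈ S, flNorm s p (u t) ≤ M := by
  refine hS.induction_on (p := fun A => ∃ M : ℝ≥0∞, M ≠ ⊤ ∧ ∀ t ∈ A, flNorm s p (u t) ≤ M) ⟨0, by simp⟩ ?_ ?_ ?_
  · rintro A B hAB ⟨M, hM, hb⟩
    exact ⟨M, hM, fun t ht => hb t (hAB ht)⟩
  · rintro A B ⟨M, hM, hb⟩ ⟨N, hN, hb'⟩
    refine ⟨M + N, ENNReal.add_ne_top.2 ⟨hM, hN⟩, fun t ht => ?_⟩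
    rcases ht with ht | ht
    · exact (hb t ht).trans le_self_add
    · exact (hb' t ht).trans le_add_self
  · intro t₀ ht₀
    refine ⟨_, (hc t₀ ht₀).eventually (ge_mem_nhds (show (0 : ℝ≥0∞) < 1 by norm_num)), 1 + flNorm s p (u t₀),
      ENNReal.add_ne_top.2 ⟨ENNReal.one_ne_top, hfin t₀ ht₀⟩, fun t ht => ?_⟩
    refine le_trans ?_ (add_le_add (show flNorm s p (u t - u t₀) ≤ 1 from ht) le_rfl)
    simp_rw [flNorm_eq_seqN, fourierCoeff_sub]
    refine (seqN_mono h.one_le fun n => ?_).trans (seqN_add_le h.one_le _ _)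
    calc ‖fourierCoeff (u t) n‖ₑ = ‖(fourierCoeff (u t) n - fourierCoeff (u t₀) n) + fourierCoeff (u t₀) n‖ₑ := by
          rw [sub_add_cancel]
      _ ≤ _ := enorm_add_le _ _

end Curve

/-- Only the values almost everywhere on `[a, b]` matter, so a profile may be exchanged for the one
of a space-time representative, or for one that agrees with it on the interval alone. -/
theorem triOp_congr_ae {a b c : ℝ} {w z : ℤ → ℝ → ℂ}
    (hwz : ∀ n, ∀ᵐ r, r ∈ Set.Icc a b → w n r = z n r) (n : ℤ) (t : ℝ) :
    triOp a b c w w w n t = triOp a b c z z z n t := by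
  unfold triOp triTerm
  refine tsum_congr fun v => ?_
  congr 1
  refine intervalIntegral.integral_congr_ae ?_
  filter_upwards [hwz v.1, hwz v.2, hwz (n - v.1 - v.2)] with r h1 h2 h3 _
  unfold oscInt
  by_cases hr : r ∈ Set.Icc a b
  · simp only [Set.indicator_of_mem hr, h1 hr, h2 hr, h3 hr]
  · simp only [Set.indicator_of_notMem hr]

/-- Summation and integration can be interchanged in the trilinear operator. -/
theorem triOp_eq_integral {s p : ℝ} (h : Admissible s p) {a b c : ℝ} {w : ℤ → ℝ → ℂ} {S : ℝ≥0∞} (hS : S ≠ ⊤)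
    (hm : ∀ n, Measurable (w n)) (hw : ∀ r ∈ Set.Icc a b, seqN s p (fun n => ‖w n r‖ₑ) ≤ S) (n : ℤ) (t : ℝ) :
    triOp a b c w w w n t = ∫ r in c..t, ∑' v : ℤ × ℤ, (triCoeff n v.1 v.2 : ℂ) *
      oscInt a b (phase n v.1 v.2 : ℤ) (fun r => w v.1 r * w v.2 r * w (n - v.1 - v.2) r) r := by
  obtain ⟨K, hK, hb⟩ := tsum_enorm_tri_le h
  have hmeas : ∀ v : ℤ × ℤ, Measurable fun r => (triCoeff n v.1 v.2 : ℂ) *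
      oscInt a b (phase n v.1 v.2 : ℤ) (fun r => w v.1 r * w v.2 r * w (n - v.1 - v.2) r) r :=
    fun v => (measurable_oscInt (((hm _).mul (hm _)).mul (hm _)) _ _ _).const_mul _
  unfold triOp triTerm
  rw [intervalIntegral.intervalIntegral_eq_integral_uIoc, integral_tsum]
  · rw [← tsum_const_smul'']
    refine tsum_congr fun v => ?_
    rw [intervalIntegral.intervalIntegral_eq_integral_uIoc, integral_const_mul, mul_smul_comm]
  · exact fun v => (hmeas v).aestronglyMeasurable
  · rw [← lintegral_tsum fun v => (hmeas v).enorm.aemeasurable]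
    refine ne_top_of_le_ne_top (b := ∫⁻ r, (Set.Icc a b).indicator
      (fun _ => ENNReal.ofReal |(n : ℝ)| * (K * (S * S * S))) r) ?_ ?_
    · rw [lintegral_indicator measurableSet_Icc, setLIntegral_const, Real.volume_Icc]
      finiteness
    · refine (lintegral_mono' Measure.restrict_le_self le_rfl).trans (lintegral_mono fun r => ?_)
      by_cases hr : r ∈ Set.Icc a b
      · rw [Set.indicator_of_mem hr]
        refine le_trans (le_of_eq (tsum_congr fun v => ?_)) ((hb (fun k => w k r) (fun k => w k r) (fun k => w k r) n).trans
          (mul_le_mul_right (mul_le_mul_right (mul_le_mul' (mul_le_mul' (hw r hr) (hw r hr)) (hw r hr)) _) _))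
        rw [enorm_mul, enorm_mul, oscInt, Set.indicator_of_mem hr, enorm_mul, ← ofReal_norm (Complex.exp _),
          norm_exp_phase, ENNReal.ofReal_one, one_mul]
      · simp [oscInt, hr]

theorem enorm_L2T_sq (f : L2T) : ‖f‖ₑ ^ 2 = ∑' n, ‖fourierCoeff f n‖ₑ ^ 2 := by
  have h1 := lp.hasSum_norm (by norm_num) ((fourierBasis (T := 2 * Real.pi)).repr f)
  rw [LinearIsometryEquiv.norm_map] at h1
  simp only [ENNReal.toReal_ofNat, Real.rpow_ofNat, fourierBasis_repr] at h1
  rw [← ofReal_norm, ← ENNReal.ofReal_pow (norm_nonneg _), ← h1.tsum_eq,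
    ENNReal.ofReal_tsum_of_nonneg (fun _ => by positivity) h1.summable]
  refine tsum_congr fun n => ?_
  rw [ENNReal.ofReal_pow (norm_nonneg _), ofReal_norm]

theorem enorm_le_flNorm {s p : ℝ} (h : Admissible s p) : ∃ K : ℝ≥0∞, K ≠ ⊤ ∧
    ∀ f : L2T, ‖f‖ₑ ≤ K * flNorm s p f := by
  obtain ⟨K, hK, hb⟩ := tsum_rpow_four_thirds_le h
  refine ⟨K ^ (3 / 4 : ℝ), ENNReal.rpow_ne_top_of_nonneg (by norm_num) hK, fun f => ?_⟩
  rw [← ENNReal.pow_le_pow_left_iff two_ne_zero, enorm_L2T_sq, flNorm_eq_seqN]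
  refine (tsum_sq_le_of_four_thirds _).trans ((ENNReal.rpow_le_rpow (hb _) (by norm_num)).trans (le_of_eq ?_))
  rw [ENNReal.mul_rpow_of_nonneg _ _ (by norm_num), mul_pow, ← ENNReal.rpow_mul, ← ENNReal.rpow_natCast,
    ← ENNReal.rpow_natCast, ← ENNReal.rpow_mul]
  norm_num

/-- Dominated convergence for the counting measure: with the suprema of the modes as majorant,
modewise continuity becomes continuity in the norm. -/
theorem tendsto_seqN_zero {s p : ℝ} (hp : 1 ≤ p) {x : ℝ → ℤ → ℝ≥0∞} {y : ℤ → ℝ≥0∞} {l : Filter ℝ}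
    [l.IsCountablyGenerated] (hxy : ∀ t n, x t n ≤ y n) (hy : seqN s p y ≠ ⊤)
    (hx : ∀ n, Tendsto (fun t => x t n) l (𝓝 0)) : Tendsto (fun t => seqN s p (x t)) l (𝓝 0) := by
  have hp0 : 0 < p := by linarith
  have h1 : Tendsto (fun t => ∑' n : ℤ, (ENNReal.ofReal (jb n ^ s) * x t n) ^ p) l (𝓝 0) := by
    have := tendsto_lintegral_filter_of_dominated_convergence (μ := Measure.count) (l := l)
      (F := fun t (n : ℤ) => (ENNReal.ofReal (jb n ^ s) * x t n) ^ p) (f := fun _ => 0)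
      (fun n : ℤ => (ENNReal.ofReal (jb n ^ s) * y n) ^ p) (Eventually.of_forall fun t => measurable_of_countable _)
      (Eventually.of_forall fun t => Eventually.of_forall fun n =>
        ENNReal.rpow_le_rpow (mul_le_mul_right (hxy t n) _) hp0.le) ?_ ?_
    · simpa only [lintegral_count, tsum_zero] using this
    · rw [lintegral_count, ← seqN_rpow hp]
      exact ENNReal.rpow_ne_top_of_nonneg hp0.le hy
    · refine Eventually.of_forall fun n => ?_
      have h2 := ENNReal.Tendsto.const_mul (a := ENNReal.ofReal (jb n ^ s)) (hx n) (Or.inr ENNReal.ofReal_ne_top)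
      have h3 := (ENNReal.continuous_rpow_const (y := p)).continuousAt.tendsto.comp h2
      rw [mul_zero, ENNReal.zero_rpow_of_pos hp0] at h3
      exact h3
  have h3 := (ENNReal.continuous_rpow_const (y := 1 / p)).continuousAt.tendsto.comp h1
  rw [ENNReal.zero_rpow_of_pos (by positivity)] at h3
  exact h3

/-! ### From profiles to solutions. -/

/-- The function of time whose interaction profile is `w`. -/
def evolve (w : ℤ → ℝ → ℂ) (t : ℝ) : L2T :=
  ofCoeff fun n => Complex.exp (Complex.I * (n ^ 3 : ℤ) * t) * w n t

section evolve

variable {s p : ℝ} {w z : ℤ → ℝ → ℂ}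

theorem enorm_exp_cube (n : ℤ) (t : ℝ) : ‖Complex.exp (Complex.I * (n ^ 3 : ℤ) * t)‖ₑ = 1 := by
  rw [← enorm_exp_I ((n ^ 3 : ℤ) * t)]; congr 2; push_cast; ring

theorem seqN_le_profN (h : Admissible s p) (w : ℤ → ℝ → ℂ) (t : ℝ) :
    seqN s p (fun n => ‖w n t‖ₑ) ≤ profN s p w :=
  seqN_mono h.one_le fun _ => (le_supN _ t).trans (supN_le_yN _)

theorem fourierCoeff_evolve (h : Admissible s p) (fw : profN s p w ≠ ⊤) (t : ℝ) (n : ℤ) :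
    fourierCoeff (evolve w t) n = Complex.exp (Complex.I * (n ^ 3 : ℤ) * t) * w n t := by
  refine fourierCoeff_ofCoeff (memlp_two_of_tsum ?_) n
  refine ne_top_of_le_ne_top ?_ (tsum_sq_le_of_four_thirds _)
  refine ENNReal.rpow_ne_top_of_nonneg (by norm_num) (tsum_four_thirds_ne_top h ?_)
  refine ne_top_of_le_ne_top fw (le_trans (le_of_eq (congrArg _ (funext fun n => ?_))) (seqN_le_profN h w t))
  rw [enorm_mul, enorm_exp_cube, one_mul]

theorem flNorm_evolve_le (h : Admissible s p) (fw : profN s p w ≠ ⊤) (t : ℝ) :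
    flNorm s p (evolve w t) ≤ profN s p w := by
  rw [flNorm_eq_seqN]
  refine le_trans (le_of_eq (congrArg _ (funext fun n => ?_))) (seqN_le_profN h w t)
  rw [fourierCoeff_evolve h fw, enorm_mul, enorm_exp_cube, one_mul]

theorem flNorm_evolve_sub_le (h : Admissible s p) (fw : profN s p w ≠ ⊤) (fz : profN s p z ≠ ⊤) (t : ℝ) :
    flNorm s p (evolve w t - evolve z t) ≤ profN s p (fun n t => w n t - z n t) := by
  rw [flNorm_eq_seqN]
  refine le_trans (le_of_eq (congrArg _ (funext fun n => ?_))) (seqN_le_profN h (fun n t => w n t - z n t) t)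
  rw [fourierCoeff_sub, fourierCoeff_evolve h fw, fourierCoeff_evolve h fz, ← mul_sub, enorm_mul, enorm_exp_cube, one_mul]

theorem tendsto_flNorm_evolve (h : Admissible s p) (hw : ∀ n, Continuous (w n)) (fw : profN s p w ≠ ⊤) (t₀ : ℝ) :
    Tendsto (fun t => flNorm s p (evolve w t - evolve w t₀)) (𝓝 t₀) (𝓝 0) := by
  simp_rw [flNorm_eq_seqN]
  refine tendsto_seqN_zero (y := fun n => 2 * yN (w n)) h.one_le (fun t n => ?_) ?_ fun n => ?_
  · rw [fourierCoeff_sub, fourierCoeff_evolve h fw, fourierCoeff_evolve h fw, two_mul]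
    refine enorm_sub_le.trans (add_le_add ?_ ?_) <;>
    · rw [enorm_mul, enorm_exp_cube, one_mul]
      exact (le_supN _ _).trans (supN_le_yN _)
  · rw [seqN_const_mul h.one_le]
    exact ENNReal.mul_ne_top (by norm_num) fw
  · simp_rw [fourierCoeff_sub, fourierCoeff_evolve h fw, ← edist_eq_enorm_sub]
    rw [← tendsto_iff_edist_tendsto_0]
    have : Continuous fun t : ℝ => Complex.exp (Complex.I * (n ^ 3 : ℤ) * t) * w n t := by
      have := hw n; fun_prop
    exact this.tendsto t₀

theorem continuous_evolve (h : Admissible s p) (hw : ∀ n, Continuous (w n)) (fw : profN s p w ≠ ⊤) :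
    Continuous (evolve w) := by
  obtain ⟨K, hK, hb⟩ := enorm_le_flNorm h
  refine continuous_iff_continuousAt.2 fun t₀ => ?_
  rw [ContinuousAt, tendsto_iff_edist_tendsto_0]
  have hlim := ENNReal.Tendsto.const_mul (a := K) (tendsto_flNorm_evolve h hw fw t₀) (Or.inr hK)
  rw [mul_zero] at hlim
  refine tendsto_of_tendsto_of_tendsto_of_le_of_le tendsto_const_nhds hlim (fun _ => zero_le) fun t => ?_
  simp only
  rw [edist_eq_enorm_sub]
  exact hb _

theorem isRealValued_evolve (h : Admissible s p) (fw : profN s p w ≠ ⊤)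
    (hr : ∀ n t, w (-n) t = (starRingEnd ℂ) (w n t)) (t : ℝ) : IsRealValued (evolve w t) := by
  refine isRealValued_of_fourierCoeff fun n => ?_
  rw [fourierCoeff_evolve h fw, fourierCoeff_evolve h fw, hr, map_mul, ← Complex.exp_conj]
  congr 2
  simp only [map_mul, Complex.conj_I, Complex.conj_ofReal, map_intCast]
  push_cast; ring

/-- The profile equation in differential form. -/
theorem hasDerivAt_evolve (h : Admissible s p) {σ T : ℝ} {w₀ : ℤ → ℂ} (hw : ∀ n, Continuous (w n))
    (fw : profN s p w ≠ ⊤) (heq : ∀ n t, w n t = duhamel σ (-T) T 0 w₀ w n t) (n : ℤ) {t : ℝ}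
    (ht : t ∈ Set.Ioo (-T) T) :
    HasDerivAt (fun t => fourierCoeff (evolve w t) n) (Complex.I * n ^ 3 * fourierCoeff (evolve w t) n +
      Complex.I * σ * cubic (fun k => fourierCoeff (evolve w t) k) n) t := by
  have hcub : Continuous fun t => cubic (fun k => fourierCoeff (evolve w t) k) n := by
    rw [← continuousOn_univ]
    exact continuousOn_cubic h (fun t _ => ne_top_of_le_ne_top fw (flNorm_evolve_le h fw t))
      (fun t _ => by rw [nhdsWithin_univ]; exact tendsto_flNorm_evolve h hw fw t) n
  set g : ℝ → ℂ := fun r => Complex.exp (-(Complex.I * (n ^ 3 : ℤ) * r)) * cubic (fun k => fourierCoeff (evolve w r) k) n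
    with hg
  have hgc : Continuous g := by fun_prop
  have hwt : ∀ r ∈ Set.Icc (-T) T, w n r = w₀ n + Complex.I * σ * ∫ r in (0 : ℝ)..r, g r := by
    intro r hr
    rw [heq, duhamel, triOp_eq_integral h fw (fun n => (hw n).measurable) (fun r _ => seqN_le_profN h w r)]
    congr 2
    refine intervalIntegral.integral_congr fun q hq => ?_
    have hT : 0 ≤ T := by have := ht.1; have := ht.2; linarith
    have hq' : q ∈ Set.Icc (-T) T := Set.uIcc_subset_Icc (Set.mem_Icc.2 ⟨by linarith, hT⟩) hr hq
    have hs := hasSum_oscillating_cubic h (x := fun k => fourierCoeff (evolve w q) k) (w := fun k => w k q) (r := q)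
      (ne_top_of_le_ne_top fw (flNorm_evolve_le h fw q)) (fun k => by
        rw [fourierCoeff_evolve h fw, ← mul_assoc, ← Complex.exp_add]; simp) n
    simp only [hg]
    rw [← hs.tsum_eq]
    refine tsum_congr fun v => ?_
    rw [oscInt, Set.indicator_of_mem hq']
  have hd : HasDerivAt (w n) (Complex.I * σ * g t) t := by
    have h1 := ((intervalIntegral.integral_hasDerivAt_right (hgc.intervalIntegrable 0 t)
      (hgc.stronglyMeasurableAtFilter _ _) hgc.continuousAt).const_mul (Complex.I * σ)).const_add (w₀ n)
    refine h1.congr_of_eventuallyEq ?_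
    filter_upwards [Icc_mem_nhds ht.1 ht.2] with r hr
    exact hwt r hr
  have he : HasDerivAt (fun t : ℝ => Complex.exp (Complex.I * (n ^ 3 : ℤ) * t))
      (Complex.exp (Complex.I * (n ^ 3 : ℤ) * t) * (Complex.I * (n ^ 3 : ℤ))) t := by
    have := ((hasDerivAt_id (t : ℂ)).const_mul (Complex.I * (n ^ 3 : ℤ))).comp_ofReal.cexp
    simpa using this
  simp_rw [fourierCoeff_evolve h fw]
  refine (he.mul hd).congr_deriv ?_
  simp only [hg]
  have e2 : Complex.exp (Complex.I * (n ^ 3 : ℤ) * t) * Complex.exp (-(Complex.I * (n ^ 3 : ℤ) * t)) = 1 := by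
    rw [← Complex.exp_add]; simp
  have hn3 : ((n ^ 3 : ℤ) : ℂ) = (n : ℂ) ^ 3 := by push_cast; ring
  simp_rw [fourierCoeff_evolve h fw]
  linear_combination (Complex.I * σ * cubic (fun k => Complex.exp (Complex.I * (k ^ 3 : ℤ) * t) * w k t) n) * e2 +
    (Complex.exp (Complex.I * (n ^ 3 : ℤ) * t) * Complex.I * w n t) * hn3

theorem isDistribSolution_evolve (h : Admissible s p) {σ T : ℝ} (hT : 0 ≤ T) {w₀ : ℤ → ℂ} (hw : ∀ n, Continuous (w n))
    (fw : profN s p w ≠ ⊤) (hr : ∀ n t, w (-n) t = (starRingEnd ℂ) (w n t))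
    (heq : ∀ n t, w n t = duhamel σ (-T) T 0 w₀ w n t) : IsDistribSolution σ T (evolve w) := by
  obtain ⟨K, hK, hb⟩ := enorm_fluxCoeff_le h
  have hfl : ∀ t, flNorm s p (evolve w t) ≠ ⊤ := fun t => ne_top_of_le_ne_top fw (flNorm_evolve_le h fw t)
  have h43 : ∀ t, ∑' n, ‖fourierCoeff (evolve w t) n‖ₑ ^ (4 / 3 : ℝ) ≠ ⊤ := fun t => tsum_four_thirds_ne_top h (hfl t)
  have hcub : ∀ t n, cubic (fun k => fourierCoeff (evolve w t) k) n = n * fluxCoeff (evolve w t) n :=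
    fun t n => cubic_eq_fluxCoeff (h43 t) (isRealValued_evolve h fw hr t) n
  have hlim : ∀ t₀ ∈ Set.Icc (-T) T, Tendsto (fun t => flNorm s p (evolve w t - evolve w t₀))
      (𝓝[Set.Icc (-T) T] t₀) (𝓝 0) := fun t₀ _ => (tendsto_flNorm_evolve h hw fw t₀).mono_left nhdsWithin_le_nhds
  set M := profN s p w + K * profN s p w ^ 3 with hM
  have hMt : M ≠ ⊤ := by finiteness
  refine isDistribSolution_of_hasDerivAt (M := M.toReal) hT (fun t _ => h43 t) (fun t _ n => ⟨?_, ?_⟩)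
    (continuousOn_fourierCoeff h hlim) (fun n => ?_) fun n t ht => ?_
  · rw [← toReal_enorm]
    refine ENNReal.toReal_mono hMt (le_trans ?_ (le_self_add))
    exact (le_seqN h.one_le (by linarith [h.half_le]) (fun n => ‖fourierCoeff (evolve w t) n‖ₑ) n).trans
      (flNorm_evolve_le h fw t)
  · rw [← toReal_enorm]
    refine ENNReal.toReal_mono hMt (le_trans (hb _ (isRealValued_evolve h fw hr t) (hfl t) n) (le_trans ?_ le_add_self))
    exact mul_le_mul_right (pow_le_pow_left' (flNorm_evolve_le h fw t) 3) _
  · exact (continuousOn_cubic h (fun t _ => hfl t) hlim n).congr fun t _ => (hcub t n).symm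
  · have := hasDerivAt_evolve h hw fw heq n ht
    rwa [hcub] at this

end evolve

/-! ### Membership of the solution in `X^{s,1/2}_{p,2}(T)`. -/

/-- A Lipschitz cutoff equal to one on `[-1, 1]` and supported in `[-2, 2]`. -/
def cutoff (t : ℝ) : ℝ := max 0 (min 1 (2 - |t|))

theorem continuous_cutoff : Continuous cutoff := by unfold cutoff; fun_prop

theorem cutoff_eq_one {t : ℝ} (ht : |t| ≤ 1) : cutoff t = 1 := by
  rw [cutoff, min_eq_left (by linarith), max_eq_right (by norm_num)]

theorem cutoff_eq_zero {t : ℝ} (ht : 2 ≤ |t|) : cutoff t = 0 := by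
  rw [cutoff, max_eq_left]; exact (min_le_right _ _).trans (by linarith)

theorem abs_cutoff_le (t : ℝ) : |cutoff t| ≤ 1 := by
  rw [cutoff, abs_of_nonneg (le_max_left _ _)]
  exact max_le (by norm_num) (min_le_left _ _)

theorem abs_cutoff_sub_le (t r : ℝ) : |cutoff t - cutoff r| ≤ |t - r| := by
  have h1 : |min 1 (2 - |t|) - min 1 (2 - |r|)| ≤ |(2 - |t|) - (2 - |r|)| := by
    have := abs_min_sub_min_le_max 1 (2 - |t|) 1 (2 - |r|)
    simpa using this
  have h2 : |cutoff t - cutoff r| ≤ |min 1 (2 - |t|) - min 1 (2 - |r|)| := by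
    have := abs_max_sub_max_le_max 0 (min 1 (2 - |t|)) 0 (min 1 (2 - |r|))
    simpa [cutoff] using this
  refine h2.trans (h1.trans ?_)
  rw [show (2 - |t|) - (2 - |r|) = -(|t| - |r|) by ring, abs_neg]
  exact abs_abs_sub_abs_le_abs_sub t r

theorem eLpNorm_cutoff_mul_le (f : ℝ → ℂ) : eLpNorm (fun t => cutoff t * f t) 2 volume ≤ 2 * supN f := by
  refine eLpNorm_two_le_of_sq_le ?_
  calc ∫⁻ t, ‖(cutoff t : ℂ) * f t‖ₑ ^ 2 ≤ ∫⁻ t, (Set.Icc (-2 : ℝ) 2).indicator (fun _ => supN f ^ 2) t := by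
        refine lintegral_mono fun t => ?_
        by_cases ht : t ∈ Set.Icc (-2 : ℝ) 2
        · rw [Set.indicator_of_mem ht]
          refine pow_le_pow_left' ?_ 2
          rw [enorm_mul]
          refine (mul_le_of_le_one_left' ?_).trans (le_supN f t)
          rw [← ofReal_norm, Complex.norm_real]
          exact ENNReal.ofReal_le_one.2 (abs_cutoff_le t)
        · rw [cutoff_eq_zero]
          · simp
          · by_contra hlt
            exact ht (abs_le.1 (not_le.1 hlt).le)
    _ = (2 * supN f) ^ 2 := by
        rw [lintegral_indicator measurableSet_Icc, setLIntegral_const, Real.volume_Icc, mul_pow, mul_comm]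
        congr 1
        rw [show (2 : ℝ) - -2 = 2 ^ 2 by norm_num, ENNReal.ofReal_pow (by norm_num)]; simp

/-- Leibniz rule: the difference quotients of the cutoff are at most 1, and for `h ≤ 1` they vanish
outside `t ∈ [-3, 2]`, an interval of length `5 ≤ 3²`. -/
theorem slobN_cutoff_mul_le {f : ℝ → ℂ} (hf : Measurable f) :
    slobN (fun t => cutoff t * f t) ≤ slobN f + 3 * supN f := by
  set μ := (volume.restrict (Set.Ioc (0 : ℝ) 1)).prod (volume : Measure ℝ) with hμ
  set A : ℝ × ℝ → ℂ := fun z => (cutoff (z.2 + z.1) : ℂ) * (tdiff z.1 f z.2 / z.1) with hA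
  set B : ℝ × ℝ → ℂ := fun z => ((cutoff (z.2 + z.1) : ℂ) - cutoff z.2) / z.1 * f z.2 with hB
  have hc : Measurable fun t => (cutoff t : ℂ) := by have := continuous_cutoff; fun_prop
  have hAm : Measurable A := (hc.comp (measurable_snd.add measurable_fst)).mul (measurable_slob hf)
  have hBm : Measurable B := by
    exact (((hc.comp (measurable_snd.add measurable_fst)).sub (hc.comp measurable_snd)).div
      (Complex.measurable_ofReal.comp measurable_fst)).mul (hf.comp measurable_snd)
  have e : (fun z : ℝ × ℝ => tdiff z.1 (fun t => cutoff t * f t) z.2 / (z.1 : ℂ)) = A + B := by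
    funext z
    simp only [tdiff, hA, hB, Pi.add_apply]
    ring
  unfold slobN
  rw [e]
  refine (eLpNorm_add_le hAm.aestronglyMeasurable hBm.aestronglyMeasurable (by norm_num)).trans (add_le_add ?_ ?_)
  · refine eLpNorm_mono fun z => ?_
    rw [hA, norm_mul, Complex.norm_real]
    exact mul_le_of_le_one_left (norm_nonneg _) (abs_cutoff_le _)
  · refine eLpNorm_two_le_of_sq_le ?_
    calc ∫⁻ z, ‖B z‖ₑ ^ 2 ∂μ ≤ ∫⁻ z, (Set.univ ×ˢ Set.Icc (-3 : ℝ) 2).indicator (fun _ => supN f ^ 2) z ∂μ := by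
          refine lintegral_mono_ae ?_
          have hae : ∀ᵐ z ∂μ, z.1 ∈ Set.Ioc (0 : ℝ) 1 := by
            have : μ = ((volume : Measure ℝ).prod volume).restrict (Set.Ioc (0 : ℝ) 1 ×ˢ Set.univ) := by
              rw [← Measure.prod_restrict, Measure.restrict_univ]
            rw [this]
            filter_upwards [ae_restrict_mem (measurableSet_Ioc.prod MeasurableSet.univ)] with z hz
            exact hz.1
          filter_upwards [hae] with z hz
          by_cases ht : z.2 ∈ Set.Icc (-3 : ℝ) 2
          · rw [Set.indicator_of_mem (Set.mk_mem_prod (Set.mem_univ _) ht)]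
            refine pow_le_pow_left' ?_ 2
            rw [hB, enorm_mul]
            refine (mul_le_of_le_one_left' ?_).trans (le_supN f z.2)
            rw [← ofReal_norm, norm_div, ← Complex.ofReal_sub, Complex.norm_real, Complex.norm_real]
            refine ENNReal.ofReal_le_one.2 (div_le_one_of_le₀ ?_ (norm_nonneg _))
            have := abs_cutoff_sub_le (z.2 + z.1) z.2
            rwa [add_sub_cancel_left] at this
          · have h1 : cutoff z.2 = 0 := by
              refine cutoff_eq_zero ?_
              by_contra hlt
              have := abs_lt.1 (not_le.1 hlt)
              exact ht ⟨by linarith, by linarith⟩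
            have h2 : cutoff (z.2 + z.1) = 0 := by
              refine cutoff_eq_zero ?_
              by_contra hlt
              have := abs_lt.1 (not_le.1 hlt)
              exact ht ⟨by linarith [hz.2], by linarith [hz.1]⟩
            simp [hB, h1, h2]
      _ = ENNReal.ofReal 5 * supN f ^ 2 := by
          rw [lintegral_indicator (MeasurableSet.univ.prod measurableSet_Icc), setLIntegral_const, hμ, Measure.prod_prod,
            Measure.restrict_apply_univ, Real.volume_Ioc, Real.volume_Icc]
          norm_num
          ring
      _ ≤ (3 * supN f) ^ 2 := by
          rw [mul_pow]
          refine mul_le_mul_left ?_ _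
          norm_num

theorem slobN_const_add (c : ℂ) (f : ℝ → ℂ) : slobN (fun t => c + f t) = slobN f := by
  unfold slobN
  congr 1
  funext z
  simp [tdiff]

section memX

variable {s p : ℝ} {w : ℤ → ℝ → ℂ}

/-- The extension is the cutoff times the solution, whose profile is defined for all times. It is
unchanged on `[-T, T]` as `T ≤ 1`, and `modN_le` bounds it mode by mode. -/
theorem memXRestr_evolve (h : Admissible s p) (hw : ∀ n, Continuous (w n)) (fw : profN s p w ≠ ⊤)
    (fs : seqN s p (fun n => slobN (w n)) ≠ ⊤) {T : ℝ} (hT : T ≤ 1) : MemXRestr s (1 / 2) p 2 T (evolve w) := by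
  set V : ℝ → L2T := fun t => (cutoff t : ℂ) • evolve w t with hV
  have hVc : Continuous V := by
    have h1 := continuous_evolve h hw fw
    have h2 := continuous_cutoff
    fun_prop
  have hVs : HasCompactSupport V := by
    refine HasCompactSupport.intro (isCompact_Icc (a := (-2 : ℝ)) (b := 2)) fun t ht => ?_
    have : cutoff t = 0 := by
      refine cutoff_eq_zero ?_
      by_contra hlt
      exact ht (abs_le.1 (not_le.1 hlt).le)
    simp only [hV, this, Complex.ofReal_zero]
    exact zero_smul ℂ _
  have hVm : MemLp V 2 volume := hVc.memLp_of_hasCompactSupport hVs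
  refine ⟨hVm.toLp V, ?_, ?_⟩
  · rw [xNorm_eq_seqN]
    have key : ∀ n : ℤ, (ENNReal.ofReal (2 * Real.pi)⁻¹ * modN (stCoeff (hVm.toLp V) n) ((n : ℝ) ^ 3)) ^ (1 / 2 : ℝ) ≤
        13 * yN (w n) + 3 * slobN (w n) := by
      intro n
      have hg : (fun t => (cutoff t : ℂ) * w n t) =ᵐ[volume]
          fun t => Complex.exp (-(Complex.I * ((n ^ 3 : ℝ) : ℂ) * t)) * stCoeff (hVm.toLp V) n t := by
        filter_upwards [(coeffCLM n).coeFn_compLp (hVm.toLp V), hVm.coeFn_toLp] with t h1 h2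
        rw [stCoeff, h1, h2, hV]
        simp only
        rw [map_smul, coeffCLM_apply, fourierCoeff_evolve h fw, smul_eq_mul]
        have : Complex.exp (-(Complex.I * ((n ^ 3 : ℝ) : ℂ) * t)) * Complex.exp (Complex.I * (n ^ 3 : ℤ) * t) = 1 := by
          rw [← Complex.exp_add]; simp
        linear_combination (-(cutoff t : ℂ) * w n t) * this
      have hc : Measurable fun t => (cutoff t : ℂ) * w n t := by
        have := continuous_cutoff; have := hw n; fun_prop
      have hb := modN_le hc hg
      rw [one_div, ENNReal.rpow_inv_le_iff (by norm_num)]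
      have h1 := eLpNorm_cutoff_mul_le (w n)
      have h2 := slobN_cutoff_mul_le (hw n).measurable
      have h3 := supN_le_yN (w n)
      calc _ ≤ 1 * modN (stCoeff (hVm.toLp V) n) ((n : ℝ) ^ 3) := by
            refine mul_le_mul_left (ENNReal.ofReal_le_one.2 (inv_le_one_of_one_le₀ ?_)) _
            linarith [Real.pi_gt_three]
        _ ≤ 2 * (2 * yN (w n)) ^ 2 + 8 * (slobN (w n) + 3 * yN (w n)) ^ 2 := by
            rw [one_mul]
            refine hb.trans ?_
            gcongr
            · exact h1.trans (by gcongr)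
            · exact h2.trans (by gcongr)
        _ ≤ (13 * yN (w n) + 3 * slobN (w n)) ^ 2 := by
            have e : (13 * yN (w n) + 3 * slobN (w n)) ^ 2 = 2 * (2 * yN (w n)) ^ 2 + 8 * (slobN (w n) + 3 * yN (w n)) ^ 2 +
              (89 * yN (w n) ^ 2 + 30 * (yN (w n) * slobN (w n)) + slobN (w n) ^ 2) := by ring
            rw [e]; exact le_self_add
        _ = _ := by rw [← ENNReal.rpow_natCast]; norm_num
    refine lt_of_le_of_lt ((seqN_mono h.one_le key).trans (seqN_add_le h.one_le _ _)) ?_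
    rw [seqN_const_mul h.one_le, seqN_const_mul h.one_le]
    exact (ENNReal.add_ne_top.2 ⟨ENNReal.mul_ne_top (by norm_num) fw, ENNReal.mul_ne_top (by norm_num) fs⟩).lt_top
  · refine (ae_restrict_iff' measurableSet_Icc).2 ?_
    filter_upwards [hVm.coeFn_toLp] with t h1 ht
    rw [h1, hV]
    simp only
    rw [cutoff_eq_one (abs_le.2 ⟨by linarith [ht.1], by linarith [ht.2]⟩)]
    simp

theorem seqN_slobN_duhamel_ne_top (h : Admissible s p) {σ a b c : ℝ} (hσ : ‖(σ : ℂ)‖ₑ = 1) (hab : a ≤ b)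
    (hL : b - a ≤ 2) {w₀ : ℤ → ℂ} (hw : ∀ n, Measurable (w n)) (fw : profN s p w ≠ ⊤)
    (heq : ∀ n t, w n t = duhamel σ a b c w₀ w n t) : seqN s p (fun n => slobN (w n)) ≠ ⊤ := by
  obtain ⟨K, hK, hb⟩ := profN_triOp_le h
  refine ne_top_of_le_ne_top ?_ ((le_of_eq (congrArg _ (funext fun n => ?_))).trans
    (hb (c := c) hab hL hw hw hw fw fw fw).2)
  · finiteness
  · rw [show w n = fun t => w₀ n + Complex.I * σ * triOp a b c w w w n t from funext fun t => heq n t,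
      slobN_const_add, slobN_const_mul, enorm_mul, hσ, ← ofReal_norm, Complex.norm_I, ENNReal.ofReal_one, one_mul, one_mul]

end memX

/-! ### Existence and continuous dependence. -/

theorem exists_small_time {A : ℝ≥0∞} (hA : A ≠ ⊤) : ∃ τ : ℝ, 0 < τ ∧ τ ≤ 1 ∧ A * ENNReal.ofReal (√(2 * τ)) ≤ 2⁻¹ := by
  set a := A.toReal with ha
  have ha0 : 0 ≤ a := ENNReal.toReal_nonneg
  -- Chosen so that `√(2τ) = 1/(2(a + 1))`.
  refine ⟨1 / (8 * (a + 1) ^ 2), by positivity, ?_, ?_⟩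
  · rw [div_le_one (by positivity)]; nlinarith
  · rw [show 2 * (1 / (8 * (a + 1) ^ 2)) = (1 / (2 * (a + 1))) ^ 2 by field_simp; norm_num, Real.sqrt_sq (by positivity),
      ← ENNReal.ofReal_toReal hA, ← ENNReal.ofReal_mul ENNReal.toReal_nonneg,
      show (2⁻¹ : ℝ≥0∞) = ENNReal.ofReal (1 / 2) by
        rw [one_div, ENNReal.ofReal_inv_of_pos (by norm_num)]; simp]
    refine ENNReal.ofReal_le_ofReal ?_
    rw [← ha, mul_one_div, div_le_div_iff₀ (by positivity) (by norm_num)]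
    linarith

theorem exists_solution_map {s p σ : ℝ} (h : Admissible s p) (hσ : ‖(σ : ℂ)‖ₑ = 1) (R : ℝ≥0) :
    ∃ T : ℝ, 0 < T ∧ T ≤ 1 ∧ ∃ (C : ℝ≥0) (Φ : L2T → ℝ → L2T),
      (∀ u₀ : L2T, IsRealValued u₀ → flNorm s p u₀ ≤ R → IsSolution s p σ T u₀ (Φ u₀)) ∧
      (∀ u₀ v₀ : L2T, IsRealValued u₀ → flNorm s p u₀ ≤ R →
        IsRealValued v₀ → flNorm s p v₀ ≤ R →
        ∀ t ∈ Set.Icc (-T) T, flNorm s p (Φ u₀ t - Φ v₀ t) ≤ C * flNorm s p (u₀ - v₀)) := by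
  obtain ⟨K, hK, hb⟩ := duhamel_lipschitz h
  obtain ⟨T, hT0, hT1, hT⟩ := exists_small_time (A := K * (R : ℝ≥0∞) ^ 2) (by finiteness)
  have hsmall : K * ENNReal.ofReal (√(T - -T)) * (R : ℝ≥0∞) ^ 2 ≤ 2⁻¹ := by
    refine le_trans (le_of_eq ?_) hT
    rw [show T - -T = 2 * T by ring]; ring
  obtain ⟨hlip, hex⟩ := hb (σ := σ) (a := -T) (b := T) (c := 0) hσ (by linarith) (by linarith)
    ENNReal.coe_ne_top hsmall
  have hw : ∀ u₀ : L2T, ∃ w : ℤ → ℝ → ℂ, IsRealValued u₀ → flNorm s p u₀ ≤ R →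
      (∀ n, Continuous (w n)) ∧ profN s p w ≤ 2 * R ∧
      (∀ n t, w n t = duhamel σ (-T) T 0 (fun n => fourierCoeff u₀ n) w n t) ∧
      ∀ n t, w (-n) t = (starRingEnd ℂ) (w n t) := by
    intro u₀
    by_cases hu : IsRealValued u₀ ∧ flNorm s p u₀ ≤ R
    · obtain ⟨w, h1, h2, h3, h4⟩ := hex (fun n => fourierCoeff u₀ n) hu.2
      exact ⟨w, fun _ _ => ⟨h1, h2, h3, h4 (fourierCoeff_neg_of_real hu.1)⟩⟩
    -- Outside the ball of real data the requirement is vacuous and any profile will do.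
    · exact ⟨0, fun h1 h2 => absurd ⟨h1, h2⟩ hu⟩
  choose w hw using hw
  have h2R : 2 * (R : ℝ≥0∞) ≠ ⊤ := by finiteness
  refine ⟨T, hT0, hT1, 2, fun u₀ => evolve (w u₀), fun u₀ hr hu => ?_, fun u₀ v₀ hr hu hr' hv t _ => ?_⟩
  · obtain ⟨h1, h2, h3, h4⟩ := hw u₀ hr hu
    have fw := ne_top_of_le_ne_top h2R h2
    refine ⟨fun t _ => isRealValued_evolve h fw h4 t, ⟨fun t _ => ((flNorm_evolve_le h fw t).trans h2).trans_lt h2R.lt_top,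
      fun t _ => (tendsto_flNorm_evolve h h1 fw t).mono_left nhdsWithin_le_nhds⟩, ?_, ?_,
      isDistribSolution_evolve h hT0.le h1 fw h4 h3⟩
    · exact memXRestr_evolve h h1 fw (seqN_slobN_duhamel_ne_top h hσ (by linarith) (by linarith)
        (fun n => (h1 n).measurable) fw h3) hT1
    · refine ext_fourierCoeff fun n => ?_
      rw [fourierCoeff_evolve h fw, h3, duhamel]
      simp [triOp, triTerm]
  · obtain ⟨h1, h2, h3, h4⟩ := hw u₀ hr hu
    obtain ⟨h1', h2', h3', h4'⟩ := hw v₀ hr' hv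
    refine (flNorm_evolve_sub_le h (ne_top_of_le_ne_top h2R h2) (ne_top_of_le_ne_top h2R h2') t).trans
      ((hlip _ _ _ _ (fun n => (h1 n).measurable) (fun n => (h1' n).measurable) h2 h2' h3 h3').trans (le_of_eq ?_))
    simp_rw [flNorm_eq_seqN, fourierCoeff_sub]
    simp

/-! ### Uniqueness. -/

/-- Freezing a function outside an interval. -/
theorem nikN_clamp_le {a b : ℝ} {f g : ℝ → ℂ} (hfc : ∀ t, f t = f (max a (min t b)))
    (hfg : ∀ᵐ t, t ∈ Set.Icc a b → f t = g t) : nikN f ≤ nikN g + 3 * supN f := by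
  refine nikN_le_iff.2 fun h hh => eLpNorm_two_le_of_sq_le ?_
  -- Off these layers either `t` and `t + h` both lie in `[a, b]` or `f` is frozen at the same
  -- endpoint value at both. The layers have measure at most `2h`, and `2² · 2 ≤ 3²`.
  set E := Set.Icc (a - h) a ∪ Set.Icc (b - h) b with hE
  have hEm : MeasurableSet E := measurableSet_Icc.union measurableSet_Icc
  have hshift : ∀ᵐ t, t + h ∈ Set.Icc a b → f (t + h) = g (t + h) :=
    (measurePreserving_add_right (volume : Measure ℝ) h).quasiMeasurePreserving.ae hfg
  calc ∫⁻ t, ‖tdiff h f t‖ₑ ^ 2 ≤ ∫⁻ t, (‖tdiff h g t‖ₑ ^ 2 + E.indicator (fun _ => (2 * supN f) ^ 2) t) := by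
        refine lintegral_mono_ae ?_
        filter_upwards [hfg, hshift] with t h1 h2
        by_cases ht : t ∈ E
        · rw [Set.indicator_of_mem ht]
          refine le_trans (pow_le_pow_left' ?_ 2) le_add_self
          rw [two_mul]
          exact enorm_sub_le.trans (add_le_add (le_supN f _) (le_supN f _))
        · rw [Set.indicator_of_notMem ht, add_zero]
          simp only [hE, Set.mem_union, Set.mem_Icc, not_or, not_and_or, not_le] at ht
          rcases lt_or_ge (t + h) a with h3 | h3
          · have : tdiff h f t = 0 := by
              rw [tdiff, hfc (t + h), hfc t, max_eq_left ((min_le_left _ _).trans h3.le),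
                max_eq_left ((min_le_left _ _).trans (by linarith)), sub_self]
            simp [this]
          · rcases lt_or_ge b t with h4 | h4
            · have : tdiff h f t = 0 := by
                rw [tdiff, hfc (t + h), hfc t, min_eq_right h4.le, min_eq_right (by linarith), sub_self]
              simp [this]
            · have h5 : a < t := by
                rcases ht.1 with h6 | h6
                · linarith
                · exact h6
              have h6 : t + h < b := by
                rcases ht.2 with h7 | h7
                · linarith
                · linarith
              rw [tdiff, tdiff, h1 ⟨h5.le, h4⟩, h2 ⟨h3, h6.le⟩]
    _ = eLpNorm (tdiff h g) 2 volume ^ 2 + (2 * supN f) ^ 2 * volume E := by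
        rw [lintegral_add_right _ (measurable_const.indicator hEm), lintegral_indicator hEm, setLIntegral_const,
          eLpNorm_two_sq]
    _ ≤ (nikN g * ENNReal.ofReal (√h)) ^ 2 + (2 * supN f) ^ 2 * (2 * ENNReal.ofReal h) := by
        gcongr
        · exact eLpNorm_tdiff_le g hh.le
        · refine (measure_union_le _ _).trans (le_of_eq ?_)
          rw [Real.volume_Icc, Real.volume_Icc, two_mul]
          congr 2 <;> ring
    _ ≤ ((nikN g + 3 * supN f) * ENNReal.ofReal (√h)) ^ 2 := by
        rw [mul_pow, mul_pow, mul_pow, ofReal_sqrt_sq hh.le]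
        have e : (nikN g + 3 * supN f) ^ 2 * ENNReal.ofReal h = nikN g ^ 2 * ENNReal.ofReal h +
          2 ^ 2 * supN f ^ 2 * (2 * ENNReal.ofReal h) +
          (6 * (nikN g * supN f) + supN f ^ 2) * ENNReal.ofReal h := by ring
        rw [e]; exact le_self_add

theorem seqN_add_ne_top {s p : ℝ} (hp : 1 ≤ p) {x y : ℤ → ℝ≥0∞} (hx : seqN s p x ≠ ⊤) (hy : seqN s p y ≠ ⊤) :
    seqN s p (fun n => x n + y n) ≠ ⊤ :=
  ne_top_of_le_ne_top (ENNReal.add_ne_top.2 ⟨hx, hy⟩) (seqN_add_le hp x y)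

/-- This permits restarting the integral equation at time `c` on a shorter interval. -/
theorem triOp_sub_base {s p : ℝ} (h : Admissible s p) {a b α β c₀ c t : ℝ} (hab : b - a ≤ 2) (haα : a ≤ α) (hβb : β ≤ b)
    (hc : c ∈ Set.Icc α β) (ht : t ∈ Set.Icc α β) {w : ℤ → ℝ → ℂ} (hw : ∀ n, Measurable (w n))
    (fw : profN s p w ≠ ⊤) (n : ℤ) :
    triOp a b c₀ w w w n t - triOp a b c₀ w w w n c = triOp α β c w w w n t := by
  have hαβ : α ≤ β := hc.1.trans hc.2
  have hab' : a ≤ b := by linarith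
  refine ((hasSum_triOp h hab' hab hw hw hw fw fw fw n t).sub
    (hasSum_triOp h hab' hab hw hw hw fw fw fw n c)).unique ?_
  refine hasSum_of_eq (hasSum_triOp h hαβ (by linarith) hw hw hw fw fw fw n t) (fun v => ?_) rfl
  rw [← mul_sub]
  congr 1
  have hi : ∀ x y, IntervalIntegrable (oscInt a b (phase n v.1 v.2 : ℤ) fun t => w v.1 t * w v.2 t * w (n - v.1 - v.2) t)
    volume x y := fun x y => (integrable_triTerm h hab' hw hw hw fw fw fw _ _ _ _).intervalIntegrable
  unfold triTerm
  rw [intervalIntegral.integral_interval_sub_left (hi _ _) (hi _ _)]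
  refine intervalIntegral.integral_congr fun r hr => ?_
  have hr' := Set.uIcc_subset_Icc hc ht hr
  simp only [oscInt]
  rw [Set.indicator_of_mem hr', Set.indicator_of_mem (Set.Icc_subset_Icc haα hβb hr')]

theorem profN_duhamel_le {s p : ℝ} (h : Admissible s p) : ∃ K : ℝ≥0∞, K ≠ ⊤ ∧ ∀ {σ a b c : ℝ} {w₀ : ℤ → ℂ}
    {w : ℤ → ℝ → ℂ}, ‖(σ : ℂ)‖ₑ = 1 → a ≤ b → b - a ≤ 2 → (∀ n, Measurable (w n)) → profN s p w ≠ ⊤ →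
    profN s p (duhamel σ a b c w₀ w) ≤ seqN s p (fun n => ‖w₀ n‖ₑ) + K * profN s p w ^ 3 := by
  obtain ⟨K, hK, hb⟩ := profN_triOp_le h
  refine ⟨K * ENNReal.ofReal (√2), by finiteness, fun {σ a b c w₀ w} hσ hab hL hw fw => ?_⟩
  have hm : ∀ n, Measurable (triOp a b c w w w n) := fun n =>
    (continuous_triOp h hab hL hw hw hw fw fw fw n).measurable
  refine (profN_add_le h.one_le (w := fun n _ => w₀ n) (fun n => measurable_const)
    (fun n => (hm n).const_mul (Complex.I * σ))).trans ?_
  rw [profN_const]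
  refine add_le_add le_rfl ((profN_const_mul_le h.one_le _ _).trans ?_)
  rw [enorm_mul, hσ, ← ofReal_norm, Complex.norm_I, ENNReal.ofReal_one, one_mul, one_mul]
  refine (hb hab hL hw hw hw fw fw fw).1.trans ?_
  calc K * ENNReal.ofReal (√(b - a)) * (profN s p w * profN s p w * profN s p w)
      = K * ENNReal.ofReal (√(b - a)) * profN s p w ^ 3 := by ring
    _ ≤ _ := by gcongr

/-- Local uniqueness propagates: two profiles of finite norm which satisfy the Duhamel equation and agree at
time zero agree throughout. -/
theorem profile_unique {s p : ℝ} (h : Admissible s p) {σ T : ℝ} (hσ : ‖(σ : ℂ)‖ₑ = 1) (hT0 : 0 < T) (hT1 : T ≤ 1)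
    {w₀ : ℤ → ℂ} {w z : ℤ → ℝ → ℂ} (hw : ∀ n, Measurable (w n)) (hz : ∀ n, Measurable (z n))
    (fw : profN s p w ≠ ⊤) (fz : profN s p z ≠ ⊤)
    (ew : ∀ n, ∀ t ∈ Set.Icc (-T) T, w n t = duhamel σ (-T) T 0 w₀ w n t)
    (ez : ∀ n, ∀ t ∈ Set.Icc (-T) T, z n t = duhamel σ (-T) T 0 w₀ z n t) :
    ∀ t ∈ Set.Icc (-T) T, ∀ n, w n t = z n t := by
  obtain ⟨K, hK, hb⟩ := duhamel_lipschitz h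
  obtain ⟨K', hK', hb'⟩ := profN_duhamel_le h
  -- Large enough to bound the Duhamel images of both profiles on every subinterval, so that one
  -- step length `τ` serves throughout.
  set R := profN s p w + K' * profN s p w ^ 3 + (profN s p z + K' * profN s p z ^ 3) with hR
  have hRt : R ≠ ⊤ := by finiteness
  obtain ⟨τ, hτ0, hτ1, hτ⟩ := exists_small_time (A := K * R ^ 2) (by finiteness)
  have restart : ∀ {y : ℤ → ℝ → ℂ}, (∀ n, Measurable (y n)) → profN s p y ≠ ⊤ →
      (∀ n, ∀ t ∈ Set.Icc (-T) T, y n t = duhamel σ (-T) T 0 w₀ y n t) → ∀ {α β c : ℝ}, -T ≤ α → β ≤ T →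
      c ∈ Set.Icc α β → ∀ n, ∀ t ∈ Set.Icc α β, y n t = duhamel σ α β c (fun n => y n c) y n t := by
    intro y hy fy ey α β c hα hβ hc n t ht
    rw [ey n t ⟨hα.trans ht.1, ht.2.trans hβ⟩, duhamel, duhamel, ← triOp_sub_base h (by linarith) hα hβ hc ht hy fy n]
    rw [ey n c ⟨hα.trans hc.1, hc.2.trans hβ⟩, duhamel]
    ring
  have step : ∀ c ∈ Set.Icc (-T) T, (∀ n, w n c = z n c) → ∀ t ∈ Set.Icc (-T) T, |t - c| ≤ τ → ∀ n, w n t = z n t := by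
    intro c hc hcz t ht htc n
    set α := max (-T) (c - τ) with hα
    set β := min T (c + τ) with hβ
    have hcm : c ∈ Set.Icc α β := ⟨max_le hc.1 (by linarith), le_min hc.2 (by linarith)⟩
    have htm : t ∈ Set.Icc α β := by
      have := abs_le.1 htc
      exact ⟨max_le ht.1 (by linarith), le_min ht.2 (by linarith)⟩
    have hαβ : α ≤ β := hcm.1.trans hcm.2
    have hlen : β - α ≤ 2 * τ := by
      have := le_max_right (-T) (c - τ); have := min_le_right T (c + τ); linarith
    have hL : β - α ≤ 2 := by linarith
    have e1 := restart hw fw ew (le_max_left _ _) (min_le_left _ _) hcm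
    have e2 := restart hz fz ez (le_max_left _ _) (min_le_left _ _) hcm
    -- The profiles solve the restarted equation on `[α, β]` only, whereas the Lipschitz estimate
    -- asks for all times. Their Duhamel images agree with them on `[α, β]` and solve it everywhere.
    have fix : ∀ {y : ℤ → ℝ → ℂ}, (∀ n, ∀ t ∈ Set.Icc α β, y n t = duhamel σ α β c (fun n => y n c) y n t) →
        ∀ n t, duhamel σ α β c (fun n => y n c) y n t =
          duhamel σ α β c (fun n => y n c) (duhamel σ α β c (fun n => y n c) y) n t := by
      intro y hy n t
      conv_lhs => rw [duhamel]
      conv_rhs => rw [duhamel]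
      rw [triOp_congr_ae fun n => Eventually.of_forall (hy n)]
    have small : K * ENNReal.ofReal (√(β - α)) * R ^ 2 ≤ 2⁻¹ := by
      refine le_trans ?_ hτ
      calc _ = K * R ^ 2 * ENNReal.ofReal (√(β - α)) := by ring
        _ ≤ _ := by gcongr
    have bound : ∀ {y : ℤ → ℝ → ℂ}, (∀ n, Measurable (y n)) → profN s p y ≠ ⊤ →
        profN s p y + K' * profN s p y ^ 3 ≤ R → profN s p (duhamel σ α β c (fun n => y n c) y) ≤ 2 * R := by
      intro y hy fy hyR
      refine (hb' hσ hαβ hL hy fy).trans (le_trans (add_le_add (seqN_le_profN h y c) le_rfl) (hyR.trans ?_))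
      rw [two_mul]; exact le_self_add
    have key := (hb hσ hαβ hL hRt small).1 (fun n => w n c) (fun n => z n c) _ _
      (fun n => (continuous_duhamel h hαβ hL _ hw fw n).measurable)
      (fun n => (continuous_duhamel h hαβ hL _ hz fz n).measurable)
      (bound hw fw le_self_add) (bound hz fz le_add_self) (fix e1) (fix e2)
    have hzero : seqN s p (fun n => ‖w n c - z n c‖ₑ) = 0 := by
      simp_rw [hcz, sub_self, enorm_zero]; exact seqN_zero h.one_le
    rw [hzero, mul_zero] at key
    have h0 := (enorm_le_profN h (fun n t => duhamel σ α β c (fun n => w n c) w n t -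
      duhamel σ α β c (fun n => z n c) z n t) n t).trans key
    rw [nonpos_iff_eq_zero, enorm_eq_zero, sub_eq_zero] at h0
    rw [e1 n t htm, e2 n t htm, h0]
  have init : ∀ n, w n 0 = z n 0 := by
    intro n
    rw [ew n 0 ⟨by linarith, hT0.le⟩, ez n 0 ⟨by linarith, hT0.le⟩, duhamel, duhamel]
    simp [triOp, triTerm]
  -- Agreement spreads from time zero in both directions by steps of length `τ`.
  have all : ∀ k : ℕ, ∀ t ∈ Set.Icc (-T) T, |t| ≤ k * τ → ∀ n, w n t = z n t := by
    intro k
    induction k with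
    | zero =>
      intro t _ htk n
      have : t = 0 := by simpa using htk
      rw [this, init]
    | succ k ih =>
      intro t ht htk n
      push_cast at htk
      have hk0 : 0 ≤ (k : ℝ) * τ := by positivity
      by_cases hk : |t| ≤ k * τ
      · exact ih t ht hk n
      · have hab := abs_le.1 htk
        rcases lt_abs.1 (not_le.1 hk) with h1 | h1
        · have hc : (k : ℝ) * τ ∈ Set.Icc (-T) T := ⟨by linarith, by linarith [ht.2]⟩
          exact step _ hc (ih _ hc (by rw [abs_of_nonneg hk0])) t ht (abs_le.2 ⟨by linarith, by linarith⟩) n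
        · have hc : -((k : ℝ) * τ) ∈ Set.Icc (-T) T := ⟨by linarith [ht.1], by linarith⟩
          exact step _ hc (ih _ hc (by rw [abs_neg, abs_of_nonneg hk0])) t ht (abs_le.2 ⟨by linarith, by linarith⟩) n
  intro t ht n
  obtain ⟨k, hk⟩ := exists_nat_ge (|t| / τ)
  exact all k t ht ((div_le_iff₀ hτ0).1 hk) n

/-- The interaction profile of a solution, frozen outside of `[-T, T]`. -/
def profile (T : ℝ) (u : ℝ → L2T) (n : ℤ) (t : ℝ) : ℂ :=
  Complex.exp (-(Complex.I * (n ^ 3 : ℤ) * (max (-T) (min t T) : ℝ))) * fourierCoeff (u (max (-T) (min t T))) n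

section solution

variable {s p σ T : ℝ} {u₀ : L2T} {u : ℝ → L2T}

theorem clamp_mem (hT : 0 < T) (t : ℝ) : max (-T) (min t T) ∈ Set.Icc (-T) T :=
  ⟨le_max_left _ _, max_le (by linarith) (min_le_right _ _)⟩

theorem clamp_eq {t : ℝ} (ht : t ∈ Set.Icc (-T) T) : max (-T) (min t T) = t := by
  rw [min_eq_left ht.2, max_eq_right ht.1]

theorem profile_clamp (hT : 0 < T) (u : ℝ → L2T) (n : ℤ) (t : ℝ) :
    profile T u n t = profile T u n (max (-T) (min t T)) := by
  unfold profile; rw [clamp_eq (clamp_mem hT t)]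

theorem profile_eq {t : ℝ} (ht : t ∈ Set.Icc (-T) T) (u : ℝ → L2T) (n : ℤ) :
    profile T u n t = Complex.exp (-(Complex.I * (n ^ 3 : ℤ) * t)) * fourierCoeff (u t) n := by
  unfold profile; rw [clamp_eq ht]

theorem enorm_profile (T : ℝ) (u : ℝ → L2T) (n : ℤ) (t : ℝ) :
    ‖profile T u n t‖ₑ = ‖fourierCoeff (u (max (-T) (min t T))) n‖ₑ := by
  rw [profile, enorm_mul]
  have := norm_exp_phase ((n ^ 3 : ℤ) : ℝ) (max (-T) (min t T))
  rw [Complex.ofReal_intCast] at this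
  rw [← ofReal_norm (Complex.exp _), this, ENNReal.ofReal_one, one_mul]

theorem continuous_profile (h : Admissible s p) (hT : 0 < T) (hu : MemCFL s p T u) (n : ℤ) :
    Continuous (profile T u n) := by
  have h1 := continuousOn_fourierCoeff h hu.2 n
  have h2 : Continuous fun t : ℝ => max (-T) (min t T) := by fun_prop
  have h3 : Continuous fun t : ℝ => fourierCoeff (u (max (-T) (min t T))) n :=
    h1.comp_continuous h2 (clamp_mem hT)
  unfold profile
  fun_prop

/-- Continuity in `FL^{s,p}` makes each mode of `u` and of the nonlinearity continuous, so the
distributional equation integrates in time; uniform boundedness on the interval justifies exchanging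
the frequency sum with the integral. -/
theorem IsSolution.profile_eq_duhamel (h : Admissible s p) (hT : 0 < T) (hu : IsSolution s p σ T u₀ u) (n : ℤ) :
    ∀ t ∈ Set.Icc (-T) T, profile T u n t =
      duhamel σ (-T) T 0 (fun n => fourierCoeff u₀ n) (profile T u) n t := by
  have hfin : ∀ t ∈ Set.Icc (-T) T, flNorm s p (u t) ≠ ⊤ := fun t ht => (hu.cont.1 t ht).ne
  obtain ⟨M, hM, hb⟩ := exists_flNorm_le h hfin hu.cont.2 isCompact_Icc
  have hcub : ∀ t ∈ Set.Icc (-T) T, cubic (fun k => fourierCoeff (u t) k) n = n * fluxCoeff (u t) n :=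
    fun t ht => cubic_eq_fluxCoeff (tsum_four_thirds_ne_top h (hfin t ht)) (hu.real t ht) n
  have hF : ContinuousOn (fun t => n * fluxCoeff (u t) n) (Set.Icc (-T) T) :=
    (continuousOn_cubic h hfin hu.cont.2 n).congr fun t ht => (hcub t ht).symm
  intro t ht
  rw [profile_eq ht, hu.eqn.eq_integral hT n (continuousOn_fourierCoeff h hu.cont.2 n) hF t ht, hu.initial, duhamel,
    intervalIntegral.integral_const_mul,
    triOp_eq_integral h hM (fun n => (continuous_profile h hT hu.cont n).measurable) (fun r _ => ?_) n t]
  · congr 2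
    refine intervalIntegral.integral_congr fun r hr => ?_
    have hr' : r ∈ Set.Icc (-T) T := Set.uIcc_subset_Icc ⟨by linarith, hT.le⟩ ht hr
    have hs := hasSum_oscillating_cubic h (x := fun k => fourierCoeff (u r) k) (w := fun k => profile T u k r) (r := r)
      (hfin r hr') (fun k => profile_eq hr' u k) n
    rw [← hcub r hr', ← hs.tsum_eq]
    refine tsum_congr fun v => ?_
    rw [oscInt, Set.indicator_of_mem hr']
  · simp_rw [enorm_profile]
    exact hb _ (clamp_mem hT r)

/-- The crux of uniqueness. The `X^{s,1/2}_{p,2}` norm yields `zN` bounds in `ℓ^p` for a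
representative of the profile. Inserted in the integral equation, they bound the suprema through
`supN_primitive_oscInt_triple_le` and the trilinear estimate. With the suprema finite, freezing the
profile outside `[-T, T]` keeps its Nikolskii seminorm finite. -/
theorem IsSolution.profN_profile_ne_top (h : Admissible s p) (hσ : ‖(σ : ℂ)‖ₑ = 1) (hT : 0 < T) (hT1 : T ≤ 1)
    (hu : IsSolution s p σ T u₀ u) : profN s p (profile T u) ≠ ⊤ := by
  obtain ⟨v, hv, hvu⟩ := hu.memX
  rw [ae_restrict_iff' measurableSet_Icc] at hvu
  set g : ℤ → ℝ → ℂ := fun n t => Complex.exp (-(Complex.I * ((n ^ 3 : ℝ) : ℂ) * t)) * stCoeff v n t with hg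
  have hgm : ∀ n, Measurable (g n) := fun n => by
    have := (Lp.stronglyMeasurable (stCoeff v n)).measurable
    exact Measurable.mul (by fun_prop) this
  have hgW : ∀ n, ∀ᵐ t, t ∈ Set.Icc (-T) T → profile T u n t = g n t := by
    intro n
    filter_upwards [(coeffCLM n).coeFn_compLp v, hvu] with t h1 h2 ht
    rw [profile_eq ht, hg]
    simp only
    rw [stCoeff, h1, h2 ht, coeffCLM_apply]
    congr 3
    push_cast; ring
  have hz : seqN s p (fun n => zN (g n)) ≠ ⊤ := by
    rw [xNorm_eq_seqN] at hv
    set q := ENNReal.ofReal (2 * Real.pi)⁻¹ with hq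
    have hq0 : q ≠ 0 := (ENNReal.ofReal_pos.2 (inv_pos.2 Real.two_pi_pos)).ne'
    have hqt : q ^ (1 / 2 : ℝ) ≠ ⊤ := ENNReal.rpow_ne_top_of_nonneg (by norm_num) ENNReal.ofReal_ne_top
    have hq0' : q ^ (1 / 2 : ℝ) ≠ 0 := by
      rw [Ne, ENNReal.rpow_eq_zero_iff]; simp [hq0]
    refine ne_top_of_le_ne_top (ENNReal.mul_ne_top (a := 3 * (q ^ (1 / 2 : ℝ))⁻¹)
      (ENNReal.mul_ne_top (by norm_num) (ENNReal.inv_ne_top.2 hq0')) hv.ne) ?_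
    rw [← seqN_const_mul h.one_le]
    refine seqN_mono h.one_le fun n => (zN_le_modN (f := stCoeff v n) (m := (n : ℝ) ^ 3) (EventuallyEq.refl _ _)).trans ?_
    rw [ENNReal.mul_rpow_of_nonneg _ _ (by norm_num), mul_assoc, ← mul_assoc _⁻¹, ENNReal.inv_mul_cancel hq0' hqt, one_mul]
  have hzn : ∀ n, zN (g n) ≠ ⊤ := fun n =>
    ne_top_of_le_ne_top hz (le_seqN h.one_le (by linarith [h.half_le]) (fun n => zN (g n)) n)
  obtain ⟨C, hC, hb⟩ := supN_primitive_oscInt_triple_le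
  obtain ⟨K, hK, hb'⟩ := seqN_trilinear_le h
  set X : ℤ → ℤ × ℤ → ℝ≥0∞ := fun n v => supN (triTerm (-T) T 0 g g g n v) with hX
  have hXs := hb' C (fun n => zN (g n)) (fun n => zN (g n)) (fun n => zN (g n)) X fun n v =>
    (hb (-T) T (by linarith) (by linarith) 0 (phase n v.1 v.2) (g v.1) (g v.2) (g (n - v.1 - v.2)) (hgm _) (hgm _) (hgm _)
      (hzn _) (hzn _) (hzn _)).2
  have hXt : seqN s p (fun n => ∑' v : ℤ × ℤ, ‖(triCoeff n v.1 v.2 : ℂ)‖ₑ * X n v) ≠ ⊤ :=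
    ne_top_of_le_ne_top (by finiteness) hXs
  have hsup : ∀ n, supN (profile T u n) ≤ ‖fourierCoeff u₀ n‖ₑ + ∑' v : ℤ × ℤ, ‖(triCoeff n v.1 v.2 : ℂ)‖ₑ * X n v := by
    intro n
    refine iSup_le fun t => ?_
    rw [profile_clamp hT, hu.profile_eq_duhamel h hT n _ (clamp_mem hT t), duhamel, triOp_congr_ae hgW]
    refine (enorm_add_le _ _).trans (add_le_add le_rfl ?_)
    rw [enorm_mul, enorm_mul, hσ, ← ofReal_norm Complex.I, Complex.norm_I, ENNReal.ofReal_one, one_mul, one_mul]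
    refine enorm_tsum_le_tsum_enorm.trans (ENNReal.tsum_le_tsum fun v => ?_)
    rw [enorm_mul]
    exact mul_le_mul_right (le_supN _ _) _
  have hu0 : seqN s p (fun n => ‖fourierCoeff u₀ n‖ₑ) ≠ ⊤ := by
    have := (hu.cont.1 0 ⟨by linarith, hT.le⟩).ne
    rwa [hu.initial] at this
  have hS : seqN s p (fun n => supN (profile T u n)) ≠ ⊤ :=
    ne_top_of_le_ne_top (seqN_add_ne_top h.one_le hu0 hXt) (seqN_mono h.one_le hsup)
  have hN : seqN s p (fun n => nikN (profile T u n)) ≠ ⊤ := by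
    refine ne_top_of_le_ne_top (seqN_add_ne_top h.one_le hz (y := fun n => 3 * supN (profile T u n)) ?_)
      (seqN_mono h.one_le fun n => (nikN_clamp_le (profile_clamp hT u n) (hgW n)).trans
        (add_le_add le_add_self le_rfl))
    rw [seqN_const_mul h.one_le]
    exact ENNReal.mul_ne_top (by norm_num) hS
  exact seqN_add_ne_top h.one_le hS hN

theorem IsSolution.unique (h : Admissible s p) (hσ : ‖(σ : ℂ)‖ₑ = 1) (hT : 0 < T) (hT1 : T ≤ 1) {v : ℝ → L2T}
    (hu : IsSolution s p σ T u₀ u) (hv : IsSolution s p σ T u₀ v) : ∀ t ∈ Set.Icc (-T) T, u t = v t := by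
  intro t ht
  have key := profile_unique h hσ hT hT1 (fun n => (continuous_profile h hT hu.cont n).measurable)
    (fun n => (continuous_profile h hT hv.cont n).measurable) (hu.profN_profile_ne_top h hσ hT hT1)
    (hv.profN_profile_ne_top h hσ hT hT1) (hu.profile_eq_duhamel h hT) (hv.profile_eq_duhamel h hT) t ht
  refine ext_fourierCoeff fun n => ?_
  have := key n
  rw [profile_eq ht, profile_eq ht] at this
  exact mul_left_cancel₀ (Complex.exp_ne_zero _) this

end solution

end MKdV

end


theorem theorem1p1 (s p : ℝ)
    (hsp : (1 / 2 ≤ s ∧ s < 3 / 4 ∧ 1 ≤ p ∧ p < 4 / (3 - 4 * s)) ∨ (3 / 4 ≤ s ∧ 1 ≤ p))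
    (σ : ℝ) (hσ : σ = 1 ∨ σ = -1) :
    -- existence, on a time interval that depends only on the size of the datum, and
    -- (Lipschitz) continuous dependence on the datum
    (∀ R : ℝ≥0, ∃ T : ℝ, 0 < T ∧ T ≤ 1 ∧ ∃ (C : ℝ≥0) (Φ : L2T → ℝ → L2T),
      (∀ u₀ : L2T, IsRealValued u₀ → flNorm s p u₀ ≤ R → IsSolution s p σ T u₀ (Φ u₀)) ∧
      (∀ u₀ v₀ : L2T, IsRealValued u₀ → flNorm s p u₀ ≤ R →
        IsRealValued v₀ → flNorm s p v₀ ≤ R →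
        ∀ t ∈ Set.Icc (-T) T, flNorm s p (Φ u₀ t - Φ v₀ t) ≤ C * flNorm s p (u₀ - v₀))) ∧
    -- uniqueness in the solution class
    (∀ T : ℝ, 0 < T → T ≤ 1 → ∀ (u₀ : L2T) (u v : ℝ → L2T),
      IsSolution s p σ T u₀ u → IsSolution s p σ T u₀ v →
      ∀ t ∈ Set.Icc (-T) T, u t = v t) := by
  have h : Admissible s p := hsp
  have hσ' : ‖(σ : ℂ)‖ₑ = 1 := by rcases hσ with rfl | rfl <;> simp
  exact ⟨exists_solution_map h hσ', fun T hT hT1 u₀ u v hu hv => hu.unique h hσ' hT hT1 hv⟩
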